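/- **Setting.** Fix $b\ge 0$, a symmetric tensor of intersection numbers $\kappa_{abc}\in\mathbb Z$ ($a,b,c=1,\dots,b$), $(xyz)=\kappa_{abc}x^ay^bz^c$, a vector $t\in\mathbb R^b$, and a set $P\subset\mathbb Z^b$ closed under addition (the D4-charges in the Kähler cone) such that for $p\in P$ the matrix $\kappa_{abc}p^c$ is invertible and $(pt^2)>0$, and $(ppp')+(pp'p')$ is even for $p,p'\in P$. Charges are $\check\gamma=(p^a,q_a)$ with $p\in P$, $q_a\in\mathbb Z+\frac12\kappa_{abc}p^bp^c$; the DSZ product is $\langle\check\gamma,\check\gamma'\rangle=q_ap'^a-q'_ap^a\in\mathbb Z$, $\gamma_{ij}=\langle\check\gamma_i,\check\gamma_j\rangle$, and $\kappa(x)=(-1)^xx$. $\mathrm{Sym}$ is the average over the permutations of the charges (together with the $c_i$, $x_i$). For charges $\check\gamma_1,\dots,\check\gamma_n$ and real $c_i$ with $\sum_ic_i=0$ put $$S_\ell=\sum_{i\le\ell}c_i,\quad \beta_{ni}=\sum_{j=1}^n\gamma_{ji},\quad \Gamma_{n\ell}=\sum_{i=1}^n\sum_{j=1}^\ell\gamma_{ij},\quad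 c_i^{(\ell)}=c_i-\frac{\beta_{ni}}{\Gamma_{n\ell}}S_\ell .$$ For $n=n_1+\dots+n_m$ ($n_k\ge1$), $j_k=n_1+\dots+n_k$, put $\check\gamma'_k=\sum_{i=j_{k-1}+1}^{j_k}\check\gamma_i$, $c_k'=\sum_{i=j_{k-1}+1}^{j_k}c_i$. Given functions $R_n(\{\check\gamma_i\};\tau_2)$ let $$W_n=\mathrm{Sym}\sum_{T}(-1)^{n_T}\prod_{v}R_v,$$ where $T$ runs over Schröder trees with $n$ leaves (rooted ordered trees whose non-leaf vertices have at least two children), the leaves carry $\check\gamma_1,\dots,\check\gamma_n$ in order, every other vertex carries the sum of the charges of its children, the product is over the $n_T$ non-leaf vertices, and $R_v$ is $R_k$ evaluated on the charges of the $k$ children of $v$. Let $g^{(0)}_n(\{\check\gamma_i,c_i\})$ be symmetric in the pairs $(\check\gamma_i,c_i)$ with $g_1^{(0)}=1$, let $\mathcal E_n=\mathcal E_n^{(0)}(\{\check\gamma_i\})+\mathcal E_n^{(+)}(\{\check\gamma_i\};\tau_2)$, and define $\widehat g_n$ by $$\widehat g_n(\{\check\gamma_i,c_i\})=g^{(0)}_n(\{\check\gamma_i,c_i\})-\mathrm{Sym}\Big\{\sum_{n_1+\dots+n_m=n,\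 m<n}\widehat g_m(\{\check\gamma_k',c_k'\})\prod_{k=1}^m\mathcal E_{n_k}(\check\gamma_{j_{k-1}+1},\dots,\check\gamma_{j_k})\Big\}.$$ Assume that for all $n\ge1$, all charges and all $\tau_2>0$ (2) $\mathcal E^{(0)}_n(\{\check\gamma_i\})=g_n^{(0)}(\{\check\gamma_i,\beta_{ni}\})$, (3) $\mathcal E^{(+)}_n=-\mathrm{Sym}\big\{\sum_{n_1+\dots+n_m=n,\ m>1}W_m(\{\check\gamma'_k\})\prod_{k=1}^m\mathcal E_{n_k}(\check\gamma_{j_{k-1}+1},\dots,\check\gamma_{j_k})\big\}$, and consider the condition on a configuration $(\check\gamma_i,c_i)_{i\le n}$ (1) $\frac14\mathrm{Sym}\big\{\sum_{\ell=1}^{n-1}(\mathrm{sgn}S_\ell-\mathrm{sgn}\Gamma_{n\ell})\,\kappa(\Gamma_{n\ell})\,g^{(0)}_\ell(\{\check\gamma_i,c_i^{(\ell)}\}_{i\le\ell})\,g^{(0)}_{n-\ell}(\{\check\gamma_i,c_i^{(\ell)}\}_{i>\ell})\big\}=g_n^{(0)}(\{\check\gamma_i,c_i\})-g_n^{(0)}(\{\check\gamma_i,\beta_{ni}\})$.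 **(a)** If (1) holds for a configuration and for all configurations obtained from it by adding up the members of groups of its pairs $(\check\gamma_i,c_i)$, then at this configuration, for all $\tau_2>0$, $$\widehat g_n=-\tfrac12\mathrm{Sym}\Big\{\sum_{\ell=1}^{n-1}\Delta_\ell\,\kappa(\gamma_{LR}^\ell)\,\widehat g_\ell(\{\check\gamma_i,c^{(\ell)}_i\}_{i\le\ell})\,\widehat g_{n-\ell}(\{\check\gamma_i,c_i^{(\ell)}\}_{i>\ell})\Big\}+W_n(\{\check\gamma_i\}),$$ where $\gamma_{LR}^\ell=\langle\sum_{i\le\ell}\check\gamma_i,\sum_{i>\ell}\check\gamma_i\rangle$ and $\Delta_\ell=\frac12[\mathrm{sgn}S_\ell+\mathrm{sgn}\gamma^\ell_{LR}]$. **(b)** Suppose that (1) holds for all generic configurations (those for which no sign function met in iterating the binary splittings, for any ordering, vanishes, i.e. no proper subset of the $c_i$ sums to $0$, $\Gamma_{n\ell}\ne0$, and the same holds for both groups $(\check\gamma_i,c_i^{(\ell)})_{i\le\ell}$, $(\check\gamma_i,c_i^{(\ell)})_{i>\ell}$). Let $\sigma$ be a quadratic refinement ($\sigma_\gamma=\pm1$,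 $\sigma_{\gamma}\sigma_{\gamma'}=(-1)^{\langle\gamma,\gamma'\rangle}\sigma_{\gamma+\gamma'}$). On $\boldsymbol x=(x_i^a)\in\mathbb R^{nb}$ use $\boldsymbol x\cdot\boldsymbol y=\sum_i(p_ix_iy_i)$, $V_\lambda=\partial_{\boldsymbol x}^2+2\pi(\boldsymbol x\cdot\partial_{\boldsymbol x}-\lambda)$ with $\partial^2_{\boldsymbol x}=\sum_i\kappa_i^{ab}\partial_{x_i^a}\partial_{x_i^b}$, where $\kappa_i^{ab}$ is the inverse of $\kappa_{abc}p_i^c$, and $$(\boldsymbol v_{ij})^a_k=\delta_{ki}p_j^a-\delta_{kj}p_i^a,\qquad(\boldsymbol u_{ij})_k^a=\delta_{ki}(p_jt^2)t^a-\delta_{kj}(p_it^2)t^a .$$ The kernel $\Phi_n(\boldsymbol x)$ (which depends on the $p_i$) of a function $f_n$ is defined by $\Phi_n(\boldsymbol x)=\sigma_{\gamma}(\sqrt{2\tau_2})^{n-1}\prod_i\sigma_{\gamma_i}^{-1}f_n$ at $x_i^a=\sqrt{2\tau_2}(\kappa_i^{ab}q_{i,b}+B^a)$, for all $q_i$, all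 $\tau_2>0$, $B\in\mathbb R^b$, where $\gamma=\sum_i\check\gamma_i$ and, if $f_n$ depends on the $c_i$, these are $c_i=\mathrm{Im}(Z_{\gamma_i}\bar Z_\gamma)$, with $\mathrm{Im}(Z_\gamma\bar Z_{\gamma'})=-\frac12[(p't^2)(q_a+(pB)_a)t^a-(pt^2)(q'_a+(p'B)_a)t^a]$, and assumed to have no proper subset with vanishing sum; off these walls of marginal stability (given for real $\boldsymbol x$ by $\sum_{i\in I}\sum_j\boldsymbol u_{ij}\cdot\boldsymbol x=0$) $\Phi_n$ is required to be continuous. Suppose further that - $g_n^{(0)}$ has a kernel $\Phi_n^{(0)}(\boldsymbol x,c)$, with the $c_i$ ($\sum_ic_i=0$) kept as independent variables, which has singularities only at walls: it is smooth in $(\boldsymbol x,c)$ where no proper subset of the $c_i$ sums to zero; - $\mathcal E_n$ has a smooth kernel $\Phi_n^{\mathcal E}(\boldsymbol x)$ which depends on $\boldsymbol x$ only through the DSZ products $\boldsymbol v_{ij}\cdot\boldsymbol x$ and satisfies $V_{n-1}\Phi^{\mathcal E}_n=0$; - $\mathcal E_n^{(+)}$ decreases exponentially for large $\tau_2$: with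 $\beta_{ni}(\boldsymbol x)=\sum_j\boldsymbol v_{ji}\cdot\boldsymbol x$, for each $\boldsymbol y$ such that no proper subset of the $\beta_{ni}(\boldsymbol y)$ sums to zero there is $\varepsilon>0$ with $\Phi_n^{\mathcal E}(\boldsymbol x)-\Phi_n^{(0)}(\boldsymbol x,\beta_{ni}(\boldsymbol x))=O(e^{-\varepsilon\tau_2})$ at $\boldsymbol x=\sqrt{2\tau_2}\,\boldsymbol y$, $\tau_2\to\infty$. Then $\widehat g_n$ has a kernel, and every kernel $\Phi^{\widehat g}_n$ of $\widehat g_n$ satisfies, for all $n\ge1$ and $p_i\in P$, the modularity constraint $$V_{n-1}\Phi^{\widehat g}_n=\mathrm{Sym}\sum_{\ell=1}^{n-1}\Big[\boldsymbol u_\ell^2\,\Delta^{\widehat g}_{n,\ell}\,\delta'(\boldsymbol u_\ell\cdot\boldsymbol x)+2\big(\boldsymbol u_\ell\cdot\partial_{\boldsymbol x}\Delta^{\widehat g}_{n,\ell}\big)\,\delta(\boldsymbol u_\ell\cdot\boldsymbol x)\Big],\qquad\Delta^{\widehat g}_{n,\ell}=\tfrac12(\boldsymbol v_\ell\cdot\boldsymbol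 x)\,\Phi^{\widehat g}_\ell(x_1,\dots,x_\ell)\,\Phi^{\widehat g}_{n-\ell}(x_{\ell+1},\dots,x_n),$$ with $\boldsymbol v_\ell=\sum_{i\le\ell<j}\boldsymbol v_{ij}$, $\boldsymbol u_\ell=\sum_{i\le\ell<j}\boldsymbol u_{ij}$, as an identity of (well-defined) distributions on $\mathbb R^{nb}$. -/

import Mathlib

open scoped ContDiff Matrix
open MeasureTheory Filter

namespace D4D2

/-! ### Charges, intersection form, stability parameters -/

/-- The projection `(p^a, q_a)` of a charge: D4-brane charge `p` (integers) and D2-brane charge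
`q` (real numbers, restricted below to a shifted lattice). -/
abbrev Charge (b : ℕ) : Type := (Fin b → ℤ) × (Fin b → ℝ)

/-- Integer vectors as real vectors. -/
def toR {b : ℕ} (p : Fin b → ℤ) : Fin b → ℝ := fun a => (p a : ℝ)

/-- The trilinear form `(xyz) = κ_{abc} x^a y^b z^c`. -/
noncomputable def cub {b : ℕ} (κ : Fin b → Fin b → Fin b → ℤ) (x y z : Fin b → ℝ) : ℝ :=
  ∑ a, ∑ a', ∑ a'', (κ a a' a'' : ℝ) * x a * y a' * z a''

/-- The matrix `κ_{ab} = κ_{abc} p^c`. -/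
noncomputable def kmat {b : ℕ} (κ : Fin b → Fin b → Fin b → ℤ) (p : Fin b → ℤ) :
    Matrix (Fin b) (Fin b) ℝ :=
  Matrix.of fun a a' => ∑ a'', (κ a a' a'' : ℝ) * (p a'' : ℝ)

/-- The standing data: intersection numbers `κ_{abc}`, the additive semigroup of admissible
D4-charges (the lattice points of the Kähler cone), and the Kähler moduli `t^a`.
The signature `(1, b - 1)` of `κ_{abc} p^c` enters only through its non-degeneracy, and `parity`
says that the DSZ product below takes integer values. -/
structure Geometry (b : ℕ) where
  κ : Fin b → Fin b → Fin b → ℤ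
  symm_left : ∀ a a' a'', κ a a' a'' = κ a' a a''
  symm_right : ∀ a a' a'', κ a a' a'' = κ a a'' a'
  D4 : AddSubsemigroup (Fin b → ℤ)
  t : Fin b → ℝ
  nondeg : ∀ p ∈ D4, (kmat κ p).det ≠ 0
  pos : ∀ p ∈ D4, 0 < cub κ (toR p) t t
  parity : ∀ p ∈ D4, ∀ p' ∈ D4,
    Even (∑ a, ∑ a', ∑ a'', κ a a' a'' * (p a * p a' * p' a'' + p a * p' a' * p' a''))

variable {b : ℕ}

/-- `Γ₊`: the D4-charge is admissible and `q_a ∈ ℤ + ½ κ_{abc} p^b p^c`. -/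
def Geometry.chargeSet (G : Geometry b) : Set (Charge b) :=
  {γ | γ.1 ∈ G.D4 ∧ ∀ a, ∃ k : ℤ,
    γ.2 a = k + (1 / 2 : ℝ) * ∑ a', ∑ a'', (G.κ a a' a'' : ℝ) * γ.1 a' * γ.1 a''}

/-- The DSZ product `⟨γ, γ'⟩ = q_a p'^a - q'_a p^a`. -/
noncomputable def dsz (γ γ' : Charge b) : ℝ :=
  ∑ a, (γ.2 a * (γ'.1 a : ℝ) - γ'.2 a * (γ.1 a : ℝ))

/-- `(-1)^x` for integer `x` (given as a real number). -/
noncomputable def negOnePow (x : ℝ) : ℝ := (-1 : ℝ) ^ ⌊x⌋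

/-- `κ(x) = (-1)^x x`. -/
noncomputable def kap (x : ℝ) : ℝ := negOnePow x * x

/-- `Im (Z_γ \bar Z_γ')` in the large volume limit, at Kähler moduli `z^a = B^a + i t^a`. -/
noncomputable def Geometry.imZZ (G : Geometry b) (B : Fin b → ℝ) (γ γ' : Charge b) : ℝ :=
  -(1 / 2 : ℝ) *
    (cub G.κ (toR γ'.1) G.t G.t * ((∑ a, γ.2 a * G.t a) + cub G.κ (toR γ.1) B G.t)
      - cub G.κ (toR γ.1) G.t G.t * ((∑ a, γ'.2 a * G.t a) + cub G.κ (toR γ'.1) B G.t))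

/-- The stability parameters `c_i = Im (Z_{γ_i} \bar Z_γ)`, `γ = ∑ γ_j`. -/
noncomputable def Geometry.stab (G : Geometry b) (B : Fin b → ℝ) {n : ℕ}
    (γ : Fin n → Charge b) : Fin n → ℝ :=
  fun i => G.imZZ B (γ i) (∑ j, γ j)

/-! ### Combinatorial notation -/

/-- Symmetrization with weight `1 / n!`. -/
noncomputable def symmetrize {n : ℕ} (F : Equiv.Perm (Fin n) → ℝ) : ℝ :=
  (n.factorial : ℝ)⁻¹ * ∑ s, F s

/-- Merging: entry `k` of the result is the sum of the entries `i` with `f i = k`. -/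
def merge {A : Type*} [AddCommMonoid A] {n m : ℕ} (f : Fin n → Fin m) (a : Fin n → A) :
    Fin m → A :=
  fun k => ∑ i with f i = k, a i

/-- The first `ℓ` indices. -/
def head {n : ℕ} (ℓ : Fin n) : Fin ℓ → Fin n := Fin.castLE ℓ.2.le

/-- The last `n - ℓ` indices. -/
def tail {n : ℕ} (ℓ : Fin n) : Fin (n - ℓ) → Fin n := fun i => ⟨ℓ + i, by omega⟩

/-- The positions `ℓ = 1, …, n - 1`. -/
def cuts (n : ℕ) : Finset (Fin n) := Finset.univ.filter fun ℓ => 0 < (ℓ : ℕ)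

/-- `S_ℓ = ∑_{i ≤ ℓ} c_i`. -/
noncomputable def partialSum {n : ℕ} (ℓ : Fin n) (c : Fin n → ℝ) : ℝ := ∑ i, c (head ℓ i)

/-- `β_{ni} = ∑_j γ_{ji}`. -/
noncomputable def beta {n : ℕ} (γ : Fin n → Charge b) : Fin n → ℝ := fun i => ∑ j, dsz (γ j) (γ i)

/-- `Γ_{nℓ} = ∑_{i ≤ n} ∑_{j ≤ ℓ} γ_{ij}`. -/
noncomputable def bigGamma {n : ℕ} (ℓ : Fin n) (γ : Fin n → Charge b) : ℝ :=
  ∑ i, ∑ j, dsz (γ i) (γ (head ℓ j))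

/-- `c_i^{(ℓ)} = c_i - (β_{ni} / Γ_{nℓ}) S_ℓ`, the stability parameters at the wall. -/
noncomputable def flow {n : ℕ} (ℓ : Fin n) (γ : Fin n → Charge b) (c : Fin n → ℝ) : Fin n → ℝ :=
  fun i => c i - beta γ i / bigGamma ℓ γ * partialSum ℓ c

/-- No proper subset of the parameters sums up to zero. -/
def GenericStab {n : ℕ} (c : Fin n → ℝ) : Prop :=
  ∀ I : Finset (Fin n), I.Nonempty → I ≠ Finset.univ → ∑ i ∈ I, c i ≠ 0

/-- A configuration is generic if no sign function met in iterating the binary splittings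
(for any ordering of the charges) has a vanishing argument. -/
def GenericConf : (n : ℕ) → (Fin n → Charge b) → (Fin n → ℝ) → Prop
  | n, γ, c => GenericStab c ∧ ∀ (s : Equiv.Perm (Fin n)) (ℓ : Fin n), 0 < (ℓ : ℕ) →
      bigGamma ℓ (γ ∘ s) ≠ 0 ∧
      GenericConf ℓ (γ ∘ s ∘ head ℓ) (flow ℓ (γ ∘ s) (c ∘ s) ∘ head ℓ) ∧
      GenericConf (n - ℓ) (γ ∘ s ∘ tail ℓ) (flow ℓ (γ ∘ s) (c ∘ s) ∘ tail ℓ)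
termination_by n => n
decreasing_by
  · exact ℓ.2
  · have := ℓ.2
    omega

/-- Schröder trees with `n` leaves: rooted ordered trees all of whose vertices, except the leaves,
have at least two children. The children of the root are listed in order, child `k` carrying
`bl.blocksFun k` of the leaves. -/
inductive SchroderTree : ℕ → Type
  | leaf : SchroderTree 1
  | node {n : ℕ} (bl : Composition n) (two : 2 ≤ bl.length)
      (child : ∀ k : Fin bl.length, SchroderTree (bl.blocksFun k)) : SchroderTree n

theorem blocksFun_lt {n : ℕ} (bl : Composition n) (two : 2 ≤ bl.length) (k : Fin bl.length) :
    bl.blocksFun k < n := by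
  rcases (bl.blocksFun_le k).lt_or_eq with h | h
  · exact h
  · exfalso
    have hs := bl.sum_blocksFun
    obtain ⟨j, hj⟩ : ∃ j : Fin bl.length, j ≠ k := by
      have : Nontrivial (Fin bl.length) := Fin.nontrivial_iff_two_le.mpr two
      exact exists_ne k
    have h1 : bl.blocksFun k + bl.blocksFun j ≤ ∑ i, bl.blocksFun i := by
      rw [← Finset.sum_pair hj.symm]
      exact Finset.sum_le_sum_of_subset (Finset.subset_univ _)
    have h2 := bl.one_le_blocksFun j
    omega

theorem schroderTree_finite (n : ℕ) : Finite (SchroderTree n) := by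
  induction n using Nat.strong_induction_on with
  | _ n ih =>
    have : ∀ bl : {bl : Composition n // 2 ≤ bl.length},
        Finite (∀ k : Fin bl.1.length, SchroderTree (bl.1.blocksFun k)) := fun bl => by
      have := fun k => ih _ (blocksFun_lt bl.1 bl.2 k)
      infer_instance
    let f : PLift (n = 1) ⊕ (Σ bl : {bl : Composition n // 2 ≤ bl.length},
        ∀ k : Fin bl.1.length, SchroderTree (bl.1.blocksFun k)) → SchroderTree n := fun x =>
      match x with
      | Sum.inl h => h.down ▸ SchroderTree.leaf
      | Sum.inr y => SchroderTree.node y.1.1 y.1.2 y.2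
    refine Finite.of_surjective f ?_
    intro T
    cases T with
    | leaf => exact ⟨Sum.inl ⟨rfl⟩, rfl⟩
    | node bl two child => exact ⟨Sum.inr ⟨⟨bl, two⟩, child⟩, rfl⟩

noncomputable instance (n : ℕ) : Fintype (SchroderTree n) :=
  @Fintype.ofFinite _ (schroderTree_finite n)

/-- `n_T`: the number of vertices which are not leaves. -/
def SchroderTree.numVertices : {n : ℕ} → SchroderTree n → ℕ
  | _, .leaf => 0
  | _, .node _ _ child => 1 + ∑ k, (child k).numVertices

/-- `∏_v R_v` for leaves carrying `γ_1, …, γ_n` from left to right: `R_v` is `R` evaluated on the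
charges of the children of `v`, and the charge of a vertex is the sum of the charges of its
leaves. -/
noncomputable def SchroderTree.prod (R : ∀ m, (Fin m → Charge b) → ℝ) :
    {n : ℕ} → SchroderTree n → (Fin n → Charge b) → ℝ
  | _, .leaf, _ => 1
  | _, .node bl _ child, γ =>
      R bl.length (merge bl.index γ) * ∏ k, (child k).prod R (γ ∘ bl.embedding k)

/-! ### The functions `W_n`, the ansatz, and the algebraic relations

In `E n γ τ`, `R n γ τ` the last argument is `τ₂`. -/

/-- `W_n = Sym ∑_T (-1)^{n_T} ∏_v R_v`. -/
noncomputable def W (R : ∀ n, (Fin n → Charge b) → ℝ → ℝ) (n : ℕ) (γ : Fin n → Charge b)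
    (τ : ℝ) : ℝ :=
  symmetrize fun s => ∑ T : SchroderTree n,
    (-1 : ℝ) ^ T.numVertices * T.prod (fun m δ => R m δ τ) (γ ∘ s)

/-- The iterative ansatz for `ĝ_n`. -/
noncomputable def ghat (g0 : ∀ n, (Fin n → Charge b) → (Fin n → ℝ) → ℝ)
    (E : ∀ n, (Fin n → Charge b) → ℝ → ℝ) :
    (n : ℕ) → (Fin n → Charge b) → (Fin n → ℝ) → ℝ → ℝ
  | n, γ, c, τ => g0 n γ c - symmetrize fun s =>
      ∑ bl : {bl : Composition n // bl.length < n},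
        ghat g0 E bl.1.length (merge bl.1.index (γ ∘ s)) (merge bl.1.index (c ∘ s)) τ *
          ∏ k, E (bl.1.blocksFun k) (γ ∘ s ∘ bl.1.embedding k) τ
termination_by n => n
decreasing_by exact bl.2

/-- The recursion for `g^{(0)}_n`, at one configuration. -/
def SeedRecursion (g0 : ∀ n, (Fin n → Charge b) → (Fin n → ℝ) → ℝ) (n : ℕ)
    (γ : Fin n → Charge b) (c : Fin n → ℝ) : Prop :=
  (1 / 4 : ℝ) * (symmetrize fun s => ∑ ℓ ∈ cuts n,
      (Real.sign (partialSum ℓ (c ∘ s)) - Real.sign (bigGamma ℓ (γ ∘ s))) *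
        kap (bigGamma ℓ (γ ∘ s)) *
        g0 ℓ (γ ∘ s ∘ head ℓ) (flow ℓ (γ ∘ s) (c ∘ s) ∘ head ℓ) *
        g0 (n - ℓ) (γ ∘ s ∘ tail ℓ) (flow ℓ (γ ∘ s) (c ∘ s) ∘ tail ℓ))
    = g0 n γ c - g0 n γ (beta γ)

/-- `γ_{LR}^ℓ = ⟨γ_1 + ⋯ + γ_ℓ, γ_{ℓ+1} + ⋯ + γ_n⟩`. -/
noncomputable def dszLR {n : ℕ} (ℓ : Fin n) (γ : Fin n → Charge b) : ℝ :=
  dsz (∑ i, γ (head ℓ i)) (∑ i, γ (tail ℓ i))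

/-- `Δ^z_{γ_L γ_R} = ½ [sgn Im (Z_L \bar Z_R) + sgn γ_{LR}]`, where `Im (Z_L \bar Z_R) = S_ℓ`. -/
noncomputable def DeltaLR {n : ℕ} (ℓ : Fin n) (γ : Fin n → Charge b) (c : Fin n → ℝ) : ℝ :=
  (1 / 2 : ℝ) * (Real.sign (partialSum ℓ c) + Real.sign (dszLR ℓ γ))

/-- The recursion that determines the coefficients `ĝ_n`, at one configuration. -/
def CoefficientRecursion (g : ∀ n, (Fin n → Charge b) → (Fin n → ℝ) → ℝ → ℝ)
    (R : ∀ n, (Fin n → Charge b) → ℝ → ℝ) (n : ℕ)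
    (γ : Fin n → Charge b) (c : Fin n → ℝ) (τ : ℝ) : Prop :=
  g n γ c τ =
    -(1 / 2 : ℝ) * (symmetrize fun s => ∑ ℓ ∈ cuts n,
      DeltaLR ℓ (γ ∘ s) (c ∘ s) * kap (dszLR ℓ (γ ∘ s)) *
        g ℓ (γ ∘ s ∘ head ℓ) (flow ℓ (γ ∘ s) (c ∘ s) ∘ head ℓ) τ *
        g (n - ℓ) (γ ∘ s ∘ tail ℓ) (flow ℓ (γ ∘ s) (c ∘ s) ∘ tail ℓ) τ)
    + W R n γ τ

/-! ### Kernels -/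

/-- The space `⨁_i Λ_i ⊗ ℝ`, with coordinates `x_i^a`. -/
abbrev Coord (n b : ℕ) : Type := Fin n → Fin b → ℝ

/-- A quadratic refinement of the DSZ product on `Γ₊`. -/
def Geometry.IsQuadraticRefinement (G : Geometry b) (σ : Charge b → ℝ) : Prop :=
  (∀ γ ∈ G.chargeSet, σ γ = 1 ∨ σ γ = -1) ∧
  ∀ γ ∈ G.chargeSet, ∀ γ' ∈ G.chargeSet, σ γ * σ γ' = negOnePow (dsz γ γ') * σ (γ + γ')

/-- The factor `σ_γ (√(2τ₂))^{n-1} / ∏ σ_{γ_i}` which relates a function to its kernel. -/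
noncomputable def kerFactor (σ : Charge b → ℝ) {n : ℕ} (γ : Fin n → Charge b) (τ : ℝ) : ℝ :=
  σ (∑ i, γ i) * Real.sqrt (2 * τ) ^ (n - 1) / ∏ i, σ (γ i)

/-- The point `x_i^a = √(2τ₂) (κ_i^{ab} q_{i,b} + B^a)`. -/
noncomputable def Geometry.point (G : Geometry b) {n : ℕ} (γ : Fin n → Charge b)
    (B : Fin b → ℝ) (τ : ℝ) : Coord n b :=
  fun i => Real.sqrt (2 * τ) • ((kmat G.κ (γ i).1)⁻¹ *ᵥ (γ i).2 + B)

/-- The bilinear form `x · y = ∑_i (p_i x_i y_i)`. -/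
noncomputable def Geometry.bil (G : Geometry b) {n : ℕ} (p : Fin n → Fin b → ℤ)
    (x y : Coord n b) : ℝ :=
  ∑ i, cub G.κ (toR (p i)) (x i) (y i)

/-- `v_{ij}`, with components `δ_{ki} p_j^a - δ_{kj} p_i^a`. -/
def vVec {n : ℕ} (p : Fin n → Fin b → ℤ) (i j : Fin n) : Coord n b := fun k a =>
  (if k = i then (p j a : ℝ) else 0) - (if k = j then (p i a : ℝ) else 0)

/-- `u_{ij}`, with components `δ_{ki} (p_j t²) t^a - δ_{kj} (p_i t²) t^a`. -/
noncomputable def Geometry.uVec (G : Geometry b) {n : ℕ} (p : Fin n → Fin b → ℤ)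
    (i j : Fin n) : Coord n b := fun k a =>
  (if k = i then cub G.κ (toR (p j)) G.t G.t * G.t a else 0)
    - (if k = j then cub G.κ (toR (p i)) G.t G.t * G.t a else 0)

/-- `v_ℓ`, the sum of the `v_{ij}` with `i ≤ ℓ < j`, for the charges in the order `s`. -/
noncomputable def vCut {n : ℕ} (p : Fin n → Fin b → ℤ) (s : Equiv.Perm (Fin n)) (ℓ : Fin n) :
    Coord n b :=
  ∑ i, ∑ j, vVec p (s (head ℓ i)) (s (tail ℓ j))

/-- `u_ℓ`, the sum of the `u_{ij}` with `i ≤ ℓ < j`, for the charges in the order `s`. -/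
noncomputable def Geometry.uCut (G : Geometry b) {n : ℕ} (p : Fin n → Fin b → ℤ)
    (s : Equiv.Perm (Fin n)) (ℓ : Fin n) : Coord n b :=
  ∑ i, ∑ j, G.uVec p (s (head ℓ i)) (s (tail ℓ j))

/-- The stability parameters (rescaled by `√(2τ₂)`) as functions of `x`:
`c_i = ∑_j Im (Z_{γ_i} \bar Z_{γ_j})`, with `u_{ij} · x` for `-2 Im (Z_{γ_i} \bar Z_{γ_j})`. -/
noncomputable def Geometry.stabX (G : Geometry b) {n : ℕ} (p : Fin n → Fin b → ℤ)
    (x : Coord n b) : Fin n → ℝ :=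
  fun i => -(1 / 2 : ℝ) * ∑ j, G.bil p (G.uVec p i j) x

/-- `β_{ni}` (rescaled by `√(2τ₂)`) as a function of `x`, with `v_{ij} · x` for `γ_{ij}`. -/
noncomputable def Geometry.betaX (G : Geometry b) {n : ℕ} (p : Fin n → Fin b → ℤ)
    (x : Coord n b) : Fin n → ℝ :=
  fun i => ∑ j, G.bil p (vVec p j i) x

/-- `Φ` is a kernel of the functions `f_n({γ_i, c_i}; τ₂)`: the two are related by the standard
factor at all charges in `Γ₊` and all moduli off the walls of marginal stability, and `Φ_n` is
continuous off these walls. -/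
def Geometry.IsKernel (G : Geometry b) (σ : Charge b → ℝ)
    (f : ∀ n, (Fin n → Charge b) → (Fin n → ℝ) → ℝ → ℝ)
    (Φ : ∀ n, (Fin n → Fin b → ℤ) → Coord n b → ℝ) : Prop :=
  (∀ n, 1 ≤ n → ∀ γ : Fin n → Charge b, (∀ i, γ i ∈ G.chargeSet) →
    ∀ (B : Fin b → ℝ) (τ : ℝ), 0 < τ → GenericStab (G.stab B γ) →
      Φ n (fun i => (γ i).1) (G.point γ B τ) = kerFactor σ γ τ * f n γ (G.stab B γ) τ) ∧
  ∀ n, 1 ≤ n → ∀ p : Fin n → Fin b → ℤ, (∀ i, p i ∈ G.D4) →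
    ContinuousOn (Φ n p) {x | GenericStab (G.stabX p x)}

/-- `Φ` is a kernel of the moduli independent functions `f_n({γ_i}; τ₂)`. -/
def Geometry.IsKernelIndep (G : Geometry b) (σ : Charge b → ℝ)
    (f : ∀ n, (Fin n → Charge b) → ℝ → ℝ)
    (Φ : ∀ n, (Fin n → Fin b → ℤ) → Coord n b → ℝ) : Prop :=
  ∀ n, 1 ≤ n → ∀ γ : Fin n → Charge b, (∀ i, γ i ∈ G.chargeSet) →
    ∀ (B : Fin b → ℝ) (τ : ℝ), 0 < τ →
      Φ n (fun i => (γ i).1) (G.point γ B τ) = kerFactor σ γ τ * f n γ τ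

/-- `Φ0 n p x c` is a kernel of `g^{(0)}_n({γ_i, c_i})` where the stability parameters are kept as
independent variables, and `g^{(0)}_n` is discontinuous only at walls of marginal stability:
the kernel is smooth in `(x, c)` wherever no proper subset of the `c_i` sums up to zero. -/
def Geometry.IsSeedKernel (G : Geometry b) (σ : Charge b → ℝ)
    (g0 : ∀ n, (Fin n → Charge b) → (Fin n → ℝ) → ℝ)
    (Φ0 : ∀ n, (Fin n → Fin b → ℤ) → Coord n b → (Fin n → ℝ) → ℝ) : Prop :=
  (∀ n, 1 ≤ n → ∀ γ : Fin n → Charge b, (∀ i, γ i ∈ G.chargeSet) →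
    ∀ (B : Fin b → ℝ) (τ : ℝ), 0 < τ →
    ∀ c : Fin n → ℝ, ∑ i, c i = 0 → GenericStab c →
      Φ0 n (fun i => (γ i).1) (G.point γ B τ) c = kerFactor σ γ τ * g0 n γ c) ∧
  ∀ n, 1 ≤ n → ∀ p : Fin n → Fin b → ℤ, (∀ i, p i ∈ G.D4) →
    ContDiffOn ℝ ∞ (fun y : Coord n b × (Fin n → ℝ) => Φ0 n p y.1 y.2)
      {y | ∑ i, y.2 i = 0 ∧ GenericStab y.2}

/-! ### Vignéras' operator and the modularity constraint -/

/-- The partial derivative with respect to `x_i^a`. -/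
noncomputable def pd {n : ℕ} (i : Fin n) (a : Fin b) (f : Coord n b → ℝ) : Coord n b → ℝ :=
  fun x => fderiv ℝ f x (Pi.single i (Pi.single a 1))

/-- `∂_x² = ∑_i κ_i^{ab} ∂_{i,a} ∂_{i,b}`. -/
noncomputable def Geometry.box (G : Geometry b) {n : ℕ} (p : Fin n → Fin b → ℤ)
    (f : Coord n b → ℝ) : Coord n b → ℝ :=
  fun x => ∑ i, ∑ a, ∑ a', (kmat G.κ (p i))⁻¹ a a' * pd i a (pd i a' f) x

/-- Vignéras' operator `V_λ = ∂_x² + 2π (x · ∂_x - λ)`. -/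
noncomputable def Geometry.vigneras (G : Geometry b) {n : ℕ} (p : Fin n → Fin b → ℤ) (lam : ℝ)
    (f : Coord n b → ℝ) : Coord n b → ℝ :=
  fun x => G.box p f x + 2 * Real.pi * ((∑ i, ∑ a, x i a * pd i a f x) - lam * f x)

/-- The formal adjoint of Vignéras' operator, acting on test functions. -/
noncomputable def Geometry.vignerasAdj (G : Geometry b) {n : ℕ} (p : Fin n → Fin b → ℤ) (lam : ℝ)
    (φ : Coord n b → ℝ) : Coord n b → ℝ :=
  fun x => G.box p φ x
    + 2 * Real.pi * (-(∑ i, ∑ a, pd i a (fun y => y i a * φ y) x) - lam * φ x)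

/-- The measure `δ(u · x) dx` on the hyperplane `u · x = 0`, for `u² ≠ 0`: Lebesgue measure on the
slab `0 ≤ u · x ≤ 1`, projected to the hyperplane along `u`. -/
noncomputable def Geometry.deltaMeasure (G : Geometry b) {n : ℕ} (p : Fin n → Fin b → ℤ)
    (u : Coord n b) : Measure (Coord n b) :=
  (volume.restrict {x | 0 ≤ G.bil p u x ∧ G.bil p u x ≤ 1}).map
    fun x => x - (G.bil p u x / G.bil p u u) • u

/-- The pairing of `δ(u · x)` with `F`. -/
noncomputable def Geometry.deltaPair (G : Geometry b) {n : ℕ} (p : Fin n → Fin b → ℤ)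
    (u : Coord n b) (F : Coord n b → ℝ) : ℝ :=
  ∫ x, F x ∂(G.deltaMeasure p u)

/-- The pairing of `δ'(u · x)` with `F`, where `δ'(u · x) = w · ∂_x δ(u · x)` for the
vector `w = u / u²`, which satisfies `u · w = 1`. -/
noncomputable def Geometry.deltaPrimePair (G : Geometry b) {n : ℕ} (p : Fin n → Fin b → ℤ)
    (u : Coord n b) (F : Coord n b → ℝ) : ℝ :=
  -∫ x, lineDeriv ℝ F x ((G.bil p u u)⁻¹ • u) ∂(G.deltaMeasure p u)

/-- `Δ_{n,ℓ} = ½ (v_ℓ, x) Φ_ℓ Φ_{n-ℓ}`, for the charges in the order `s`. -/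
noncomputable def Geometry.jump (G : Geometry b)
    (Φ : ∀ n, (Fin n → Fin b → ℤ) → Coord n b → ℝ) {n : ℕ} (p : Fin n → Fin b → ℤ)
    (s : Equiv.Perm (Fin n)) (ℓ : Fin n) : Coord n b → ℝ := fun x =>
  (1 / 2 : ℝ) * G.bil p (vCut p s ℓ) x * Φ ℓ (p ∘ s ∘ head ℓ) (x ∘ s ∘ head ℓ)
    * Φ (n - ℓ) (p ∘ s ∘ tail ℓ) (x ∘ s ∘ tail ℓ)

/-- The modularity constraint
`V_{n-1} Φ_n = Sym ∑_ℓ [u_ℓ² Δ_{n,ℓ} δ'(u_ℓ · x) + 2 (u_ℓ · ∂_x Δ_{n,ℓ}) δ(u_ℓ · x)]`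
as an identity of distributions, together with the facts that make both sides well defined. -/
structure Geometry.ModularityConstraint (G : Geometry b)
    (Φ : ∀ n, (Fin n → Fin b → ℤ) → Coord n b → ℝ) (n : ℕ) (p : Fin n → Fin b → ℤ) : Prop where
  locallyIntegrable : LocallyIntegrable (Φ n p) volume
  lineDifferentiable : ∀ (s : Equiv.Perm (Fin n)) (ℓ : Fin n), 0 < (ℓ : ℕ) →
    ∀ᵐ x ∂(G.deltaMeasure p (G.uCut p s ℓ)),
      LineDifferentiableAt ℝ (G.jump Φ p s ℓ) x (G.uCut p s ℓ)
  integrable : ∀ φ : Coord n b → ℝ, ContDiff ℝ ∞ φ → HasCompactSupport φ →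
    ∀ (s : Equiv.Perm (Fin n)) (ℓ : Fin n), 0 < (ℓ : ℕ) →
      Integrable (fun x => lineDeriv ℝ (G.jump Φ p s ℓ) x (G.uCut p s ℓ) * φ x)
        (G.deltaMeasure p (G.uCut p s ℓ)) ∧
      Integrable (fun x => G.jump Φ p s ℓ x * lineDeriv ℝ φ x (G.uCut p s ℓ))
        (G.deltaMeasure p (G.uCut p s ℓ))
  equation : ∀ φ : Coord n b → ℝ, ContDiff ℝ ∞ φ → HasCompactSupport φ →
    ∫ x, Φ n p x * G.vignerasAdj p ((n : ℝ) - 1) φ x =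
      symmetrize fun s => ∑ ℓ ∈ cuts n,
        (G.bil p (G.uCut p s ℓ) (G.uCut p s ℓ) *
            G.deltaPrimePair p (G.uCut p s ℓ) (fun x => G.jump Φ p s ℓ x * φ x)
          + 2 * G.deltaPair p (G.uCut p s ℓ)
            (fun x => lineDeriv ℝ (G.jump Φ p s ℓ) x (G.uCut p s ℓ) * φ x))

end D4D2

open D4D2

namespace D4D2

/-! ### Counting permutations with prescribed fibres -/

/-! The coefficient recursion is an identity in an algebra of symmetric families. A symmetric family
`E` with `E_1 = 1` acts on a family `F` by substitution: the charges are grouped, each group is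
weighted by `E`, and `F` is evaluated on the sums (`substFam`). Binary splitting (`splitFam`)
commutes with substitution, because its ingredients, namely partial sums of the `c_i`, DSZ products
and parameters at the wall, are additive under grouping (`splitFam_substFam`, `substFam_splitFam`).
The ansatz says that `ghat` turns into `g0` under substitution of `E` (`substFam_ghat`), and the two
assumptions on `E` together say that `W` turns into `g0` at `c = beta γ` (`substFam_W`). After
substitution the coefficient recursion is therefore the recursion of the seeds, and substitution can
be undone since `E_1 = 1` (`eq_of_substFam_eq`).

For the modularity constraint the kernel is studied chamber by chamber. At charges in general
position the seed recursion allows only finitely many values of `g0`, so the seed kernel, being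
continuous in `c`, is constant on each chamber (`KernelSystem.seed_eq_of_sameChamber`). Since `g0`
does not involve `τ₂`, the seed kernel is homogeneous of degree `n - 1` in `x`, hence analytic. The
rescaled kernel `r^(1-n) ΦE(r y)` converges to it exponentially fast. Vignéras' equation turns the
dependence on `r` into a flow with velocity proportional to `r⁻³ ∂²` of the rescaled kernel;
convergence faster than `r⁻²` then forces the limit to be annihilated by `∂²`
(`Geometry.box_eq_zero_of_tendsto`, `KernelSystem.box_seed`). So seed kernels solve Vignéras'
equation. In the ansatz every term is a product of kernels with pairwise orthogonal gradients,
because block kernels are invariant under common translations; hence the kernel of `ghat` solves the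
equation in every chamber (`KernelSystem.vigneras_ghatKernel`).

What remains of `V_{n-1} Φ` is carried by the walls and determined by the jumps there. When the
coefficient recursion is compared on the two sides of a wall, `W` and all splittings not along the
wall cancel, and the jump is a symmetrized sum of the functions `Δ_{n,ℓ}`
(`KernelSystem.ghatKernel_jump`). Integration by parts for functions smooth in the chambers of a
hyperplane arrangement (`integral_apply_pattern_mul_fderiv`) turns a jump `J` across `u · x = 0`
into the integral of `(u · ∂J) φ - J (u · ∂φ)` over the wall. This is the pairing of `u² J δ'(u · x)
+ 2 (u · ∂J) δ(u · x)` with `φ` (`KernelSystem.deltaPrimePair_add_deltaPair`). -/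

theorem exists_perm_comp_eq {α κ : Type*} [Fintype α] [DecidableEq κ] (f g : α → κ)
    (h : ∀ k, (Finset.univ.filter (f · = k)).card = (Finset.univ.filter (g · = k)).card) :
    ∃ s : Equiv.Perm α, f ∘ s = g := by
  have e : ∀ k, Nonempty ({a // g a = k} ≃ {a // f a = k}) := fun k => by
    rw [← Fintype.card_eq, Fintype.card_subtype, Fintype.card_subtype, h]
  let e' := fun k => (e k).some
  refine ⟨(Equiv.sigmaFiberEquiv g).symm.trans
    ((Equiv.sigmaCongrRight e').trans (Equiv.sigmaFiberEquiv f)), ?_⟩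
  funext a
  exact (e' (g a) ⟨a, rfl⟩).2

/-- The solutions form a coset of the stabilizer of `f`, and the stabilizer permutes every fibre of
`f` independently. -/
theorem card_perm_comp_eq {α κ : Type*} [Fintype α] [DecidableEq α] [DecidableEq κ] [Fintype κ]
    (f g : α → κ)
    (h : ∀ k, (Finset.univ.filter (f · = k)).card = (Finset.univ.filter (g · = k)).card) :
    (Finset.univ.filter fun s : Equiv.Perm α => f ∘ s = g).card
      = ∏ k, ((Finset.univ.filter (f · = k)).card).factorial := by
  obtain ⟨s₀, rfl⟩ := exists_perm_comp_eq f g h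
  have h1 := DomMulAct.stabilizer_card f
  simp only [Fintype.card_subtype] at h1
  rw [← h1]
  refine Finset.card_bij (fun s _ => s * s₀⁻¹) ?_ ?_ ?_
  · intro s hs
    simp only [Finset.mem_filter, Finset.mem_univ, true_and] at hs ⊢
    funext a
    have := congrFun hs (s₀⁻¹ a)
    simpa using this
  · intro s _ t _ hst
    simpa using hst
  · intro s hs
    simp only [Finset.mem_filter, Finset.mem_univ, true_and] at hs
    refine ⟨s * s₀, ?_, by simp⟩
    simp only [Finset.mem_filter, Finset.mem_univ, true_and]
    funext a
    exact congrFun hs (s₀ a)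

theorem card_fiber_comp_perm {α κ : Type*} [Fintype α] [DecidableEq κ]
    (f : α → κ) (s : Equiv.Perm α) (k : κ) :
    (Finset.univ.filter ((f ∘ s) · = k)).card = (Finset.univ.filter (f · = k)).card := by
  refine Finset.card_bij (fun a _ => s a) (by simp) (by simp) ?_
  intro a ha
  exact ⟨s.symm a, by simpa using ha, by simp⟩

theorem card_fiber_index {n : ℕ} (bl : Composition n) (k : Fin bl.length) :
    (Finset.univ.filter (bl.index · = k)).card = bl.blocksFun k := by
  have : (Finset.univ.filter (bl.index · = k)) = Finset.univ.map (bl.embedding k).toEmbedding := by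
    ext i
    simp only [Finset.mem_filter, Finset.mem_univ, true_and, Finset.mem_map]
    constructor
    · rintro rfl
      exact ⟨_, bl.embedding_comp_inv i⟩
    · rintro ⟨j, rfl⟩
      exact bl.index_embedding k j
  rw [this]
  simp

/-- Trades an average over orderings for a sum over set functions: `g ∘ s.symm = f` means `f ∘ s =
g`, and the number of such `s` depends only on the fibre sizes. -/
theorem sum_perm_apply_comp_symm {n : ℕ} {κ : Type*} [Fintype κ] [DecidableEq κ]
    (g : Fin n → κ) (Y : (Fin n → κ) → ℝ) :
    ∑ s : Equiv.Perm (Fin n), Y (g ∘ s.symm)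
      = ∑ f : Fin n → κ,
        if ∀ k, (Finset.univ.filter (f · = k)).card = (Finset.univ.filter (g · = k)).card then
          (∏ k, (((Finset.univ.filter (f · = k)).card).factorial : ℝ)) * Y f else 0 := by
  have h1 : ∀ s : Equiv.Perm (Fin n), Y (g ∘ s.symm)
      = ∑ f : Fin n → κ, if f ∘ s = g then Y f else 0 := by
    intro s
    rw [Finset.sum_eq_single (g ∘ s.symm)]
    · rw [if_pos]
      funext a
      simp
    · intro f _ hf
      rw [if_neg]
      rintro rfl
      apply hf
      funext a
      simp
    · simp
  simp_rw [h1]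
  rw [Finset.sum_comm]
  refine Finset.sum_congr rfl fun f _ => ?_
  rw [← Finset.sum_filter, Finset.sum_const, nsmul_eq_mul]
  split_ifs with h
  · rw [card_perm_comp_eq f g h]
    push_cast
    rfl
  · have : (Finset.univ.filter fun s : Equiv.Perm (Fin n) => f ∘ s = g) = ∅ := by
      rw [Finset.filter_eq_empty_iff]
      rintro s _ rfl
      exact h fun k => (card_fiber_comp_perm f s k).symm
    rw [this]
    simp

theorem sigma_cast_eq {n m m' : ℕ} (h : m = m') (f : Fin n → Fin m) :
    (⟨m', Fin.cast h ∘ f⟩ : Σ m, Fin n → Fin m) = ⟨m, f⟩ := by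
  subst h
  rfl

/-- A sum over permutations and compositions is a sum over surjections. -/
theorem sum_perm_composition {n : ℕ} (Y : ∀ m, (Fin n → Fin m) → ℝ) :
    ∑ s : Equiv.Perm (Fin n), ∑ bl : Composition n, Y bl.length (bl.index ∘ s.symm)
      = ∑ m ∈ Finset.range (n + 1), ∑ f : Fin n → Fin m,
        open Classical in if Function.Surjective f then
          (∏ k, (((Finset.univ.filter (f · = k)).card).factorial : ℝ)) * Y m f else 0 := by
  classical
  rw [Finset.sum_comm]
  simp_rw [fun bl : Composition n => sum_perm_apply_comp_symm bl.index (Y bl.length),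
    card_fiber_index]
  rw [Finset.sum_sigma', Finset.sum_sigma', ← Finset.sum_filter, ← Finset.sum_filter]
  refine Finset.sum_bij (fun x _ => ⟨x.1.length, x.2⟩) ?_ ?_ ?_ ?_
  · rintro ⟨bl, f⟩ h
    simp only [Finset.mem_filter, Finset.mem_sigma, Finset.mem_univ, true_and, and_true,
      Finset.mem_range, Finset.univ_sigma_univ] at h ⊢
    refine ⟨Nat.lt_succ_of_le bl.length_le, fun k => ?_⟩
    have h1 : 0 < (Finset.univ.filter (f · = k)).card := by
      rw [h k]
      exact bl.one_le_blocksFun k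
    obtain ⟨a, ha⟩ := Finset.card_pos.mp h1
    exact ⟨a, by simpa using ha⟩
  · rintro ⟨bl, f⟩ h ⟨bl', f'⟩ h' heq
    simp only [Finset.mem_filter, Finset.mem_univ, true_and, Finset.univ_sigma_univ] at h h' heq
    -- The list of fibre sizes, from which the composition is recovered.
    let B : (Σ m, Fin n → Fin m) → List ℕ := fun x =>
      List.ofFn fun k => (Finset.univ.filter (x.2 · = k)).card
    have e1 : B ⟨bl.length, f⟩ = bl.blocks := by
      rw [← bl.ofFn_blocksFun]
      exact congrArg List.ofFn (funext h)
    have e2 : B ⟨bl'.length, f'⟩ = bl'.blocks := by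
      rw [← bl'.ofFn_blocksFun]
      exact congrArg List.ofFn (funext h')
    have : bl = bl' := by
      ext1
      rw [← e1, ← e2, heq]
    subst this
    simpa using heq
  · rintro ⟨m, f⟩ h
    simp only [Finset.mem_filter, Finset.mem_sigma, Finset.mem_univ, and_true,
      Finset.mem_range] at h
    let L : List ℕ := List.ofFn fun k : Fin m => (Finset.univ.filter (f · = k)).card
    let bl : Composition n := ⟨L, by
        intro i hi
        rw [List.mem_ofFn] at hi
        obtain ⟨k, rfl⟩ := hi
        obtain ⟨a, ha⟩ := h.2 k
        exact Finset.card_pos.mpr ⟨a, by simpa using ha⟩, by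
        rw [List.sum_ofFn]
        have := Finset.card_eq_sum_card_fiberwise (f := f) (s := Finset.univ) (t := Finset.univ)
          (by simp)
        simpa using this.symm⟩
    have hl : bl.length = m := by
      change L.length = m
      simp [L]
    refine ⟨⟨bl, Fin.cast hl.symm ∘ f⟩, ?_, sigma_cast_eq hl.symm f⟩
    simp only [Finset.mem_filter, Finset.mem_univ, true_and, Finset.univ_sigma_univ]
    intro k
    have : bl.blocksFun k = (Finset.univ.filter (f · = Fin.cast hl k)).card := by
      change L.get k = _
      simp only [L, List.get_ofFn]
    rw [this]
    congr 1
    ext a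
    simp only [Finset.mem_filter, Finset.mem_univ, true_and, Function.comp]
    constructor <;> intro h <;> apply Fin.ext <;> simpa [Fin.ext_iff] using h
  · rintro ⟨bl, f⟩ _
    rfl

/-- A sum over permutations and cuts is a sum over subsets. -/
theorem sum_perm_cut {n : ℕ} (ℓ : Fin n) (X : Finset (Fin n) → ℝ) :
    ∑ s : Equiv.Perm (Fin n), X (Finset.univ.image (s ∘ head ℓ))
      = ∑ I : Finset (Fin n), if I.card = ℓ then
        (((ℓ : ℕ).factorial : ℝ) * ((n - ℓ).factorial : ℝ)) * X I else 0 := by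
  classical
  -- A cut is a colouring of the positions by two colours, so the count is the one for fibre sizes
  -- `ℓ` and `n - ℓ`.
  let g : Fin n → Bool := fun i => decide (i < ℓ)
  have key := sum_perm_apply_comp_symm g fun f => X (Finset.univ.filter (f · = true))
  have hX : ∀ s : Equiv.Perm (Fin n), Finset.univ.filter ((g ∘ s.symm) · = true)
      = Finset.univ.image (s ∘ head ℓ) := by
    intro s
    ext i
    simp only [g, Function.comp, Finset.mem_filter, Finset.mem_univ, true_and, decide_eq_true_eq,
      Finset.mem_image, head]
    constructor
    · intro h
      exact ⟨⟨s.symm i, h⟩, by simp [Fin.castLE]⟩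
    · rintro ⟨j, rfl⟩
      simp [Fin.lt_def]
  simp_rw [hX] at key
  rw [key]
  let e : (Fin n → Bool) ≃ Finset (Fin n) :=
    { toFun := fun f => Finset.univ.filter (f · = true)
      invFun := fun I i => decide (i ∈ I)
      left_inv := fun f => by ext i; simp
      right_inv := fun I => by ext i; simp }
  rw [← e.sum_comp]
  refine Finset.sum_congr rfl fun f _ => ?_
  have hf : ∀ f : Fin n → Bool, (Finset.univ.filter (f · = false)).card
      = n - (Finset.univ.filter (f · = true)).card := by
    intro f
    have : Finset.univ.filter (f · = false) = (Finset.univ.filter (f · = true))ᶜ := by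
      ext; simp
    rw [this, Finset.card_compl, Fintype.card_fin]
  have hg : (Finset.univ.filter (g · = true)).card = ℓ := by
    have : Finset.univ.filter (g · = true) = Finset.Iio ℓ := by
      ext
      simp [g]
    rw [this, Fin.card_Iio]
  simp only [Bool.forall_bool, hf, hg, Fintype.prod_bool]
  change _ = if (Finset.univ.filter (f · = true)).card = ℓ then _ else 0
  by_cases h : (Finset.univ.filter (f · = true)).card = ℓ
  · rw [if_pos ⟨by rw [h], h⟩, if_pos h, h]
    rfl
  · rw [if_neg (fun h' => h h'.2), if_neg h]


/-! ### Substitution of symmetric families, as sums over set functions -/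

/-- Merging along a function on an arbitrary index type. -/
def push {A ι : Type*} [AddCommMonoid A] [Fintype ι] {m : ℕ} (f : ι → Fin m) (a : ι → A) :
    Fin m → A :=
  fun k => ∑ i with f i = k, a i

theorem merge_eq_push {A : Type*} [AddCommMonoid A] {n m : ℕ} (f : Fin n → Fin m) (a : Fin n → A) :
    merge f a = push f a := rfl

theorem push_comp_equiv {A ι ι' : Type*} [AddCommMonoid A] [Fintype ι] [Fintype ι'] {m : ℕ}
    (e : ι ≃ ι') (f : ι' → Fin m) (a : ι' → A) : push (f ∘ e) (a ∘ e) = push f a := by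
  funext k
  simp only [push, Finset.sum_filter, Function.comp]
  exact e.sum_comp fun i => if f i = k then a i else 0

theorem merge_comp_perm {A : Type*} [AddCommMonoid A] {n m : ℕ} (f : Fin n → Fin m) (a : Fin n → A)
    (s : Equiv.Perm (Fin n)) : merge f (a ∘ s) = merge (f ∘ s.symm) a := by
  rw [merge_eq_push, merge_eq_push, ← push_comp_equiv s (f ∘ s.symm) a]
  congr 1
  funext i
  simp

theorem push_perm_comp {A ι : Type*} [AddCommMonoid A] [Fintype ι] {m : ℕ} (t : Equiv.Perm (Fin m))
    (f : ι → Fin m) (a : ι → A) : push f a ∘ t = push (t.symm ∘ f) a := by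
  funext k
  simp only [push, Function.comp]
  congr 1
  ext i
  simp [Equiv.symm_apply_eq]

theorem comp_perm_eq_merge {A : Type*} [AddCommMonoid A] {n : ℕ} (s : Equiv.Perm (Fin n))
    (a : Fin n → A) : a ∘ s = merge s.symm a := by
  funext k
  simp only [merge, Function.comp]
  rw [Finset.sum_eq_single (s k)]
  · intro j hj hne
    simp only [Finset.mem_filter, Finset.mem_univ, true_and] at hj
    exact absurd (by simp [← hj]) hne
  · simp

/-- Evaluation of a family on the subset `I` of the charges. -/
noncomputable def blockVal (E : ∀ n, (Fin n → Charge b) → ℝ) {ι : Type*} (γ : ι → Charge b)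
    (I : Finset ι) : ℝ := E I.card fun j => γ (I.equivFin.symm j)

/-- A family of functions which is symmetric on the set `S`. -/
def SymmOn (S : Set (Charge b)) (E : ∀ n, (Fin n → Charge b) → ℝ) : Prop :=
  ∀ n (γ : Fin n → Charge b), (∀ i, γ i ∈ S) → ∀ s : Equiv.Perm (Fin n), E n (γ ∘ s) = E n γ

/-- The enumeration `Finset.equivFin` inside `blockVal` is arbitrary; for a symmetric family any
other injective enumeration of the same set gives the same value. -/
theorem eq_blockVal {S : Set (Charge b)} {E : ∀ n, (Fin n → Charge b) → ℝ} (hE : SymmOn S E)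
    {ι : Type*} {γ : ι → Charge b} (hγ : ∀ i, γ i ∈ S) {k : ℕ} (e : Fin k → ι)
    (he : Function.Injective e) (I : Finset ι) (hI : ∀ i, i ∈ I ↔ ∃ j, e j = i) :
    E k (γ ∘ e) = blockVal E γ I := by
  classical
  have hk : k = I.card := by
    have : I = Finset.univ.image e := by
      ext i
      simp [hI]
    rw [this, Finset.card_image_of_injective _ he]
    simp
  subst hk
  let g : Fin I.card → Fin I.card := fun j => I.equivFin ⟨e j, (hI _).mpr ⟨j, rfl⟩⟩
  have hg : Function.Bijective g := by
    rw [← Finite.injective_iff_bijective]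
    intro i j hij
    apply he
    simpa [g] using hij
  have := hE I.card (fun j => γ (I.equivFin.symm j)) (fun _ => hγ _) (Equiv.ofBijective g hg)
  rw [blockVal, ← this]
  congr 1
  funext j
  simp [g]

theorem blockVal_comp {S : Set (Charge b)} {E : ∀ n, (Fin n → Charge b) → ℝ} (hE : SymmOn S E)
    {ι κ : Type*} {γ : κ → Charge b} (hγ : ∀ i, γ i ∈ S) (e : ι ↪ κ) (I : Finset ι) :
    blockVal E (γ ∘ e) I = blockVal E γ (I.map e) := by
  refine eq_blockVal hE hγ (fun j => e (I.equivFin.symm j)) ?_ _ ?_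
  · intro i j hij
    simpa using hij
  · intro i
    simp only [Finset.mem_map]
    constructor
    · rintro ⟨a, ha, rfl⟩
      exact ⟨I.equivFin ⟨a, ha⟩, by simp⟩
    · rintro ⟨j, rfl⟩
      exact ⟨_, (I.equivFin.symm j).2, rfl⟩

/-- The weight of a block. -/
noncomputable def blockWeight (E : ∀ n, (Fin n → Charge b) → ℝ) {ι : Type*} (γ : ι → Charge b)
    (I : Finset ι) : ℝ :=
  open Classical in if I.Nonempty then (I.card.factorial : ℝ) * blockVal E γ I else 0

theorem blockWeight_comp {S : Set (Charge b)} {E : ∀ n, (Fin n → Charge b) → ℝ} (hE : SymmOn S E)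
    {ι κ : Type*} {γ : κ → Charge b} (hγ : ∀ i, γ i ∈ S) (e : ι ↪ κ) (I : Finset ι) :
    blockWeight E (γ ∘ e) I = blockWeight E γ (I.map e) := by
  simp only [blockWeight, blockVal_comp hE hγ, Finset.map_nonempty, Finset.card_map]

/-- The product of the weights of the fibres. -/
noncomputable def fiberWeight (E : ∀ n, (Fin n → Charge b) → ℝ) {ι : Type*} [Fintype ι]
    (γ : ι → Charge b) {m : ℕ} (f : ι → Fin m) : ℝ :=
  ∏ k, blockWeight E γ (Finset.univ.filter (f · = k))

/-- Empty fibres have weight zero by convention. Sums over compositions may thus run over all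
functions, which can be cut and glued freely. -/
theorem fiberWeight_eq_zero (E : ∀ n, (Fin n → Charge b) → ℝ) {ι : Type*} [Fintype ι]
    (γ : ι → Charge b) {m : ℕ} (f : ι → Fin m) (hf : ¬ Function.Surjective f) :
    fiberWeight E γ f = 0 := by
  simp only [Function.Surjective, not_forall, not_exists] at hf
  obtain ⟨k, hk⟩ := hf
  refine Finset.prod_eq_zero (Finset.mem_univ k) ?_
  rw [blockWeight, if_neg]
  rw [Finset.not_nonempty_iff_eq_empty, Finset.filter_eq_empty_iff]
  exact fun i _ => hk i

theorem fiberWeight_of_surjective (E : ∀ n, (Fin n → Charge b) → ℝ) {ι : Type*} [Fintype ι]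
    (γ : ι → Charge b) {m : ℕ} (f : ι → Fin m) (hf : Function.Surjective f) :
    fiberWeight E γ f = (∏ k, ((Finset.univ.filter (f · = k)).card.factorial : ℝ)) *
      ∏ k, blockVal E γ (Finset.univ.filter (f · = k)) := by
  rw [fiberWeight, ← Finset.prod_mul_distrib]
  refine Finset.prod_congr rfl fun k _ => ?_
  rw [blockWeight, if_pos]
  obtain ⟨i, hi⟩ := hf k
  exact ⟨i, by simpa using hi⟩

theorem fiberWeight_perm_comp (E : ∀ n, (Fin n → Charge b) → ℝ) {ι : Type*} [Fintype ι]
    (γ : ι → Charge b) {m : ℕ} (f : ι → Fin m) (t : Equiv.Perm (Fin m)) :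
    fiberWeight E γ (t ∘ f) = fiberWeight E γ f := by
  rw [fiberWeight, ← Equiv.prod_comp t]
  simp [fiberWeight]

theorem fiberWeight_comp_equiv {S : Set (Charge b)} {E : ∀ n, (Fin n → Charge b) → ℝ}
    (hE : SymmOn S E) {ι κ : Type*} [Fintype ι] [Fintype κ] {γ : κ → Charge b}
    (hγ : ∀ i, γ i ∈ S) {m : ℕ} (f : κ → Fin m) (e : ι ≃ κ) :
    fiberWeight E (γ ∘ e) (f ∘ e) = fiberWeight E γ f := by
  refine Finset.prod_congr rfl fun k _ => ?_
  rw [show γ ∘ e = γ ∘ e.toEmbedding from rfl, blockWeight_comp hE hγ]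
  congr 1
  ext i
  simp only [Finset.mem_map, Finset.mem_filter, Finset.mem_univ, true_and]
  constructor
  · rintro ⟨a, ha, rfl⟩
    exact ha
  · intro h
    exact ⟨e.symm i, by simpa using h, by simp⟩

/-- The term of degree `m` of the substitution of `E` into `F`. -/
noncomputable def substTerm (F : ∀ n, (Fin n → Charge b) → (Fin n → ℝ) → ℝ)
    (E : ∀ n, (Fin n → Charge b) → ℝ) {ι : Type*} [Fintype ι] [DecidableEq ι] (γ : ι → Charge b)
    (c : ι → ℝ) (m : ℕ) : ℝ :=
  ∑ f : ι → Fin m, F m (push f γ) (push f c) * fiberWeight E γ f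

theorem substTerm_comp_equiv {S : Set (Charge b)} {E : ∀ n, (Fin n → Charge b) → ℝ}
    (hE : SymmOn S E) (F : ∀ n, (Fin n → Charge b) → (Fin n → ℝ) → ℝ)
    {ι κ : Type*} [Fintype ι] [Fintype κ] [DecidableEq ι] [DecidableEq κ] {γ : κ → Charge b}
    (hγ : ∀ i, γ i ∈ S) (c : κ → ℝ) (m : ℕ) (e : ι ≃ κ) :
    substTerm F E (γ ∘ e) (c ∘ e) m = substTerm F E γ c m := by
  rw [substTerm, ← (e.arrowCongr (Equiv.refl (Fin m))).symm.sum_comp]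
  refine Finset.sum_congr rfl fun f _ => ?_
  have : (e.arrowCongr (Equiv.refl (Fin m))).symm f = f ∘ e := rfl
  rw [this, push_comp_equiv, push_comp_equiv, fiberWeight_comp_equiv hE hγ]

theorem substTerm_eq_zero (F : ∀ n, (Fin n → Charge b) → (Fin n → ℝ) → ℝ)
    (E : ∀ n, (Fin n → Charge b) → ℝ) {ι : Type*} [Fintype ι] [DecidableEq ι] (γ : ι → Charge b)
    (c : ι → ℝ) (m : ℕ) (hm : Fintype.card ι < m) : substTerm F E γ c m = 0 := by
  refine Finset.sum_eq_zero fun f _ => ?_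
  rw [fiberWeight_eq_zero, mul_zero]
  intro hf
  have := Fintype.card_le_of_surjective f hf
  simp at this
  omega

/-- Substitution of the symmetric family `E` into `F`. -/
noncomputable def substFam (F : ∀ n, (Fin n → Charge b) → (Fin n → ℝ) → ℝ)
    (E : ∀ n, (Fin n → Charge b) → ℝ) (n : ℕ) (γ : Fin n → Charge b) (c : Fin n → ℝ) : ℝ :=
  symmetrize fun s => ∑ bl : Composition n,
    F bl.length (merge bl.index (γ ∘ s)) (merge bl.index (c ∘ s)) *
      ∏ k, E (bl.blocksFun k) (γ ∘ s ∘ bl.embedding k)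

theorem factorial_mul_symmetrize {n : ℕ} (F : Equiv.Perm (Fin n) → ℝ) :
    (n.factorial : ℝ) * symmetrize F = ∑ s, F s := by
  rw [symmetrize, mul_inv_cancel_left₀]
  exact_mod_cast n.factorial_ne_zero

theorem prod_embedding_eq_blockVal {S : Set (Charge b)} {E : ∀ n, (Fin n → Charge b) → ℝ}
    (hE : SymmOn S E) {n : ℕ} {γ : Fin n → Charge b} (hγ : ∀ i, γ i ∈ S)
    (s : Equiv.Perm (Fin n)) (bl : Composition n) (k : Fin bl.length) :
    E (bl.blocksFun k) (γ ∘ s ∘ bl.embedding k)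
      = blockVal E γ (Finset.univ.filter ((bl.index ∘ s.symm) · = k)) := by
  refine eq_blockVal hE hγ (s ∘ bl.embedding k)
    (s.injective.comp (bl.embedding k).injective) _ fun i => ?_
  simp only [Finset.mem_filter, Finset.mem_univ, true_and, Function.comp]
  constructor
  · rintro rfl
    exact ⟨_, by rw [bl.embedding_comp_inv]; simp⟩
  · rintro ⟨j, rfl⟩
    simp [bl.index_embedding]

/-- The analogue of composing exponential generating functions: once `n!` is cleared, the orderings
disappear and every group carries its own factorial. -/
theorem factorial_mul_substFam {S : Set (Charge b)} {E : ∀ n, (Fin n → Charge b) → ℝ}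
    (hE : SymmOn S E) (F : ∀ n, (Fin n → Charge b) → (Fin n → ℝ) → ℝ) {n : ℕ}
    {γ : Fin n → Charge b} (hγ : ∀ i, γ i ∈ S) (c : Fin n → ℝ) :
    (n.factorial : ℝ) * substFam F E n γ c = ∑ m ∈ Finset.range (n + 1), substTerm F E γ c m := by
  rw [substFam, factorial_mul_symmetrize]
  simp_rw [merge_comp_perm, prod_embedding_eq_blockVal hE hγ]
  rw [sum_perm_composition fun m f => F m (merge f γ) (merge f c) *
    ∏ k, blockVal E γ (Finset.univ.filter (f · = k))]
  refine Finset.sum_congr rfl fun m _ => Finset.sum_congr rfl fun f _ => ?_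
  split_ifs with hf
  · rw [fiberWeight_of_surjective E γ f hf, merge_eq_push, merge_eq_push]
    ring
  · rw [fiberWeight_eq_zero E γ f hf, mul_zero]

/-! ### Splitting of functions -/

/-- The function built from functions on the two parts of the index set. -/
def glue {ι : Type*} [DecidableEq ι] {m : ℕ} (ℓ : Fin m) (I : Finset ι) (f : {i // i ∈ I} → Fin ℓ)
    (g : {i // i ∉ I} → Fin (m - ℓ)) : ι → Fin m :=
  fun i => if h : i ∈ I then head ℓ (f ⟨i, h⟩) else tail ℓ (g ⟨i, h⟩)

theorem glue_mem {ι : Type*} [DecidableEq ι] {m : ℕ} (ℓ : Fin m) (I : Finset ι)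
    (f : {i // i ∈ I} → Fin ℓ) (g : {i // i ∉ I} → Fin (m - ℓ)) (i : {i // i ∈ I}) :
    glue ℓ I f g i = head ℓ (f i) := by
  simp [glue, i.2]

theorem glue_not_mem {ι : Type*} [DecidableEq ι] {m : ℕ} (ℓ : Fin m) (I : Finset ι)
    (f : {i // i ∈ I} → Fin ℓ) (g : {i // i ∉ I} → Fin (m - ℓ)) (i : {i // i ∉ I}) :
    glue ℓ I f g i = tail ℓ (g i) := by
  simp [glue, i.2]

theorem head_lt {m : ℕ} (ℓ : Fin m) (j : Fin ℓ) : head ℓ j < ℓ := by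
  simp [head, Fin.lt_def]

theorem not_tail_lt {m : ℕ} (ℓ : Fin m) (j : Fin (m - ℓ)) : ¬ tail ℓ j < ℓ := by
  simp [tail, Fin.lt_def]

theorem head_injective {m : ℕ} (ℓ : Fin m) : Function.Injective (head ℓ) := by
  intro i j h
  simpa [head] using h

theorem tail_injective {m : ℕ} (ℓ : Fin m) : Function.Injective (tail ℓ) := by
  intro i j h
  simpa [tail, Fin.ext_iff] using h

theorem head_ne_tail {m : ℕ} (ℓ : Fin m) (i : Fin ℓ) (j : Fin (m - ℓ)) : head ℓ i ≠ tail ℓ j :=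
  fun h => not_tail_lt ℓ j (h ▸ head_lt ℓ i)

theorem exists_head {m : ℕ} (ℓ : Fin m) {i : Fin m} (h : i < ℓ) : ∃ j, head ℓ j = i :=
  ⟨⟨i, h⟩, by simp [head]⟩

theorem exists_tail {m : ℕ} (ℓ : Fin m) {i : Fin m} (h : ¬ i < ℓ) : ∃ j, tail ℓ j = i :=
  ⟨⟨i - ℓ, by have := i.2; rw [Fin.lt_def] at h; omega⟩, by
    rw [Fin.lt_def] at h
    simp only [tail, Fin.ext_iff]
    omega⟩

theorem glue_lt_iff {ι : Type*} [DecidableEq ι] {m : ℕ} (ℓ : Fin m) (I : Finset ι)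
    (f : {i // i ∈ I} → Fin ℓ) (g : {i // i ∉ I} → Fin (m - ℓ)) (i : ι) :
    glue ℓ I f g i < ℓ ↔ i ∈ I := by
  by_cases h : i ∈ I
  · simp only [h, iff_true]
    exact (glue_mem ℓ I f g ⟨i, h⟩) ▸ head_lt ℓ _
  · simp only [h, iff_false]
    exact (glue_not_mem ℓ I f g ⟨i, h⟩) ▸ not_tail_lt ℓ _

/-- A function to `Fin m` amounts to the set `I` sent below `ℓ` together with its restrictions to
`I` and to the complement. -/
theorem sum_eq_sum_glue {ι : Type*} [Fintype ι] [DecidableEq ι] {m : ℕ} (ℓ : Fin m)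
    (T : (ι → Fin m) → ℝ) :
    ∑ f, T f = ∑ I : Finset ι, ∑ f : {i // i ∈ I} → Fin ℓ, ∑ g : {i // i ∉ I} → Fin (m - ℓ),
      T (glue ℓ I f g) := by
  rw [← Finset.sum_fiberwise Finset.univ (fun f : ι → Fin m => Finset.univ.filter (f · < ℓ)) T]
  refine Finset.sum_congr rfl fun I _ => ?_
  rw [← Finset.sum_product']
  symm
  refine Finset.sum_bij (fun x _ => glue ℓ I x.1 x.2) ?_ ?_ ?_ (fun _ _ => rfl)
  · intro x _
    simp [glue_lt_iff]
  · rintro ⟨f, g⟩ _ ⟨f', g'⟩ _ h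
    simp only [Prod.mk.injEq]
    constructor
    · funext i
      have := congrFun h i
      simp only [glue_mem] at this
      exact head_injective ℓ this
    · funext i
      have := congrFun h i
      simp only [glue_not_mem] at this
      exact tail_injective ℓ this
  · intro f hf
    simp only [Finset.mem_filter, Finset.mem_univ, true_and] at hf
    have hf' : ∀ i, i ∈ I ↔ f i < ℓ := by
      intro i
      simp [← hf]
    choose g hg using fun i : {i // i ∈ I} => exists_head ℓ ((hf' i).mp i.2)
    choose g' hg' using fun i : {i // i ∉ I} => exists_tail ℓ (mt (hf' i).mpr i.2)
    refine ⟨(g, g'), by simp, ?_⟩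
    funext i
    by_cases h : i ∈ I
    · exact (glue_mem ℓ I g g' ⟨i, h⟩).trans (hg _)
    · exact (glue_not_mem ℓ I g g' ⟨i, h⟩).trans (hg' _)

theorem prod_head_mul_prod_tail {A : Type*} [CommMonoid A] {m : ℕ} (ℓ : Fin m) (F : Fin m → A) :
    (∏ j, F (head ℓ j)) * ∏ j, F (tail ℓ j) = ∏ k, F k := by
  rw [← Finset.prod_filter_mul_prod_filter_not Finset.univ (fun k => k < ℓ)]
  congr 1
  · refine Finset.prod_bij (fun j _ => head ℓ j) (fun j _ => by simp [head_lt])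
      (fun i _ j _ h => head_injective ℓ h) (fun k hk => ?_) (fun _ _ => rfl)
    obtain ⟨j, hj⟩ := exists_head ℓ (by simpa using hk : k < ℓ)
    exact ⟨j, Finset.mem_univ _, hj⟩
  · refine Finset.prod_bij (fun j _ => tail ℓ j)
      (fun j _ => by simpa using le_of_not_gt (not_tail_lt ℓ j))
      (fun i _ j _ h => tail_injective ℓ h) (fun k hk => ?_) (fun _ _ => rfl)
    obtain ⟨j, hj⟩ := exists_tail ℓ (by simpa using hk : ¬ k < ℓ)
    exact ⟨j, Finset.mem_univ _, hj⟩

theorem sum_head_add_sum_tail {A : Type*} [AddCommMonoid A] {m : ℕ} (ℓ : Fin m) (F : Fin m → A) :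
    (∑ j, F (head ℓ j)) + ∑ j, F (tail ℓ j) = ∑ k, F k :=
  prod_head_mul_prod_tail (A := Multiplicative A) ℓ F

theorem fiber_glue_head {ι : Type*} [Fintype ι] [DecidableEq ι] {m : ℕ} (ℓ : Fin m) (I : Finset ι)
    (f : {i // i ∈ I} → Fin ℓ) (g : {i // i ∉ I} → Fin (m - ℓ)) (k : Fin ℓ) :
    Finset.univ.filter (glue ℓ I f g · = head ℓ k)
      = (Finset.univ.filter (f · = k)).map (Function.Embedding.subtype _) := by
  ext i
  simp only [Finset.mem_filter, Finset.mem_univ, true_and, Finset.mem_map,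
    Function.Embedding.subtype_apply]
  constructor
  · intro h
    have hi : i ∈ I := (glue_lt_iff ℓ I f g i).mp (h ▸ head_lt ℓ k)
    refine ⟨⟨i, hi⟩, head_injective ℓ ?_, rfl⟩
    rw [← glue_mem ℓ I f g ⟨i, hi⟩, h]
  · rintro ⟨i, rfl, rfl⟩
    exact glue_mem ℓ I f g i

theorem fiber_glue_tail {ι : Type*} [Fintype ι] [DecidableEq ι] {m : ℕ} (ℓ : Fin m) (I : Finset ι)
    (f : {i // i ∈ I} → Fin ℓ) (g : {i // i ∉ I} → Fin (m - ℓ)) (k : Fin (m - ℓ)) :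
    Finset.univ.filter (glue ℓ I f g · = tail ℓ k)
      = (Finset.univ.filter (g · = k)).map (Function.Embedding.subtype _) := by
  ext i
  simp only [Finset.mem_filter, Finset.mem_univ, true_and, Finset.mem_map,
    Function.Embedding.subtype_apply]
  constructor
  · intro h
    have hi : i ∉ I := fun hi => not_tail_lt ℓ k (h ▸ (glue_lt_iff ℓ I f g i).mpr hi)
    refine ⟨⟨i, hi⟩, tail_injective ℓ ?_, rfl⟩
    rw [← glue_not_mem ℓ I f g ⟨i, hi⟩, h]
  · rintro ⟨i, rfl, rfl⟩
    exact glue_not_mem ℓ I f g i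

theorem push_glue_head {A ι : Type*} [AddCommMonoid A] [Fintype ι] [DecidableEq ι] {m : ℕ}
    (ℓ : Fin m) (I : Finset ι) (f : {i // i ∈ I} → Fin ℓ) (g : {i // i ∉ I} → Fin (m - ℓ))
    (a : ι → A) : push (glue ℓ I f g) a ∘ head ℓ = push f (a ∘ Subtype.val) := by
  funext k
  simp only [push, Function.comp, fiber_glue_head, Finset.sum_map,
    Function.Embedding.subtype_apply]

theorem push_glue_tail {A ι : Type*} [AddCommMonoid A] [Fintype ι] [DecidableEq ι] {m : ℕ}
    (ℓ : Fin m) (I : Finset ι) (f : {i // i ∈ I} → Fin ℓ) (g : {i // i ∉ I} → Fin (m - ℓ))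
    (a : ι → A) : push (glue ℓ I f g) a ∘ tail ℓ = push g (a ∘ Subtype.val) := by
  funext k
  simp only [push, Function.comp, fiber_glue_tail, Finset.sum_map,
    Function.Embedding.subtype_apply]

theorem fiberWeight_glue {S : Set (Charge b)} {E : ∀ n, (Fin n → Charge b) → ℝ}
    (hE : SymmOn S E) {ι : Type*} [Fintype ι] [DecidableEq ι] {γ : ι → Charge b}
    (hγ : ∀ i, γ i ∈ S) {m : ℕ} (ℓ : Fin m) (I : Finset ι) (f : {i // i ∈ I} → Fin ℓ)
    (g : {i // i ∉ I} → Fin (m - ℓ)) :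
    fiberWeight E γ (glue ℓ I f g) = fiberWeight E (fun i : {i // i ∈ I} => γ i) f *
      fiberWeight E (fun i : {i // i ∉ I} => γ i) g := by
  rw [fiberWeight, ← prod_head_mul_prod_tail ℓ]
  simp_rw [fiber_glue_head, fiber_glue_tail, ← blockWeight_comp hE hγ]
  rfl


/-! ### The DSZ product and partial sums under merging -/

theorem dsz_add_left (x y z : Charge b) : dsz (x + y) z = dsz x z + dsz y z := by
  simp only [dsz, Prod.fst_add, Prod.snd_add, Pi.add_apply, ← Finset.sum_add_distrib]
  refine Finset.sum_congr rfl fun a _ => ?_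
  push_cast
  ring

theorem dsz_swap (x y : Charge b) : dsz x y = -dsz y x := by
  simp only [dsz, ← Finset.sum_neg_distrib]
  refine Finset.sum_congr rfl fun a _ => ?_
  ring

theorem dsz_self (x : Charge b) : dsz x x = 0 := by
  simp [dsz]

theorem dsz_sum_left {ι : Type*} (I : Finset ι) (x : ι → Charge b) (z : Charge b) :
    dsz (∑ i ∈ I, x i) z = ∑ i ∈ I, dsz (x i) z :=
  map_sum (⟨⟨fun x => dsz x z, by simp [dsz]⟩, fun x y => dsz_add_left x y z⟩ : Charge b →+ ℝ) x I

theorem dsz_sum_right {ι : Type*} (I : Finset ι) (x : ι → Charge b) (z : Charge b) :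
    dsz z (∑ i ∈ I, x i) = ∑ i ∈ I, dsz z (x i) := by
  simp only [dsz_swap z, dsz_sum_left, Finset.sum_neg_distrib]

theorem beta_eq {n : ℕ} (γ : Fin n → Charge b) (i : Fin n) :
    beta γ i = dsz (∑ j, γ j) (γ i) := by
  rw [beta, dsz_sum_left]

theorem sum_merge {A : Type*} [AddCommMonoid A] {n m : ℕ} (f : Fin n → Fin m) (a : Fin n → A)
    (J : Finset (Fin m)) : ∑ k ∈ J, merge f a k = ∑ i with f i ∈ J, a i := by
  simp only [merge]
  rw [← Finset.sum_fiberwise_of_maps_to (s := Finset.univ.filter (f · ∈ J)) (t := J) (g := f)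
    (by simp)]
  refine Finset.sum_congr rfl fun k hk => Finset.sum_congr ?_ fun _ _ => rfl
  ext i
  simp only [Finset.mem_filter, Finset.mem_univ, true_and]
  constructor
  · rintro rfl
    exact ⟨hk, rfl⟩
  · exact fun h => h.2

theorem sum_univ_merge {A : Type*} [AddCommMonoid A] {n m : ℕ} (f : Fin n → Fin m)
    (a : Fin n → A) : ∑ k, merge f a k = ∑ i, a i := by
  simp [sum_merge]

theorem beta_merge {n m : ℕ} (f : Fin n → Fin m) (γ : Fin n → Charge b) :
    beta (merge f γ) = merge f (beta γ) := by
  funext k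
  rw [beta_eq, sum_univ_merge]
  simp only [merge, dsz_sum_right]
  exact Finset.sum_congr rfl fun i _ => (beta_eq γ i).symm

theorem sum_beta {n : ℕ} (γ : Fin n → Charge b) : ∑ i, beta γ i = 0 := by
  simp only [beta_eq, ← dsz_sum_right, dsz_self]

theorem sum_head {A : Type*} [AddCommMonoid A] {n : ℕ} (ℓ : Fin n) (a : Fin n → A) :
    ∑ j, a (head ℓ j) = ∑ i with i < ℓ, a i := by
  refine Finset.sum_bij (fun j _ => head ℓ j) (fun j _ => by simp [head_lt])
    (fun i _ j _ h => head_injective ℓ h) (fun k hk => ?_) (fun _ _ => rfl)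
  obtain ⟨j, hj⟩ := exists_head ℓ (by simpa using hk : k < ℓ)
  exact ⟨j, Finset.mem_univ _, hj⟩

theorem sum_tail {A : Type*} [AddCommMonoid A] {n : ℕ} (ℓ : Fin n) (a : Fin n → A) :
    ∑ j, a (tail ℓ j) = ∑ i with ¬ i < ℓ, a i := by
  refine Finset.sum_bij (fun j _ => tail ℓ j)
    (fun j _ => by simpa using le_of_not_gt (not_tail_lt ℓ j))
    (fun i _ j _ h => tail_injective ℓ h) (fun k hk => ?_) (fun _ _ => rfl)
  obtain ⟨j, hj⟩ := exists_tail ℓ (by simpa using hk : ¬ k < ℓ)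
  exact ⟨j, Finset.mem_univ _, hj⟩

theorem bigGamma_eq {n : ℕ} (ℓ : Fin n) (γ : Fin n → Charge b) :
    bigGamma ℓ γ = ∑ i with i < ℓ, beta γ i := by
  rw [bigGamma, Finset.sum_comm, ← sum_head]
  rfl

theorem partialSum_eq {n : ℕ} (ℓ : Fin n) (c : Fin n → ℝ) :
    partialSum ℓ c = ∑ i with i < ℓ, c i := sum_head ℓ c

/-- `⟨γ_I, γ_{I^c}⟩`. -/
noncomputable def dszSub {n : ℕ} (γ : Fin n → Charge b) (I : Finset (Fin n)) : ℝ :=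
  dsz (∑ i ∈ I, γ i) (∑ i ∈ Iᶜ, γ i)

theorem dszLR_eq {n : ℕ} (ℓ : Fin n) (γ : Fin n → Charge b) :
    dszLR ℓ γ = dszSub γ (Finset.univ.filter (· < ℓ)) := by
  rw [dszLR, dszSub, sum_head, sum_tail, Finset.compl_filter]

/-- By antisymmetry `⟨γ_I, γ_I⟩ = 0`, so the complement may be replaced by the total charge. -/
theorem dszSub_eq {n : ℕ} (γ : Fin n → Charge b) (I : Finset (Fin n)) :
    dszSub γ I = -∑ i ∈ I, beta γ i := by
  simp only [beta_eq, ← dsz_sum_right]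
  rw [← Finset.sum_add_sum_compl I, dsz_add_left, dsz_self, dszSub, dsz_swap]
  ring

theorem dszLR_eq_neg_bigGamma {n : ℕ} (ℓ : Fin n) (γ : Fin n → Charge b) :
    dszLR ℓ γ = -bigGamma ℓ γ := by
  rw [dszLR_eq, dszSub_eq, bigGamma_eq]

/-- The stability parameters at the wall of the subset `I`. -/
noncomputable def flowSub {n : ℕ} (γ : Fin n → Charge b) (c : Fin n → ℝ) (I : Finset (Fin n)) :
    Fin n → ℝ :=
  fun i => c i - beta γ i / (∑ j ∈ I, beta γ j) * ∑ j ∈ I, c j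

theorem flow_eq {n : ℕ} (ℓ : Fin n) (γ : Fin n → Charge b) (c : Fin n → ℝ) :
    flow ℓ γ c = flowSub γ c (Finset.univ.filter (· < ℓ)) := by
  funext i
  rw [flow, flowSub, bigGamma_eq, partialSum_eq]

/-- The parameters at the wall are built from `c`, `beta` and their sums over a subset, all of which
are additive under grouping. This is the reason why splitting commutes with substitution. -/
theorem flowSub_merge {n m : ℕ} (f : Fin n → Fin m) (γ : Fin n → Charge b) (c : Fin n → ℝ)
    (J : Finset (Fin m)) :
    flowSub (merge f γ) (merge f c) J
      = merge f (flowSub γ c (Finset.univ.filter (f · ∈ J))) := by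
  funext k
  simp only [flowSub, beta_merge, sum_merge]
  simp only [merge, flowSub, Finset.sum_sub_distrib, ← Finset.sum_mul, ← Finset.sum_div]

theorem dszSub_merge {n m : ℕ} (f : Fin n → Fin m) (γ : Fin n → Charge b) (J : Finset (Fin m)) :
    dszSub (merge f γ) J = dszSub γ (Finset.univ.filter (f · ∈ J)) := by
  rw [dszSub_eq, dszSub_eq, beta_merge, sum_merge]

/-- The coefficient of a splitting. -/
noncomputable def splitCoeff {n : ℕ} (γ : Fin n → Charge b) (c : Fin n → ℝ)
    (I : Finset (Fin n)) : ℝ :=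
  (1 / 2 : ℝ) * (Real.sign (∑ i ∈ I, c i) + Real.sign (dszSub γ I)) * kap (dszSub γ I)

theorem splitCoeff_merge {n m : ℕ} (f : Fin n → Fin m) (γ : Fin n → Charge b) (c : Fin n → ℝ)
    (J : Finset (Fin m)) :
    splitCoeff (merge f γ) (merge f c) J = splitCoeff γ c (Finset.univ.filter (f · ∈ J)) := by
  rw [splitCoeff, splitCoeff, dszSub_merge, sum_merge]

theorem DeltaLR_mul_kap {n : ℕ} (ℓ : Fin n) (γ : Fin n → Charge b) (c : Fin n → ℝ) :
    DeltaLR ℓ γ c * kap (dszLR ℓ γ) = splitCoeff γ c (Finset.univ.filter (· < ℓ)) := by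
  rw [DeltaLR, splitCoeff, dszLR_eq, partialSum_eq]

/-- Trivial splittings have vanishing DSZ product, so one can sum over all subsets rather than over
proper nonempty ones. -/
theorem splitCoeff_empty {n : ℕ} (γ : Fin n → Charge b) (c : Fin n → ℝ) :
    splitCoeff γ c ∅ = 0 := by
  simp [splitCoeff, dszSub_eq, kap]

theorem splitCoeff_univ {n : ℕ} (γ : Fin n → Charge b) (c : Fin n → ℝ) :
    splitCoeff γ c Finset.univ = 0 := by
  simp [splitCoeff, dszSub_eq, kap, sum_beta]

/-! ### The bilinear operation defined by binary splittings -/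

/-- The summand of a binary splitting. -/
noncomputable def splitTerm (F G : ∀ n, (Fin n → Charge b) → (Fin n → ℝ) → ℝ) {n : ℕ}
    (γ : Fin n → Charge b) (c : Fin n → ℝ) (ℓ : Fin n) : ℝ :=
  DeltaLR ℓ γ c * kap (dszLR ℓ γ) * F ℓ (γ ∘ head ℓ) (flow ℓ γ c ∘ head ℓ) *
    G (n - ℓ) (γ ∘ tail ℓ) (flow ℓ γ c ∘ tail ℓ)

/-- The symmetrized sum over binary splittings. -/
noncomputable def splitFam (F G : ∀ n, (Fin n → Charge b) → (Fin n → ℝ) → ℝ) (n : ℕ)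
    (γ : Fin n → Charge b) (c : Fin n → ℝ) : ℝ :=
  symmetrize fun s => ∑ ℓ ∈ cuts n, splitTerm F G (γ ∘ s) (c ∘ s) ℓ

/-- The contribution of the splitting into `I` and its complement. -/
noncomputable def splitSubst (F G : ∀ n, (Fin n → Charge b) → (Fin n → ℝ) → ℝ)
    (E : ∀ n, (Fin n → Charge b) → ℝ) {n : ℕ} (γ : Fin n → Charge b) (c : Fin n → ℝ)
    (I : Finset (Fin n)) : ℝ :=
  splitCoeff γ c I *
    (∑ m ∈ Finset.range (n + 1), substTerm F E (fun i : {i // i ∈ I} => γ i)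
      (fun i => flowSub γ c I i) m) *
    (∑ m ∈ Finset.range (n + 1), substTerm G E (fun i : {i // i ∉ I} => γ i)
      (fun i => flowSub γ c I i) m)

theorem sum_range_substTerm (F : ∀ n, (Fin n → Charge b) → (Fin n → ℝ) → ℝ)
    (E : ∀ n, (Fin n → Charge b) → ℝ) {ι : Type*} [Fintype ι] [DecidableEq ι] (γ : ι → Charge b)
    (c : ι → ℝ) {N : ℕ} (hN : Fintype.card ι ≤ N) :
    ∑ m ∈ Finset.range (N + 1), substTerm F E γ c m
      = ∑ m ∈ Finset.range (Fintype.card ι + 1), substTerm F E γ c m := by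
  symm
  refine Finset.sum_subset (Finset.range_mono (by omega)) fun m _ hm => ?_
  exact substTerm_eq_zero F E γ c m (by simpa using hm)

theorem exists_equiv_of_injective {k n : ℕ} (e : Fin k → Fin n) (he : Function.Injective e)
    (P : Fin n → Prop) (hP : ∀ i, P i ↔ ∃ j, e j = i) :
    ∃ e' : Fin k ≃ {i // P i}, ∀ j, (e' j : Fin n) = e j :=
  ⟨Equiv.ofBijective (fun j => ⟨e j, (hP _).mpr ⟨j, rfl⟩⟩)
    ⟨fun i j h => he (by simpa using h), fun i => by
      obtain ⟨j, hj⟩ := (hP i).mp i.2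
      exact ⟨j, Subtype.ext hj⟩⟩, fun _ => rfl⟩

theorem factorial_mul_substFam_comp {S : Set (Charge b)} {E : ∀ n, (Fin n → Charge b) → ℝ}
    (hE : SymmOn S E) (F : ∀ n, (Fin n → Charge b) → (Fin n → ℝ) → ℝ) {k n : ℕ}
    {γ : Fin n → Charge b} (hγ : ∀ i, γ i ∈ S) (c : Fin n → ℝ) (e : Fin k → Fin n)
    (he : Function.Injective e) (P : Fin n → Prop) [Fintype {i // P i}]
    (hP : ∀ i, P i ↔ ∃ j, e j = i) :
    (k.factorial : ℝ) * substFam F E k (γ ∘ e) (c ∘ e) =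
      ∑ m ∈ Finset.range (n + 1),
        substTerm F E (fun i : {i // P i} => γ i) (fun i => c i) m := by
  obtain ⟨e', he'⟩ := exists_equiv_of_injective e he P hP
  have hk : k ≤ n := by simpa using Fintype.card_le_of_injective e he
  rw [factorial_mul_substFam hE F (γ := γ ∘ e) (fun _ => hγ _)]
  have h1 := sum_range_substTerm F E (γ ∘ e) (c ∘ e) (N := n) (by simpa using hk)
  rw [Fintype.card_fin] at h1
  rw [← h1]
  refine Finset.sum_congr rfl fun m _ => ?_
  rw [← substTerm_comp_equiv hE F (γ := fun i : {i // P i} => γ i) (fun _ => hγ _)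
    (fun i => c i) m e']
  congr 1 <;> funext j <;> simp [he']

/-- One half of the commutation: splitting first and grouping each side afterwards leads to a sum
over subsets `I`. Grouping first leads to the same sum (`substFam_splitFam`). -/
theorem splitFam_substFam {S : Set (Charge b)} {E : ∀ n, (Fin n → Charge b) → ℝ}
    (hE : SymmOn S E) (F G : ∀ n, (Fin n → Charge b) → (Fin n → ℝ) → ℝ) {n : ℕ}
    {γ : Fin n → Charge b} (hγ : ∀ i, γ i ∈ S) (c : Fin n → ℝ) :
    (n.factorial : ℝ) * splitFam (substFam F E) (substFam G E) n γ c
      = ∑ I : Finset (Fin n), splitSubst F G E γ c I := by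
  rw [splitFam, factorial_mul_symmetrize, Finset.sum_comm]
  -- The summand sees the ordering and the cut only through the set of the first `ℓ` charges; the
  -- factorials are those hidden in the averages over the two sides.
  have key : ∀ (s : Equiv.Perm (Fin n)) (ℓ : Fin n),
      splitTerm (substFam F E) (substFam G E) (γ ∘ s) (c ∘ s) ℓ
        = ((ℓ : ℕ).factorial : ℝ)⁻¹ * ((n - ℓ).factorial : ℝ)⁻¹ *
          splitSubst F G E γ c (Finset.univ.image (s ∘ head ℓ)) := by
    intro s ℓ
    have hI : Finset.univ.filter (s.symm · ∈ Finset.univ.filter (· < ℓ))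
        = Finset.univ.image (s ∘ head ℓ) := by
      ext i
      simp only [Finset.mem_filter, Finset.mem_univ, true_and, Finset.mem_image, Function.comp]
      constructor
      · intro h
        obtain ⟨j, hj⟩ := exists_head ℓ h
        exact ⟨j, by simp [hj]⟩
      · rintro ⟨j, rfl⟩
        simp [head_lt]
    set I := Finset.univ.image (s ∘ head ℓ) with hIdef
    have hmem : ∀ i, i ∈ I ↔ s.symm i < ℓ := by
      intro i
      rw [← hI]
      simp
    have h1 : DeltaLR ℓ (γ ∘ s) (c ∘ s) * kap (dszLR ℓ (γ ∘ s)) = splitCoeff γ c I := by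
      rw [DeltaLR_mul_kap, comp_perm_eq_merge s γ, comp_perm_eq_merge s c, splitCoeff_merge, hI]
    have h2 : flow ℓ (γ ∘ s) (c ∘ s) = flowSub γ c I ∘ s := by
      rw [flow_eq, comp_perm_eq_merge s γ, comp_perm_eq_merge s c, flowSub_merge, hI,
        ← comp_perm_eq_merge]
    have hL := factorial_mul_substFam_comp hE F hγ (flowSub γ c I) (s ∘ head ℓ)
      (s.injective.comp (head_injective ℓ)) (· ∈ I) (fun i => by simp [hIdef])
    have hR := factorial_mul_substFam_comp hE G hγ (flowSub γ c I) (s ∘ tail ℓ)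
      (s.injective.comp (tail_injective ℓ)) (· ∉ I) (fun i => by
        rw [hmem]
        constructor
        · intro h
          obtain ⟨j, hj⟩ := exists_tail ℓ h
          exact ⟨j, by simp [hj]⟩
        · rintro ⟨j, rfl⟩
          simpa using le_of_not_gt (not_tail_lt ℓ j))
    rw [splitTerm, splitSubst, h1, h2, ← hL, ← hR]
    have f1 : ((ℓ : ℕ).factorial : ℝ) ≠ 0 := by exact_mod_cast (ℓ : ℕ).factorial_ne_zero
    have f2 : ((n - ℓ).factorial : ℝ) ≠ 0 := by exact_mod_cast (n - ℓ).factorial_ne_zero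
    simp only [Function.comp_assoc]
    field_simp
  simp_rw [key, ← Finset.mul_sum, sum_perm_cut]
  have key2 : ∀ ℓ : Fin n, ((ℓ : ℕ).factorial : ℝ)⁻¹ * ((n - ℓ).factorial : ℝ)⁻¹ *
      (∑ I : Finset (Fin n), if I.card = ℓ then
        (((ℓ : ℕ).factorial : ℝ) * ((n - ℓ).factorial : ℝ)) * splitSubst F G E γ c I else 0)
      = ∑ I : Finset (Fin n), if I.card = ℓ then splitSubst F G E γ c I else 0 := by
    intro ℓ
    have f1 : ((ℓ : ℕ).factorial : ℝ) ≠ 0 := by exact_mod_cast (ℓ : ℕ).factorial_ne_zero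
    have f2 : ((n - ℓ).factorial : ℝ) ≠ 0 := by exact_mod_cast (n - ℓ).factorial_ne_zero
    rw [Finset.mul_sum]
    refine Finset.sum_congr rfl fun I _ => ?_
    split_ifs
    · field_simp
    · simp
  simp_rw [key2]
  rw [Finset.sum_comm]
  refine Finset.sum_congr rfl fun I _ => ?_
  by_cases h0 : I = ∅
  · subst h0
    simp [splitSubst, splitCoeff_empty]
  by_cases h1 : I = Finset.univ
  · subst h1
    simp [splitSubst, splitCoeff_univ]
  have hc0 : 0 < I.card := Finset.card_pos.mpr (Finset.nonempty_iff_ne_empty.mpr h0)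
  have hc1 : I.card < n := by
    have := Finset.card_lt_univ_of_notMem (s := I) (x := (not_forall.mp
      (mt Finset.eq_univ_iff_forall.mpr h1)).choose) (not_forall.mp
      (mt Finset.eq_univ_iff_forall.mpr h1)).choose_spec
    simpa using this
  -- A subset `I` arises only from the cut position `|I|`.
  rw [Finset.sum_eq_single (⟨I.card, hc1⟩ : Fin n)]
  · simp
  · intro ℓ _ hne
    rw [if_neg]
    intro h
    exact hne (Fin.ext h.symm)
  · intro h
    exact absurd (by simpa [cuts] using hc0) h

/-- A Cauchy product: a cut `ℓ` of `m` is the pair `(ℓ, m - ℓ)` of positive numbers. Pairs with a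
zero entry are not cuts, hence the vanishing of `P 0` and `Q 0`; the bound `p + q ≤ n` ensures that
no nonzero product is truncated. -/
theorem sum_cuts_mul {n p q : ℕ} (hpq : p + q ≤ n) (P Q : ℕ → ℝ) (hP0 : P 0 = 0) (hQ0 : Q 0 = 0)
    (hP : ∀ m, p < m → P m = 0) (hQ : ∀ m, q < m → Q m = 0) :
    ∑ m ∈ Finset.range (n + 1), ∑ ℓ ∈ cuts m, P ℓ * Q (m - ℓ)
      = (∑ m ∈ Finset.range (n + 1), P m) * ∑ m ∈ Finset.range (n + 1), Q m := by
  rw [Finset.sum_mul_sum, ← Finset.sum_product', Finset.sum_sigma']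
  refine Finset.sum_bij_ne_zero (fun x _ _ => ((x.2 : ℕ), x.1 - x.2)) ?_ ?_ ?_ ?_
  · rintro ⟨m, ℓ⟩ h _
    simp only [Finset.mem_sigma, Finset.mem_range, Finset.mem_product] at h ⊢
    have := ℓ.2
    omega
  · rintro ⟨m, ℓ⟩ _ _ ⟨m', ℓ'⟩ _ _ h
    simp only [Prod.mk.injEq] at h
    have := ℓ.2
    have := ℓ'.2
    obtain rfl : m = m' := by omega
    obtain rfl : ℓ = ℓ' := Fin.ext h.1
    rfl
  · rintro ⟨i, j⟩ _ h
    have hi : i ≠ 0 := by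
      rintro rfl
      simp [hP0] at h
    have hj : j ≠ 0 := by
      rintro rfl
      simp [hQ0] at h
    have hi' : i ≤ p := by
      by_contra hc
      simp [hP i (by omega)] at h
    have hj' : j ≤ q := by
      by_contra hc
      simp [hQ j (by omega)] at h
    refine ⟨⟨i + j, ⟨i, by omega⟩⟩, ?_, ?_, ?_⟩
    · simp [cuts]
      omega
    · simpa using h
    · simp
  · rintro ⟨m, ℓ⟩ _ _
    rfl

theorem substTerm_zero (F : ∀ n, (Fin n → Charge b) → (Fin n → ℝ) → ℝ)
    (E : ∀ n, (Fin n → Charge b) → ℝ) {ι : Type*} [Fintype ι] [DecidableEq ι] (γ : ι → Charge b)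
    (c : ι → ℝ) (hι : Nonempty ι) : substTerm F E γ c 0 = 0 := by
  rw [substTerm]
  have : IsEmpty (ι → Fin 0) := ⟨fun f => (f hι.some).elim0⟩
  simp

/-- The other half of the commutation: a grouping into `m` groups with a cut at `ℓ` is a subset `I`
together with a grouping of `I` into `ℓ` groups and of its complement into `m - ℓ`. -/
theorem substFam_splitFam {S : Set (Charge b)} {E : ∀ n, (Fin n → Charge b) → ℝ}
    (hE : SymmOn S E) (F G : ∀ n, (Fin n → Charge b) → (Fin n → ℝ) → ℝ) {n : ℕ}
    {γ : Fin n → Charge b} (hγ : ∀ i, γ i ∈ S) (c : Fin n → ℝ) :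
    (n.factorial : ℝ) * substFam (splitFam F G) E n γ c
      = ∑ I : Finset (Fin n), splitSubst F G E γ c I := by
  rw [factorial_mul_substFam hE _ hγ]
  have step1 : ∀ m, substTerm (splitFam F G) E γ c m
      = ∑ ℓ ∈ cuts m, ∑ f : Fin n → Fin m,
        splitTerm F G (push f γ) (push f c) ℓ * fiberWeight E γ f := by
    intro m
    rw [substTerm, Finset.sum_comm]
    simp_rw [← Finset.sum_mul]
    have e1 : ∀ f : Fin n → Fin m,
        splitFam F G m (push f γ) (push f c) * fiberWeight E γ f
          = (m.factorial : ℝ)⁻¹ * ∑ t : Equiv.Perm (Fin m),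
            (∑ ℓ ∈ cuts m, splitTerm F G (push (t.symm ∘ f) γ) (push (t.symm ∘ f) c) ℓ) *
              fiberWeight E γ (t.symm ∘ f) := by
      intro f
      simp_rw [splitFam, symmetrize, push_perm_comp, fiberWeight_perm_comp, ← Finset.sum_mul]
      ring
    simp_rw [e1]
    rw [← Finset.mul_sum, Finset.sum_comm]
    -- The sum over all `f` is invariant under relabelling the groups, so the average over orderings
    -- of the groups is superfluous.
    have e2 : ∀ t : Equiv.Perm (Fin m), ∑ f : Fin n → Fin m,
        (∑ ℓ ∈ cuts m, splitTerm F G (push (t.symm ∘ f) γ) (push (t.symm ∘ f) c) ℓ) *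
              fiberWeight E γ (t.symm ∘ f)
        = ∑ f : Fin n → Fin m,
        (∑ ℓ ∈ cuts m, splitTerm F G (push f γ) (push f c) ℓ) * fiberWeight E γ f := by
      intro t
      exact ((Equiv.refl (Fin n)).arrowCongr t.symm).sum_comp fun f =>
        (∑ ℓ ∈ cuts m, splitTerm F G (push f γ) (push f c) ℓ) * fiberWeight E γ f
    simp_rw [e2]
    rw [Finset.sum_const, Finset.card_univ, Fintype.card_perm, Fintype.card_fin, nsmul_eq_mul,
      inv_mul_cancel_left₀]
    exact_mod_cast m.factorial_ne_zero
  have step2 : ∀ (m : ℕ) (ℓ : Fin m), ∑ f : Fin n → Fin m,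
      splitTerm F G (push f γ) (push f c) ℓ * fiberWeight E γ f
      = ∑ I : Finset (Fin n), splitCoeff γ c I *
        (substTerm F E (fun i : {i // i ∈ I} => γ i) (fun i => flowSub γ c I i) ℓ *
        substTerm G E (fun i : {i // i ∉ I} => γ i) (fun i => flowSub γ c I i) (m - ℓ)) := by
    intro m ℓ
    rw [sum_eq_sum_glue ℓ]
    refine Finset.sum_congr rfl fun I _ => ?_
    rw [substTerm, substTerm, Finset.sum_mul_sum, Finset.mul_sum]
    refine Finset.sum_congr rfl fun f _ => ?_
    rw [Finset.mul_sum]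
    refine Finset.sum_congr rfl fun g _ => ?_
    have hI : Finset.univ.filter (glue ℓ I f g · ∈ Finset.univ.filter (· < ℓ)) = I := by
      ext i
      simp [glue_lt_iff]
    rw [splitTerm, DeltaLR_mul_kap, flow_eq, ← merge_eq_push, ← merge_eq_push, splitCoeff_merge,
      flowSub_merge, hI, merge_eq_push, merge_eq_push, push_glue_head, push_glue_head,
      push_glue_tail, push_glue_tail, fiberWeight_glue hE hγ]
    simp only [Function.comp_def]
    ring
  simp_rw [step1, step2]
  have step3 : ∀ m : ℕ, ∑ ℓ ∈ cuts m, ∑ I : Finset (Fin n), splitCoeff γ c I *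
        (substTerm F E (fun i : {i // i ∈ I} => γ i) (fun i => flowSub γ c I i) ℓ *
        substTerm G E (fun i : {i // i ∉ I} => γ i) (fun i => flowSub γ c I i) (m - ℓ))
      = ∑ I : Finset (Fin n), splitCoeff γ c I * ∑ ℓ ∈ cuts m,
        substTerm F E (fun i : {i // i ∈ I} => γ i) (fun i => flowSub γ c I i) ℓ *
        substTerm G E (fun i : {i // i ∉ I} => γ i) (fun i => flowSub γ c I i) (m - ℓ) := by
    intro m
    rw [Finset.sum_comm]
    simp_rw [Finset.mul_sum]
  simp_rw [step3]
  rw [Finset.sum_comm]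
  simp_rw [← Finset.mul_sum]
  refine Finset.sum_congr rfl fun I _ => ?_
  by_cases h0 : I = ∅
  · subst h0
    simp [splitSubst, splitCoeff_empty]
  by_cases h1 : I = Finset.univ
  · subst h1
    simp [splitSubst, splitCoeff_univ]
  have n1 : Nonempty {i // i ∈ I} := by
    obtain ⟨i, hi⟩ := Finset.nonempty_iff_ne_empty.mpr h0
    exact ⟨i, hi⟩
  have n2 : Nonempty {i // i ∉ I} := by
    obtain ⟨i, hi⟩ := not_forall.mp (mt Finset.eq_univ_iff_forall.mpr h1)
    exact ⟨i, hi⟩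
  rw [splitSubst, mul_assoc, sum_cuts_mul (p := Fintype.card {i // i ∈ I})
    (q := Fintype.card {i // i ∉ I}) ?_
    (fun m => substTerm F E (fun i : {i // i ∈ I} => γ i) (fun i => flowSub γ c I i) m)
    (fun m => substTerm G E (fun i : {i // i ∉ I} => γ i) (fun i => flowSub γ c I i) m)
    (substTerm_zero F E _ _ n1) (substTerm_zero G E _ _ n2)
    (fun m hm => substTerm_eq_zero F E _ _ m hm) (fun m hm => substTerm_eq_zero G E _ _ m hm)]
  have := Fintype.card_subtype_compl (fun i => i ∈ I)
  have h3 := Fintype.card_subtype_le (fun i => i ∈ I)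
  rw [Fintype.card_fin] at this h3
  omega


/-! ### Integrality and closure properties of the charges -/

/-- The cross terms of `½ κ (x + y)(x + y)` combine, by symmetry of `κ`, into the integer `κ x y`.
-/
theorem Geometry.add_mem_chargeSet (G : Geometry b) {x y : Charge b} (hx : x ∈ G.chargeSet)
    (hy : y ∈ G.chargeSet) : x + y ∈ G.chargeSet := by
  refine ⟨G.D4.add_mem hx.1 hy.1, fun a => ?_⟩
  obtain ⟨k, hk⟩ := hx.2 a
  obtain ⟨k', hk'⟩ := hy.2 a
  refine ⟨k + k' - ∑ a', ∑ a'', G.κ a a' a'' * x.1 a' * y.1 a'', ?_⟩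
  have hs : ∑ a', ∑ a'', (G.κ a a' a'' : ℝ) * y.1 a' * x.1 a''
      = ∑ a', ∑ a'', (G.κ a a' a'' : ℝ) * x.1 a' * y.1 a'' := by
    rw [Finset.sum_comm]
    refine Finset.sum_congr rfl fun i _ => Finset.sum_congr rfl fun j _ => ?_
    rw [G.symm_right a j i]
    ring
  have he : ∑ a', ∑ a'', (G.κ a a' a'' : ℝ) * (x + y).1 a' * (x + y).1 a''
      = ∑ a', ∑ a'', (G.κ a a' a'' : ℝ) * x.1 a' * x.1 a''
        + ∑ a', ∑ a'', (G.κ a a' a'' : ℝ) * y.1 a' * y.1 a''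
        + (∑ a', ∑ a'', (G.κ a a' a'' : ℝ) * x.1 a' * y.1 a''
          + ∑ a', ∑ a'', (G.κ a a' a'' : ℝ) * y.1 a' * x.1 a'') := by
    simp only [← Finset.sum_add_distrib]
    refine Finset.sum_congr rfl fun i _ => Finset.sum_congr rfl fun j _ => ?_
    simp only [Prod.fst_add, Pi.add_apply]
    push_cast
    ring
  rw [he, hs, Prod.snd_add, Pi.add_apply, hk, hk']
  push_cast
  ring

theorem Geometry.sum_mem_chargeSet (G : Geometry b) {ι : Type*} {γ : ι → Charge b}
    (hγ : ∀ i, γ i ∈ G.chargeSet) {I : Finset ι} (hI : I.Nonempty) :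
    ∑ i ∈ I, γ i ∈ G.chargeSet :=
  Finset.sum_induction_nonempty _ _ (fun _ _ => G.add_mem_chargeSet) hI fun i _ => hγ i

theorem Geometry.merge_mem_chargeSet (G : Geometry b) {n m : ℕ} {γ : Fin n → Charge b}
    (hγ : ∀ i, γ i ∈ G.chargeSet) {f : Fin n → Fin m} (hf : Function.Surjective f) (k : Fin m) :
    merge f γ k ∈ G.chargeSet := by
  refine G.sum_mem_chargeSet hγ ?_
  obtain ⟨i, hi⟩ := hf k
  exact ⟨i, by simpa using hi⟩

/-- The half-integral shifts contribute `½ [(xxy) - (xyy)]`, which differs from `½ [(xxy) + (xyy)]`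
by an integer; the latter is an integer by `parity`. -/
theorem Geometry.exists_int_dsz (G : Geometry b) {x y : Charge b} (hx : x ∈ G.chargeSet)
    (hy : y ∈ G.chargeSet) : ∃ k : ℤ, dsz x y = k := by
  choose k hk using hx.2
  choose k' hk' using hy.2
  obtain ⟨r, hr⟩ := G.parity x.1 hx.1 y.1 hy.1
  refine ⟨∑ a, (k a * y.1 a - k' a * x.1 a) + r
    - ∑ a, ∑ a', ∑ a'', G.κ a a' a'' * (x.1 a * y.1 a' * y.1 a''), ?_⟩
  have hr' : (∑ a, ∑ a', ∑ a'', (G.κ a a' a'' : ℝ) * (x.1 a * x.1 a' * y.1 a''))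
      + (∑ a, ∑ a', ∑ a'', (G.κ a a' a'' : ℝ) * (x.1 a * y.1 a' * y.1 a'')) = r + r := by
    rw [← Int.cast_add, ← hr]
    push_cast
    simp only [← Finset.sum_add_distrib]
    refine Finset.sum_congr rfl fun i _ => Finset.sum_congr rfl fun j _ =>
      Finset.sum_congr rfl fun l _ => ?_
    ring
  have hX : ∑ a, (y.1 a : ℝ) * ∑ a', ∑ a'', (G.κ a a' a'' : ℝ) * x.1 a' * x.1 a''
      = ∑ a, ∑ a', ∑ a'', (G.κ a a' a'' : ℝ) * (x.1 a * x.1 a' * y.1 a'') := by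
    simp only [Finset.mul_sum]
    rw [Finset.sum_comm]
    refine Finset.sum_congr rfl fun i _ => ?_
    rw [Finset.sum_comm]
    refine Finset.sum_congr rfl fun j _ => Finset.sum_congr rfl fun l _ => ?_
    rw [G.symm_left l i j, G.symm_right i l j]
    ring
  have hY : ∑ a, (x.1 a : ℝ) * ∑ a', ∑ a'', (G.κ a a' a'' : ℝ) * y.1 a' * y.1 a''
      = ∑ a, ∑ a', ∑ a'', (G.κ a a' a'' : ℝ) * (x.1 a * y.1 a' * y.1 a'') := by
    simp only [Finset.mul_sum]
    refine Finset.sum_congr rfl fun i _ => Finset.sum_congr rfl fun j _ =>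
      Finset.sum_congr rfl fun l _ => ?_
    ring
  have h1 : dsz x y = ∑ a, ((k a : ℝ) * y.1 a - k' a * x.1 a)
      + (1 / 2 : ℝ) * (∑ a, (y.1 a : ℝ) * ∑ a', ∑ a'', (G.κ a a' a'' : ℝ) * x.1 a' * x.1 a''
        - ∑ a, (x.1 a : ℝ) * ∑ a', ∑ a'', (G.κ a a' a'' : ℝ) * y.1 a' * y.1 a'') := by
    rw [dsz, ← Finset.sum_sub_distrib, Finset.mul_sum, ← Finset.sum_add_distrib]
    refine Finset.sum_congr rfl fun a _ => ?_
    rw [hk, hk']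
    ring
  rw [h1, hX, hY]
  push_cast
  linarith

theorem Geometry.exists_int_bigGamma (G : Geometry b) {n : ℕ} {γ : Fin n → Charge b}
    (hγ : ∀ i, γ i ∈ G.chargeSet) (ℓ : Fin n) : ∃ k : ℤ, bigGamma ℓ γ = k := by
  choose k hk using fun i j => G.exists_int_dsz (hγ i) (hγ j)
  exact ⟨∑ i, ∑ j, k i (head ℓ j), by simp [bigGamma, hk]⟩

/-- Oddness needs an integral argument, because `negOnePow` is defined through a floor. -/
theorem kap_neg_intCast (k : ℤ) : kap (-(k : ℝ)) = -kap k := by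
  rw [← Int.cast_neg, kap, kap, negOnePow, negOnePow, Int.floor_intCast, Int.floor_intCast,
    zpow_neg, ← inv_zpow]
  norm_num

/-! ### Symmetrization -/

theorem symmetrize_const {n : ℕ} (x : ℝ) : (symmetrize fun _ : Equiv.Perm (Fin n) => x) = x := by
  rw [symmetrize, Finset.sum_const, Finset.card_univ, Fintype.card_perm, Fintype.card_fin,
    nsmul_eq_mul, inv_mul_cancel_left₀]
  exact_mod_cast n.factorial_ne_zero

theorem symmetrize_add {n : ℕ} (F F' : Equiv.Perm (Fin n) → ℝ) :
    (symmetrize fun s => F s + F' s) = symmetrize F + symmetrize F' := by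
  simp only [symmetrize, Finset.sum_add_distrib, mul_add]

theorem symmetrize_sub {n : ℕ} (F F' : Equiv.Perm (Fin n) → ℝ) :
    (symmetrize fun s => F s - F' s) = symmetrize F - symmetrize F' := by
  simp only [symmetrize, Finset.sum_sub_distrib, mul_sub]

theorem symmetrize_mul {n : ℕ} (x : ℝ) (F : Equiv.Perm (Fin n) → ℝ) :
    (symmetrize fun s => x * F s) = x * symmetrize F := by
  simp only [symmetrize, ← Finset.mul_sum]
  ring

theorem symmetrize_mul_left {n : ℕ} (t : Equiv.Perm (Fin n)) (F : Equiv.Perm (Fin n) → ℝ) :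
    (symmetrize fun s => F (t * s)) = symmetrize F := by
  rw [symmetrize, symmetrize, ← Equiv.sum_comp (Equiv.mulLeft t) F]
  rfl

/-- A family which is symmetric in the pairs `(γ_i, c_i)`, for charges in `S`. -/
def SymmPairOn (S : Set (Charge b)) (F : ∀ n, (Fin n → Charge b) → (Fin n → ℝ) → ℝ) : Prop :=
  ∀ n (γ : Fin n → Charge b), (∀ i, γ i ∈ S) → ∀ (c : Fin n → ℝ) (s : Equiv.Perm (Fin n)),
    F n (γ ∘ s) (c ∘ s) = F n γ c

theorem merge_merge {A : Type*} [AddCommMonoid A] {n m k : ℕ} (f : Fin n → Fin m)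
    (g : Fin m → Fin k) (a : Fin n → A) : merge g (merge f a) = merge (g ∘ f) a := by
  funext j
  rw [merge, sum_merge]
  simp [merge]

theorem SymmPairOn.apply_merge {S : Set (Charge b)}
    {F : ∀ n, (Fin n → Charge b) → (Fin n → ℝ) → ℝ} (hF : SymmPairOn S F) {n m : ℕ}
    {γ : Fin n → Charge b} (hγ : ∀ i, γ i ∈ S) (c : Fin n → ℝ) (hm : m = n) (f : Fin n → Fin m)
    (hf : Function.Surjective f) : F m (merge f γ) (merge f c) = F n γ c := by
  subst hm
  have hf' : Function.Bijective f := Finite.surjective_iff_bijective.mp hf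
  have : f = (Equiv.ofBijective f hf').symm.symm := rfl
  rw [this, ← comp_perm_eq_merge, ← comp_perm_eq_merge]
  exact hF m γ hγ c _

theorem index_comp_perm_surjective {n : ℕ} (bl : Composition n) (s : Equiv.Perm (Fin n)) :
    Function.Surjective (bl.index ∘ s.symm) := by
  intro k
  exact ⟨s (bl.embedding k ⟨0, bl.one_le_blocksFun k⟩), by simp [bl.index_embedding]⟩

/-- The part of a substitution which comes from proper mergings. -/
noncomputable def substRest (F : ∀ n, (Fin n → Charge b) → (Fin n → ℝ) → ℝ)
    (E : ∀ n, (Fin n → Charge b) → ℝ) (n : ℕ) (γ : Fin n → Charge b) (c : Fin n → ℝ) : ℝ :=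
  symmetrize fun s => ∑ bl : {bl : Composition n // bl.length < n},
    F bl.1.length (merge bl.1.index (γ ∘ s)) (merge bl.1.index (c ∘ s)) *
      ∏ k, E (bl.1.blocksFun k) (γ ∘ s ∘ bl.1.embedding k)

/-- The only composition of `n` of length `n` consists of ones; as `E_1 = 1` it contributes `F n γ
c` itself. Substitution is thus unipotent with respect to the number of charges. -/
theorem substFam_eq_add_substRest {S : Set (Charge b)} {E : ∀ n, (Fin n → Charge b) → ℝ}
    (hE1 : ∀ x ∈ S, E 1 (fun _ => x) = 1)
    {F : ∀ n, (Fin n → Charge b) → (Fin n → ℝ) → ℝ} (hF : SymmPairOn S F) {n : ℕ}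
    {γ : Fin n → Charge b} (hγ : ∀ i, γ i ∈ S) (c : Fin n → ℝ) :
    substFam F E n γ c = F n γ c + substRest F E n γ c := by
  rw [substFam, substRest, ← symmetrize_const (n := n) (F n γ c), ← symmetrize_add]
  congr 1
  funext s
  rw [← Finset.sum_filter_add_sum_filter_not Finset.univ
    (fun bl : Composition n => bl.length < n), add_comm]
  congr 1
  · have : Finset.univ.filter (fun bl : Composition n => ¬ bl.length < n)
        = {Composition.ones n} := by
      ext bl
      have := bl.length_le
      simp only [Finset.mem_filter, Finset.mem_univ, true_and, Finset.mem_singleton,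
        Composition.eq_ones_iff_length]
      omega
    rw [this, Finset.sum_singleton, merge_comp_perm, merge_comp_perm,
      hF.apply_merge hγ c (Composition.ones_length n) _ (index_comp_perm_surjective _ s),
      Finset.prod_eq_one, mul_one]
    intro k _
    have h1 : ∀ (j : ℕ) (hj : j = 1) (δ : Fin j → Charge b), (∀ i, δ i ∈ S) → E j δ = 1 := by
      intro j hj δ hδ
      subst hj
      rw [← hE1 (δ 0) (hδ 0)]
      congr 1
      funext i
      rw [Subsingleton.elim i 0]
    exact h1 _ (Composition.ones_blocksFun n k) _ fun i => hγ _
  · rw [Finset.sum_subtype (p := fun bl : Composition n => bl.length < n)]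
    simp

theorem substRest_congr {F F' : ∀ n, (Fin n → Charge b) → (Fin n → ℝ) → ℝ}
    (E : ∀ n, (Fin n → Charge b) → ℝ) {n : ℕ} {γ : Fin n → Charge b} {c : Fin n → ℝ}
    (h : ∀ m, m < n → ∀ f : Fin n → Fin m, Function.Surjective f →
      F m (merge f γ) (merge f c) = F' m (merge f γ) (merge f c)) :
    substRest F E n γ c = substRest F' E n γ c := by
  unfold substRest
  congr 1
  funext s
  refine Finset.sum_congr rfl fun bl _ => ?_
  rw [merge_comp_perm, merge_comp_perm, h _ bl.2 _ (index_comp_perm_surjective _ s)]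

/-- Substitution of a family `E` with `E_1 = 1` is injective. -/
theorem eq_of_substFam_eq (G : Geometry b) {E : ∀ n, (Fin n → Charge b) → ℝ}
    (hE1 : ∀ x ∈ G.chargeSet, E 1 (fun _ => x) = 1)
    {F F' : ∀ n, (Fin n → Charge b) → (Fin n → ℝ) → ℝ} (hF : SymmPairOn G.chargeSet F)
    (hF' : SymmPairOn G.chargeSet F') {n : ℕ} {γ : Fin n → Charge b}
    (hγ : ∀ i, γ i ∈ G.chargeSet) (c : Fin n → ℝ)
    (h : ∀ m (f : Fin n → Fin m), Function.Surjective f →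
      substFam F E m (merge f γ) (merge f c) = substFam F' E m (merge f γ) (merge f c)) :
    F n γ c = F' n γ c := by
  induction n using Nat.strong_induction_on with
  | _ n ih =>
    -- Proper mergings have fewer charges, and a merging of a merging is again a merging, so the
    -- induction hypothesis covers every term except the leading one.
    have h1 : substRest F E n γ c = substRest F' E n γ c := by
      refine substRest_congr E fun m hm f hf => ?_
      refine ih m hm (G.merge_mem_chargeSet hγ hf) _ fun k g hg => ?_
      rw [merge_merge, merge_merge]
      exact h k (g ∘ f) (hg.comp hf)
    have h2 := h n id Function.surjective_id
    have e1 : merge id γ = γ := (comp_perm_eq_merge 1 γ).symm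
    have e2 : merge id c = c := (comp_perm_eq_merge 1 c).symm
    rw [e1, e2, substFam_eq_add_substRest hE1 hF hγ, substFam_eq_add_substRest hE1 hF' hγ,
      h1] at h2
    exact add_right_cancel h2

/-! ### The recursion for the coefficients -/

theorem ghat_eq (g0 : ∀ n, (Fin n → Charge b) → (Fin n → ℝ) → ℝ)
    (E : ∀ n, (Fin n → Charge b) → ℝ → ℝ) (n : ℕ) (γ : Fin n → Charge b) (c : Fin n → ℝ) (τ : ℝ) :
    ghat g0 E n γ c τ = g0 n γ c
      - substRest (fun m δ d => ghat g0 E m δ d τ) (fun m δ => E m δ τ) n γ c := by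
  rw [ghat, substRest]

theorem substRest_comp_perm (F : ∀ n, (Fin n → Charge b) → (Fin n → ℝ) → ℝ)
    (E : ∀ n, (Fin n → Charge b) → ℝ) {n : ℕ} (γ : Fin n → Charge b) (c : Fin n → ℝ)
    (t : Equiv.Perm (Fin n)) : substRest F E n (γ ∘ t) (c ∘ t) = substRest F E n γ c := by
  rw [substRest, substRest]
  exact symmetrize_mul_left t (fun s => ∑ bl : {bl : Composition n // bl.length < n},
    F bl.1.length (merge bl.1.index (γ ∘ s)) (merge bl.1.index (c ∘ s)) *
      ∏ k, E (bl.1.blocksFun k) (γ ∘ s ∘ bl.1.embedding k))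

theorem ghat_symm {S : Set (Charge b)} {g0 : ∀ n, (Fin n → Charge b) → (Fin n → ℝ) → ℝ}
    (hg : SymmPairOn S g0) (E : ∀ n, (Fin n → Charge b) → ℝ → ℝ) (τ : ℝ) :
    SymmPairOn S fun n γ c => ghat g0 E n γ c τ := by
  intro n γ hγ c s
  change ghat g0 E n (γ ∘ s) (c ∘ s) τ = ghat g0 E n γ c τ
  rw [ghat_eq, ghat_eq g0 E n γ, substRest_comp_perm, hg n γ hγ c s]

/-- The sum subtracted in the ansatz is precisely the contribution of the proper mergings: `ghat` is
`g0` substituted by the inverse of `E`. -/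
theorem substFam_ghat {S : Set (Charge b)} {g0 : ∀ n, (Fin n → Charge b) → (Fin n → ℝ) → ℝ}
    (hg : SymmPairOn S g0) {E : ∀ n, (Fin n → Charge b) → ℝ → ℝ} {τ : ℝ}
    (hE1 : ∀ x ∈ S, E 1 (fun _ => x) τ = 1) {n : ℕ}
    {γ : Fin n → Charge b} (hγ : ∀ i, γ i ∈ S) (c : Fin n → ℝ) :
    substFam (fun n γ c => ghat g0 E n γ c τ) (fun n γ => E n γ τ) n γ c = g0 n γ c := by
  rw [substFam_eq_add_substRest hE1 (ghat_symm hg E τ) hγ, ghat_eq]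
  ring

theorem splitFam_symm (S : Set (Charge b)) (F F' : ∀ n, (Fin n → Charge b) → (Fin n → ℝ) → ℝ) :
    SymmPairOn S (splitFam F F') := by
  intro n γ _ c t
  rw [splitFam, splitFam]
  exact symmetrize_mul_left t (fun s => ∑ ℓ ∈ cuts n, splitTerm F F' (γ ∘ s) (c ∘ s) ℓ)

theorem splitFam_congr {S : Set (Charge b)}
    {F F' G G' : ∀ n, (Fin n → Charge b) → (Fin n → ℝ) → ℝ}
    (hF : ∀ n γ c, (∀ i, γ i ∈ S) → F n γ c = F' n γ c)
    (hG : ∀ n γ c, (∀ i, γ i ∈ S) → G n γ c = G' n γ c) {n : ℕ}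
    {γ : Fin n → Charge b} (hγ : ∀ i, γ i ∈ S) (c : Fin n → ℝ) :
    splitFam F G n γ c = splitFam F' G' n γ c := by
  unfold splitFam splitTerm
  congr 1
  funext s
  refine Finset.sum_congr rfl fun ℓ _ => ?_
  rw [hF ℓ ((γ ∘ s) ∘ head ℓ) _ fun i => hγ _, hG _ ((γ ∘ s) ∘ tail ℓ) _ fun i => hγ _]

theorem W_symm (R : ∀ n, (Fin n → Charge b) → ℝ → ℝ) {n : ℕ} (γ : Fin n → Charge b) (τ : ℝ)
    (t : Equiv.Perm (Fin n)) : W R n (γ ∘ t) τ = W R n γ τ := by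
  rw [W, W]
  exact symmetrize_mul_left t (fun s => ∑ T : SchroderTree n,
    (-1 : ℝ) ^ T.numVertices * T.prod (fun m δ => R m δ τ) (γ ∘ s))

/-- Besides symmetry, this is the only property of the tree sum that enters: a vertex with two
children needs two leaves, so the single leaf is the only tree. -/
theorem W_one (R : ∀ n, (Fin n → Charge b) → ℝ → ℝ) (γ : Fin 1 → Charge b) (τ : ℝ) :
    W R 1 γ τ = 1 := by
  have h : ∀ T : SchroderTree 1, T = .leaf := by
    intro T
    cases T with
    | leaf => rfl
    | node bl two child =>
      have := bl.length_le
      omega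
  rw [W, ← symmetrize_const (n := 1) 1]
  congr 1
  funext s
  have hu : (Finset.univ : Finset (SchroderTree 1)) = {.leaf} := by
    ext T
    simp [h T]
  rw [hu, Finset.sum_singleton]
  simp [SchroderTree.numVertices, SchroderTree.prod]

/-- `bigGamma` is `-dszLR`, and `kap` is odd on integers, so a quarter of `(sgn S - sgn Γ) κ(Γ)`
equals `-½ Δ κ(γ_LR)`. -/
theorem seedRecursion_iff (G : Geometry b) (g0 : ∀ n, (Fin n → Charge b) → (Fin n → ℝ) → ℝ)
    {n : ℕ} {γ : Fin n → Charge b} (hγ : ∀ i, γ i ∈ G.chargeSet) (c : Fin n → ℝ) :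
    SeedRecursion g0 n γ c ↔
      -(1 / 2 : ℝ) * splitFam g0 g0 n γ c = g0 n γ c - g0 n γ (beta γ) := by
  rw [SeedRecursion, splitFam, ← symmetrize_mul, ← symmetrize_mul]
  have : ∀ (s : Equiv.Perm (Fin n)) (ℓ : Fin n),
      (1 / 4 : ℝ) * ((Real.sign (partialSum ℓ (c ∘ s)) - Real.sign (bigGamma ℓ (γ ∘ s))) *
        kap (bigGamma ℓ (γ ∘ s)) *
        g0 ℓ (γ ∘ s ∘ head ℓ) (flow ℓ (γ ∘ s) (c ∘ s) ∘ head ℓ) *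
        g0 (n - ℓ) (γ ∘ s ∘ tail ℓ) (flow ℓ (γ ∘ s) (c ∘ s) ∘ tail ℓ))
      = -(1 / 2 : ℝ) * splitTerm g0 g0 (γ ∘ s) (c ∘ s) ℓ := by
    intro s ℓ
    obtain ⟨k, hk⟩ := G.exists_int_bigGamma (γ := γ ∘ s) (fun _ => hγ _) ℓ
    rw [splitTerm, DeltaLR, dszLR_eq_neg_bigGamma, hk, kap_neg_intCast, Real.sign_neg]
    simp only [Function.comp_assoc]
    ring
  simp_rw [Finset.mul_sum, this]

theorem beta_comp_perm {n : ℕ} (γ : Fin n → Charge b) (s : Equiv.Perm (Fin n)) :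
    beta (γ ∘ s) = beta γ ∘ s := by
  rw [comp_perm_eq_merge s γ, beta_merge, ← comp_perm_eq_merge]

theorem symmOn_of_recursion (G : Geometry b) {g0 : ∀ n, (Fin n → Charge b) → (Fin n → ℝ) → ℝ}
    (hg : SymmPairOn G.chargeSet g0) {E : ∀ n, (Fin n → Charge b) → ℝ → ℝ}
    {R : ∀ n, (Fin n → Charge b) → ℝ → ℝ} {τ : ℝ}
    (hE : ∀ n, 1 ≤ n → ∀ γ : Fin n → Charge b, (∀ i, γ i ∈ G.chargeSet) →
      E n γ τ = g0 n γ (beta γ) - symmetrize fun s =>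
        ∑ bl : Composition n with 1 < bl.length, W R bl.length (merge bl.index (γ ∘ s)) τ *
          ∏ k, E (bl.blocksFun k) (γ ∘ s ∘ bl.embedding k) τ) :
    SymmOn G.chargeSet fun n γ => E n γ τ := by
  intro n γ hγ t
  rcases Nat.eq_zero_or_pos n with rfl | hn
  · rw [Subsingleton.elim (γ ∘ t) γ]
  · simp only [hE n hn γ hγ, hE n hn (γ ∘ t) fun i => hγ _, beta_comp_perm,
      hg n γ hγ (beta γ) t]
    congr 1
    exact symmetrize_mul_left t (fun s => ∑ bl : Composition n with 1 < bl.length,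
      W R bl.length (merge bl.index (γ ∘ s)) τ *
          ∏ k, E (bl.blocksFun k) (γ ∘ s ∘ bl.embedding k) τ)

theorem one_of_recursion (G : Geometry b) {g0 : ∀ n, (Fin n → Charge b) → (Fin n → ℝ) → ℝ}
    (hone : ∀ γ ∈ G.chargeSet, ∀ c, g0 1 (fun _ => γ) c = 1)
    {E : ∀ n, (Fin n → Charge b) → ℝ → ℝ} {R : ∀ n, (Fin n → Charge b) → ℝ → ℝ} {τ : ℝ}
    (hE : ∀ n, 1 ≤ n → ∀ γ : Fin n → Charge b, (∀ i, γ i ∈ G.chargeSet) →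
      E n γ τ = g0 n γ (beta γ) - symmetrize fun s =>
        ∑ bl : Composition n with 1 < bl.length, W R bl.length (merge bl.index (γ ∘ s)) τ *
          ∏ k, E (bl.blocksFun k) (γ ∘ s ∘ bl.embedding k) τ) :
    ∀ x ∈ G.chargeSet, E 1 (fun _ => x) τ = 1 := by
  intro x hx
  rw [hE 1 le_rfl _ fun _ => hx, hone x hx]
  have : (Finset.univ.filter fun bl : Composition 1 => 1 < bl.length) = ∅ := by
    rw [Finset.filter_eq_empty_iff]
    intro bl _
    have := bl.length_le
    omega
  rw [this]
  simp [symmetrize_const]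

/-- The composition with one block contributes `W_1 E_n = E_n`; those with more blocks are exactly
what is subtracted from `g0 n γ (beta γ)` in the formula for `E_n`. -/
theorem substFam_W (G : Geometry b) {g0 : ∀ n, (Fin n → Charge b) → (Fin n → ℝ) → ℝ}
    {E : ∀ n, (Fin n → Charge b) → ℝ → ℝ}
    {R : ∀ n, (Fin n → Charge b) → ℝ → ℝ} {τ : ℝ}
    (hE : ∀ n, 1 ≤ n → ∀ γ : Fin n → Charge b, (∀ i, γ i ∈ G.chargeSet) →
      E n γ τ = g0 n γ (beta γ) - symmetrize fun s =>
        ∑ bl : Composition n with 1 < bl.length, W R bl.length (merge bl.index (γ ∘ s)) τ *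
          ∏ k, E (bl.blocksFun k) (γ ∘ s ∘ bl.embedding k) τ)
    (hsymm : SymmOn G.chargeSet fun n γ => E n γ τ) {n : ℕ} (hn : 1 ≤ n) {γ : Fin n → Charge b}
    (hγ : ∀ i, γ i ∈ G.chargeSet) (c : Fin n → ℝ) :
    substFam (fun n γ _ => W R n γ τ) (fun n γ => E n γ τ) n γ c = g0 n γ (beta γ) := by
  rw [eq_sub_iff_add_eq.mp (hE n hn γ hγ) |>.symm, substFam,
    ← symmetrize_const (n := n) (E n γ τ), ← symmetrize_add]
  congr 1
  funext s
  rw [← Finset.sum_filter_add_sum_filter_not Finset.univ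
    (fun bl : Composition n => 1 < bl.length), add_comm]
  congr 1
  have : Finset.univ.filter (fun bl : Composition n => ¬ 1 < bl.length)
      = {Composition.single n hn} := by
    ext bl
    have := bl.length_pos_iff.mpr hn
    simp only [Finset.mem_filter, Finset.mem_univ, true_and, Finset.mem_singleton,
      Composition.eq_single_iff_length hn]
    omega
  rw [this, Finset.sum_singleton]
  have hW : ∀ (m : ℕ) (hm : m = 1) (δ : Fin m → Charge b), W R m δ τ = 1 := by
    intro m hm δ
    subst hm
    exact W_one R δ τ
  rw [hW _ (Composition.single_length hn), one_mul]
  have hsub : Subsingleton (Fin (Composition.single n hn).length) := by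
    rw [Composition.single_length]
    infer_instance
  have hk : ∀ k, E ((Composition.single n hn).blocksFun k)
      (γ ∘ s ∘ (Composition.single n hn).embedding k) τ = E n γ τ := by
    intro k
    rw [prod_embedding_eq_blockVal hsymm hγ s _ k]
    refine (eq_blockVal hsymm hγ id Function.injective_id _ fun i => ?_).symm
    simp only [Finset.mem_filter, Finset.mem_univ, true_and]
    exact ⟨fun _ => ⟨i, rfl⟩, fun _ => Subsingleton.elim _ _⟩
  simp_rw [hk]
  rw [Finset.prod_const, Finset.card_univ, Fintype.card_fin, Composition.single_length, pow_one]

/-- Both sides of the claim are symmetric families, so it is enough to compare them after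
substitution of `E`, at the configuration and at all its mergings. -/
theorem coefficientRecursion_of_seedRecursion (G : Geometry b)
    {g0 : ∀ n, (Fin n → Charge b) → (Fin n → ℝ) → ℝ} (hg : SymmPairOn G.chargeSet g0)
    (hone : ∀ γ ∈ G.chargeSet, ∀ c, g0 1 (fun _ => γ) c = 1)
    {E : ∀ n, (Fin n → Charge b) → ℝ → ℝ} {R : ∀ n, (Fin n → Charge b) → ℝ → ℝ} {τ : ℝ}
    (hE : ∀ n, 1 ≤ n → ∀ γ : Fin n → Charge b, (∀ i, γ i ∈ G.chargeSet) →
      E n γ τ = g0 n γ (beta γ) - symmetrize fun s =>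
        ∑ bl : Composition n with 1 < bl.length, W R bl.length (merge bl.index (γ ∘ s)) τ *
          ∏ k, E (bl.blocksFun k) (γ ∘ s ∘ bl.embedding k) τ)
    {n : ℕ} (hn : 1 ≤ n) {γ : Fin n → Charge b} (hγ : ∀ i, γ i ∈ G.chargeSet) (c : Fin n → ℝ)
    (hseed : ∀ m (f : Fin n → Fin m), Function.Surjective f →
      SeedRecursion g0 m (merge f γ) (merge f c)) :
    CoefficientRecursion (ghat g0 E) R n γ c τ := by
  have hsymm := symmOn_of_recursion G hg hE
  have hE1 := one_of_recursion G hone hE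
  let gh : ∀ n, (Fin n → Charge b) → (Fin n → ℝ) → ℝ := fun n γ c => ghat g0 E n γ c τ
  let E' : ∀ n, (Fin n → Charge b) → ℝ := fun n γ => E n γ τ
  have hgh : SymmPairOn G.chargeSet gh := ghat_symm hg E τ
  let F' : ∀ n, (Fin n → Charge b) → (Fin n → ℝ) → ℝ := fun n γ c =>
    -(1 / 2 : ℝ) * splitFam gh gh n γ c + W R n γ τ
  have hF' : SymmPairOn G.chargeSet F' := by
    intro k δ hδ d s
    simp only [F', splitFam_symm G.chargeSet gh gh k δ hδ d s, W_symm]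
  have key : gh n γ c = F' n γ c := by
    refine eq_of_substFam_eq G (E := E') hE1 hgh hF' hγ c fun m f hf => ?_
    have hδ := G.merge_mem_chargeSet hγ hf
    have hm : 1 ≤ m := by
      have := (f ⟨0, hn⟩).2
      omega
    have h1 : substFam F' E' m (merge f γ) (merge f c)
        = -(1 / 2 : ℝ) * substFam (splitFam gh gh) E' m (merge f γ) (merge f c)
          + substFam (fun n γ _ => W R n γ τ) E' m (merge f γ) (merge f c) := by
      rw [substFam, substFam, substFam, ← symmetrize_mul, ← symmetrize_add]
      congr 1
      funext s
      rw [Finset.mul_sum, ← Finset.sum_add_distrib]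
      refine Finset.sum_congr rfl fun bl _ => ?_
      simp only [F']
      ring
    -- Substitution passes through the splitting and turns both factors into `g0`.
    have h2 : substFam (splitFam gh gh) E' m (merge f γ) (merge f c)
        = splitFam g0 g0 m (merge f γ) (merge f c) := by
      have hf0 : (m.factorial : ℝ) ≠ 0 := by exact_mod_cast m.factorial_ne_zero
      refine mul_left_cancel₀ hf0 ?_
      rw [substFam_splitFam hsymm gh gh hδ, ← splitFam_substFam hsymm gh gh hδ]
      congr 1
      exact splitFam_congr (fun k δ d h => substFam_ghat hg hE1 h d)
        (fun k δ d h => substFam_ghat hg hE1 h d) hδ _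
    -- After substitution the claim reads `g0 = -½ splitFam g0 g0 + g0 (beta)`, the recursion of the
    -- seed.
    rw [h1, h2, substFam_W G hE hsymm hm hδ, (seedRecursion_iff G g0 hδ _).mp (hseed m f hf)]
    rw [substFam_ghat hg hE1 hδ]
    ring
  exact key


/-! ### The trilinear form and the quadratic forms -/

theorem cub_add_left (κ : Fin b → Fin b → Fin b → ℤ) (x x' y z : Fin b → ℝ) :
    cub κ (x + x') y z = cub κ x y z + cub κ x' y z := by
  simp only [cub, Pi.add_apply, mul_add, add_mul, Finset.sum_add_distrib]

theorem cub_smul_left (κ : Fin b → Fin b → Fin b → ℤ) (r : ℝ) (x y z : Fin b → ℝ) :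
    cub κ (r • x) y z = r * cub κ x y z := by
  simp only [cub, Pi.smul_apply, smul_eq_mul, Finset.mul_sum]
  refine Finset.sum_congr rfl fun _ _ => Finset.sum_congr rfl fun _ _ =>
    Finset.sum_congr rfl fun _ _ => ?_
  ring

theorem Geometry.cub_swap_left (G : Geometry b) (x y z : Fin b → ℝ) :
    cub G.κ x y z = cub G.κ y x z := by
  rw [cub, Finset.sum_comm]
  refine Finset.sum_congr rfl fun i _ => Finset.sum_congr rfl fun j _ =>
    Finset.sum_congr rfl fun l _ => ?_
  rw [G.symm_left]
  ring

theorem Geometry.cub_swap_right (G : Geometry b) (x y z : Fin b → ℝ) :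
    cub G.κ x y z = cub G.κ x z y := by
  refine Finset.sum_congr rfl fun i _ => ?_
  rw [Finset.sum_comm]
  refine Finset.sum_congr rfl fun j _ => Finset.sum_congr rfl fun l _ => ?_
  rw [G.symm_right]
  ring

theorem Geometry.cub_rotate (G : Geometry b) (x y z : Fin b → ℝ) :
    cub G.κ x y z = cub G.κ z x y := by
  rw [G.cub_swap_right, G.cub_swap_left]

theorem Geometry.cub_add_right (G : Geometry b) (x y z z' : Fin b → ℝ) :
    cub G.κ x y (z + z') = cub G.κ x y z + cub G.κ x y z' := by
  rw [G.cub_rotate x y, G.cub_rotate x y, G.cub_rotate x y, cub_add_left]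

theorem Geometry.cub_smul_right (G : Geometry b) (r : ℝ) (x y z : Fin b → ℝ) :
    cub G.κ x y (r • z) = r * cub G.κ x y z := by
  rw [G.cub_rotate x y, G.cub_rotate x y, cub_smul_left]

theorem Geometry.cub_sum_left (G : Geometry b) {ι : Type*} (I : Finset ι) (x : ι → Fin b → ℝ)
    (y z : Fin b → ℝ) : cub G.κ (∑ i ∈ I, x i) y z = ∑ i ∈ I, cub G.κ (x i) y z :=
  map_sum (⟨⟨fun x => cub G.κ x y z, by simp [cub]⟩, fun x x' => cub_add_left _ x x' y z⟩ :
    (Fin b → ℝ) →+ ℝ) x I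

theorem toR_sum {ι : Type*} (I : Finset ι) (p : ι → Fin b → ℤ) :
    toR (∑ i ∈ I, p i) = ∑ i ∈ I, toR (p i) := by
  funext a
  simp [toR]

theorem cub_eq_dotProduct (κ : Fin b → Fin b → Fin b → ℤ) (p : Fin b → ℤ) (x y : Fin b → ℝ)
    (hs : ∀ a a' a'', κ a a' a'' = κ a a'' a') (hs' : ∀ a a' a'', κ a a' a'' = κ a' a a'') :
    cub κ (toR p) x y = x ⬝ᵥ (kmat κ p *ᵥ y) := by
  simp only [cub, dotProduct, Matrix.mulVec, kmat, Matrix.of_apply, toR, Finset.mul_sum,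
    Finset.sum_mul]
  rw [Finset.sum_comm]
  refine Finset.sum_congr rfl fun i _ => ?_
  rw [Finset.sum_comm]
  refine Finset.sum_congr rfl fun j _ => Finset.sum_congr rfl fun l _ => ?_
  rw [hs' l i j, hs i l j]
  ring

theorem Geometry.cub_toR (G : Geometry b) (p : Fin b → ℤ) (x y : Fin b → ℝ) :
    cub G.κ (toR p) x y = x ⬝ᵥ (kmat G.κ p *ᵥ y) :=
  cub_eq_dotProduct _ _ _ _ G.symm_right G.symm_left

theorem Geometry.kmat_sum (G : Geometry b) {ι : Type*} (I : Finset ι) (p : ι → Fin b → ℤ) :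
    kmat G.κ (∑ i ∈ I, p i) = ∑ i ∈ I, kmat G.κ (p i) := by
  ext a a'
  simp only [kmat, Matrix.of_apply, Matrix.sum_apply, Finset.sum_apply, Int.cast_sum,
    Finset.mul_sum]
  rw [Finset.sum_comm]

theorem Geometry.kmat_transpose (G : Geometry b) (p : Fin b → ℤ) :
    (kmat G.κ p)ᵀ = kmat G.κ p := by
  ext a a'
  simp only [kmat, Matrix.of_apply, Matrix.transpose_apply]
  exact Finset.sum_congr rfl fun _ _ => by rw [G.symm_left]

theorem Geometry.isUnit_det (G : Geometry b) {p : Fin b → ℤ} (hp : p ∈ G.D4) :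
    IsUnit (kmat G.κ p).det := isUnit_iff_ne_zero.mpr (G.nondeg p hp)

theorem Geometry.toR_ne_zero (G : Geometry b) {p : Fin b → ℤ} (hp : p ∈ G.D4) : toR p ≠ 0 := by
  intro h
  have := G.pos p hp
  rw [h] at this
  simp [cub] at this

theorem Geometry.sum_mem_D4 (G : Geometry b) {ι : Type*} {p : ι → Fin b → ℤ}
    (hp : ∀ i, p i ∈ G.D4) {I : Finset ι} (hI : I.Nonempty) : ∑ i ∈ I, p i ∈ G.D4 :=
  Finset.sum_induction_nonempty _ _ (fun _ _ => G.D4.add_mem) hI fun i _ => hp i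

theorem Geometry.merge_mem_D4 (G : Geometry b) {n m : ℕ} {p : Fin n → Fin b → ℤ}
    (hp : ∀ i, p i ∈ G.D4) {f : Fin n → Fin m} (hf : Function.Surjective f) (k : Fin m) :
    merge f p k ∈ G.D4 := by
  refine G.sum_mem_D4 hp ?_
  obtain ⟨i, hi⟩ := hf k
  exact ⟨i, by simpa using hi⟩

/-- The bilinear form as a linear functional of the second argument. -/
noncomputable def Geometry.bilL (G : Geometry b) {n : ℕ} (p : Fin n → Fin b → ℤ) (u : Coord n b) :
    Coord n b →ₗ[ℝ] ℝ where
  toFun := G.bil p u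
  map_add' x y := by
    simp only [Geometry.bil, Pi.add_apply, G.cub_add_right, Finset.sum_add_distrib]
  map_smul' r x := by
    simp only [Geometry.bil, Pi.smul_apply, G.cub_smul_right, Finset.mul_sum, RingHom.id_apply,
      smul_eq_mul]

theorem Geometry.bilL_apply (G : Geometry b) {n : ℕ} (p : Fin n → Fin b → ℤ) (u x : Coord n b) :
    G.bilL p u x = G.bil p u x := rfl

theorem Geometry.bil_comm (G : Geometry b) {n : ℕ} (p : Fin n → Fin b → ℤ) (u x : Coord n b) :
    G.bil p u x = G.bil p x u :=
  Finset.sum_congr rfl fun _ _ => G.cub_swap_right _ _ _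

theorem Geometry.bil_sum_left (G : Geometry b) {n : ℕ} (p : Fin n → Fin b → ℤ) {ι : Type*}
    (I : Finset ι) (u : ι → Coord n b) (x : Coord n b) :
    G.bil p (∑ i ∈ I, u i) x = ∑ i ∈ I, G.bil p (u i) x := by
  rw [G.bil_comm, ← G.bilL_apply, map_sum]
  exact Finset.sum_congr rfl fun i _ => G.bil_comm _ _ _

theorem Geometry.bil_neg_left (G : Geometry b) {n : ℕ} (p : Fin n → Fin b → ℤ)
    (u x : Coord n b) : G.bil p (-u) x = -G.bil p u x := by
  rw [G.bil_comm, ← G.bilL_apply, map_neg, G.bilL_apply, G.bil_comm]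

/-- `(p_i t²)`. -/
noncomputable def Geometry.mass (G : Geometry b) {n : ℕ} (p : Fin n → Fin b → ℤ) (i : Fin n) : ℝ :=
  cub G.κ (toR (p i)) G.t G.t

/-- `(p_i t x_i)`. -/
noncomputable def Geometry.height (G : Geometry b) {n : ℕ} (p : Fin n → Fin b → ℤ) (x : Coord n b)
    (i : Fin n) : ℝ := cub G.κ (toR (p i)) G.t (x i)

theorem Geometry.mass_pos (G : Geometry b) {n : ℕ} {p : Fin n → Fin b → ℤ}
    (hp : ∀ i, p i ∈ G.D4) (i : Fin n) : 0 < G.mass p i := G.pos _ (hp i)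

theorem Geometry.bil_single (G : Geometry b) {n : ℕ} (p : Fin n → Fin b → ℤ) (x : Coord n b)
    (i : Fin n) (w : Fin b → ℝ) :
    G.bil p (Pi.single i w) x = cub G.κ (toR (p i)) w (x i) := by
  rw [Geometry.bil, Finset.sum_eq_single i]
  · simp
  · intro j _ hj
    simp [Pi.single_eq_of_ne hj, cub]
  · simp

theorem Geometry.bil_sub_left (G : Geometry b) {n : ℕ} (p : Fin n → Fin b → ℤ)
    (u u' x : Coord n b) : G.bil p (u - u') x = G.bil p u x - G.bil p u' x := by
  rw [G.bil_comm, ← G.bilL_apply, map_sub, G.bilL_apply, G.bilL_apply, G.bil_comm, G.bil_comm p x]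

theorem vVec_eq {n : ℕ} (p : Fin n → Fin b → ℤ) (i j : Fin n) :
    vVec p i j = Pi.single i (toR (p j)) - Pi.single j (toR (p i)) := by
  funext k a
  simp only [vVec, Pi.sub_apply, Pi.single_apply]
  split_ifs <;> simp [toR]

theorem Geometry.uVec_eq (G : Geometry b) {n : ℕ} (p : Fin n → Fin b → ℤ) (i j : Fin n) :
    G.uVec p i j = Pi.single i (G.mass p j • G.t) - Pi.single j (G.mass p i • G.t) := by
  funext k a
  simp only [Geometry.uVec, Pi.sub_apply, Pi.single_apply, Geometry.mass]
  split_ifs <;> simp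

theorem Geometry.bil_vVec (G : Geometry b) {n : ℕ} (p : Fin n → Fin b → ℤ) (i j : Fin n)
    (x : Coord n b) : G.bil p (vVec p i j) x
      = cub G.κ (toR (p i)) (toR (p j)) (x i) - cub G.κ (toR (p j)) (toR (p i)) (x j) := by
  rw [vVec_eq, G.bil_sub_left, G.bil_single, G.bil_single]

theorem Geometry.bil_uVec (G : Geometry b) {n : ℕ} (p : Fin n → Fin b → ℤ) (i j : Fin n)
    (x : Coord n b) : G.bil p (G.uVec p i j) x
      = G.mass p j * G.height p x i - G.mass p i * G.height p x j := by
  rw [G.uVec_eq, G.bil_sub_left, G.bil_single, G.bil_single, G.cub_swap_right,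
    G.cub_swap_right _ (G.mass p i • G.t), G.cub_smul_right, G.cub_smul_right,
    G.cub_swap_right _ (x i), G.cub_swap_right _ (x j)]
  rfl

theorem Geometry.stabX_eq (G : Geometry b) {n : ℕ} (p : Fin n → Fin b → ℤ) (x : Coord n b)
    (i : Fin n) : G.stabX p x i = -(1 / 2 : ℝ) *
      ((∑ j, G.mass p j) * G.height p x i - G.mass p i * ∑ j, G.height p x j) := by
  simp only [Geometry.stabX, G.bil_uVec, Finset.sum_sub_distrib, Finset.sum_mul, Finset.mul_sum]

theorem Geometry.sum_stabX (G : Geometry b) {n : ℕ} (p : Fin n → Fin b → ℤ) (x : Coord n b) :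
    ∑ i, G.stabX p x i = 0 := by
  simp only [G.stabX_eq, ← Finset.mul_sum, Finset.sum_sub_distrib, ← Finset.sum_mul]
  ring

theorem Geometry.betaX_eq (G : Geometry b) {n : ℕ} (p : Fin n → Fin b → ℤ) (x : Coord n b)
    (i : Fin n) : G.betaX p x i = ∑ j, (cub G.κ (toR (p j)) (toR (p i)) (x j)
      - cub G.κ (toR (p i)) (toR (p j)) (x i)) := by
  simp only [Geometry.betaX, G.bil_vVec]

theorem Geometry.sum_betaX (G : Geometry b) {n : ℕ} (p : Fin n → Fin b → ℤ) (x : Coord n b) :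
    ∑ i, G.betaX p x i = 0 := by
  simp only [G.betaX_eq, Finset.sum_sub_distrib]
  rw [Finset.sum_comm, sub_self]

theorem Geometry.betaX_smul (G : Geometry b) {n : ℕ} (p : Fin n → Fin b → ℤ) (r : ℝ)
    (x : Coord n b) : G.betaX p (r • x) = r • G.betaX p x := by
  funext i
  simp only [Geometry.betaX, ← G.bilL_apply, map_smul, Pi.smul_apply, Finset.smul_sum]

/-! ### Points associated with charges -/

theorem Geometry.kmat_mulVec_point (G : Geometry b) {n : ℕ} {γ : Fin n → Charge b}
    (hγ : ∀ i, (γ i).1 ∈ G.D4) (B : Fin b → ℝ) (τ : ℝ) (i : Fin n) :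
    kmat G.κ (γ i).1 *ᵥ G.point γ B τ i
      = Real.sqrt (2 * τ) • ((γ i).2 + kmat G.κ (γ i).1 *ᵥ B) := by
  rw [Geometry.point, Matrix.mulVec_smul, Matrix.mulVec_add, Matrix.mulVec_mulVec,
    Matrix.mul_nonsing_inv _ (G.isUnit_det (hγ i)), Matrix.one_mulVec]

theorem Geometry.cub_point (G : Geometry b) {n : ℕ} {γ : Fin n → Charge b}
    (hγ : ∀ i, (γ i).1 ∈ G.D4) (B : Fin b → ℝ) (τ : ℝ) (i : Fin n) (w : Fin b → ℝ) :
    cub G.κ (toR (γ i).1) w (G.point γ B τ i)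
      = Real.sqrt (2 * τ) * ((∑ a, (γ i).2 a * w a) + cub G.κ (toR (γ i).1) B w) := by
  rw [G.cub_toR, G.kmat_mulVec_point hγ, dotProduct_smul, dotProduct_add, ← G.cub_toR,
    G.cub_swap_right, smul_eq_mul]
  simp only [dotProduct, mul_comm]

/-- The contribution `(p_i p_j B)` of the B-field is symmetric in `i` and `j` and drops out. -/
theorem Geometry.bil_vVec_point (G : Geometry b) {n : ℕ} {γ : Fin n → Charge b}
    (hγ : ∀ i, (γ i).1 ∈ G.D4) (B : Fin b → ℝ) (τ : ℝ) (i j : Fin n) :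
    G.bil (fun i => (γ i).1) (vVec (fun i => (γ i).1) i j) (G.point γ B τ)
      = Real.sqrt (2 * τ) * dsz (γ i) (γ j) := by
  rw [G.bil_vVec, G.cub_point hγ, G.cub_point hγ, G.cub_swap_left _ B, G.cub_swap_left _ B,
    G.cub_swap_right B, dsz, Finset.sum_sub_distrib]
  simp only [toR]
  ring

theorem Geometry.betaX_point (G : Geometry b) {n : ℕ} {γ : Fin n → Charge b}
    (hγ : ∀ i, (γ i).1 ∈ G.D4) (B : Fin b → ℝ) (τ : ℝ) :
    G.betaX (fun i => (γ i).1) (G.point γ B τ) = Real.sqrt (2 * τ) • beta γ := by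
  funext i
  simp only [Geometry.betaX, G.bil_vVec_point hγ, beta, Pi.smul_apply, smul_eq_mul,
    Finset.mul_sum]

theorem Geometry.imZZ_eq_bil (G : Geometry b) {n : ℕ} {γ : Fin n → Charge b}
    (hγ : ∀ i, (γ i).1 ∈ G.D4) (B : Fin b → ℝ) (τ : ℝ) (i j : Fin n) :
    G.bil (fun i => (γ i).1) (G.uVec (fun i => (γ i).1) i j) (G.point γ B τ)
      = -2 * (Real.sqrt (2 * τ) * G.imZZ B (γ i) (γ j)) := by
  rw [G.bil_uVec, Geometry.height, Geometry.height, G.cub_point hγ, G.cub_point hγ,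
    Geometry.imZZ, Geometry.mass, Geometry.mass]
  ring

theorem Geometry.imZZ_add_right (G : Geometry b) (B : Fin b → ℝ) (x y z : Charge b) :
    G.imZZ B x (y + z) = G.imZZ B x y + G.imZZ B x z := by
  have h : toR (y + z).1 = toR y.1 + toR z.1 := by
    funext a
    simp [toR]
  simp only [Geometry.imZZ, h, cub_add_left, Prod.snd_add, Pi.add_apply, add_mul,
    Finset.sum_add_distrib]
  ring

theorem Geometry.stabX_point (G : Geometry b) {n : ℕ} {γ : Fin n → Charge b}
    (hγ : ∀ i, (γ i).1 ∈ G.D4) (B : Fin b → ℝ) (τ : ℝ) :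
    G.stabX (fun i => (γ i).1) (G.point γ B τ) = Real.sqrt (2 * τ) • G.stab B γ := by
  funext i
  have h : G.imZZ B (γ i) (∑ j, γ j) = ∑ j, G.imZZ B (γ i) (γ j) :=
    map_sum (⟨⟨fun x => G.imZZ B (γ i) x, by simp [Geometry.imZZ, toR, cub]⟩,
      fun x y => G.imZZ_add_right B (γ i) x y⟩ : Charge b →+ ℝ) γ Finset.univ
  rw [Pi.smul_apply, Geometry.stab, h]
  simp only [Geometry.stabX, G.imZZ_eq_bil hγ, smul_eq_mul, Finset.mul_sum]
  exact Finset.sum_congr rfl fun j _ => by ring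

/-- The map of coordinates induced by merging. -/
noncomputable def Geometry.mergeX (G : Geometry b) {n m : ℕ} (f : Fin n → Fin m)
    (p : Fin n → Fin b → ℤ) (x : Coord n b) : Coord m b :=
  fun k => (kmat G.κ (merge f p k))⁻¹ *ᵥ merge f (fun i => kmat G.κ (p i) *ᵥ x i) k

theorem fst_merge {n m : ℕ} (f : Fin n → Fin m) (γ : Fin n → Charge b) (k : Fin m) :
    (merge f γ k).1 = merge f (fun i => (γ i).1) k := by
  simp [merge, Prod.fst_sum]

/-- The vectors `κ_i x_i = √(2τ₂) (q_i + κ_i B)` add up when charges are merged, because `κ_i` is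
linear in `p_i`; `mergeX` adds these vectors and inverts the total form. -/
theorem Geometry.point_merge (G : Geometry b) {n m : ℕ} {f : Fin n → Fin m}
    (hf : Function.Surjective f) {γ : Fin n → Charge b}
    (hγ : ∀ i, (γ i).1 ∈ G.D4) (B : Fin b → ℝ) (τ : ℝ) :
    G.point (merge f γ) B τ = G.mergeX f (fun i => (γ i).1) (G.point γ B τ) := by
  funext k
  have h1 : IsUnit (kmat G.κ (merge f γ k).1).det := by
    rw [fst_merge]
    exact G.isUnit_det (G.merge_mem_D4 hγ hf k)
  have h2 : kmat G.κ (merge f γ k).1 *ᵥ G.point (merge f γ) B τ k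
      = merge f (fun i => kmat G.κ (γ i).1 *ᵥ G.point γ B τ i) k := by
    rw [G.kmat_mulVec_point (fun k => by rw [fst_merge]; exact G.merge_mem_D4 hγ hf k)]
    simp only [merge, G.kmat_mulVec_point hγ, ← Finset.smul_sum, Finset.sum_add_distrib,
      Prod.fst_sum, Prod.snd_sum, G.kmat_sum, Matrix.sum_mulVec]
  rw [Geometry.mergeX, ← h2, ← fst_merge, Matrix.mulVec_mulVec, Matrix.nonsing_inv_mul _ h1,
    Matrix.one_mulVec]

theorem Geometry.mergeX_add_smul (G : Geometry b) {n m : ℕ} (f : Fin n → Fin m)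
    (p : Fin n → Fin b → ℤ) (r : ℝ) (x y : Coord n b) :
    G.mergeX f p (x + r • y) = G.mergeX f p x + r • G.mergeX f p y := by
  funext k
  simp only [Geometry.mergeX, merge, Pi.add_apply, Pi.smul_apply, Matrix.mulVec_add,
    Matrix.mulVec_smul, Finset.sum_add_distrib, ← Finset.smul_sum]

/-- `mergeX` as a continuous linear map. -/
noncomputable def Geometry.mergeXL (G : Geometry b) {n m : ℕ} (f : Fin n → Fin m)
    (p : Fin n → Fin b → ℤ) : Coord n b →L[ℝ] Coord m b :=
  LinearMap.toContinuousLinearMap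
    { toFun := G.mergeX f p
      map_add' := fun x y => by simpa using G.mergeX_add_smul f p 1 x y
      map_smul' := fun r x => by
        have h0 : G.mergeX f p 0 = 0 := by
          funext k
          simp [Geometry.mergeX, merge]
        simpa [h0] using G.mergeX_add_smul f p r 0 x }

theorem Geometry.mergeXL_apply (G : Geometry b) {n m : ℕ} (f : Fin n → Fin m)
    (p : Fin n → Fin b → ℤ) (x : Coord n b) : G.mergeXL f p x = G.mergeX f p x := rfl


/-! ### Open dense sets -/

/-- Open dense sets. -/
def OpenDense {X : Type*} [TopologicalSpace X] (s : Set X) : Prop := IsOpen s ∧ Dense s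

theorem OpenDense.inter {X : Type*} [TopologicalSpace X] {s t : Set X} (hs : OpenDense s)
    (ht : OpenDense t) : OpenDense (s ∩ t) :=
  ⟨hs.1.inter ht.1, hs.2.inter_of_isOpen_left ht.2 hs.1⟩

theorem openDense_univ {X : Type*} [TopologicalSpace X] : OpenDense (Set.univ : Set X) :=
  ⟨isOpen_univ, dense_univ⟩

theorem OpenDense.iInter {X ι : Type*} [TopologicalSpace X] [Finite ι] {s : ι → Set X}
    (hs : ∀ i, OpenDense (s i)) : OpenDense (⋂ i, s i) := by
  have := Fintype.ofFinite ι
  have h : ∀ I : Finset ι, OpenDense (⋂ i ∈ I, s i) := by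
    classical
    intro I
    induction I using Finset.induction_on with
    | empty => simpa using openDense_univ
    | insert a I _ ih =>
      rw [Finset.set_biInter_insert]
      exact (hs a).inter ih
  simpa using h Finset.univ

theorem OpenDense.setOf_and {X : Type*} [TopologicalSpace X] {P Q : X → Prop}
    (hs : OpenDense {x | P x}) (ht : OpenDense {x | Q x}) : OpenDense {x | P x ∧ Q x} :=
  hs.inter ht

theorem OpenDense.setOf_forall {X ι : Type*} [TopologicalSpace X] [Finite ι] {P : ι → X → Prop}
    (hs : ∀ i, OpenDense {x | P i x}) : OpenDense {x | ∀ i, P i x} := by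
  have := OpenDense.iInter hs
  rwa [← Set.ofPred_forall] at this

theorem OpenDense.setOf_imp {X : Type*} [TopologicalSpace X] {q : Prop} {P : X → Prop}
    (hs : q → OpenDense {x | P x}) : OpenDense {x | q → P x} := by
  by_cases h : q
  · simpa [h] using hs h
  · simpa [h] using openDense_univ

theorem OpenDense.preimage_linear {V V' : Type*} [NormedAddCommGroup V] [NormedSpace ℝ V]
    [FiniteDimensional ℝ V] [NormedAddCommGroup V'] [NormedSpace ℝ V'] [FiniteDimensional ℝ V']
    (T : V →ₗ[ℝ] V') (hT : Function.Surjective T) {s : Set V'} (hs : OpenDense s) :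
    OpenDense (T ⁻¹' s) :=
  ⟨hs.1.preimage T.continuous_of_finiteDimensional,
    hs.2.preimage (T.isOpenMap_of_finiteDimensional hT)⟩

theorem openDense_ne_zero {V : Type*} [NormedAddCommGroup V] [NormedSpace ℝ V]
    [FiniteDimensional ℝ V] (φ : V →ₗ[ℝ] ℝ) (h : ∃ v, φ v ≠ 0) : OpenDense {x | φ x ≠ 0} := by
  obtain ⟨v, hv⟩ := h
  have hs : Function.Surjective φ := fun r => ⟨(r / φ v) • v, by simp [hv]⟩
  exact OpenDense.preimage_linear φ hs (s := {0}ᶜ) ⟨isOpen_compl_singleton, dense_compl_singleton 0⟩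

/-! ### Stability parameters with vanishing sum -/

/-- Parameters `c` with `∑ c_i = 0`. -/
def zeroSum (n : ℕ) : Submodule ℝ (Fin n → ℝ) where
  carrier := {c | ∑ i, c i = 0}
  add_mem' {x y} hx hy := by
    simp only [Set.mem_ofPred_eq, Pi.add_apply, Finset.sum_add_distrib] at *
    rw [hx, hy, add_zero]
  zero_mem' := by simp
  smul_mem' r x hx := by
    simp only [Set.mem_ofPred_eq, Pi.smul_apply, ← Finset.smul_sum] at *
    rw [hx, smul_zero]

theorem mem_zeroSum {n : ℕ} {c : Fin n → ℝ} : c ∈ zeroSum n ↔ ∑ i, c i = 0 := Iff.rfl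

/-- The sum over a subset as a linear functional. -/
def subsetSum {n : ℕ} (I : Finset (Fin n)) : (Fin n → ℝ) →ₗ[ℝ] ℝ :=
  ∑ i ∈ I, LinearMap.proj i

theorem subsetSum_apply {n : ℕ} (I : Finset (Fin n)) (c : Fin n → ℝ) :
    subsetSum I c = ∑ i ∈ I, c i := by
  simp [subsetSum]

theorem single_sub_single_mem {n : ℕ} (i j : Fin n) :
    (Pi.single i 1 - Pi.single j 1 : Fin n → ℝ) ∈ zeroSum n := by
  simp [mem_zeroSum]

theorem sum_single_sub_single {n : ℕ} (i j : Fin n) (I : Finset (Fin n)) :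
    ∑ k ∈ I, (Pi.single i 1 - Pi.single j 1 : Fin n → ℝ) k
      = (if i ∈ I then 1 else 0) - (if j ∈ I then 1 else 0) := by
  simp only [Pi.sub_apply, Finset.sum_sub_distrib, Finset.sum_pi_single']

theorem openDense_genericStab (n : ℕ) : OpenDense {c : zeroSum n | GenericStab (c : Fin n → ℝ)} := by
  refine OpenDense.setOf_forall fun I => OpenDense.setOf_imp fun hI => OpenDense.setOf_imp fun hI' =>
    ?_
  have := openDense_ne_zero ((subsetSum I).comp (zeroSum n).subtype) ?_
  · simpa [subsetSum_apply] using this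
  · obtain ⟨i, hi⟩ := hI
    obtain ⟨j, hj⟩ := not_forall.mp (mt Finset.eq_univ_iff_forall.mpr hI')
    refine ⟨⟨_, single_sub_single_mem i j⟩, ?_⟩
    simp only [LinearMap.comp_apply, Submodule.subtype_apply, subsetSum_apply]
    rw [sum_single_sub_single]
    simp [hi, hj]

theorem openDense_merge {n m : ℕ} {f : Fin n → Fin m} (hf : Function.Surjective f)
    {Q : (Fin m → ℝ) → Prop} (hQ : OpenDense {d : zeroSum m | Q d}) :
    OpenDense {c : zeroSum n | Q (merge f c)} := by
  let T : zeroSum n →ₗ[ℝ] zeroSum m :=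
    { toFun := fun c => ⟨merge f c, by rw [mem_zeroSum, sum_univ_merge]; exact c.2⟩
      map_add' := fun x y => by
        ext k
        simp [merge, Finset.sum_add_distrib]
      map_smul' := fun r x => by
        ext k
        simp [merge, Finset.mul_sum] }
  refine OpenDense.preimage_linear T ?_ hQ
  intro d
  -- Merging along a section of `f` is a right inverse of merging along `f`.
  choose g hg using hf
  have hd : merge f (merge g (d : Fin m → ℝ)) = d := by
    rw [merge_merge]
    have : f ∘ g = (Equiv.refl (Fin m)).symm := by
      funext k
      exact hg k
    rw [this, ← comp_perm_eq_merge]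
    rfl
  refine ⟨⟨merge g (d : Fin m → ℝ), by rw [mem_zeroSum, sum_univ_merge]; exact d.2⟩, Subtype.ext hd⟩

theorem sum_flowSub {n : ℕ} (γ : Fin n → Charge b) (c : Fin n → ℝ) (I : Finset (Fin n))
    (h : ∑ i ∈ I, beta γ i ≠ 0) : ∑ i ∈ I, flowSub γ c I i = 0 := by
  simp only [flowSub, Finset.sum_sub_distrib, ← Finset.sum_mul, ← Finset.sum_div]
  rw [div_self h, one_mul, sub_self]

theorem sum_univ_flowSub {n : ℕ} (γ : Fin n → Charge b) (c : Fin n → ℝ) (I : Finset (Fin n)) :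
    ∑ i, flowSub γ c I i = ∑ i, c i := by
  simp only [flowSub, Finset.sum_sub_distrib, ← Finset.sum_mul, ← Finset.sum_div, sum_beta]
  simp

theorem sum_flow_head {n : ℕ} (γ : Fin n → Charge b) (c : Fin n → ℝ) (ℓ : Fin n)
    (h : bigGamma ℓ γ ≠ 0) : ∑ j, (flow ℓ γ c ∘ head ℓ) j = 0 := by
  rw [bigGamma_eq] at h
  rw [flow_eq]
  exact (sum_head ℓ _).trans (sum_flowSub γ c _ h)

theorem sum_flow_tail {n : ℕ} (γ : Fin n → Charge b) {c : Fin n → ℝ} (hc : ∑ i, c i = 0)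
    (ℓ : Fin n) (h : bigGamma ℓ γ ≠ 0) : ∑ j, (flow ℓ γ c ∘ tail ℓ) j = 0 := by
  have h1 := sum_head_add_sum_tail ℓ (flow ℓ γ c)
  have h2 := sum_flow_head γ c ℓ h
  simp only [Function.comp] at h2 ⊢
  rw [h2, zero_add] at h1
  rw [h1, flow_eq, sum_univ_flowSub, hc]

theorem flow_add_smul {n : ℕ} (γ : Fin n → Charge b) (ℓ : Fin n) (r : ℝ) (c d : Fin n → ℝ) :
    flow ℓ γ (c + r • d) = flow ℓ γ c + r • flow ℓ γ d := by
  funext i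
  simp only [flow, partialSum, Pi.add_apply, Pi.smul_apply, smul_eq_mul, Finset.sum_add_distrib,
    ← Finset.mul_sum]
  ring

theorem flow_of_partialSum_eq_zero {n : ℕ} (γ : Fin n → Charge b) (ℓ : Fin n) {c : Fin n → ℝ}
    (hc : partialSum ℓ c = 0) : flow ℓ γ c = c := by
  funext i
  simp [flow, hc]

/-- Restriction of the parameters at the wall, as a linear map. -/
noncomputable def flowLin {n k : ℕ} (γ : Fin n → Charge b) (ℓ : Fin n) (e : Fin k → Fin n)
    (h : ∀ c ∈ zeroSum n, flow ℓ γ c ∘ e ∈ zeroSum k) : zeroSum n →ₗ[ℝ] zeroSum k where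
  toFun c := ⟨flow ℓ γ c ∘ e, h c c.2⟩
  map_add' x y := by
    have := flow_add_smul γ ℓ 1 (x : Fin n → ℝ) y
    simp only [one_smul] at this
    ext j
    simp [this]
  map_smul' r x := by
    have h0 : flow ℓ γ (0 : Fin n → ℝ) = 0 := by
      funext i
      simp [flow, partialSum]
    have := flow_add_smul γ ℓ r 0 (x : Fin n → ℝ)
    rw [zero_add, h0, zero_add] at this
    ext j
    simp [this]

/-- The map to the parameters of the first cluster is onto: extended by zero, a vector `d` of
vanishing sum has vanishing partial sum, and the flow leaves it unchanged. -/
theorem openDense_flow_head {n : ℕ} (γ : Fin n → Charge b) (ℓ : Fin n) (h : bigGamma ℓ γ ≠ 0)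
    {Q : (Fin ℓ → ℝ) → Prop} (hQ : OpenDense {d : zeroSum ℓ | Q d}) :
    OpenDense {c : zeroSum n | Q (flow ℓ γ c ∘ head ℓ)} := by
  refine OpenDense.preimage_linear (flowLin γ ℓ (head ℓ) fun c _ => sum_flow_head γ c ℓ h) ?_ hQ
  intro d
  have h1 : ∀ j, Function.extend (head ℓ) (d : Fin ℓ → ℝ) 0 (head ℓ j) = d.1 j :=
    fun j => (head_injective ℓ).extend_apply _ _ j
  have h2 : ∀ j, Function.extend (head ℓ) (d : Fin ℓ → ℝ) 0 (tail ℓ j) = 0 := fun j =>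
    Function.extend_apply' _ _ _ (by rintro ⟨i, hi⟩; exact head_ne_tail ℓ i j hi)
  have h3 : partialSum ℓ (Function.extend (head ℓ) (d : Fin ℓ → ℝ) 0) = 0 := by
    simp only [partialSum, h1]
    exact d.2
  refine ⟨⟨Function.extend (head ℓ) d 0, ?_⟩, ?_⟩
  · rw [mem_zeroSum, ← sum_head_add_sum_tail ℓ]
    simp only [h1, h2, Finset.sum_const_zero, add_zero]
    exact d.2
  · ext j
    change flow ℓ γ _ (head ℓ j) = _
    rw [flow_of_partialSum_eq_zero γ ℓ h3, h1]

theorem openDense_flow_tail {n : ℕ} (γ : Fin n → Charge b) (ℓ : Fin n) (h : bigGamma ℓ γ ≠ 0)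
    {Q : (Fin (n - ℓ) → ℝ) → Prop} (hQ : OpenDense {d : zeroSum (n - ℓ) | Q d}) :
    OpenDense {c : zeroSum n | Q (flow ℓ γ c ∘ tail ℓ)} := by
  refine OpenDense.preimage_linear (flowLin γ ℓ (tail ℓ) fun c hc => sum_flow_tail γ hc ℓ h) ?_ hQ
  intro d
  have h1 : ∀ j, Function.extend (tail ℓ) (d : Fin (n - ℓ) → ℝ) 0 (tail ℓ j) = d.1 j :=
    fun j => (tail_injective ℓ).extend_apply _ _ j
  have h2 : ∀ j, Function.extend (tail ℓ) (d : Fin (n - ℓ) → ℝ) 0 (head ℓ j) = 0 := fun j =>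
    Function.extend_apply' _ _ _ (by rintro ⟨i, hi⟩; exact head_ne_tail ℓ j i hi.symm)
  have h3 : partialSum ℓ (Function.extend (tail ℓ) (d : Fin (n - ℓ) → ℝ) 0) = 0 := by
    simp only [partialSum, h2, Finset.sum_const_zero]
  refine ⟨⟨Function.extend (tail ℓ) d 0, ?_⟩, ?_⟩
  · rw [mem_zeroSum, ← sum_head_add_sum_tail ℓ]
    simp only [h1, h2, Finset.sum_const_zero, zero_add]
    exact d.2
  · ext j
    change flow ℓ γ _ (tail ℓ j) = _
    rw [flow_of_partialSum_eq_zero γ ℓ h3, h1]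

/-! ### Charges in general position -/

/-- No DSZ product `⟨γ_L, γ_I⟩` with `∅ ≠ I ⊊ L` vanishes. -/
def GoodConf {n : ℕ} (γ : Fin n → Charge b) : Prop :=
  ∀ L I : Finset (Fin n), I ⊂ L → I.Nonempty → ∑ i ∈ I, ∑ j ∈ L, dsz (γ j) (γ i) ≠ 0

theorem GoodConf.comp {n k : ℕ} {γ : Fin n → Charge b} (h : GoodConf γ) (e : Fin k → Fin n)
    (he : Function.Injective e) : GoodConf (γ ∘ e) := by
  intro L I hI hI'
  have := h (L.map ⟨e, he⟩) (I.map ⟨e, he⟩) (Finset.map_ssubset_map.mpr hI) (hI'.map)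
  simpa using this

theorem GoodConf.merge {n m : ℕ} {γ : Fin n → Charge b} (h : GoodConf γ) {f : Fin n → Fin m}
    (hf : Function.Surjective f) : GoodConf (merge f γ) := by
  intro L I hI hI'
  have h1 : ∑ i ∈ I, ∑ j ∈ L, dsz (D4D2.merge f γ j) (D4D2.merge f γ i)
      = dsz (∑ j ∈ L, D4D2.merge f γ j) (∑ i ∈ I, D4D2.merge f γ i) := by
    rw [dsz_sum_right]
    exact Finset.sum_congr rfl fun i _ => (dsz_sum_left _ _ _).symm
  rw [h1, sum_merge, sum_merge, dsz_sum_right]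
  simp only [dsz_sum_left]
  obtain ⟨k, hk, hk'⟩ := Finset.exists_of_ssubset hI
  refine h _ _ (Finset.ssubset_iff_subset_ne.mpr ⟨?_, ?_⟩) ?_
  · intro i
    simp only [Finset.mem_filter, Finset.mem_univ, true_and]
    exact fun hi => hI.1 hi
  · intro heq
    obtain ⟨i, rfl⟩ := hf k
    have : i ∈ Finset.univ.filter (f · ∈ I) := by
      rw [heq]
      simpa using hk
    exact hk' (by simpa using this)
  · obtain ⟨k, hk⟩ := hI'
    obtain ⟨i, rfl⟩ := hf k
    exact ⟨i, by simpa using hk⟩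

theorem GoodConf.sum_beta_ne_zero {n : ℕ} {γ : Fin n → Charge b} (h : GoodConf γ)
    {I : Finset (Fin n)} (hI : I.Nonempty) (hI' : I ≠ Finset.univ) : ∑ i ∈ I, beta γ i ≠ 0 :=
  h Finset.univ I (Finset.ssubset_univ_iff.mpr hI') hI

theorem filter_lt_nonempty {n : ℕ} {ℓ : Fin n} (hℓ : 0 < (ℓ : ℕ)) :
    (Finset.univ.filter (· < ℓ)).Nonempty :=
  ⟨⟨0, by omega⟩, Finset.mem_filter.mpr ⟨Finset.mem_univ _, Fin.lt_def.mpr hℓ⟩⟩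

theorem filter_lt_ne_univ {n : ℕ} (ℓ : Fin n) : Finset.univ.filter (· < ℓ) ≠ Finset.univ := by
  intro h
  have : ℓ ∈ Finset.univ.filter (· < ℓ) := by
    rw [h]
    simp
  simp at this

theorem GoodConf.bigGamma_ne_zero {n : ℕ} {γ : Fin n → Charge b} (h : GoodConf γ) {ℓ : Fin n}
    (hℓ : 0 < (ℓ : ℕ)) : bigGamma ℓ γ ≠ 0 := by
  rw [bigGamma_eq]
  exact h.sum_beta_ne_zero (filter_lt_nonempty hℓ) (filter_lt_ne_univ ℓ)

/-- There are finitely many conditions. The denominators `bigGamma` are nonzero at all stages, since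
general position is inherited by parts of the configuration, and each later condition is the
preimage of an open dense set under a surjective linear map. -/
theorem openDense_genericConf {n : ℕ} {γ : Fin n → Charge b} (h : GoodConf γ) :
    OpenDense {c : zeroSum n | GenericConf n γ c} := by
  induction n using Nat.strong_induction_on with
  | _ n ih =>
    have : {c : zeroSum n | GenericConf n γ c} = {c : zeroSum n | GenericStab (c : Fin n → ℝ) ∧
        ∀ (s : Equiv.Perm (Fin n)) (ℓ : Fin n), 0 < (ℓ : ℕ) → bigGamma ℓ (γ ∘ s) ≠ 0 ∧
        GenericConf ℓ (γ ∘ s ∘ head ℓ) (flow ℓ (γ ∘ s) (c ∘ s) ∘ head ℓ) ∧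
        GenericConf (n - ℓ) (γ ∘ s ∘ tail ℓ) (flow ℓ (γ ∘ s) (c ∘ s) ∘ tail ℓ)} := by
      ext c
      rw [Set.mem_ofPred_eq, GenericConf]
      rfl
    rw [this]
    refine (openDense_genericStab n).setOf_and ?_
    refine OpenDense.setOf_forall fun s => OpenDense.setOf_forall fun ℓ =>
      OpenDense.setOf_imp fun hℓ => ?_
    have hs : GoodConf (γ ∘ s) := h.comp s s.injective
    have hΓ := hs.bigGamma_ne_zero hℓ
    have h1 := ih ℓ ℓ.2 (γ := γ ∘ s ∘ head ℓ) (hs.comp _ (head_injective ℓ))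
    have h2 := ih (n - ℓ) (by omega) (γ := γ ∘ s ∘ tail ℓ) (hs.comp _ (tail_injective ℓ))
    have h3 := openDense_merge s.symm.surjective (Q := fun c =>
      GenericConf ℓ (γ ∘ s ∘ head ℓ) (flow ℓ (γ ∘ s) c ∘ head ℓ)) (openDense_flow_head _ ℓ hΓ h1)
    have h4 := openDense_merge s.symm.surjective (Q := fun c =>
      GenericConf (n - ℓ) (γ ∘ s ∘ tail ℓ) (flow ℓ (γ ∘ s) c ∘ tail ℓ))
      (openDense_flow_tail _ ℓ hΓ h2)
    simp only [← comp_perm_eq_merge] at h3 h4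
    simpa [hΓ] using h3.setOf_and h4

/-! ### Density of the points associated with charges -/

/-- At fixed `p` the vectors `q` fill a shifted lattice; scaled by `√(2τ₂)`, which may be taken
arbitrarily small, it approximates every point. Taking `B = 0` is enough. -/
theorem Geometry.dense_points (G : Geometry b) {n : ℕ} {p : Fin n → Fin b → ℤ}
    (hp : ∀ i, p i ∈ G.D4) :
    Dense {x : Coord n b | ∃ γ : Fin n → Charge b, (∀ i, γ i ∈ G.chargeSet) ∧
      (fun i => (γ i).1) = p ∧ ∃ τ : ℝ, 0 < τ ∧ G.point γ 0 τ = x} := by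
  intro x
  let lam : ℕ → ℝ := fun N => 1 / ((N : ℝ) + 1)
  have hlam : ∀ N, 0 < lam N := fun N => by positivity
  let sh : Fin n → Fin b → ℝ := fun i a =>
    (1 / 2 : ℝ) * ∑ a', ∑ a'', (G.κ a a' a'' : ℝ) * p i a' * p i a''
  -- The charge in the shifted lattice nearest to `κ_i x_i / lam N`, where `lam N` is the value of
  -- `√(2τ₂)`.
  let k : ℕ → Fin n → Fin b → ℤ := fun N i a =>
    round ((kmat G.κ (p i) *ᵥ x i) a / lam N - sh i a)
  let γ : ℕ → Fin n → Charge b := fun N i => (p i, fun a => k N i a + sh i a)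
  have hpt : ∀ N, G.point (γ N) 0 (lam N ^ 2 / 2) = fun i =>
      (kmat G.κ (p i))⁻¹ *ᵥ (lam N • (γ N i).2) := by
    intro N
    funext i
    have : Real.sqrt (2 * (lam N ^ 2 / 2)) = lam N := by
      rw [mul_div_cancel₀ _ (two_ne_zero), Real.sqrt_sq (hlam N).le]
    rw [Geometry.point, this, add_zero, Matrix.mulVec_smul]
  refine mem_closure_of_tendsto (f := fun N => G.point (γ N) 0 (lam N ^ 2 / 2)) (b := atTop) ?_
    (Eventually.of_forall fun N => ⟨γ N, fun i => ⟨hp i, fun a => ⟨k N i a, rfl⟩⟩, rfl,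
      lam N ^ 2 / 2, by have := hlam N; positivity, rfl⟩)
  simp_rw [hpt]
  rw [tendsto_pi_nhds]
  intro i
  have hx : (kmat G.κ (p i))⁻¹ *ᵥ (kmat G.κ (p i) *ᵥ x i) = x i := by
    rw [Matrix.mulVec_mulVec, Matrix.nonsing_inv_mul _ (G.isUnit_det (hp i)), Matrix.one_mulVec]
  have hc : Continuous fun v : Fin b → ℝ => (kmat G.κ (p i))⁻¹ *ᵥ v :=
    Continuous.matrix_mulVec continuous_const continuous_id
  rw [← hx]
  refine (hc.tendsto _).comp ?_
  rw [tendsto_pi_nhds]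
  intro a
  have hl0 : Tendsto lam atTop (nhds 0) := tendsto_one_div_add_atTop_nhds_zero_nat
  rw [tendsto_iff_dist_tendsto_zero]
  refine squeeze_zero (fun _ => dist_nonneg) (fun N => ?_) hl0
  have h1 := abs_sub_round ((kmat G.κ (p i) *ᵥ x i) a / lam N - sh i a)
  have h2 : lam N • (γ N i).2 a - (kmat G.κ (p i) *ᵥ x i) a
      = -(lam N * ((kmat G.κ (p i) *ᵥ x i) a / lam N - sh i a - k N i a)) := by
    have := (hlam N).ne'
    simp only [γ, smul_eq_mul]
    field_simp
    ring
  rw [Pi.smul_apply, Real.dist_eq, h2, abs_neg, abs_mul, abs_of_pos (hlam N)]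
  have : |(kmat G.κ (p i) *ᵥ x i) a / lam N - sh i a - k N i a| ≤ 1 := h1.trans (by norm_num)
  nlinarith [hlam N]

theorem Geometry.exists_mem_openDense (G : Geometry b) {n : ℕ} {p : Fin n → Fin b → ℤ}
    (hp : ∀ i, p i ∈ G.D4) {U : Set (Coord n b)} (hU : OpenDense U) :
    Dense {x : Coord n b | x ∈ U ∧ ∃ γ : Fin n → Charge b, (∀ i, γ i ∈ G.chargeSet) ∧
      (fun i => (γ i).1) = p ∧ ∃ τ : ℝ, 0 < τ ∧ G.point γ 0 τ = x} :=
  hU.2.inter_of_isOpen_left (G.dense_points hp) hU.1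

/-- The DSZ product `⟨γ_L, γ_I⟩` as a linear functional of the coordinates. -/
noncomputable def Geometry.dszForm (G : Geometry b) {n : ℕ} (p : Fin n → Fin b → ℤ)
    (L I : Finset (Fin n)) : Coord n b →ₗ[ℝ] ℝ :=
  ∑ i ∈ I, ∑ j ∈ L, G.bilL p (vVec p j i)

theorem Geometry.dszForm_apply (G : Geometry b) {n : ℕ} (p : Fin n → Fin b → ℤ)
    (L I : Finset (Fin n)) (x : Coord n b) :
    G.dszForm p L I x = ∑ i ∈ I, ∑ j ∈ L, G.bil p (vVec p j i) x := by
  simp [Geometry.dszForm, LinearMap.sum_apply, G.bilL_apply]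

theorem Geometry.exists_cub_ne_zero (G : Geometry b) {p : Fin b → ℤ} (hp : p ∈ G.D4)
    {v : Fin b → ℝ} (hv : v ≠ 0) : ∃ w, cub G.κ (toR p) v w ≠ 0 := by
  by_contra! h
  apply hv
  have h1 : kmat G.κ p *ᵥ v = 0 := by
    apply dotProduct_eq_zero _
    intro w
    rw [dotProduct_comm, ← G.cub_toR, G.cub_swap_right, h]
  rw [← Matrix.one_mulVec v, ← Matrix.nonsing_inv_mul _ (G.isUnit_det hp), ← Matrix.mulVec_mulVec,
    h1, Matrix.mulVec_zero]

theorem Geometry.openDense_good (G : Geometry b) {n : ℕ} {p : Fin n → Fin b → ℤ}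
    (hp : ∀ i, p i ∈ G.D4) :
    OpenDense {x : Coord n b | ∀ L I : Finset (Fin n), I ⊂ L → I.Nonempty →
      G.dszForm p L I x ≠ 0} := by
  refine OpenDense.setOf_forall fun L => OpenDense.setOf_forall fun I =>
    OpenDense.setOf_imp fun hI => OpenDense.setOf_imp fun hI' => openDense_ne_zero _ ?_
  -- Only the coordinate `x_j` with `j` in `L` but not in `I` is moved. The form then reduces to
  -- `(p_j p_I w)`, which is nonzero for some `w` since `κ_j` is nondegenerate and `p_I ≠ 0`.
  obtain ⟨j, hj, hj'⟩ := Finset.exists_of_ssubset hI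
  have hpI : ∑ i ∈ I, p i ∈ G.D4 := G.sum_mem_D4 hp hI'
  obtain ⟨w, hw⟩ := G.exists_cub_ne_zero (hp j) (G.toR_ne_zero hpI)
  refine ⟨Pi.single j w, ?_⟩
  convert hw using 1
  rw [G.dszForm_apply, toR_sum, G.cub_swap_left, G.cub_sum_left]
  refine Finset.sum_congr rfl fun i hi => ?_
  have hij : i ≠ j := fun h => hj' (h ▸ hi)
  rw [Finset.sum_eq_single j]
  · rw [G.bil_vVec, Pi.single_eq_same, Pi.single_eq_of_ne hij, G.cub_swap_left]
    simp [cub]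
  · intro k _ hk
    rw [G.bil_vVec, Pi.single_eq_of_ne hij, Pi.single_eq_of_ne hk]
    simp [cub]
  · exact fun h => absurd hj h

theorem Geometry.dszForm_point (G : Geometry b) {n : ℕ} {γ : Fin n → Charge b}
    (hγ : ∀ i, (γ i).1 ∈ G.D4) (B : Fin b → ℝ) (τ : ℝ) (L I : Finset (Fin n)) :
    G.dszForm (fun i => (γ i).1) L I (G.point γ B τ)
      = Real.sqrt (2 * τ) * ∑ i ∈ I, ∑ j ∈ L, dsz (γ j) (γ i) := by
  simp only [G.dszForm_apply, G.bil_vVec_point hγ, Finset.mul_sum]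

theorem Geometry.goodConf_of_point (G : Geometry b) {n : ℕ} {γ : Fin n → Charge b}
    (hγ : ∀ i, (γ i).1 ∈ G.D4) (B : Fin b → ℝ) (τ : ℝ)
    (h : ∀ L I : Finset (Fin n), I ⊂ L → I.Nonempty →
      G.dszForm (fun i => (γ i).1) L I (G.point γ B τ) ≠ 0) : GoodConf γ := by
  intro L I hI hI'
  have := h L I hI hI'
  rw [G.dszForm_point hγ] at this
  exact right_ne_zero_of_mul this


/-! ### Chambers -/

/-- The two sets of parameters are in the same chamber. -/
def SameChamber {n : ℕ} (c c' : Fin n → ℝ) : Prop :=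
  ∀ I : Finset (Fin n), 0 < ∑ i ∈ I, c i ↔ 0 < ∑ i ∈ I, c' i

theorem SameChamber.symm {n : ℕ} {c c' : Fin n → ℝ} (h : SameChamber c c') : SameChamber c' c :=
  fun I => (h I).symm

theorem SameChamber.trans {n : ℕ} {c c' c'' : Fin n → ℝ} (h : SameChamber c c')
    (h' : SameChamber c' c'') : SameChamber c c'' :=
  fun I => (h I).trans (h' I)

theorem SameChamber.refl {n : ℕ} (c : Fin n → ℝ) : SameChamber c c := fun _ => Iff.rfl

theorem SameChamber.merge {n m : ℕ} {c c' : Fin n → ℝ} (h : SameChamber c c')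
    (f : Fin n → Fin m) : SameChamber (merge f c) (merge f c') := by
  intro I
  rw [sum_merge, sum_merge]
  exact h _

theorem sameChamber_smul {n : ℕ} (c : Fin n → ℝ) {r : ℝ} (hr : 0 < r) : SameChamber (r • c) c := by
  intro I
  simp only [Pi.smul_apply, smul_eq_mul, ← Finset.mul_sum]
  exact ⟨fun h => pos_of_mul_pos_right h hr.le, fun h => mul_pos hr h⟩

theorem GenericStab.merge {n m : ℕ} {c : Fin n → ℝ} (h : GenericStab c) {f : Fin n → Fin m}
    (hf : Function.Surjective f) : GenericStab (merge f c) := by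
  intro I hI hI'
  rw [sum_merge]
  obtain ⟨k, hk⟩ := hI
  obtain ⟨j, hj⟩ := not_forall.mp (mt Finset.eq_univ_iff_forall.mpr hI')
  obtain ⟨i, rfl⟩ := hf k
  obtain ⟨i', rfl⟩ := hf j
  refine h _ ⟨i, by simpa using hk⟩ fun h' => ?_
  have : i' ∈ Finset.univ.filter (f · ∈ I) := by
    rw [h']
    simp
  exact hj (by simpa using this)

theorem sum_compl_eq_neg {n : ℕ} {c : Fin n → ℝ} (hc : ∑ i, c i = 0) (I : Finset (Fin n)) :
    ∑ i ∈ Iᶜ, c i = -∑ i ∈ I, c i := by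
  rw [← Finset.sum_add_sum_compl I] at hc
  linarith

/-- For vanishing total, negativity on `I` is positivity on the complement, so testing positivity
alone determines all signs. -/
theorem SameChamber.neg_iff {n : ℕ} {c c' : Fin n → ℝ} (h : SameChamber c c')
    (hc : ∑ i, c i = 0) (hc' : ∑ i, c' i = 0) (I : Finset (Fin n)) :
    ∑ i ∈ I, c i < 0 ↔ ∑ i ∈ I, c' i < 0 := by
  have := h Iᶜ
  rw [sum_compl_eq_neg hc, sum_compl_eq_neg hc'] at this
  simpa using this

theorem SameChamber.sign_eq {n : ℕ} {c c' : Fin n → ℝ} (h : SameChamber c c')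
    (hc : ∑ i, c i = 0) (hc' : ∑ i, c' i = 0) (I : Finset (Fin n)) :
    Real.sign (∑ i ∈ I, c i) = Real.sign (∑ i ∈ I, c' i) := by
  rcases lt_trichotomy (∑ i ∈ I, c i) 0 with h1 | h1 | h1
  · rw [Real.sign_of_neg h1, Real.sign_of_neg ((h.neg_iff hc hc' I).mp h1)]
  · have h2 : ¬ ∑ i ∈ I, c' i < 0 := by rw [← h.neg_iff hc hc' I]; exact h1.not_lt
    have h3 : ¬ 0 < ∑ i ∈ I, c' i := by rw [← h I]; exact h1.not_gt
    rw [h1, le_antisymm (not_lt.mp h3) (not_lt.mp h2)]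
  · rw [Real.sign_of_pos h1, Real.sign_of_pos ((h I).mp h1)]

theorem SameChamber.genericStab {n : ℕ} {c c' : Fin n → ℝ} (h : SameChamber c c')
    (hc : ∑ i, c i = 0) (hc' : ∑ i, c' i = 0) (hg : GenericStab c) : GenericStab c' := by
  intro I hI hI'
  rcases lt_or_gt_of_ne (hg I hI hI') with h1 | h1
  · exact ((h.neg_iff hc hc' I).mp h1).ne
  · exact ((h I).mp h1).ne'

/-- The chamber of `c`, in the space of parameters with vanishing sum. -/
def chamber {n : ℕ} (c : Fin n → ℝ) : Set (zeroSum n) := {d | SameChamber c (d : Fin n → ℝ)}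

theorem mem_chamber_iff {n : ℕ} {c : Fin n → ℝ} (hc : ∑ i, c i = 0) (hg : GenericStab c)
    (d : zeroSum n) : d ∈ chamber c ↔ ∀ I : Finset (Fin n), I.Nonempty → I ≠ Finset.univ →
      0 < (∑ i ∈ I, c i) * ∑ i ∈ I, (d : Fin n → ℝ) i := by
  constructor
  · intro h I hI hI'
    rcases lt_or_gt_of_ne (hg I hI hI') with h1 | h1
    · exact mul_pos_of_neg_of_neg h1 ((SameChamber.neg_iff h hc d.2 I).mp h1)
    · exact mul_pos h1 ((h I).mp h1)
  · intro h I
    by_cases hI : I.Nonempty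
    · by_cases hI' : I = Finset.univ
      · subst hI'
        have := d.2
        rw [mem_zeroSum] at this
        rw [hc, this]
      · have := h I hI hI'
        exact ⟨fun h1 => pos_of_mul_pos_right this h1.le, fun h1 => pos_of_mul_pos_left this h1.le⟩
    · rw [Finset.not_nonempty_iff_eq_empty.mp hI]
      simp

theorem isOpen_chamber {n : ℕ} {c : Fin n → ℝ} (hc : ∑ i, c i = 0) (hg : GenericStab c) :
    IsOpen (chamber c) := by
  have : chamber c = ⋂ I : Finset (Fin n), ⋂ _ : I.Nonempty, ⋂ _ : I ≠ Finset.univ,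
      {d : zeroSum n | 0 < (∑ i ∈ I, c i) * ∑ i ∈ I, (d : Fin n → ℝ) i} := by
    ext d
    simp [mem_chamber_iff hc hg]
  rw [this]
  refine isOpen_iInter_of_finite fun I => isOpen_iInter_of_finite fun _ =>
    isOpen_iInter_of_finite fun _ => isOpen_lt continuous_const ?_
  fun_prop

/-- A chamber is cut out by strict linear inequalities and is therefore convex. -/
theorem isPreconnected_chamber {n : ℕ} {c : Fin n → ℝ} (hc : ∑ i, c i = 0) (hg : GenericStab c) :
    IsPreconnected (chamber c) := by
  refine Convex.isPreconnected ?_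
  intro x hx y hy r s hr hs hrs
  rw [mem_chamber_iff hc hg] at *
  intro I hI hI'
  have h1 := hx I hI hI'
  have h2 := hy I hI hI'
  have : (∑ i ∈ I, c i) * ∑ i ∈ I, ((r • x + s • y : zeroSum n) : Fin n → ℝ) i
      = r * ((∑ i ∈ I, c i) * ∑ i ∈ I, (x : Fin n → ℝ) i)
        + s * ((∑ i ∈ I, c i) * ∑ i ∈ I, (y : Fin n → ℝ) i) := by
    simp only [Submodule.coe_add, Submodule.coe_smul, Pi.add_apply, Pi.smul_apply, smul_eq_mul,
      Finset.sum_add_distrib, ← Finset.mul_sum]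
    ring
  rw [this]
  rcases hr.eq_or_lt with rfl | hr
  · have : s = 1 := by linarith
    subst this
    simpa using h2
  · nlinarith [mul_pos hr h1, mul_nonneg hs h2.le]

/-! ### Finiteness of the values of the seeds -/

/-- At fixed charges the recursion expresses `g0` by signs and by values of `g0` on fewer charges,
again at generic parameters. By induction only finitely many values can occur, although `c` varies
continuously. -/
theorem seed_values_finite (G : Geometry b) {g0 : ∀ n, (Fin n → Charge b) → (Fin n → ℝ) → ℝ}
    (hseed : ∀ n, 1 ≤ n → ∀ γ : Fin n → Charge b, (∀ i, γ i ∈ G.chargeSet) →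
        ∀ c : Fin n → ℝ, ∑ i, c i = 0 → GenericConf n γ c → SeedRecursion g0 n γ c)
    {n : ℕ} (hn : 1 ≤ n) {γ : Fin n → Charge b} (hγ : ∀ i, γ i ∈ G.chargeSet) :
    {r | ∃ c : Fin n → ℝ, ∑ i, c i = 0 ∧ GenericConf n γ c ∧ g0 n γ c = r}.Finite := by
  induction n using Nat.strong_induction_on with
  | _ n ih =>
    let A : Equiv.Perm (Fin n) → Fin n → Set ℝ := fun s ℓ =>
      {r | ∃ c, ∑ i, c i = 0 ∧ GenericConf ℓ (γ ∘ s ∘ head ℓ) c ∧ g0 ℓ (γ ∘ s ∘ head ℓ) c = r}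
        ∪ {0}
    let A' : Equiv.Perm (Fin n) → Fin n → Set ℝ := fun s ℓ =>
      {r | ∃ c, ∑ i, c i = 0 ∧ GenericConf (n - ℓ) (γ ∘ s ∘ tail ℓ) c ∧
        g0 (n - ℓ) (γ ∘ s ∘ tail ℓ) c = r} ∪ {0}
    let V : Equiv.Perm (Fin n) → Fin n → Set ℝ := fun s ℓ =>
      if 0 < (ℓ : ℕ) then Set.image2 (· * ·) (A s ℓ) (A' s ℓ) else {0}
    have hV : ∀ s ℓ, (V s ℓ).Finite := by
      intro s ℓ
      by_cases hℓ : 0 < (ℓ : ℕ)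
      · simp only [V, if_pos hℓ]
        exact Set.Finite.image2 _
          ((ih ℓ ℓ.2 hℓ (γ := γ ∘ s ∘ head ℓ) fun _ => hγ _).union (Set.finite_singleton 0))
          ((ih (n - ℓ) (by omega) (by omega) (γ := γ ∘ s ∘ tail ℓ) fun _ => hγ _).union
            (Set.finite_singleton 0))
      · simp [V, if_neg hℓ]
    have hT : (Set.univ.pi fun s : Equiv.Perm (Fin n) => Set.univ.pi fun ℓ : Fin n =>
        Set.image2 (fun (e v : ℝ) => (e - Real.sign (bigGamma ℓ (γ ∘ s))) *
        kap (bigGamma ℓ (γ ∘ s)) * v) {-1, 0, 1} (V s ℓ)).Finite :=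
      Set.Finite.pi fun s => Set.Finite.pi fun ℓ => Set.Finite.image2 _ (Set.toFinite _) (hV s ℓ)
    refine (hT.image fun w => g0 n γ (beta γ)
      + (1 / 4 : ℝ) * symmetrize fun s => ∑ ℓ ∈ cuts n, w s ℓ).subset ?_
    rintro r ⟨c, hc, hgen, rfl⟩
    have hgen' := hgen
    rw [GenericConf] at hgen'
    refine ⟨fun s ℓ => if 0 < (ℓ : ℕ) then
        (Real.sign (partialSum ℓ (c ∘ s)) - Real.sign (bigGamma ℓ (γ ∘ s))) *
        kap (bigGamma ℓ (γ ∘ s)) *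
        (g0 ℓ (γ ∘ s ∘ head ℓ) (flow ℓ (γ ∘ s) (c ∘ s) ∘ head ℓ) *
        g0 (n - ℓ) (γ ∘ s ∘ tail ℓ) (flow ℓ (γ ∘ s) (c ∘ s) ∘ tail ℓ)) else 0, ?_, ?_⟩
    · intro s _ ℓ _
      by_cases hℓ : 0 < (ℓ : ℕ)
      · obtain ⟨h1, h2, h3⟩ := hgen'.2 s ℓ hℓ
        have hcs : ∑ i, (c ∘ s) i = 0 := by
          rw [← hc]
          exact Equiv.sum_comp s c
        refine ⟨_, ?_, g0 ℓ (γ ∘ s ∘ head ℓ) (flow ℓ (γ ∘ s) (c ∘ s) ∘ head ℓ) *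
          g0 (n - ℓ) (γ ∘ s ∘ tail ℓ) (flow ℓ (γ ∘ s) (c ∘ s) ∘ tail ℓ), ?_,
          by simp only [if_pos hℓ]; rfl⟩
        · rcases Real.sign_apply_eq (partialSum ℓ (c ∘ s)) with h | h | h <;> simp [h]
        · simp only [V, if_pos hℓ]
          exact ⟨_, Or.inl ⟨_, sum_flow_head _ _ ℓ h1, h2, rfl⟩, _,
            Or.inl ⟨_, sum_flow_tail _ hcs ℓ h1, h3, rfl⟩, rfl⟩
      · exact ⟨0, by simp, 0, by simp [V, if_neg hℓ], by simp [if_neg hℓ]⟩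
    · have hrec := hseed n hn γ hγ c hc hgen
      rw [SeedRecursion] at hrec
      have : (symmetrize fun s => ∑ ℓ ∈ cuts n, if 0 < (ℓ : ℕ) then
        (Real.sign (partialSum ℓ (c ∘ s)) - Real.sign (bigGamma ℓ (γ ∘ s))) *
        kap (bigGamma ℓ (γ ∘ s)) *
        (g0 ℓ (γ ∘ s ∘ head ℓ) (flow ℓ (γ ∘ s) (c ∘ s) ∘ head ℓ) *
        g0 (n - ℓ) (γ ∘ s ∘ tail ℓ) (flow ℓ (γ ∘ s) (c ∘ s) ∘ tail ℓ)) else 0)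
          = symmetrize fun s => ∑ ℓ ∈ cuts n,
          (Real.sign (partialSum ℓ (c ∘ s)) - Real.sign (bigGamma ℓ (γ ∘ s))) *
        kap (bigGamma ℓ (γ ∘ s)) *
        g0 ℓ (γ ∘ s ∘ head ℓ) (flow ℓ (γ ∘ s) (c ∘ s) ∘ head ℓ) *
        g0 (n - ℓ) (γ ∘ s ∘ tail ℓ) (flow ℓ (γ ∘ s) (c ∘ s) ∘ tail ℓ) := by
        congr 1
        funext s
        refine Finset.sum_congr rfl fun ℓ hℓ => ?_
        rw [if_pos (by simpa [cuts] using hℓ)]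
        ring
      simp only [this]
      rw [hrec]
      ring

/-! ### The data of the modularity statement -/

/-- The assumptions of the modularity statement. -/
structure KernelSystem (G : Geometry b) (g0 : ∀ n, (Fin n → Charge b) → (Fin n → ℝ) → ℝ)
    (E R : ∀ n, (Fin n → Charge b) → ℝ → ℝ) (σ : Charge b → ℝ)
    (Φ0 : ∀ n, (Fin n → Fin b → ℤ) → Coord n b → (Fin n → ℝ) → ℝ)
    (ΦE : ∀ n, (Fin n → Fin b → ℤ) → Coord n b → ℝ) : Prop where
  one : ∀ γ ∈ G.chargeSet, ∀ c, g0 1 (fun _ => γ) c = 1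
  symm : SymmPairOn G.chargeSet g0
  recursion : ∀ τ : ℝ, 0 < τ →
    ∀ n, 1 ≤ n → ∀ γ : Fin n → Charge b, (∀ i, γ i ∈ G.chargeSet) →
      E n γ τ = g0 n γ (beta γ) - symmetrize fun s =>
        ∑ bl : Composition n with 1 < bl.length, W R bl.length (merge bl.index (γ ∘ s)) τ *
          ∏ k, E (bl.blocksFun k) (γ ∘ s ∘ bl.embedding k) τ
  seed : ∀ n, 1 ≤ n → ∀ γ : Fin n → Charge b, (∀ i, γ i ∈ G.chargeSet) →
    ∀ c : Fin n → ℝ, ∑ i, c i = 0 → GenericConf n γ c → SeedRecursion g0 n γ c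
  refinement : G.IsQuadraticRefinement σ
  seedKernel : G.IsSeedKernel σ g0 Φ0
  kernelIndep : G.IsKernelIndep σ E ΦE
  vigneras : ∀ n, 1 ≤ n → ∀ p : Fin n → Fin b → ℤ, (∀ i, p i ∈ G.D4) →
    ContDiff ℝ ∞ (ΦE n p) ∧ ∀ x, G.vigneras p ((n : ℝ) - 1) (ΦE n p) x = 0
  invariant : ∀ n, 1 ≤ n → ∀ p : Fin n → Fin b → ℤ, (∀ i, p i ∈ G.D4) → ∀ x x' : Coord n b,
    (∀ i j, G.bil p (vVec p i j) x = G.bil p (vVec p i j) x') → ΦE n p x = ΦE n p x'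
  decay : ∀ n, 1 ≤ n → ∀ p : Fin n → Fin b → ℤ, (∀ i, p i ∈ G.D4) → ∀ y : Coord n b,
    GenericStab (G.betaX p y) → ∃ ε : ℝ, 0 < ε ∧
      (fun τ : ℝ => ΦE n p (Real.sqrt (2 * τ) • y)
          - Φ0 n p (Real.sqrt (2 * τ) • y) (G.betaX p (Real.sqrt (2 * τ) • y)))
        =O[Filter.atTop] fun τ : ℝ => Real.exp (-ε * τ)

theorem Geometry.IsQuadraticRefinement.ne_zero {G : Geometry b} {σ : Charge b → ℝ}
    (h : G.IsQuadraticRefinement σ) {γ : Charge b} (hγ : γ ∈ G.chargeSet) : σ γ ≠ 0 := by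
  rcases h.1 γ hγ with h | h <;> simp [h]

theorem Geometry.IsQuadraticRefinement.kerFactor_ne_zero {G : Geometry b} {σ : Charge b → ℝ}
    (h : G.IsQuadraticRefinement σ) {n : ℕ} (hn : 1 ≤ n) {γ : Fin n → Charge b}
    (hγ : ∀ i, γ i ∈ G.chargeSet) {τ : ℝ} (hτ : 0 < τ) : kerFactor σ γ τ ≠ 0 := by
  have h1 : Real.sqrt (2 * τ) ≠ 0 := (Real.sqrt_pos.mpr (by positivity)).ne'
  refine div_ne_zero (mul_ne_zero (h.ne_zero ?_) (pow_ne_zero _ h1))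
    (Finset.prod_ne_zero_iff.mpr fun i _ => h.ne_zero (hγ i))
  exact G.sum_mem_chargeSet hγ ⟨⟨0, hn⟩, Finset.mem_univ _⟩

/-! ### Local constancy of the seed kernels in the stability parameters. -/

namespace KernelSystem

variable {G : Geometry b} {g0 : ∀ n, (Fin n → Charge b) → (Fin n → ℝ) → ℝ}
  {E R : ∀ n, (Fin n → Charge b) → ℝ → ℝ} {σ : Charge b → ℝ}
  {Φ0 : ∀ n, (Fin n → Fin b → ℤ) → Coord n b → (Fin n → ℝ) → ℝ}
  {ΦE : ∀ n, (Fin n → Fin b → ℤ) → Coord n b → ℝ}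

theorem contDiff_seed (K : KernelSystem G g0 E R σ Φ0 ΦE) {n : ℕ} (hn : 1 ≤ n)
    {p : Fin n → Fin b → ℤ} (hp : ∀ i, p i ∈ G.D4) {c : Fin n → ℝ} (hc : ∑ i, c i = 0)
    (hg : GenericStab c) : ContDiff ℝ ∞ fun x => Φ0 n p x c := by
  rw [← contDiffOn_univ]
  exact (K.seedKernel.2 n hn p hp).comp (t := {y | ∑ i, y.2 i = 0 ∧ GenericStab y.2})
    (s := Set.univ)
    (f := fun x => (x, c)) (contDiff_id.prodMk contDiff_const).contDiffOn fun x _ => ⟨hc, hg⟩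

theorem continuousOn_seed (K : KernelSystem G g0 E R σ Φ0 ΦE) {n : ℕ} (hn : 1 ≤ n)
    {p : Fin n → Fin b → ℤ} (hp : ∀ i, p i ∈ G.D4) (x : Coord n b) :
    ContinuousOn (fun d : zeroSum n => Φ0 n p x d) {d | GenericStab (d : Fin n → ℝ)} :=
  (K.seedKernel.2 n hn p hp).continuousOn.comp (t := {y | ∑ i, y.2 i = 0 ∧ GenericStab y.2})
    (f := fun d : zeroSum n => (x, (d : Fin n → ℝ))) (by fun_prop) fun d hd => ⟨d.2, hd⟩

/-- The seed kernel depends on the stability parameters only through their chamber. -/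
theorem seed_eq_of_sameChamber (K : KernelSystem G g0 E R σ Φ0 ΦE) {n : ℕ} (hn : 1 ≤ n)
    {p : Fin n → Fin b → ℤ} (hp : ∀ i, p i ∈ G.D4) {c c' : Fin n → ℝ} (hc : ∑ i, c i = 0)
    (hc' : ∑ i, c' i = 0) (hg : GenericStab c) (hcc : SameChamber c c') (x : Coord n b) :
    Φ0 n p x c = Φ0 n p x c' := by
  have hg' := hcc.genericStab hc hc' hg
  -- Both sides are continuous in `x`, so it is enough to compare them at points of charges in
  -- general position.
  have hd := G.exists_mem_openDense hp (G.openDense_good hp)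
  refine congrFun (Continuous.ext_on hd (K.contDiff_seed hn hp hc hg).continuous
    (K.contDiff_seed hn hp hc' hg').continuous ?_) x
  rintro _ ⟨hgood, γ, hγ, rfl, τ, hτ, rfl⟩
  have hgood' : GoodConf γ := G.goodConf_of_point (fun i => (hγ i).1) 0 τ hgood
  set v : zeroSum n → ℝ := fun d => Φ0 n (fun i => (γ i).1) (G.point γ 0 τ) d with hv
  have hcont : ContinuousOn v (chamber c) :=
    (K.continuousOn_seed hn (fun i => (hγ i).1) _).mono fun d hd =>
      SameChamber.genericStab hd hc d.2 hg
  have hT := (seed_values_finite G K.seed hn hγ).image fun r => kerFactor σ γ τ * r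
  set T := (fun r => kerFactor σ γ τ * r) ''
    {r | ∃ c : Fin n → ℝ, ∑ i, c i = 0 ∧ GenericConf n γ c ∧ g0 n γ c = r} with hTdef
  -- Generic parameters are dense in the chamber and have values in the finite set `T`. As `T` is
  -- closed, continuity gives the same for all parameters of the chamber.
  have hmaps : Set.MapsTo v (chamber c) T := by
    intro d hd
    have hdense := (openDense_genericConf hgood').2
    have hcl : d ∈ closure (chamber c ∩ {c : zeroSum n | GenericConf n γ c}) :=
      hdense.open_subset_closure_inter (isOpen_chamber hc hg) hd
    have h1 : v d ∈ closure (v '' (chamber c ∩ {c : zeroSum n | GenericConf n γ c})) :=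
      ((hcont d hd).mono Set.inter_subset_left).mem_closure_image hcl
    refine closure_minimal ?_ hT.isClosed h1
    rintro _ ⟨e, ⟨he, he'⟩, rfl⟩
    refine ⟨g0 n γ e, ⟨e, e.2, he', rfl⟩, ?_⟩
    exact (K.seedKernel.1 n hn γ hγ 0 τ hτ e e.2 (SameChamber.genericStab he hc e.2 hg)).symm
  -- A continuous map from a connected set to a finite, hence discrete, set is constant.
  have key := (isPreconnected_chamber hc hg).constant_of_mapsTo hT.isDiscrete hcont hmaps
    (show (⟨c, hc⟩ : zeroSum n) ∈ chamber c from SameChamber.refl c)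
    (show (⟨c', hc'⟩ : zeroSum n) ∈ chamber c from hcc)
  exact key

end KernelSystem

/-! ### The kernel of the coefficients at independent stability parameters -/

/-- The kernel of `ĝ_n`, with the stability parameters as independent variables. -/
noncomputable def Geometry.ghatKernel (G : Geometry b)
    (Φ0 : ∀ n, (Fin n → Fin b → ℤ) → Coord n b → (Fin n → ℝ) → ℝ)
    (ΦE : ∀ n, (Fin n → Fin b → ℤ) → Coord n b → ℝ) :
    (n : ℕ) → (Fin n → Fin b → ℤ) → Coord n b → (Fin n → ℝ) → ℝ
  | n, p, x, c => Φ0 n p x c - symmetrize fun s =>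
      ∑ bl : {bl : Composition n // bl.length < n},
        G.ghatKernel Φ0 ΦE bl.1.length (merge bl.1.index (p ∘ s))
            (G.mergeX bl.1.index (p ∘ s) (x ∘ s)) (merge bl.1.index (c ∘ s)) *
          ∏ k, ΦE (bl.1.blocksFun k) (p ∘ s ∘ bl.1.embedding k) (x ∘ s ∘ bl.1.embedding k)
termination_by n => n
decreasing_by exact bl.2

theorem index_surjective {n : ℕ} (bl : Composition n) : Function.Surjective bl.index := fun k =>
  ⟨bl.embedding k ⟨0, bl.one_le_blocksFun k⟩, bl.index_embedding _ _⟩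

theorem one_le_length {n : ℕ} (hn : 1 ≤ n) (bl : Composition n) : 1 ≤ bl.length :=
  bl.length_pos_iff.mpr hn

/-- Precomposition with a map of indices. -/
noncomputable def reindexL {n k : ℕ} (e : Fin k → Fin n) : Coord n b →L[ℝ] Coord k b :=
  ContinuousLinearMap.pi fun j => ContinuousLinearMap.proj (e j)

theorem reindexL_apply {n k : ℕ} (e : Fin k → Fin n) (x : Coord n b) : reindexL e x = x ∘ e := rfl

theorem kerFactor_comp_perm {σ : Charge b → ℝ} {n : ℕ} (γ : Fin n → Charge b) (τ : ℝ)
    (s : Equiv.Perm (Fin n)) : kerFactor σ (γ ∘ s) τ = kerFactor σ γ τ := by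
  rw [kerFactor, kerFactor]
  congr 1
  · congr 2
    exact Equiv.sum_comp s γ
  · exact Equiv.prod_comp s fun i => σ (γ i)

theorem sum_embedding {A : Type*} [AddCommMonoid A] {n : ℕ} (bl : Composition n) (a : Fin n → A)
    (k : Fin bl.length) : ∑ j, a (bl.embedding k j) = merge bl.index a k := by
  rw [merge]
  refine Finset.sum_bij (fun j _ => bl.embedding k j) (fun j _ => by simp [bl.index_embedding])
    (fun i _ j _ h => (bl.embedding k).injective h) (fun i hi => ?_) (fun _ _ => rfl)
  simp only [Finset.mem_filter, Finset.mem_univ, true_and] at hi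
  subst hi
  exact ⟨_, Finset.mem_univ _, bl.embedding_comp_inv i⟩

/-- The signs of the cluster charges cancel between the two factors, and the powers of `√(2τ₂)`
match because `(m - 1) + ∑ (n_k - 1) = n - 1`. -/
theorem kerFactor_merge {σ : Charge b → ℝ} {n : ℕ} (hn : 1 ≤ n) (γ : Fin n → Charge b) (τ : ℝ)
    (bl : Composition n) (h : ∀ k, σ (merge bl.index γ k) ≠ 0) :
    kerFactor σ (merge bl.index γ) τ * ∏ k, kerFactor σ (γ ∘ bl.embedding k) τ
      = kerFactor σ γ τ := by
  have h1 : ∏ k, kerFactor σ (γ ∘ bl.embedding k) τ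
      = (∏ k, σ (merge bl.index γ k)) * Real.sqrt (2 * τ) ^ (∑ k, (bl.blocksFun k - 1))
        / ∏ i, σ (γ i) := by
    simp only [kerFactor, Function.comp, sum_embedding]
    rw [Finset.prod_div_distrib, Finset.prod_mul_distrib, Finset.prod_pow_eq_pow_sum,
      bl.prod_prod_apply_embedding fun i => σ (γ i)]
  have h2 : (bl.length - 1) + ∑ k, (bl.blocksFun k - 1) = n - 1 := by
    have h3 : ∑ k, (bl.blocksFun k - 1) + bl.length = n := by
      have : ∑ k, ((bl.blocksFun k - 1) + 1) = ∑ k, bl.blocksFun k :=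
        Finset.sum_congr rfl fun k _ => Nat.sub_add_cancel (bl.one_le_blocksFun k)
      rw [Finset.sum_add_distrib, bl.sum_blocksFun] at this
      simpa using this
    have := one_le_length hn bl
    omega
  have h4 : ∏ k, σ (merge bl.index γ k) ≠ 0 := Finset.prod_ne_zero_iff.mpr fun k _ => h k
  rw [h1, kerFactor, kerFactor, sum_univ_merge, ← h2, pow_add]
  field_simp

theorem Geometry.smul_point (G : Geometry b) {n : ℕ} (γ : Fin n → Charge b) (B : Fin b → ℝ)
    (τ : ℝ) {r : ℝ} (hr : 0 < r) : r • G.point γ B τ = G.point γ B (r ^ 2 * τ) := by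
  have : Real.sqrt (2 * (r ^ 2 * τ)) = r * Real.sqrt (2 * τ) := by
    rw [show 2 * (r ^ 2 * τ) = r ^ 2 * (2 * τ) by ring, Real.sqrt_mul (by positivity),
      Real.sqrt_sq hr.le]
  funext i
  simp only [Geometry.point, this, Pi.smul_apply, smul_smul]

theorem kerFactor_smul {σ : Charge b → ℝ} {n : ℕ} (γ : Fin n → Charge b) (τ : ℝ) {r : ℝ}
    (hr : 0 < r) : kerFactor σ γ (r ^ 2 * τ) = r ^ (n - 1) * kerFactor σ γ τ := by
  have : Real.sqrt (2 * (r ^ 2 * τ)) = r * Real.sqrt (2 * τ) := by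
    rw [show 2 * (r ^ 2 * τ) = r ^ 2 * (2 * τ) by ring, Real.sqrt_mul (by positivity),
      Real.sqrt_sq hr.le]
  rw [kerFactor, kerFactor, this, mul_pow]
  ring

/-! ### Homogeneity of the seed kernels, and smoothness and values of the kernel of `ghat`. -/

namespace KernelSystem

variable {G : Geometry b} {g0 : ∀ n, (Fin n → Charge b) → (Fin n → ℝ) → ℝ}
  {E R : ∀ n, (Fin n → Charge b) → ℝ → ℝ} {σ : Charge b → ℝ}
  {Φ0 : ∀ n, (Fin n → Fin b → ℤ) → Coord n b → (Fin n → ℝ) → ℝ}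
  {ΦE : ∀ n, (Fin n → Fin b → ℤ) → Coord n b → ℝ}

/-- Scaling the point of a charge by `r` replaces `τ₂` by `r² τ₂` at the same charges. As `g0` does
not depend on `τ₂`, only the factor `√(2τ₂)^(n-1)` changes. -/
theorem seed_smul (K : KernelSystem G g0 E R σ Φ0 ΦE) {n : ℕ} (hn : 1 ≤ n)
    {p : Fin n → Fin b → ℤ} (hp : ∀ i, p i ∈ G.D4) {c : Fin n → ℝ} (hc : ∑ i, c i = 0)
    (hg : GenericStab c) {r : ℝ} (hr : 0 < r) (x : Coord n b) :
    Φ0 n p (r • x) c = r ^ (n - 1) * Φ0 n p x c := by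
  have hcont := (K.contDiff_seed hn hp hc hg).continuous
  refine congrFun (Continuous.ext_on (G.dense_points hp) (f := fun x => Φ0 n p (r • x) c)
    (hcont.comp (continuous_const_smul r)) (hcont.const_smul (r ^ (n - 1))) ?_) x
  rintro _ ⟨γ, hγ, rfl, τ, hτ, rfl⟩
  simp only [Pi.smul_apply, smul_eq_mul]
  rw [G.smul_point γ 0 τ hr, K.seedKernel.1 n hn γ hγ 0 (r ^ 2 * τ) (by positivity) c hc hg,
    K.seedKernel.1 n hn γ hγ 0 τ hτ c hc hg, kerFactor_smul γ τ hr, mul_assoc]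

theorem contDiff_ghatKernel (K : KernelSystem G g0 E R σ Φ0 ΦE) {n : ℕ} (hn : 1 ≤ n)
    {p : Fin n → Fin b → ℤ} (hp : ∀ i, p i ∈ G.D4) {c : Fin n → ℝ} (hc : ∑ i, c i = 0)
    (hg : GenericStab c) : ContDiff ℝ ∞ fun x => G.ghatKernel Φ0 ΦE n p x c := by
  induction n using Nat.strong_induction_on with
  | _ n ih =>
    have : (fun x => G.ghatKernel Φ0 ΦE n p x c) = fun x => Φ0 n p x c - symmetrize fun s =>
      ∑ bl : {bl : Composition n // bl.length < n},
        G.ghatKernel Φ0 ΦE bl.1.length (merge bl.1.index (p ∘ s))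
            (G.mergeX bl.1.index (p ∘ s) (x ∘ s)) (merge bl.1.index (c ∘ s)) *
          ∏ k, ΦE (bl.1.blocksFun k) (p ∘ s ∘ bl.1.embedding k) (x ∘ s ∘ bl.1.embedding k) := by
      funext x
      rw [Geometry.ghatKernel]
    rw [this]
    refine (K.contDiff_seed hn hp hc hg).sub (contDiff_const.mul (ContDiff.sum fun s _ =>
      ContDiff.sum fun bl _ => ContDiff.mul ?_ (contDiff_prod fun k _ => ?_)))
    · have h1 := ih bl.1.length bl.2 (one_le_length hn bl.1)
        (G.merge_mem_D4 (p := p ∘ s) (fun i => hp _) (index_surjective bl.1))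
        (c := merge bl.1.index (c ∘ s))
        (by rw [sum_univ_merge]; exact (Equiv.sum_comp s c).trans hc)
        (by rw [merge_comp_perm]; exact hg.merge (index_comp_perm_surjective bl.1 s))
      exact h1.comp ((G.mergeXL bl.1.index (p ∘ s)).comp (reindexL s)).contDiff
    · exact (K.vigneras _ (bl.1.one_le_blocksFun k) (p ∘ s ∘ bl.1.embedding k) fun i => hp _).1.comp
        (reindexL (s ∘ bl.1.embedding k)).contDiff

/-- Merging maps chambers into chambers, so the local constancy of the seeds passes through the
ansatz. -/
theorem ghatKernel_eq_of_sameChamber (K : KernelSystem G g0 E R σ Φ0 ΦE) {n : ℕ} (hn : 1 ≤ n)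
    {p : Fin n → Fin b → ℤ} (hp : ∀ i, p i ∈ G.D4) {c c' : Fin n → ℝ} (hc : ∑ i, c i = 0)
    (hc' : ∑ i, c' i = 0) (hg : GenericStab c) (hcc : SameChamber c c') (x : Coord n b) :
    G.ghatKernel Φ0 ΦE n p x c = G.ghatKernel Φ0 ΦE n p x c' := by
  induction n using Nat.strong_induction_on with
  | _ n ih =>
    rw [Geometry.ghatKernel, Geometry.ghatKernel, K.seed_eq_of_sameChamber hn hp hc hc' hg hcc]
    congr 2
    funext s
    refine Finset.sum_congr rfl fun bl _ => ?_
    congr 1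
    refine ih bl.1.length bl.2 (one_le_length hn bl.1)
        (G.merge_mem_D4 (p := p ∘ s) (fun i => hp _) (index_surjective bl.1)) ?_ ?_ ?_ ?_ _
    · rw [sum_univ_merge]; exact (Equiv.sum_comp s c).trans hc
    · rw [sum_univ_merge]; exact (Equiv.sum_comp s c').trans hc'
    · rw [merge_comp_perm]; exact hg.merge (index_comp_perm_surjective bl.1 s)
    · rw [merge_comp_perm, merge_comp_perm]; exact hcc.merge _

/-- The recursion for `ghatKernel` is the ansatz multiplied by the standard factor, which
distributes over clusters by `kerFactor_merge`. -/
theorem ghatKernel_point (K : KernelSystem G g0 E R σ Φ0 ΦE) {n : ℕ} (hn : 1 ≤ n)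
    {γ : Fin n → Charge b} (hγ : ∀ i, γ i ∈ G.chargeSet) (B : Fin b → ℝ) {τ : ℝ} (hτ : 0 < τ)
    {c : Fin n → ℝ} (hc : ∑ i, c i = 0) (hg : GenericStab c) :
    G.ghatKernel Φ0 ΦE n (fun i => (γ i).1) (G.point γ B τ) c
      = kerFactor σ γ τ * ghat g0 E n γ c τ := by
  induction n using Nat.strong_induction_on with
  | _ n ih =>
    rw [Geometry.ghatKernel, ghat, K.seedKernel.1 n hn γ hγ B τ hτ c hc hg, mul_sub,
      ← symmetrize_mul]
    congr 2
    funext s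
    rw [Finset.mul_sum]
    refine Finset.sum_congr rfl fun bl _ => ?_
    have hs : ∀ i, (γ ∘ s) i ∈ G.chargeSet := fun i => hγ _
    have hm := G.merge_mem_chargeSet hs (index_surjective bl.1)
    have h1 := ih bl.1.length bl.2 (one_le_length hn bl.1) hm
        (c := merge bl.1.index (c ∘ s))
        (by rw [sum_univ_merge]; exact (Equiv.sum_comp s c).trans hc)
        (by rw [merge_comp_perm]; exact hg.merge (index_comp_perm_surjective bl.1 s))
    have h2 : G.ghatKernel Φ0 ΦE bl.1.length (merge bl.1.index ((fun i => (γ i).1) ∘ s))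
        (G.mergeX bl.1.index ((fun i => (γ i).1) ∘ s) (G.point γ B τ ∘ s))
        (merge bl.1.index (c ∘ s)) = kerFactor σ (merge bl.1.index (γ ∘ s)) τ *
          ghat g0 E bl.1.length (merge bl.1.index (γ ∘ s)) (merge bl.1.index (c ∘ s)) τ := by
      rw [← h1, G.point_merge (index_surjective bl.1) (fun i => (hs i).1)]
      congr 1
      funext k
      exact (fst_merge _ _ k).symm
    have h3 : ∀ k, ΦE (bl.1.blocksFun k) ((fun i => (γ i).1) ∘ s ∘ bl.1.embedding k)
        (G.point γ B τ ∘ s ∘ bl.1.embedding k) = kerFactor σ ((γ ∘ s) ∘ bl.1.embedding k) τ *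
          E (bl.1.blocksFun k) (γ ∘ s ∘ bl.1.embedding k) τ := fun k =>
      K.kernelIndep _ (bl.1.one_le_blocksFun k) (γ ∘ s ∘ bl.1.embedding k) (fun i => hγ _) B τ hτ
    simp_rw [h2, h3]
    rw [Finset.prod_mul_distrib, ← kerFactor_comp_perm γ τ s, ← kerFactor_merge hn (γ ∘ s) τ bl.1
      fun k => K.refinement.ne_zero (hm k)]
    ring

end KernelSystem

/-! ### Homogeneous smooth functions -/

theorem fderiv_smul_of_homogeneous {V F : Type} [NormedAddCommGroup V] [NormedSpace ℝ V]
    [NormedAddCommGroup F] [NormedSpace ℝ F] {k : ℕ} {f : V → F} (hf : ContDiff ℝ ∞ f)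
    (hk : ∀ r : ℝ, 0 < r → ∀ x, f (r • x) = r ^ (k + 1) • f x) {r : ℝ} (hr : 0 < r) (x : V) :
    fderiv ℝ f (r • x) = r ^ k • fderiv ℝ f x := by
  have hd := hf.differentiable (by simp)
  have h1 : HasFDerivAt (fun x => f (r • x)) (r • fderiv ℝ f (r • x)) x := by
    have := (hd (r • x)).hasFDerivAt.comp x ((hasFDerivAt_id (𝕜 := ℝ) x).const_smul r)
    refine this.congr_fderiv ?_
    ext v
    simp
  have h2 : HasFDerivAt (fun x => f (r • x)) (r ^ (k + 1) • fderiv ℝ f x) x := by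
    have := (hd x).hasFDerivAt.const_smul (r ^ (k + 1))
    refine this.congr_of_eventuallyEq (Eventually.of_forall fun y => ?_)
    exact hk r hr y
  have h3 := h1.unique h2
  rw [pow_succ', mul_smul] at h3
  exact smul_right_injective _ hr.ne' h3

theorem fderiv_self_of_homogeneous {V F : Type} [NormedAddCommGroup V] [NormedSpace ℝ V]
    [NormedAddCommGroup F] [NormedSpace ℝ F] {k : ℕ} {f : V → F} (hf : ContDiff ℝ ∞ f)
    (hk : ∀ r : ℝ, 0 < r → ∀ x, f (r • x) = r ^ k • f x) (x : V) :
    fderiv ℝ f x x = (k : ℝ) • f x := by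
  have hd := hf.differentiable (by simp)
  have h1 : HasDerivAt (fun r : ℝ => f (r • x)) (fderiv ℝ f x x) 1 := by
    have h := (hasDerivAt_id (1 : ℝ)).smul_const x
    have h' : HasFDerivAt f (fderiv ℝ f x) ((1 : ℝ) • x) := by
      rw [one_smul]
      exact (hd x).hasFDerivAt
    have h3 := h'.comp_hasDerivAt (1 : ℝ) h
    rw [one_smul] at h3
    exact h3
  have h2 : HasDerivAt (fun r : ℝ => f (r • x)) ((k : ℝ) • f x) 1 := by
    have h := (hasDerivAt_pow k (1 : ℝ)).smul_const (f x)
    simp only [one_pow, mul_one] at h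
    refine h.congr_of_eventuallyEq ?_
    filter_upwards [lt_mem_nhds (zero_lt_one' ℝ)] with r hr using hk r hr x
  exact h1.unique h2

/-- Smooth functions of natural homogeneity degree are polynomial; only analyticity is needed. The
derivative has degree one less and is analytic by induction, and Euler's identity recovers `f` from
it. The target space varies because the derivative takes values in a space of linear maps. -/
theorem analyticOnNhd_of_homogeneous {V : Type} [NormedAddCommGroup V] [NormedSpace ℝ V] (k : ℕ) :
    ∀ {F : Type} [NormedAddCommGroup F] [NormedSpace ℝ F] {f : V → F}, ContDiff ℝ ∞ f →
      (∀ r : ℝ, 0 < r → ∀ x, f (r • x) = r ^ k • f x) → AnalyticOnNhd ℝ f Set.univ := by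
  induction k with
  | zero =>
    intro F _ _ f hf hk
    -- In degree zero `f` is constant along open rays, and continuity at the origin makes it
    -- constant.
    have h0 : ∀ x, f x = f 0 := by
      intro x
      have h1 : Tendsto (fun r : ℝ => f (r • x)) (nhdsWithin 0 (Set.Ioi 0)) (nhds (f 0)) := by
        have : Continuous fun r : ℝ => f (r • x) := by
          have := hf.continuous
          fun_prop
        have h := this.tendsto 0
        rw [zero_smul] at h
        exact h.mono_left nhdsWithin_le_nhds
      refine tendsto_nhds_unique (Tendsto.congr' ?_ tendsto_const_nhds) h1
      filter_upwards [self_mem_nhdsWithin] with r hr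
      rw [hk r hr, pow_zero, one_smul]
    have : f = fun _ => f 0 := funext h0
    rw [this]
    exact analyticOnNhd_const
  | succ k ih =>
    intro F _ _ f hf hk
    have hd : AnalyticOnNhd ℝ (fderiv ℝ f) Set.univ :=
      ih (hf.fderiv_right (m := ∞) (by simp)) fun r hr x => fderiv_smul_of_homogeneous hf hk hr x
    have he : f = fun x => ((k : ℝ) + 1)⁻¹ • fderiv ℝ f x x := by
      funext x
      rw [fderiv_self_of_homogeneous hf hk, smul_smul]
      push_cast
      rw [inv_mul_cancel₀ (by positivity), one_smul]
    rw [he]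
    intro x hx
    have h2 : AnalyticAt ℝ (fun x : V => x) x := analyticAt_id
    exact analyticAt_const.smul
      (((ContinuousLinearMap.id ℝ (V →L[ℝ] F)).analyticAt_bilinear (fderiv ℝ f x, x)).comp₂
        (hd x hx) h2)

/-! ### Derivatives in coordinates -/

/-- The coordinate direction `(i, a)`. -/
def coordDir {n : ℕ} (i : Fin n) (a : Fin b) : Coord n b := Pi.single i (Pi.single a 1)

theorem pd_apply {n : ℕ} (i : Fin n) (a : Fin b) (f : Coord n b → ℝ) (x : Coord n b) :
    pd i a f x = fderiv ℝ f x (coordDir i a) := rfl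

theorem contDiff_pd {n : ℕ} {f : Coord n b → ℝ} (hf : ContDiff ℝ ∞ f) (i : Fin n) (a : Fin b) :
    ContDiff ℝ ∞ (pd i a f) :=
  (hf.fderiv_right (m := ∞) (by simp)).clm_apply contDiff_const

theorem hasCompactSupport_pd {n : ℕ} {f : Coord n b → ℝ} (hf : HasCompactSupport f) (i : Fin n)
    (a : Fin b) : HasCompactSupport (pd i a f) :=
  (hf.fderiv ℝ).comp_left (g := fun L : Coord n b →L[ℝ] ℝ => L (coordDir i a)) rfl

theorem sum_coordDir {n : ℕ} (x : Coord n b) : ∑ i, ∑ a, x i a • coordDir i a = x := by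
  funext j c
  simp only [coordDir, Finset.sum_apply, Pi.smul_apply, smul_eq_mul]
  rw [Finset.sum_eq_single j, Finset.sum_eq_single c]
  · simp
  · intro a _ ha
    simp [Pi.single_eq_of_ne ha.symm]
  · simp
  · intro i _ hi
    simp [Pi.single_eq_of_ne hi.symm]
  · simp

/-- Euler's operator. -/
theorem sum_mul_pd {n : ℕ} (f : Coord n b → ℝ) (x : Coord n b) :
    ∑ i, ∑ a, x i a * pd i a f x = fderiv ℝ f x x := by
  conv_rhs => rw [← sum_coordDir x]
  simp [pd_apply, map_sum]
  simp_rw [sum_coordDir]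

theorem contDiff_box (G : Geometry b) {n : ℕ} (p : Fin n → Fin b → ℤ) {f : Coord n b → ℝ}
    (hf : ContDiff ℝ ∞ f) : ContDiff ℝ ∞ (G.box p f) :=
  ContDiff.sum fun _ _ => ContDiff.sum fun _ _ => ContDiff.sum fun _ _ =>
    contDiff_const.mul (contDiff_pd (contDiff_pd hf _ _) _ _)

theorem Geometry.box_eq_zero_of_notMem_tsupport (G : Geometry b) {n : ℕ} (p : Fin n → Fin b → ℤ)
    {f : Coord n b → ℝ} {x : Coord n b} (hx : x ∉ tsupport f) : G.box p f x = 0 := by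
  refine Finset.sum_eq_zero fun i _ => Finset.sum_eq_zero fun a _ =>
    Finset.sum_eq_zero fun a' _ => ?_
  have h1 : ∀ (g : Coord n b → ℝ) (i : Fin n) (a : Fin b), tsupport (pd i a g) ⊆ tsupport g :=
    fun g i a => closure_minimal (fun y hy => by
      by_contra h
      exact hy (by rw [pd_apply, fderiv_of_notMem_tsupport (𝕜 := ℝ) h]; rfl)) (isClosed_tsupport g)
  have : pd i a (pd i a' f) x = 0 :=
    image_eq_zero_of_notMem_tsupport fun h => hx (h1 _ _ _ (h1 _ _ _ h))
  rw [this, mul_zero]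

theorem hasCompactSupport_box (G : Geometry b) {n : ℕ} (p : Fin n → Fin b → ℤ)
    {f : Coord n b → ℝ} (hf : HasCompactSupport f) : HasCompactSupport (G.box p f) :=
  HasCompactSupport.intro hf.isCompact fun _ => G.box_eq_zero_of_notMem_tsupport p

theorem integral_pd_mul {n : ℕ} {f φ : Coord n b → ℝ} (hf : ContDiff ℝ ∞ f) (hφ : ContDiff ℝ ∞ φ)
    (hc : HasCompactSupport φ) (i : Fin n) (a : Fin b) :
    ∫ x, pd i a f x * φ x = -∫ x, f x * pd i a φ x := by
  have h := integral_mul_fderiv_eq_neg_fderiv_mul_of_integrable (μ := (volume : Measure (Coord n b)))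
    (f := f) (g := φ) (v := coordDir i a) ?_ ?_ ?_ (fun x _ => hf.differentiable (by simp) x)
    (fun x _ => hφ.differentiable (by simp) x)
  · simp only [pd_apply]
    rw [h, neg_neg]
  · exact ((contDiff_pd hf i a).continuous.mul hφ.continuous).integrable_of_hasCompactSupport
      hc.mul_left
  · exact (hf.continuous.mul (contDiff_pd hφ i a).continuous).integrable_of_hasCompactSupport
      (hasCompactSupport_pd hc i a).mul_left
  · exact (hf.continuous.mul hφ.continuous).integrable_of_hasCompactSupport hc.mul_left

theorem pd_comm {n : ℕ} {f : Coord n b → ℝ} (hf : ContDiff ℝ ∞ f) (i j : Fin n) (a a' : Fin b) :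
    pd i a (pd j a' f) = pd j a' (pd i a f) := by
  have hd : Differentiable ℝ (fderiv ℝ f) :=
    (hf.fderiv_right (m := ∞) (by simp)).differentiable (by simp)
  have h1 : ∀ (i j : Fin n) (a a' : Fin b) x, pd i a (pd j a' f) x
      = fderiv ℝ (fderiv ℝ f) x (coordDir i a) (coordDir j a') := by
    intro i j a a' x
    have : pd j a' f = fun x => fderiv ℝ f x (coordDir j a') := rfl
    rw [pd_apply, this, fderiv_clm_apply (hd x) (differentiableAt_const _)]
    simp
  funext x
  rw [h1, h1]
  exact (hf.contDiffAt.isSymmSndFDerivAt (by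
    rw [minSmoothness_of_isRCLikeNormedField]
    exact WithTop.coe_le_coe.mpr le_top)).eq _ _

theorem Geometry.inv_kmat_symm (G : Geometry b) (p : Fin b → ℤ) (a a' : Fin b) :
    (kmat G.κ p)⁻¹ a a' = (kmat G.κ p)⁻¹ a' a := by
  conv_lhs => rw [← G.kmat_transpose, ← Matrix.transpose_nonsing_inv]
  rfl

theorem Geometry.integral_box_mul (G : Geometry b) {n : ℕ} (p : Fin n → Fin b → ℤ)
    {f φ : Coord n b → ℝ} (hf : ContDiff ℝ ∞ f) (hφ : ContDiff ℝ ∞ φ) (hc : HasCompactSupport φ) :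
    ∫ x, G.box p f x * φ x = ∫ x, f x * G.box p φ x := by
  have hI1 : ∀ i a a', Integrable fun x => (kmat G.κ (p i))⁻¹ a a' * pd i a (pd i a' f) x * φ x :=
    fun i a a' => ((continuous_const.mul (contDiff_pd (contDiff_pd hf i a') i a).continuous).mul
      hφ.continuous).integrable_of_hasCompactSupport hc.mul_left
  have hI2 : ∀ i a a', Integrable fun x => f x * ((kmat G.κ (p i))⁻¹ a a' * pd i a (pd i a' φ) x) :=
    fun i a a' => (hf.continuous.mul (continuous_const.mul
      (contDiff_pd (contDiff_pd hφ i a') i a).continuous)).integrable_of_hasCompactSupport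
      (hasCompactSupport_pd (hasCompactSupport_pd hc i a') i a).mul_left.mul_left
  simp only [Geometry.box, Finset.sum_mul, Finset.mul_sum]
  rw [integral_finsetSum _ fun i _ => integrable_finsetSum _ fun a _ => integrable_finsetSum _
    fun a' _ => hI1 i a a', integral_finsetSum _ fun i _ => integrable_finsetSum _ fun a _ =>
    integrable_finsetSum _ fun a' _ => hI2 i a a']
  refine Finset.sum_congr rfl fun i _ => ?_
  rw [integral_finsetSum _ fun a _ => integrable_finsetSum _ fun a' _ => hI1 i a a',
    integral_finsetSum _ fun a _ => integrable_finsetSum _ fun a' _ => hI2 i a a']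
  refine Finset.sum_congr rfl fun a _ => ?_
  rw [integral_finsetSum _ fun a' _ => hI1 i a a', integral_finsetSum _ fun a' _ => hI2 i a a']
  refine Finset.sum_congr rfl fun a' _ => ?_
  have h1 : ∀ x, (kmat G.κ (p i))⁻¹ a a' * pd i a (pd i a' f) x * φ x
      = (kmat G.κ (p i))⁻¹ a a' * (pd i a (pd i a' f) x * φ x) := fun x => by ring
  have h2 : ∀ x, f x * ((kmat G.κ (p i))⁻¹ a a' * pd i a (pd i a' φ) x)
      = (kmat G.κ (p i))⁻¹ a a' * (f x * pd i a' (pd i a φ) x) := fun x => by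
    rw [pd_comm hφ]
    ring
  simp_rw [h1, h2, integral_const_mul]
  rw [integral_pd_mul (contDiff_pd hf i a') hφ hc, integral_pd_mul hf (contDiff_pd hφ i a)
    (hasCompactSupport_pd hc i a), neg_neg]


/-! ### Rescaling solutions of Vignéras' equation -/

theorem Geometry.box_comp_smul (G : Geometry b) {n : ℕ} (p : Fin n → Fin b → ℤ)
    {f : Coord n b → ℝ} (hf : ContDiff ℝ ∞ f) (r : ℝ) (x : Coord n b) :
    G.box p (fun y => f (r • y)) x = r ^ 2 * G.box p f (r • x) := by
  have h1 : ∀ {f : Coord n b → ℝ}, ContDiff ℝ ∞ f → ∀ i a,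
      pd i a (fun y => f (r • y)) = fun y => r * pd i a f (r • y) := by
    intro f hf i a
    funext y
    have h := ((hf.differentiable (by simp)) (r • y)).hasFDerivAt.comp y
      ((hasFDerivAt_id (𝕜 := ℝ) y).const_smul r)
    have h' : fderiv ℝ (fun y => f (r • y)) y = _ := h.fderiv
    rw [pd_apply, h', pd_apply]
    simp
  simp only [Geometry.box, Finset.mul_sum]
  refine Finset.sum_congr rfl fun i _ => Finset.sum_congr rfl fun a _ =>
    Finset.sum_congr rfl fun a' _ => ?_
  rw [h1 hf i a']
  have h2 : pd i a (fun y => r * pd i a' f (r • y)) x = r * pd i a (fun y => pd i a' f (r • y)) x := by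
    have hd : DifferentiableAt ℝ (fun y => pd i a' f (r • y)) x :=
      (((contDiff_pd hf i a').comp (contDiff_const_smul r)).differentiable (by simp)) x
    rw [pd_apply, fderiv_const_mul hd]
    rfl
  rw [h2, h1 (contDiff_pd hf i a')]
  ring

/-- A smooth solution of Vignéras' equation, rescaled. -/
noncomputable def rescaled {n : ℕ} (f : Coord n b → ℝ) (k : ℕ) (r : ℝ) (y : Coord n b) : ℝ :=
  (r ^ k)⁻¹ * f (r • y)

theorem contDiff_rescaled {n : ℕ} {f : Coord n b → ℝ} (hf : ContDiff ℝ ∞ f) (k : ℕ) (r : ℝ) :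
    ContDiff ℝ ∞ (rescaled f k r) :=
  contDiff_const.mul (hf.comp (contDiff_const_smul r))

/-- The derivative in `r` of `r⁻ᵏ f(r y)` is `r⁻¹ r⁻ᵏ` times `(x · ∂ - k) f` at `r y`, which
Vignéras' equation replaces by `-(2π)⁻¹ ∂² f`. -/
theorem Geometry.hasDerivAt_rescaled (G : Geometry b) {n : ℕ} (p : Fin n → Fin b → ℤ) {k : ℕ}
    {f : Coord n b → ℝ} (hf : ContDiff ℝ ∞ f) (hV : ∀ x, G.vigneras p k f x = 0) {r : ℝ}
    (hr : 0 < r) (y : Coord n b) :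
    HasDerivAt (fun r => rescaled f k r y)
      (-(2 * Real.pi)⁻¹ * r⁻¹ * ((r ^ k)⁻¹ * G.box p f (r • y))) r := by
  have hd := hf.differentiable (by simp)
  have h1 : HasDerivAt (fun r : ℝ => f (r • y)) (fderiv ℝ f (r • y) y) r := by
    have h := (hasDerivAt_id r).smul_const y
    have h' : HasFDerivAt f (fderiv ℝ f (r • y)) (r • y) := (hd _).hasFDerivAt
    have h3 := h'.comp_hasDerivAt r h
    rw [one_smul] at h3
    exact h3
  have h2 : HasDerivAt (fun r : ℝ => (r ^ k)⁻¹) (-((k : ℝ) * r ^ (k - 1)) / (r ^ k) ^ 2) r :=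
    (hasDerivAt_pow k r).inv (pow_ne_zero _ hr.ne')
  refine (h2.mul h1).congr_deriv ?_
  have hV' := hV (r • y)
  rw [Geometry.vigneras, sum_mul_pd, map_smul, smul_eq_mul] at hV'
  have h3 : G.box p f (r • y) = -(2 * Real.pi * (r * fderiv ℝ f (r • y) y - k * f (r • y))) := by
    linarith
  rw [h3]
  have hpi := Real.pi_pos.ne'
  rcases Nat.eq_zero_or_pos k with rfl | hk
  · simp
    field_simp
  · obtain ⟨m, rfl⟩ := Nat.exists_eq_add_of_le' hk
    simp only [Nat.add_sub_cancel]
    field_simp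
    ring

/-- Tested against `φ`, the operator `∂²` moves to `φ`, with `r⁻²` from rescaling its argument. The
velocity then involves only the rescaled function, whose limit is controlled, and none of its
derivatives. -/
theorem Geometry.hasDerivAt_integral_rescaled (G : Geometry b) {n : ℕ} (p : Fin n → Fin b → ℤ)
    {k : ℕ} {f φ : Coord n b → ℝ} (hf : ContDiff ℝ ∞ f) (hV : ∀ x, G.vigneras p k f x = 0)
    (hφ : ContDiff ℝ ∞ φ) (hc : HasCompactSupport φ) {r : ℝ} (hr : 0 < r) :
    HasDerivAt (fun r => ∫ y, rescaled f k r y * φ y)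
      (-(2 * Real.pi)⁻¹ * (r ^ 3)⁻¹ * ∫ y, rescaled f k r y * G.box p φ y) r := by
  let F' : ℝ → Coord n b → ℝ := fun r y =>
    (-(2 * Real.pi)⁻¹ * r⁻¹ * ((r ^ k)⁻¹ * G.box p f (r • y))) * φ y
  have hbox := (contDiff_box G p hf).continuous
  have hcont : ContinuousOn (fun z : ℝ × Coord n b => F' z.1 z.2)
      (Set.Icc (r / 2) (2 * r) ×ˢ tsupport φ) := by
    have hφ' := hφ.continuous
    refine ContinuousOn.mul (ContinuousOn.mul (continuousOn_const.mul
      (continuousOn_fst.inv₀ ?_)) (ContinuousOn.mul ((continuousOn_fst.pow k).inv₀ ?_) ?_)) ?_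
    · rintro z ⟨hz, -⟩
      have := hz.1
      exact (show 0 < z.1 by linarith).ne'
    · rintro z ⟨hz, -⟩
      have := hz.1
      exact pow_ne_zero _ (show 0 < z.1 by linarith).ne'
    · exact Continuous.continuousOn (hbox.comp (continuous_fst.smul continuous_snd))
    · exact (hφ'.comp continuous_snd).continuousOn
  obtain ⟨M, hM⟩ := (isCompact_Icc.prod hc.isCompact).exists_bound_of_continuousOn hcont
  have hmem : Set.Ioo (r / 2) (2 * r) ∈ nhds r := Ioo_mem_nhds (by linarith) (by linarith)
  -- The integrand vanishes off the support of `φ`, and is bounded for `r'` in a compact interval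
  -- around `r` and `y` in that support; this provides the constant dominating function.
  have key := hasDerivAt_integral_of_dominated_loc_of_deriv_le (μ := (volume : Measure (Coord n b)))
    (F := fun r y => rescaled f k r y * φ y) (F' := F') (x₀ := r) (s := Set.Ioo (r / 2) (2 * r))
    (bound := (tsupport φ).indicator fun _ => M) hmem ?_ ?_ ?_ ?_ ?_ ?_
  · refine key.2.congr_deriv ?_
    have h1 : ∀ y, F' r y = (-(2 * Real.pi)⁻¹ * (r ^ 3)⁻¹) *
        (G.box p (rescaled f k r) y * φ y) := by
      intro y
      have h2 : G.box p (rescaled f k r) y = (r ^ k)⁻¹ * (r ^ 2 * G.box p f (r • y)) := by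
        rw [← G.box_comp_smul p hf]
        have : rescaled f k r = fun x => (fun x => (r ^ k)⁻¹ * f x) (r • x) := rfl
        rw [this, G.box_comp_smul p (contDiff_const.mul hf), G.box_comp_smul p hf]
        have h3 : ∀ i a, pd i a (fun x => (r ^ k)⁻¹ * f x) = fun x => (r ^ k)⁻¹ * pd i a f x := by
          intro i a
          funext x
          rw [pd_apply, fderiv_const_mul (hf.differentiable (by simp) x)]
          rfl
        have h4 : ∀ i a a' x, pd i a (fun x => (r ^ k)⁻¹ * pd i a' f x) x
            = (r ^ k)⁻¹ * pd i a (pd i a' f) x := by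
          intro i a a' x
          rw [pd_apply, fderiv_const_mul ((contDiff_pd hf i a').differentiable (by simp) x)]
          rfl
        simp only [Geometry.box, h3, h4, Finset.mul_sum]
        refine Finset.sum_congr rfl fun i _ => Finset.sum_congr rfl fun a _ =>
          Finset.sum_congr rfl fun a' _ => by ring
      simp only [F', h2]
      field_simp
    simp_rw [h1, integral_const_mul]
    rw [G.integral_box_mul p (contDiff_rescaled hf k r) hφ hc]
  · exact Eventually.of_forall fun r =>
      ((contDiff_rescaled hf k r).continuous.mul hφ.continuous).aestronglyMeasurable
  · exact ((contDiff_rescaled hf k r).continuous.mul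
      hφ.continuous).integrable_of_hasCompactSupport hc.mul_left
  · refine Continuous.aestronglyMeasurable ?_
    exact (continuous_const.mul (continuous_const.mul
      (hbox.comp (continuous_const_smul r)))).mul hφ.continuous
  · refine Eventually.of_forall fun y r' hr' => ?_
    by_cases hy : y ∈ tsupport φ
    · rw [Set.indicator_of_mem hy]
      exact hM (r', y) ⟨⟨hr'.1.le, hr'.2.le⟩, hy⟩
    · rw [Set.indicator_of_notMem hy]
      simp [F', image_eq_zero_of_notMem_tsupport hy]
  · rw [integrable_indicator_iff (isClosed_tsupport φ).measurableSet]
    exact integrableOn_const hc.isCompact.measure_lt_top.ne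
  · refine Eventually.of_forall fun y r' hr' => ?_
    exact (G.hasDerivAt_rescaled p hf hV (by linarith [hr'.1]) y).mul_const _

/-- If the rescaled solution converges fast enough on an open set, its limit is harmonic there. -/
theorem Geometry.box_eq_zero_of_tendsto (G : Geometry b) {n : ℕ} (p : Fin n → Fin b → ℤ) {k : ℕ}
    {f P : Coord n b → ℝ} (hf : ContDiff ℝ ∞ f) (hV : ∀ x, G.vigneras p k f x = 0)
    (hP : ContDiff ℝ ∞ P) {U : Set (Coord n b)} (hU : IsOpen U) {N : ℝ}
    (hbd : ∀ y ∈ U, ∀ r, N ≤ r → ‖r ^ 2 * (rescaled f k r y - P y)‖ ≤ 1)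
    (hlim : ∀ y ∈ U, Tendsto (fun r : ℝ => r ^ 2 * (rescaled f k r y - P y)) atTop (nhds 0)) :
    ∀ y ∈ U, G.box p P y = 0 := by
  have hlim' : ∀ y ∈ U, Tendsto (fun r : ℝ => rescaled f k r y) atTop (nhds (P y)) := by
    intro y hy
    have h1 : Tendsto (fun r : ℝ => (r ^ 2)⁻¹) atTop (nhds 0) :=
      tendsto_inv_atTop_zero.comp (tendsto_pow_atTop two_ne_zero)
    have h2 := (h1.mul (hlim y hy)).add_const (P y)
    rw [zero_mul, zero_add] at h2
    refine h2.congr' ?_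
    filter_upwards [eventually_gt_atTop 0] with r hr
    field_simp
    ring
  -- against every test function
  have key : ∀ φ : Coord n b → ℝ, ContDiff ℝ ∞ φ → HasCompactSupport φ → tsupport φ ⊆ U →
      ∫ y, φ y • G.box p P y = 0 := by
    intro φ hφ hc hsupp
    have hboxsupp : ∀ y, y ∉ U → G.box p φ y = 0 := by
      exact fun y hy => G.box_eq_zero_of_notMem_tsupport p fun h => hy (hsupp h)
    have hφU : ∀ y, y ∉ U → φ y = 0 := fun y hy =>
      image_eq_zero_of_notMem_tsupport fun h => hy (hsupp h)
    -- the two limits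
    have hbound : ∀ r, max N 1 ≤ r → ∀ y ∈ U, ‖rescaled f k r y - P y‖ ≤ 1 := by
      intro r hr y hy
      have h1 := hbd y hy r ((le_max_left _ _).trans hr)
      rw [norm_mul] at h1
      have h2 : 1 ≤ r := (le_max_right _ _).trans hr
      have h3 : 1 ≤ ‖r ^ 2‖ := by
        rw [Real.norm_of_nonneg (by positivity)]
        nlinarith
      nlinarith [norm_nonneg (rescaled f k r y - P y)]
    have hC : Tendsto (fun r => ∫ y, rescaled f k r y * G.box p φ y) atTop
        (nhds (∫ y, P y * G.box p φ y)) := by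
      refine tendsto_integral_filter_of_dominated_convergence
        (fun y => (‖P y‖ + 1) * ‖G.box p φ y‖) ?_ ?_ ?_ ?_
      · exact Eventually.of_forall fun r => ((contDiff_rescaled hf k r).continuous.mul
          (contDiff_box G p hφ).continuous).aestronglyMeasurable
      · filter_upwards [eventually_ge_atTop (max N 1)] with r hr
        refine Eventually.of_forall fun y => ?_
        by_cases hy : y ∈ U
        · rw [norm_mul]
          refine mul_le_mul_of_nonneg_right ?_ (norm_nonneg _)
          calc ‖rescaled f k r y‖ = ‖P y + (rescaled f k r y - P y)‖ := by rw [add_sub_cancel]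
            _ ≤ ‖P y‖ + ‖rescaled f k r y - P y‖ := norm_add_le _ _
            _ ≤ _ := by linarith [hbound r hr y hy]
        · rw [hboxsupp y hy]
          simp
      · exact ((hP.continuous.norm.add continuous_const).mul
          (contDiff_box G p hφ).continuous.norm).integrable_of_hasCompactSupport
          (hasCompactSupport_box G p hc).norm.mul_left
      · refine Eventually.of_forall fun y => ?_
        by_cases hy : y ∈ U
        · exact (hlim' y hy).mul_const _
        · simp [hboxsupp y hy]
    have hA : Tendsto (fun r => ∫ y, r ^ 2 * (rescaled f k r y - P y) * φ y) atTop (nhds 0) := by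
      have : (0 : ℝ) = ∫ y : Coord n b, (0 : ℝ) * φ y := by simp
      rw [this]
      refine tendsto_integral_filter_of_dominated_convergence (fun y => ‖φ y‖) ?_ ?_ ?_ ?_
      · exact Eventually.of_forall fun r => ((continuous_const.mul
          ((contDiff_rescaled hf k r).continuous.sub hP.continuous)).mul
          hφ.continuous).aestronglyMeasurable
      · filter_upwards [eventually_ge_atTop N] with r hr
        refine Eventually.of_forall fun y => ?_
        by_cases hy : y ∈ U
        · rw [norm_mul]
          exact mul_le_of_le_one_left (norm_nonneg _) (hbd y hy r hr)
        · simp [hφU y hy]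
      · exact hφ.continuous.norm.integrable_of_hasCompactSupport hc.norm
      · refine Eventually.of_forall fun y => ?_
        by_cases hy : y ∈ U
        · exact (hlim y hy).mul_const _
        · simp [hφU y hy]
    set A : ℝ → ℝ := fun r => ∫ y, rescaled f k r y * φ y with hAdef
    set A0 := ∫ y, P y * φ y with hA0
    have hA' : ∀ r, ∫ y, r ^ 2 * (rescaled f k r y - P y) * φ y = r ^ 2 * (A r - A0) := by
      intro r
      rw [hAdef, hA0, ← integral_sub, ← integral_const_mul]
      · congr 1
        funext y
        ring
      · exact ((contDiff_rescaled hf k r).continuous.mul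
          hφ.continuous).integrable_of_hasCompactSupport hc.mul_left
      · exact (hP.continuous.mul hφ.continuous).integrable_of_hasCompactSupport hc.mul_left
    simp_rw [hA'] at hA
    have hsq : Tendsto (fun r : ℝ => (r ^ 2)⁻¹) atTop (nhds 0) :=
      tendsto_inv_atTop_zero.comp (tendsto_pow_atTop two_ne_zero)
    have hAlim : Tendsto (fun r => A r - A0) atTop (nhds 0) := by
      have h2 := hsq.mul hA
      rw [zero_mul] at h2
      refine h2.congr' ?_
      filter_upwards [eventually_gt_atTop 0] with r hr
      field_simp
    -- L'Hôpital's rule for `(A(r) - A0) / r⁻²`: the quotient of the derivatives tends to `(4π)⁻¹ ∫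
    -- P ∂²φ`, whereas the quotient itself tends to zero by the assumed rate of convergence. Hence
    -- the integral vanishes.
    have hL := HasDerivAt.lhopital_zero_atTop (f := fun r => A r - A0) (g := fun r => (r ^ 2)⁻¹)
      (f' := fun r => -(2 * Real.pi)⁻¹ * (r ^ 3)⁻¹ * ∫ y, rescaled f k r y * G.box p φ y)
      (g' := fun r => -2 * (r ^ 3)⁻¹) (l := nhds ((4 * Real.pi)⁻¹ * ∫ y, P y * G.box p φ y))
      ?_ ?_ ?_ hAlim hsq ?_
    · have hL' : Tendsto (fun r => (A r - A0) / (r ^ 2)⁻¹) atTop (nhds 0) := by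
        refine hA.congr fun r => ?_
        rw [div_inv_eq_mul, mul_comm]
      have h0 := tendsto_nhds_unique hL hL'
      have h1 : ∫ y, P y * G.box p φ y = 0 := by
        have hpi := Real.pi_pos
        rcases mul_eq_zero.mp h0 with h | h
        · exact absurd h (by positivity)
        · exact h
      rw [← G.integral_box_mul p hP hφ hc] at h1
      rw [← h1]
      congr 1
      funext y
      rw [smul_eq_mul, mul_comm]
    · filter_upwards [eventually_gt_atTop 0] with r hr
      exact (G.hasDerivAt_integral_rescaled p hf hV hφ hc hr).sub_const _
    · filter_upwards [eventually_gt_atTop 0] with r hr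
      refine ((hasDerivAt_pow 2 r).inv (by positivity)).congr_deriv ?_
      field_simp
      norm_num [mul_comm]
    · filter_upwards [eventually_gt_atTop 0] with r hr
      have : (r ^ 3)⁻¹ ≠ 0 := by positivity
      simpa using hr.ne'
    · refine (hC.const_mul (4 * Real.pi)⁻¹).congr' ?_
      filter_upwards [eventually_gt_atTop 0] with r hr
      have hpi := Real.pi_pos.ne'
      field_simp
      ring
  -- The fundamental lemma of the calculus of variations gives vanishing almost everywhere on `U`,
  -- and continuity gives it everywhere there.
  have hcont := (contDiff_box G p hP).continuous
  have hae := hU.ae_eq_zero_of_integral_contDiff_smul_eq_zero (μ := volume)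
    (hcont.locallyIntegrable.locallyIntegrableOn U) key
  have h2 := (MeasureTheory.ae_restrict_iff' hU.measurableSet).mpr hae
  intro y hy
  exact Measure.eqOn_open_of_ae_eq (g := fun _ => (0 : ℝ)) h2 hU hcont.continuousOn
    continuousOn_const hy


/-! ### The seed kernels solve Vignéras' equation -/

/-- With `P` the total D4-charge, take `κ_i x_i` proportional to `c_i P`. The terms containing the
other `x_j` sum up to a multiple of `∑ c_j = 0`, and what is left is `c_i` when the factor is `-1 /
(P · P)`. -/
theorem Geometry.exists_betaX_eq (G : Geometry b) {n : ℕ} (hn : 1 ≤ n) {p : Fin n → Fin b → ℤ}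
    (hp : ∀ i, p i ∈ G.D4) {c : Fin n → ℝ} (hc : ∑ i, c i = 0) : ∃ x, G.betaX p x = c := by
  have hP : ∑ i, p i ∈ G.D4 := G.sum_mem_D4 hp ⟨⟨0, hn⟩, Finset.mem_univ _⟩
  set P : Fin b → ℝ := toR (∑ i, p i) with hPdef
  have hPP : P ⬝ᵥ P ≠ 0 := by
    rw [Ne, dotProduct_self_eq_zero]
    exact G.toR_ne_zero hP
  let x : Coord n b := fun i => (kmat G.κ (p i))⁻¹ *ᵥ ((-c i / (P ⬝ᵥ P)) • P)
  have hx : ∀ i w, cub G.κ (toR (p i)) w (x i) = -c i / (P ⬝ᵥ P) * (w ⬝ᵥ P) := by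
    intro i w
    rw [G.cub_toR, Matrix.mulVec_mulVec, Matrix.mul_nonsing_inv _ (G.isUnit_det (hp i)),
      Matrix.one_mulVec, dotProduct_smul, smul_eq_mul]
  refine ⟨x, ?_⟩
  funext i
  rw [G.betaX_eq]
  simp only [hx]
  rw [Finset.sum_sub_distrib, ← Finset.sum_mul, ← Finset.sum_div, Finset.sum_neg_distrib, hc,
    ← Finset.mul_sum, ← sum_dotProduct, ← toR_sum]
  field_simp
  simp [mul_comm, hPdef]

theorem Geometry.continuous_bil (G : Geometry b) {n : ℕ} (p : Fin n → Fin b → ℤ) (u : Coord n b) :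
    Continuous fun x => G.bil p u x :=
  (G.bilL p u).continuous_of_finiteDimensional

theorem Geometry.continuous_betaX (G : Geometry b) {n : ℕ} (p : Fin n → Fin b → ℤ) :
    Continuous (G.betaX p) :=
  continuous_pi fun _ => continuous_finsetSum _ fun _ _ => G.continuous_bil p _

theorem Geometry.continuous_stabX (G : Geometry b) {n : ℕ} (p : Fin n → Fin b → ℤ) :
    Continuous (G.stabX p) :=
  continuous_pi fun _ => continuous_const.mul
    (continuous_finsetSum _ fun _ _ => G.continuous_bil p _)

theorem isOpen_sameChamber {X : Type*} [TopologicalSpace X] {n : ℕ} {c : Fin n → ℝ}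
    (hc : ∑ i, c i = 0) (hg : GenericStab c) {f : X → Fin n → ℝ} (hf : Continuous f)
    (hf0 : ∀ x, ∑ i, f x i = 0) : IsOpen {x | SameChamber c (f x)} := by
  have h : Continuous fun x => (⟨f x, hf0 x⟩ : zeroSum n) := hf.subtype_mk _
  exact (isOpen_chamber hc hg).preimage h

theorem analyticOnNhd_box (G : Geometry b) {n : ℕ} (p : Fin n → Fin b → ℤ)
    {f : Coord n b → ℝ} (hf : AnalyticOnNhd ℝ f Set.univ) :
    AnalyticOnNhd ℝ (G.box p f) Set.univ := by
  have h : ∀ (g : Coord n b → ℝ), AnalyticOnNhd ℝ g Set.univ → ∀ i a,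
      AnalyticOnNhd ℝ (pd i a g) Set.univ := by
    intro g hg i a
    exact ((ContinuousLinearMap.apply ℝ ℝ (coordDir i a)).analyticOnNhd Set.univ).comp
      (hg.fderiv) (Set.mapsTo_univ _ _)
  exact Finset.analyticOnNhd_fun_sum _ fun i _ => Finset.analyticOnNhd_fun_sum _ fun a _ =>
    Finset.analyticOnNhd_fun_sum _ fun a' _ => analyticOnNhd_const.mul (h _ (h _ hf i a') i a)

namespace KernelSystem

variable {G : Geometry b} {g0 : ∀ n, (Fin n → Charge b) → (Fin n → ℝ) → ℝ}
  {E R : ∀ n, (Fin n → Charge b) → ℝ → ℝ} {σ : Charge b → ℝ}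
  {Φ0 : ∀ n, (Fin n → Fin b → ℤ) → Coord n b → (Fin n → ℝ) → ℝ}
  {ΦE : ∀ n, (Fin n → Fin b → ℤ) → Coord n b → ℝ}

/-- By homogeneity the seed kernel at `r y` is `r^(n-1)` times its value at `y`, and scaling by `r >
0` does not leave the chamber. The remaining difference decays exponentially, which beats the factor
`r²`. -/
theorem tendsto_rescaled (K : KernelSystem G g0 E R σ Φ0 ΦE) {n : ℕ} (hn : 1 ≤ n)
    {p : Fin n → Fin b → ℤ} (hp : ∀ i, p i ∈ G.D4) {c : Fin n → ℝ} (hc : ∑ i, c i = 0)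
    (hg : GenericStab c) {y : Coord n b} (hy : SameChamber c (G.betaX p y)) :
    Tendsto (fun r : ℝ => r ^ 2 * (rescaled (ΦE n p) (n - 1) r y - Φ0 n p y c)) atTop
      (nhds 0) := by
  obtain ⟨ε, hε, hO⟩ := K.decay n hn p hp y (hy.genericStab hc (G.sum_betaX p y) hg)
  have ho := hO.trans_isLittleO (isLittleO_exp_neg_mul_rpow_atTop hε (-1))
  -- The choice `τ₂ = r² / 2` makes `√(2τ₂) = r`.
  have h1 : Tendsto (fun r : ℝ => r ^ 2 / 2) atTop atTop :=
    (tendsto_pow_atTop two_ne_zero).atTop_div_const two_pos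
  have h2 := (ho.comp_tendsto h1).tendsto_div_nhds_zero
  have h3 := (h2.norm.const_mul 2)
  rw [norm_zero, mul_zero] at h3
  refine squeeze_zero_norm' ?_ h3
  filter_upwards [eventually_ge_atTop 1] with r hr
  have hr0 : 0 < r := by linarith
  have hs : Real.sqrt (2 * (r ^ 2 / 2)) = r := by
    rw [mul_div_cancel₀ _ two_ne_zero, Real.sqrt_sq hr0.le]
  simp only [Function.comp, hs]
  have h4 : Φ0 n p (r • y) (G.betaX p (r • y)) = r ^ (n - 1) * Φ0 n p y c := by
    rw [← K.seed_smul hn hp hc hg hr0]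
    refine (K.seed_eq_of_sameChamber hn hp hc (G.sum_betaX p _) hg ?_ _).symm
    rw [G.betaX_smul]
    exact hy.trans (sameChamber_smul _ hr0).symm
  rw [h4, Real.rpow_neg_one, div_inv_eq_mul, rescaled]
  have h5 : (1 : ℝ) ≤ r ^ (n - 1) := one_le_pow₀ hr
  have h6 : r ^ 2 * ((r ^ (n - 1))⁻¹ * ΦE n p (r • y) - Φ0 n p y c)
      = (r ^ (n - 1))⁻¹ * (2 * ((ΦE n p (r • y) - r ^ (n - 1) * Φ0 n p y c) * (r ^ 2 / 2))) := by
    field_simp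
  rw [h6, norm_mul, norm_mul 2, Real.norm_of_nonneg (by positivity : (0:ℝ) ≤ 2)]
  refine mul_le_of_le_one_left (by positivity) ?_
  rw [Real.norm_of_nonneg (by positivity)]
  exact inv_le_one_of_one_le₀ h5

/-- The decay is assumed along each ray separately. Baire's theorem makes it uniform on some open
set where `betaX` lies in the chamber of `c`; there the limit is harmonic, and analyticity spreads
this to all `x`. -/
theorem box_seed (K : KernelSystem G g0 E R σ Φ0 ΦE) {n : ℕ} (hn : 1 ≤ n)
    {p : Fin n → Fin b → ℤ} (hp : ∀ i, p i ∈ G.D4) {c : Fin n → ℝ} (hc : ∑ i, c i = 0)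
    (hg : GenericStab c) (x : Coord n b) : G.box p (fun x => Φ0 n p x c) x = 0 := by
  set P := fun x => Φ0 n p x c with hPdef
  have hP := K.contDiff_seed hn hp hc hg
  have hE := K.vigneras n hn p hp
  set U := {y : Coord n b | SameChamber c (G.betaX p y)} with hU
  have hUo : IsOpen U := isOpen_sameChamber hc hg (G.continuous_betaX p) (G.sum_betaX p)
  obtain ⟨y0, hy0⟩ := G.exists_betaX_eq hn hp hc
  have hy0U : y0 ∈ U := by
    rw [hU, Set.mem_ofPred_eq, hy0]
    exact SameChamber.refl c
  -- Closed sets on which the convergence is bounded from `N` on; the complement of `U` is added so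
  -- that together they cover the space.
  let S : Option ℕ → Set (Coord n b) := fun o => match o with
    | none => Uᶜ
    | some N => {y | ∀ r : ℝ, (N : ℝ) ≤ r →
        ‖r ^ 2 * (rescaled (ΦE n p) (n - 1) r y - P y)‖ ≤ 1}
  have hSc : ∀ o, IsClosed (S o) := by
    rintro (_ | N)
    · exact hUo.isClosed_compl
    · have : S (some N) = ⋂ r : ℝ, ⋂ _ : (N : ℝ) ≤ r,
          {y | ‖r ^ 2 * (rescaled (ΦE n p) (n - 1) r y - P y)‖ ≤ 1} := by
        ext y
        simp [S]
      rw [this]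
      refine isClosed_iInter fun r => isClosed_iInter fun _ => isClosed_le ?_ continuous_const
      exact (continuous_const.mul
        ((contDiff_rescaled hE.1 _ r).continuous.sub hP.continuous)).norm
  have hSu : ⋃ o, S o = Set.univ := by
    refine Set.eq_univ_of_forall fun y => ?_
    rw [Set.mem_iUnion]
    by_cases hy : y ∈ U
    · have h1 := (K.tendsto_rescaled hn hp hc hg hy).norm
      rw [norm_zero] at h1
      obtain ⟨r0, hr0⟩ := eventually_atTop.mp (h1.eventually (gt_mem_nhds one_pos))
      obtain ⟨N, hN⟩ := exists_nat_ge r0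
      exact ⟨some N, fun r hr => (hr0 r (hN.trans hr)).le⟩
    · exact ⟨none, hy⟩
  have hdense := dense_iUnion_interior_of_closed hSc hSu
  obtain ⟨y1, hy1U, hy1⟩ := hdense.exists_mem_open hUo ⟨y0, hy0U⟩
  obtain ⟨o, ho⟩ := Set.mem_iUnion.mp hy1U
  rcases o with _ | N
  · exact absurd hy1 (interior_subset ho)
  · have hopen : IsOpen (U ∩ interior (S (some N))) := hUo.inter isOpen_interior
    have hloc := G.box_eq_zero_of_tendsto p (k := n - 1) hE.1 (P := P) (by
        intro x
        rw [Nat.cast_sub hn, Nat.cast_one]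
        exact hE.2 x) hP hopen (N := N)
      (fun y hy => interior_subset hy.2) (fun y hy => K.tendsto_rescaled hn hp hc hg hy.1)
    -- An analytic function that vanishes near one point of a connected space vanishes identically.
    have han := analyticOnNhd_box G p (analyticOnNhd_of_homogeneous (n - 1) hP fun r hr x =>
      K.seed_smul hn hp hc hg hr x)
    have h0 : (G.box p P) =ᶠ[nhds y1] 0 := by
      filter_upwards [hopen.mem_nhds ⟨hy1, ho⟩] with y hy using hloc y hy
    exact han.eqOn_zero_of_preconnected_of_eventuallyEq_zero isPreconnected_univ (Set.mem_univ y1)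
      h0 (Set.mem_univ x)

/-- Harmonicity removes the second order part, and Euler's identity in degree `n - 1` removes the
rest. -/
theorem vigneras_seed (K : KernelSystem G g0 E R σ Φ0 ΦE) {n : ℕ} (hn : 1 ≤ n)
    {p : Fin n → Fin b → ℤ} (hp : ∀ i, p i ∈ G.D4) {c : Fin n → ℝ} (hc : ∑ i, c i = 0)
    (hg : GenericStab c) (x : Coord n b) :
    G.vigneras p ((n : ℝ) - 1) (fun x => Φ0 n p x c) x = 0 := by
  rw [Geometry.vigneras, K.box_seed hn hp hc hg, sum_mul_pd,
    fderiv_self_of_homogeneous (K.contDiff_seed hn hp hc hg) fun r hr x =>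
      K.seed_smul hn hp hc hg hr x, Nat.cast_sub hn]
  simp

end KernelSystem

/-! ### Vignéras' operator in invariant form -/

/-- Contraction of a bilinear form with the inverse of the quadratic form. -/
noncomputable def Geometry.cometric (G : Geometry b) {n : ℕ} (p : Fin n → Fin b → ℤ)
    (B : Coord n b → Coord n b → ℝ) : ℝ :=
  ∑ i, ∑ a, ∑ a', (kmat G.κ (p i))⁻¹ a a' * B (coordDir i a) (coordDir i a')

/-- The vector dual to a coordinate. -/
noncomputable def Geometry.dualDir (G : Geometry b) {n : ℕ} (p : Fin n → Fin b → ℤ) (i : Fin n)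
    (a : Fin b) : Coord n b := Pi.single i ((kmat G.κ (p i))⁻¹ *ᵥ Pi.single a 1)

theorem Geometry.dualDir_eq (G : Geometry b) {n : ℕ} (p : Fin n → Fin b → ℤ) (i : Fin n)
    (a' : Fin b) : G.dualDir p i a' = ∑ a, (kmat G.κ (p i))⁻¹ a a' • coordDir i a := by
  funext j c
  simp only [Geometry.dualDir, coordDir, Finset.sum_apply, Pi.smul_apply, smul_eq_mul]
  by_cases hj : j = i
  · subst hj
    simp [Pi.single_apply]
  · simp [Pi.single_eq_of_ne hj]

theorem Geometry.cometric_eq (G : Geometry b) {n : ℕ} (p : Fin n → Fin b → ℤ)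
    {B : Coord n b → Coord n b → ℝ} (hB : ∀ w, IsLinearMap ℝ fun v => B v w) :
    G.cometric p B = ∑ i, ∑ a, B (G.dualDir p i a) (coordDir i a) := by
  refine Finset.sum_congr rfl fun i _ => ?_
  rw [Finset.sum_comm]
  refine Finset.sum_congr rfl fun a' _ => ?_
  rw [G.dualDir_eq, ← (hB (coordDir i a')).mk'_apply, map_sum]
  simp

theorem Geometry.cometric_add (G : Geometry b) {n : ℕ} (p : Fin n → Fin b → ℤ)
    (B B' : Coord n b → Coord n b → ℝ) :
    G.cometric p (fun v w => B v w + B' v w) = G.cometric p B + G.cometric p B' := by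
  simp only [Geometry.cometric, mul_add, Finset.sum_add_distrib]

theorem Geometry.cometric_mul_left (G : Geometry b) {n : ℕ} (p : Fin n → Fin b → ℤ) (r : ℝ)
    (B : Coord n b → Coord n b → ℝ) :
    G.cometric p (fun v w => r * B v w) = r * G.cometric p B := by
  simp only [Geometry.cometric, Finset.mul_sum]
  refine Finset.sum_congr rfl fun i _ => Finset.sum_congr rfl fun a _ =>
    Finset.sum_congr rfl fun a' _ => by ring

theorem Geometry.cometric_swap (G : Geometry b) {n : ℕ} (p : Fin n → Fin b → ℤ)
    (B : Coord n b → Coord n b → ℝ) : G.cometric p (fun v w => B w v) = G.cometric p B := by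
  refine Finset.sum_congr rfl fun i _ => ?_
  rw [Finset.sum_comm]
  refine Finset.sum_congr rfl fun a _ => Finset.sum_congr rfl fun a' _ => ?_
  rw [G.inv_kmat_symm]

theorem pd_pd_apply {n : ℕ} {f : Coord n b → ℝ} (hf : ContDiff ℝ ∞ f) (i j : Fin n) (a a' : Fin b)
    (x : Coord n b) : pd i a (pd j a' f) x
      = fderiv ℝ (fderiv ℝ f) x (coordDir i a) (coordDir j a') := by
  have hd : Differentiable ℝ (fderiv ℝ f) :=
    (hf.fderiv_right (m := ∞) (by simp)).differentiable (by simp)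
  have : pd j a' f = fun x => fderiv ℝ f x (coordDir j a') := rfl
  rw [pd_apply, this, fderiv_clm_apply (hd x) (differentiableAt_const _)]
  simp

theorem Geometry.box_eq_cometric (G : Geometry b) {n : ℕ} (p : Fin n → Fin b → ℤ)
    {f : Coord n b → ℝ} (hf : ContDiff ℝ ∞ f) (x : Coord n b) :
    G.box p f x = G.cometric p fun v w => fderiv ℝ (fderiv ℝ f) x v w := by
  simp only [Geometry.box, Geometry.cometric, pd_pd_apply hf]

theorem Geometry.vigneras_eq (G : Geometry b) {n : ℕ} (p : Fin n → Fin b → ℤ) (lam : ℝ)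
    {f : Coord n b → ℝ} (hf : ContDiff ℝ ∞ f) (x : Coord n b) :
    G.vigneras p lam f x = (G.cometric p fun v w => fderiv ℝ (fderiv ℝ f) x v w)
      + 2 * Real.pi * (fderiv ℝ f x x - lam * f x) := by
  rw [Geometry.vigneras, G.box_eq_cometric p hf, sum_mul_pd]

theorem differentiable_fderiv {n : ℕ} {f : Coord n b → ℝ} (hf : ContDiff ℝ ∞ f) :
    Differentiable ℝ (fderiv ℝ f) :=
  (hf.fderiv_right (m := ∞) (by simp)).differentiable (by simp)

theorem Geometry.vigneras_sub (G : Geometry b) {n : ℕ} (p : Fin n → Fin b → ℤ) (lam : ℝ)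
    {f g : Coord n b → ℝ} (hf : ContDiff ℝ ∞ f) (hg : ContDiff ℝ ∞ g) (x : Coord n b) :
    G.vigneras p lam (fun x => f x - g x) x = G.vigneras p lam f x - G.vigneras p lam g x := by
  have h1 : ∀ x, fderiv ℝ (fun x => f x - g x) x = fderiv ℝ f x - fderiv ℝ g x := fun x =>
    fderiv_fun_sub (hf.differentiable (by simp) x) (hg.differentiable (by simp) x)
  have h2 : fderiv ℝ (fderiv ℝ (fun x => f x - g x)) x
      = fderiv ℝ (fderiv ℝ f) x - fderiv ℝ (fderiv ℝ g) x := by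
    rw [funext h1]
    exact fderiv_fun_sub (differentiable_fderiv hf x) (differentiable_fderiv hg x)
  rw [G.vigneras_eq p lam (hf.sub hg), G.vigneras_eq p lam hf, G.vigneras_eq p lam hg, h1, h2]
  simp only [Geometry.cometric, sub_apply, mul_sub, Finset.sum_sub_distrib]
  ring

theorem Geometry.vigneras_const_mul (G : Geometry b) {n : ℕ} (p : Fin n → Fin b → ℤ) (lam r : ℝ)
    {f : Coord n b → ℝ} (hf : ContDiff ℝ ∞ f) (x : Coord n b) :
    G.vigneras p lam (fun x => r * f x) x = r * G.vigneras p lam f x := by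
  have h1 : ∀ x, fderiv ℝ (fun x => r * f x) x = r • fderiv ℝ f x := fun x =>
    fderiv_const_mul (hf.differentiable (by simp) x) r
  have h2 : fderiv ℝ (fderiv ℝ (fun x => r * f x)) x = r • fderiv ℝ (fderiv ℝ f) x := by
    rw [funext h1]
    exact fderiv_fun_const_smul (differentiable_fderiv hf x) r
  rw [G.vigneras_eq p lam (contDiff_const.mul hf), G.vigneras_eq p lam hf, h1, h2]
  simp only [smul_apply, smul_eq_mul, G.cometric_mul_left]
  ring

theorem Geometry.vigneras_sum (G : Geometry b) {n : ℕ} (p : Fin n → Fin b → ℤ) (lam : ℝ)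
    {ι : Type*} (I : Finset ι) {f : ι → Coord n b → ℝ} (hf : ∀ i ∈ I, ContDiff ℝ ∞ (f i))
    (x : Coord n b) :
    G.vigneras p lam (fun x => ∑ i ∈ I, f i x) x = ∑ i ∈ I, G.vigneras p lam (f i) x := by
  have h1 : ∀ x, fderiv ℝ (fun x => ∑ i ∈ I, f i x) x = ∑ i ∈ I, fderiv ℝ (f i) x := fun x =>
    fderiv_fun_sum fun i hi => (hf i hi).differentiable (by simp) x
  have h2 : fderiv ℝ (fderiv ℝ (fun x => ∑ i ∈ I, f i x)) x
      = ∑ i ∈ I, fderiv ℝ (fderiv ℝ (f i)) x := by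
    rw [funext h1]
    exact fderiv_fun_sum fun i hi => differentiable_fderiv (hf i hi) x
  rw [G.vigneras_eq p lam (ContDiff.sum hf), h1, h2]
  have h3 : ∑ i ∈ I, G.vigneras p lam (f i) x = ∑ i ∈ I,
      ((G.cometric p fun v w => fderiv ℝ (fderiv ℝ (f i)) x v w)
        + 2 * Real.pi * (fderiv ℝ (f i) x x - lam * f i x)) :=
    Finset.sum_congr rfl fun i hi => G.vigneras_eq p lam (hf i hi) x
  rw [h3, Finset.sum_add_distrib, ← Finset.mul_sum, Finset.sum_sub_distrib, ← Finset.mul_sum]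
  congr 1
  · simp only [Geometry.cometric, sum_apply, Finset.mul_sum]
    symm
    rw [Finset.sum_comm]
    refine Finset.sum_congr rfl fun i _ => ?_
    rw [Finset.sum_comm]
    refine Finset.sum_congr rfl fun a _ => ?_
    rw [Finset.sum_comm]
  · simp only [sum_apply]

/-- The pairing of two gradients. -/
noncomputable def Geometry.gradPair (G : Geometry b) {n : ℕ} (p : Fin n → Fin b → ℤ)
    (f g : Coord n b → ℝ) (x : Coord n b) : ℝ :=
  G.cometric p fun v w => fderiv ℝ f x v * fderiv ℝ g x w

theorem Geometry.gradPair_mul_right (G : Geometry b) {n : ℕ} (p : Fin n → Fin b → ℤ)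
    (f : Coord n b → ℝ) {g h : Coord n b → ℝ} (hg : ContDiff ℝ ∞ g) (hh : ContDiff ℝ ∞ h)
    (x : Coord n b) : G.gradPair p f (fun x => g x * h x) x
      = g x * G.gradPair p f h x + h x * G.gradPair p f g x := by
  have h1 : fderiv ℝ (fun x => g x * h x) x = g x • fderiv ℝ h x + h x • fderiv ℝ g x :=
    fderiv_fun_mul (hg.differentiable (by simp) x) (hh.differentiable (by simp) x)
  simp only [Geometry.gradPair, h1, ← G.cometric_mul_left, ← G.cometric_add,
    add_apply, smul_apply, smul_eq_mul]
  congr 1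
  funext v w
  ring

/-- Euler's operator is a derivation, so the weights add; the only obstruction to products of
solutions being solutions is the pairing of the gradients. -/
theorem Geometry.vigneras_mul (G : Geometry b) {n : ℕ} (p : Fin n → Fin b → ℤ) (lam mu : ℝ)
    {f g : Coord n b → ℝ} (hf : ContDiff ℝ ∞ f) (hg : ContDiff ℝ ∞ g) (x : Coord n b) :
    G.vigneras p (lam + mu) (fun x => f x * g x) x = f x * G.vigneras p mu g x
      + g x * G.vigneras p lam f x + 2 * G.gradPair p f g x := by
  have h1 : ∀ x, fderiv ℝ (fun x => f x * g x) x = f x • fderiv ℝ g x + g x • fderiv ℝ f x :=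
    fun x => fderiv_fun_mul (hf.differentiable (by simp) x) (hg.differentiable (by simp) x)
  have h2 : ∀ v w, fderiv ℝ (fderiv ℝ (fun x => f x * g x)) x v w
      = (f x * fderiv ℝ (fderiv ℝ g) x v w + g x * fderiv ℝ (fderiv ℝ f) x v w)
        + (fderiv ℝ f x v * fderiv ℝ g x w + fderiv ℝ f x w * fderiv ℝ g x v) := by
    intro v w
    have hdf := hf.differentiable (by simp) x
    have hdg := hg.differentiable (by simp) x
    rw [funext h1, fderiv_fun_add (hdf.fun_smul (differentiable_fderiv hg x))
      (hdg.fun_smul (differentiable_fderiv hf x)), fderiv_fun_smul hdf (differentiable_fderiv hg x),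
      fderiv_fun_smul hdg (differentiable_fderiv hf x)]
    simp only [add_apply, smul_apply, smul_eq_mul,
      ContinuousLinearMap.smulRight_apply]
    ring
  rw [G.vigneras_eq p _ (hf.mul hg), G.vigneras_eq p _ hf, G.vigneras_eq p _ hg]
  simp only [h2]
  have h3 : G.gradPair p f g x = G.cometric p fun v w => fderiv ℝ f x w * fderiv ℝ g x v :=
    (G.cometric_swap p fun v w => fderiv ℝ f x v * fderiv ℝ g x w).symm
  rw [G.cometric_add, G.cometric_add, G.cometric_add, G.cometric_mul_left, G.cometric_mul_left,
    ← h3, h1]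
  simp only [add_apply, smul_apply, smul_eq_mul]
  change _ + (G.gradPair p f g x + _) + _ = _
  ring

theorem Geometry.gradPair_prod_eq_zero (G : Geometry b) {n : ℕ} (p : Fin n → Fin b → ℤ)
    {ι : Type*} (I : Finset ι) {f : Coord n b → ℝ} {g : ι → Coord n b → ℝ}
    (hg : ∀ i, ContDiff ℝ ∞ (g i)) (x : Coord n b) (h : ∀ i ∈ I, G.gradPair p f (g i) x = 0) :
    G.gradPair p f (fun x => ∏ i ∈ I, g i x) x = 0 := by
  classical
  induction I using Finset.induction_on with
  | empty =>
    simp only [Finset.prod_empty, Geometry.gradPair, fderiv_fun_const]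
    simp [Geometry.cometric]
  | insert i I hi ih =>
    simp only [Finset.prod_insert hi]
    rw [G.gradPair_mul_right p f (hg i) (contDiff_prod fun i _ => hg i),
      ih fun j hj => h j (Finset.mem_insert_of_mem hj), h i (Finset.mem_insert_self _ _)]
    simp

theorem Geometry.vigneras_prod_eq_zero (G : Geometry b) {n : ℕ} (p : Fin n → Fin b → ℤ)
    {ι : Type*} (I : Finset ι) {lam : ι → ℝ} {g : ι → Coord n b → ℝ}
    (hg : ∀ i, ContDiff ℝ ∞ (g i)) (x : Coord n b) (h : ∀ i ∈ I, G.vigneras p (lam i) (g i) x = 0)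
    (hpair : ∀ i ∈ I, ∀ j ∈ I, i ≠ j → G.gradPair p (g i) (g j) x = 0) :
    G.vigneras p (∑ i ∈ I, lam i) (fun x => ∏ i ∈ I, g i x) x = 0 := by
  classical
  induction I using Finset.induction_on with
  | empty =>
    simp only [Finset.prod_empty, Finset.sum_empty]
    rw [G.vigneras_eq p _ contDiff_const]
    simp [Geometry.cometric]
  | insert i I hi ih =>
    simp only [Finset.prod_insert hi, Finset.sum_insert hi]
    rw [G.vigneras_mul p _ _ (hg i) (contDiff_prod fun i _ => hg i), h i (Finset.mem_insert_self _ _),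
      ih (fun j hj => h j (Finset.mem_insert_of_mem hj)) (fun j hj k hk => hpair j
        (Finset.mem_insert_of_mem hj) k (Finset.mem_insert_of_mem hk)),
      G.gradPair_prod_eq_zero p I hg x fun j hj => hpair i (Finset.mem_insert_self _ _) j
        (Finset.mem_insert_of_mem hj) (by rintro rfl; exact hi hj)]
    simp

/-! ### Pulling back along linear maps -/

/-- Linear maps which are compatible with the contraction by the inverse quadratic forms. -/
def Geometry.IsCometricMap (G : Geometry b) {n m : ℕ} (p : Fin n → Fin b → ℤ)
    (q : Fin m → Fin b → ℤ) (T : Coord n b →L[ℝ] Coord m b) : Prop :=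
  ∀ B : Coord m b →L[ℝ] Coord m b →L[ℝ] ℝ,
    G.cometric p (fun v w => B (T v) (T w)) = G.cometric q fun v w => B v w

theorem Geometry.IsCometricMap.vigneras_comp {G : Geometry b} {n m : ℕ} {p : Fin n → Fin b → ℤ}
    {q : Fin m → Fin b → ℤ} {T : Coord n b →L[ℝ] Coord m b} (hT : G.IsCometricMap p q T)
    (lam : ℝ) {f : Coord m b → ℝ} (hf : ContDiff ℝ ∞ f) (x : Coord n b) :
    G.vigneras p lam (fun x => f (T x)) x = G.vigneras q lam f (T x) := by
  have h1 : ∀ x, fderiv ℝ (fun x => f (T x)) x = (fderiv ℝ f (T x)).comp T := fun x =>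
    ((hf.differentiable (by simp) (T x)).hasFDerivAt.comp x T.hasFDerivAt).fderiv
  have h2 : ∀ v w, fderiv ℝ (fderiv ℝ (fun x => f (T x))) x v w
      = fderiv ℝ (fderiv ℝ f) (T x) (T v) (T w) := by
    intro v w
    have h3 : HasFDerivAt (fun x => (fderiv ℝ f (T x)).comp T) _ x :=
      (((differentiable_fderiv hf (T x)).hasFDerivAt.comp x T.hasFDerivAt)).clm_comp
        (hasFDerivAt_const T x)
    rw [funext h1, h3.fderiv]
    simp
  have hfT : ContDiff ℝ ∞ fun x => f (T x) := hf.comp T.contDiff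
  rw [G.vigneras_eq p _ hfT, G.vigneras_eq q _ hf, h1]
  simp only [h2]
  rw [hT]
  rfl

theorem reindexL_single {n k : ℕ} {e : Fin k → Fin n} (he : Function.Injective e) (i : Fin k)
    (w : Fin b → ℝ) :
    reindexL e (Pi.single (e i) w : Coord n b) = (Pi.single i w : Coord k b) := by
  funext j
  rw [reindexL_apply]
  by_cases hj : j = i
  · subst hj
    simp
  · simp [Pi.single_eq_of_ne hj, Pi.single_eq_of_ne (he.ne hj)]

theorem reindexL_single_of_notMem {n k : ℕ} {e : Fin k → Fin n} {i : Fin n}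
    (hi : i ∉ Set.range e) (w : Fin b → ℝ) :
    reindexL e (Pi.single i w : Coord n b) = (0 : Coord k b) := by
  funext j
  rw [reindexL_apply]
  have : e j ≠ i := fun h => hi ⟨j, h⟩
  simp [Pi.single_eq_of_ne this]

theorem Geometry.isCometricMap_reindexL (G : Geometry b) {n k : ℕ} (p : Fin n → Fin b → ℤ)
    {e : Fin k → Fin n} (he : Function.Injective e) : G.IsCometricMap p (p ∘ e) (reindexL e) := by
  intro B
  rw [G.cometric_eq p fun w => ⟨fun x y => by simp, fun r x => by simp⟩,
    G.cometric_eq (p ∘ e) fun w => ⟨fun x y => by simp, fun r x => by simp⟩]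
  rw [← Finset.sum_subset (Finset.subset_univ (Finset.univ.map ⟨e, he⟩)), Finset.sum_map]
  · refine Finset.sum_congr rfl fun i _ => Finset.sum_congr rfl fun a _ => ?_
    simp only [Geometry.dualDir, coordDir, Function.Embedding.coeFn_mk, reindexL_single he, Function.comp]
  · intro i _ hi
    refine Finset.sum_eq_zero fun a _ => ?_
    rw [Geometry.dualDir, reindexL_single_of_notMem (by simpa using hi)]
    simp

theorem merge_single {n m : ℕ} (f : Fin n → Fin m) {A : Type*} [AddCommMonoid A] (i : Fin n)
    (w : A) : merge f (Pi.single i w) = Pi.single (f i) w := by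
  funext k
  rw [merge, Finset.sum_filter, Finset.sum_eq_single i]
  · by_cases h : f i = k
    · subst h
      simp
    · simp [h]
  · intro j _ hj
    simp [Pi.single_eq_of_ne hj]
  · simp

theorem Geometry.mergeX_single (G : Geometry b) {n m : ℕ} (f : Fin n → Fin m)
    (p : Fin n → Fin b → ℤ) (i : Fin n) (w : Fin b → ℝ) :
    G.mergeX f p (Pi.single i w)
      = Pi.single (f i) ((kmat G.κ (merge f p (f i)))⁻¹ *ᵥ (kmat G.κ (p i) *ᵥ w)) := by
  have h : (fun j => kmat G.κ (p j) *ᵥ (Pi.single i w : Coord n b) j)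
      = Pi.single i (kmat G.κ (p i) *ᵥ w) := by
    funext j
    by_cases hj : j = i
    · subst hj
      simp
    · simp [Pi.single_eq_of_ne hj]
  funext k
  rw [Geometry.mergeX, h, merge_single]
  by_cases hk : k = f i
  · subst hk
    simp
  · simp [Pi.single_eq_of_ne hk]

/-- `mergeX` adds the vectors `κ_i x_i`, so a direction dual to a coordinate of a charge goes to the
one dual to the same coordinate of its cluster, whichever charge of the cluster it came from. -/
theorem Geometry.mergeX_dualDir (G : Geometry b) {n m : ℕ} (f : Fin n → Fin m)
    {p : Fin n → Fin b → ℤ} (hp : ∀ i, p i ∈ G.D4) (i : Fin n) (a : Fin b) :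
    G.mergeX f p (G.dualDir p i a) = G.dualDir (merge f p) (f i) a := by
  rw [Geometry.dualDir, G.mergeX_single, Matrix.mulVec_mulVec (M := kmat G.κ (p i)),
    Matrix.mul_nonsing_inv _ (G.isUnit_det (hp i)), Matrix.one_mulVec, Geometry.dualDir]

/-- Dual directions in one cluster have the same image, so the coordinate directions may be summed
over the cluster first. As the `κ_i` of a cluster add up to its total form, that sum is the
coordinate direction of the cluster. -/
theorem Geometry.isCometricMap_mergeXL (G : Geometry b) {n m : ℕ} {f : Fin n → Fin m}
    (hf : Function.Surjective f) {p : Fin n → Fin b → ℤ} (hp : ∀ i, p i ∈ G.D4) :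
    G.IsCometricMap p (merge f p) (G.mergeXL f p) := by
  intro B
  rw [G.cometric_eq p fun w => ⟨fun x y => by simp, fun r x => by simp⟩,
    G.cometric_eq (merge f p) fun w => ⟨fun x y => by simp, fun r x => by simp⟩]
  simp only [G.mergeXL_apply, G.mergeX_dualDir f hp]
  rw [← Finset.sum_fiberwise Finset.univ f]
  refine Finset.sum_congr rfl fun k _ => ?_
  rw [Finset.sum_comm]
  refine Finset.sum_congr rfl fun a _ => ?_
  have h1 : ∀ i ∈ Finset.univ.filter (f · = k),
      B (G.dualDir (merge f p) (f i) a) (G.mergeX f p (coordDir i a))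
        = B (G.dualDir (merge f p) k a) (G.mergeX f p (coordDir i a)) := by
    intro i hi
    rw [(Finset.mem_filter.mp hi).2]
  rw [Finset.sum_congr rfl h1, ← map_sum]
  congr 1
  have h2 : ∀ i ∈ Finset.univ.filter (f · = k), G.mergeX f p (coordDir i a)
      = Pi.single k ((kmat G.κ (merge f p k))⁻¹ *ᵥ (kmat G.κ (p i) *ᵥ Pi.single a 1)) := by
    intro i hi
    rw [coordDir, G.mergeX_single, (Finset.mem_filter.mp hi).2]
  rw [Finset.sum_congr rfl h2]
  funext j
  rw [Finset.sum_apply]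
  by_cases hj : j = k
  · subst hj
    simp only [Pi.single_eq_same, coordDir]
    rw [← Matrix.mulVec_sum, ← Matrix.sum_mulVec, ← G.kmat_sum]
    change (kmat G.κ (merge f p j))⁻¹ *ᵥ (kmat G.κ (merge f p j) *ᵥ _) = _
    rw [Matrix.mulVec_mulVec, Matrix.nonsing_inv_mul _ (G.isUnit_det (G.merge_mem_D4 hp hf j)),
      Matrix.one_mulVec]
  · simp [coordDir, Pi.single_eq_of_ne hj]


/-! ### The completed kernels solve Vignéras' equation in every chamber -/

theorem fderiv_comp_clm {n m : ℕ} (T : Coord n b →L[ℝ] Coord m b) {f : Coord m b → ℝ}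
    (hf : ContDiff ℝ ∞ f) (x v : Coord n b) :
    fderiv ℝ (fun x => f (T x)) x v = fderiv ℝ f (T x) (T v) := by
  have : fderiv ℝ (fun x => f (T x)) x = (fderiv ℝ f (T x)).comp T :=
    ((hf.differentiable (by simp) (T x)).hasFDerivAt.comp x T.hasFDerivAt).fderiv
  rw [this]
  rfl

theorem Geometry.gradPair_eq (G : Geometry b) {n : ℕ} (p : Fin n → Fin b → ℤ)
    (f g : Coord n b → ℝ) (x : Coord n b) : G.gradPair p f g x
      = ∑ i, ∑ a, fderiv ℝ f x (G.dualDir p i a) * fderiv ℝ g x (coordDir i a) :=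
  G.cometric_eq p (B := fun v w => fderiv ℝ f x v * fderiv ℝ g x w)
    fun w => ⟨fun y z => by simp [add_mul], fun r y => by simp [mul_assoc]⟩

theorem Geometry.gradPair_disjoint (G : Geometry b) {n k k' : ℕ} (p : Fin n → Fin b → ℤ)
    {e : Fin k → Fin n} {e' : Fin k' → Fin n} (he : ∀ i j, e i ≠ e' j) {f : Coord k b → ℝ}
    {g : Coord k' b → ℝ} (hf : ContDiff ℝ ∞ f) (hg : ContDiff ℝ ∞ g) (x : Coord n b) :
    G.gradPair p (fun x => f (reindexL e x)) (fun x => g (reindexL e' x)) x = 0 := by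
  rw [G.gradPair_eq]
  refine Finset.sum_eq_zero fun i _ => Finset.sum_eq_zero fun a _ => ?_
  rw [fderiv_comp_clm _ hf, fderiv_comp_clm _ hg]
  by_cases hi : i ∈ Set.range e
  · obtain ⟨j, rfl⟩ := hi
    rw [coordDir, reindexL_single_of_notMem (e := e') (by rintro ⟨l, hl⟩; exact he _ _ hl.symm)]
    simp
  · rw [Geometry.dualDir, reindexL_single_of_notMem hi]
    simp

theorem Geometry.bil_vVec_const (G : Geometry b) {n : ℕ} (p : Fin n → Fin b → ℤ) (i j : Fin n)
    (w : Fin b → ℝ) : G.bil p (vVec p i j) (fun _ => w) = 0 := by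
  rw [G.bil_vVec, G.cub_swap_left, sub_self]

/-- In dual directions the derivative of a function of the merged coordinates is the same for all
members of a cluster. The pairing therefore differentiates `g` along the diagonal of its block,
where it is constant. -/
theorem Geometry.gradPair_merge_block (G : Geometry b) {n : ℕ} (bl : Composition n)
    {p : Fin n → Fin b → ℤ} (hp : ∀ i, p i ∈ G.D4) (k : Fin bl.length)
    {f : Coord bl.length b → ℝ} {g : Coord (bl.blocksFun k) b → ℝ} (hf : ContDiff ℝ ∞ f)
    (hg : ContDiff ℝ ∞ g) (hinv : ∀ y w, g (y + fun _ => w) = g y) (x : Coord n b) :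
    G.gradPair p (fun x => f (G.mergeXL bl.index p x))
      (fun x => g (reindexL (bl.embedding k) x)) x = 0 := by
  have hinj := (bl.embedding k).injective
  -- Infinitesimal form of the invariance under common translations.
  have hdiag : ∀ y w, fderiv ℝ g y (fun _ => w) = 0 := by
    intro y w
    have h1 : HasDerivAt (fun r : ℝ => g (y + r • fun _ => w)) (fderiv ℝ g y (fun _ => w)) 0 := by
      have h := ((hasDerivAt_id (0 : ℝ)).smul_const (fun _ => w : Coord (bl.blocksFun k) b)).const_add
        y
      have h' : HasFDerivAt g (fderiv ℝ g y) (y + (0 : ℝ) • fun _ => w) := by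
        rw [zero_smul, add_zero]
        exact (hg.differentiable (by simp) y).hasFDerivAt
      have h3 := h'.comp_hasDerivAt (0 : ℝ) h
      rw [one_smul] at h3
      exact h3
    have h2 : (fun r : ℝ => g (y + r • fun _ => w)) = fun _ => g y := by
      funext r
      exact hinv y (r • w)
    rw [h2] at h1
    exact h1.unique (hasDerivAt_const _ _)
  rw [G.gradPair_eq, Finset.sum_comm]
  refine Finset.sum_eq_zero fun a _ => ?_
  simp only [fderiv_comp_clm _ hf, fderiv_comp_clm _ hg]
  simp only [G.mergeXL_apply, G.mergeX_dualDir _ hp]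
  rw [← Finset.sum_subset (Finset.subset_univ (Finset.univ.map (bl.embedding k).toEmbedding)),
    Finset.sum_map]
  · simp only [RelEmbedding.coe_toEmbedding, bl.index_embedding, coordDir]
    simp_rw [show ∀ j, reindexL (bl.embedding k)
      (Pi.single (bl.embedding k j) (Pi.single a 1) : Coord n b)
        = (Pi.single j (Pi.single a 1) : Coord (bl.blocksFun k) b) from
        fun j => reindexL_single hinj j _]
    rw [← Finset.mul_sum, ← map_sum]
    have : ∑ j, (Pi.single j (Pi.single a 1) : Coord (bl.blocksFun k) b)
        = fun _ => Pi.single a 1 := by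
      funext j
      rw [Finset.sum_apply]
      simp
    rw [this, hdiag, mul_zero]
  · intro i _ hi
    rw [coordDir, reindexL_single_of_notMem (e := bl.embedding k) (by simpa using hi)]
    simp

namespace KernelSystem

variable {G : Geometry b} {g0 : ∀ n, (Fin n → Charge b) → (Fin n → ℝ) → ℝ}
  {E R : ∀ n, (Fin n → Charge b) → ℝ → ℝ} {σ : Charge b → ℝ}
  {Φ0 : ∀ n, (Fin n → Fin b → ℤ) → Coord n b → (Fin n → ℝ) → ℝ}
  {ΦE : ∀ n, (Fin n → Fin b → ℤ) → Coord n b → ℝ}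

theorem translation_invariant (K : KernelSystem G g0 E R σ Φ0 ΦE) {n : ℕ} (hn : 1 ≤ n)
    {p : Fin n → Fin b → ℤ} (hp : ∀ i, p i ∈ G.D4) (y : Coord n b) (w : Fin b → ℝ) :
    ΦE n p (y + fun _ => w) = ΦE n p y := by
  refine K.invariant n hn p hp _ _ fun i j => ?_
  rw [← G.bilL_apply, map_add, G.bilL_apply, G.bilL_apply, G.bil_vVec_const, add_zero]

/-- Each term of the ansatz is a function of the merged coordinates times functions of the separate
blocks. These have pairwise orthogonal gradients and solve the equation separately, with weights `m
- 1` and `n_k - 1` that add up to `n - 1`. -/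
theorem vigneras_ghatKernel (K : KernelSystem G g0 E R σ Φ0 ΦE) {n : ℕ} (hn : 1 ≤ n)
    {p : Fin n → Fin b → ℤ} (hp : ∀ i, p i ∈ G.D4) {c : Fin n → ℝ} (hc : ∑ i, c i = 0)
    (hg : GenericStab c) (x : Coord n b) :
    G.vigneras p ((n : ℝ) - 1) (fun x => G.ghatKernel Φ0 ΦE n p x c) x = 0 := by
  induction n using Nat.strong_induction_on with
  | _ n ih =>
    let A : ∀ (s : Equiv.Perm (Fin n)) (bl : Composition n), Coord n b → ℝ := fun s bl y =>
      G.ghatKernel Φ0 ΦE bl.length (merge bl.index (p ∘ s)) (G.mergeXL bl.index (p ∘ s) y)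
        (merge bl.index (c ∘ s))
    let B : ∀ (s : Equiv.Perm (Fin n)) (bl : Composition n), Fin bl.length → Coord n b → ℝ :=
      fun s bl k y => ΦE (bl.blocksFun k) (p ∘ s ∘ bl.embedding k) (reindexL (bl.embedding k) y)
    have hps : ∀ s : Equiv.Perm (Fin n), ∀ i, (p ∘ s) i ∈ G.D4 := fun s i => hp _
    have hcs : ∀ s : Equiv.Perm (Fin n), ∑ i, (c ∘ s) i = 0 := fun s => by
      rw [← hc]
      exact Equiv.sum_comp s c
    have hgs : ∀ s : Equiv.Perm (Fin n), GenericStab (c ∘ s) := fun s => by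
      rw [comp_perm_eq_merge]
      exact hg.merge s.symm.surjective
    have hAker : ∀ (s : Equiv.Perm (Fin n)) (bl : Composition n), ContDiff ℝ ∞ fun y =>
        G.ghatKernel Φ0 ΦE bl.length (merge bl.index (p ∘ s)) y (merge bl.index (c ∘ s)) := by
      intro s bl
      refine K.contDiff_ghatKernel (one_le_length hn bl)
        (G.merge_mem_D4 (hps s) (index_surjective bl)) ?_ ((hgs s).merge (index_surjective bl))
      rw [sum_univ_merge, hcs]
    have hBker : ∀ (s : Equiv.Perm (Fin n)) (bl : Composition n) k,
        ContDiff ℝ ∞ (ΦE (bl.blocksFun k) (p ∘ s ∘ bl.embedding k)) := fun s bl k =>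
      (K.vigneras _ (bl.one_le_blocksFun k) _ fun i => hp _).1
    have hA : ∀ s bl, ContDiff ℝ ∞ (A s bl) := fun s bl => (hAker s bl).comp (G.mergeXL _ _).contDiff
    have hB : ∀ s bl k, ContDiff ℝ ∞ (B s bl k) := fun s bl k =>
      (hBker s bl k).comp (reindexL _).contDiff
    have hAB : ∀ (s : Equiv.Perm (Fin n)) (bl : Composition n), ContDiff ℝ ∞ fun y => A s bl y * ∏ k, B s bl k y :=
      fun s bl => (hA s bl).mul (contDiff_prod fun k _ => hB s bl k)
    have hterm : ∀ (s : Equiv.Perm (Fin n)) (bl : Composition n), bl.length < n → ∀ y,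
        G.vigneras (p ∘ s) ((n : ℝ) - 1) (fun y => A s bl y * ∏ k, B s bl k y) y = 0 := by
      intro s bl hbl y
      -- The weights match because the block sizes sum up to `n`.
      have hdeg : (n : ℝ) - 1 = ((bl.length : ℝ) - 1) + ∑ k, ((bl.blocksFun k : ℝ) - 1) := by
        rw [Finset.sum_sub_distrib, ← Nat.cast_sum, bl.sum_blocksFun]
        simp
      rw [hdeg, G.vigneras_mul (p ∘ s) _ _ (hA s bl) (contDiff_prod fun k _ => hB s bl k)]
      have h1 : G.vigneras (p ∘ s) ((bl.length : ℝ) - 1) (A s bl) y = 0 := by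
        have := (G.isCometricMap_mergeXL (index_surjective bl) (hps s)).vigneras_comp
          ((bl.length : ℝ) - 1) (hAker s bl) y
        refine this.trans (ih bl.length hbl (one_le_length hn bl)
          (G.merge_mem_D4 (hps s) (index_surjective bl)) ?_ ((hgs s).merge (index_surjective bl)) _)
        rw [sum_univ_merge, hcs]
      have h2 : G.vigneras (p ∘ s) (∑ k, ((bl.blocksFun k : ℝ) - 1)) (fun y => ∏ k, B s bl k y) y
          = 0 := by
        refine G.vigneras_prod_eq_zero (p ∘ s) Finset.univ (hB s bl) y (fun k _ => ?_)
          fun k _ k' _ hk => ?_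
        · have := (G.isCometricMap_reindexL (p ∘ s) (bl.embedding k).injective).vigneras_comp
            ((bl.blocksFun k : ℝ) - 1) (hBker s bl k) y
          exact this.trans ((K.vigneras _ (bl.one_le_blocksFun k) _ fun i => hp _).2 _)
        · refine G.gradPair_disjoint (p ∘ s) (fun i j h => hk ?_) (hBker s bl k) (hBker s bl k') y
          have := congrArg bl.index h
          rwa [bl.index_embedding, bl.index_embedding] at this
      have h3 : G.gradPair (p ∘ s) (A s bl) (fun y => ∏ k, B s bl k y) y = 0 :=
        G.gradPair_prod_eq_zero (p ∘ s) Finset.univ (hB s bl) y fun k _ =>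
          G.gradPair_merge_block bl (hps s) k (hAker s bl) (hBker s bl k)
            (K.translation_invariant (bl.one_le_blocksFun k) fun i => hp _) y
      rw [h1, h2, h3]
      simp
    -- A reordering of the charges is a cometric map, so the equation carries over from the order
    -- `s` to the given one.
    have hterm' : ∀ (s : Equiv.Perm (Fin n)) (bl : Composition n), bl.length < n →
        G.vigneras p ((n : ℝ) - 1)
          (fun x => A s bl (reindexL s x) * ∏ k, B s bl k (reindexL s x)) x = 0 := fun s bl hbl =>
      ((G.isCometricMap_reindexL p s.injective).vigneras_comp ((n : ℝ) - 1) (hAB s bl) x).trans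
        (hterm s bl hbl _)
    have hsm : ∀ (s : Equiv.Perm (Fin n)) (bl : Composition n),
        ContDiff ℝ ∞ fun x => A s bl (reindexL s x) * ∏ k, B s bl k (reindexL s x) := fun s bl =>
      (hAB s bl).comp (reindexL s).contDiff
    have heq : (fun x => G.ghatKernel Φ0 ΦE n p x c) = fun x => Φ0 n p x c
        - (n.factorial : ℝ)⁻¹ * ∑ s : Equiv.Perm (Fin n),
          ∑ bl : {bl : Composition n // bl.length < n},
            A s bl.1 (reindexL s x) * ∏ k, B s bl.1 k (reindexL s x) := by
      funext x
      rw [Geometry.ghatKernel]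
      rfl
    rw [heq, G.vigneras_sub p _ (K.contDiff_seed hn hp hc hg) (contDiff_const.mul
      (ContDiff.sum fun s _ => ContDiff.sum fun bl _ => hsm s bl.1)), K.vigneras_seed hn hp hc hg,
      G.vigneras_const_mul p _ _ (ContDiff.sum fun s _ => ContDiff.sum fun bl _ => hsm s bl.1),
      G.vigneras_sum p _ _ fun s _ => ContDiff.sum fun bl _ => hsm s bl.1]
    have h0 : ∀ s : Equiv.Perm (Fin n), G.vigneras p ((n : ℝ) - 1)
        (fun x => ∑ bl : {bl : Composition n // bl.length < n},
          A s bl.1 (reindexL s x) * ∏ k, B s bl.1 k (reindexL s x)) x = 0 := by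
      intro s
      rw [G.vigneras_sum p _ _ fun bl _ => hsm s bl.1]
      exact Finset.sum_eq_zero fun bl _ => hterm' s bl.1 bl.2
    simp [h0]

end KernelSystem

/-! ### The first charges in a given order -/

/-- The set of the first `ℓ` charges in the order `s`. -/
def cutSet {n : ℕ} (s : Equiv.Perm (Fin n)) (ℓ : Fin n) : Finset (Fin n) :=
  (Finset.univ.filter (· < ℓ)).map s.toEmbedding

theorem sum_cutSet {A : Type*} [AddCommMonoid A] {n : ℕ} (s : Equiv.Perm (Fin n)) (ℓ : Fin n)
    (a : Fin n → A) : ∑ i ∈ cutSet s ℓ, a i = ∑ i with i < ℓ, a (s i) := by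
  simp [cutSet]

theorem partialSum_comp_perm {n : ℕ} (s : Equiv.Perm (Fin n)) (ℓ : Fin n) (c : Fin n → ℝ) :
    partialSum ℓ (c ∘ s) = ∑ i ∈ cutSet s ℓ, c i := by
  rw [partialSum_eq, sum_cutSet]
  rfl

theorem cutSet_nonempty {n : ℕ} (s : Equiv.Perm (Fin n)) {ℓ : Fin n} (hℓ : 0 < (ℓ : ℕ)) :
    (cutSet s ℓ).Nonempty := (filter_lt_nonempty hℓ).map

theorem cutSet_ne_univ {n : ℕ} (s : Equiv.Perm (Fin n)) (ℓ : Fin n) :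
    cutSet s ℓ ≠ Finset.univ := by
  intro h
  have : s ℓ ∈ cutSet s ℓ := by
    rw [h]
    exact Finset.mem_univ _
  simp [cutSet] at this

theorem bigGamma_comp_perm {n : ℕ} (s : Equiv.Perm (Fin n)) (ℓ : Fin n) (γ : Fin n → Charge b) :
    bigGamma ℓ (γ ∘ s) = ∑ i ∈ cutSet s ℓ, beta γ i := by
  rw [bigGamma_eq, beta_comp_perm, sum_cutSet]
  rfl

theorem flow_comp_perm {n : ℕ} (s : Equiv.Perm (Fin n)) (ℓ : Fin n) (γ : Fin n → Charge b)
    (c : Fin n → ℝ) : flow ℓ (γ ∘ s) (c ∘ s) = flowSub γ c (cutSet s ℓ) ∘ s := by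
  funext i
  rw [flow, bigGamma_comp_perm, partialSum_comp_perm, beta_comp_perm]
  rfl

theorem map_head_ssubset {n : ℕ} (s : Equiv.Perm (Fin n)) (ℓ : Fin n) {K : Finset (Fin ℓ)}
    (hK : K ≠ Finset.univ) : K.image (s ∘ head ℓ) ⊂ cutSet s ℓ := by
  rw [Finset.ssubset_iff_of_subset]
  · obtain ⟨j, hj⟩ := not_forall.mp (mt Finset.eq_univ_iff_forall.mpr hK)
    refine ⟨s (head ℓ j), by simp [cutSet, head_lt], ?_⟩
    simp only [Finset.mem_image, not_exists, not_and, Function.comp]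
    intro k hk h
    exact hj (head_injective ℓ (s.injective h) ▸ hk)
  · intro i hi
    obtain ⟨k, -, rfl⟩ := Finset.mem_image.mp hi
    simp [cutSet, head_lt]

theorem map_tail_ssubset {n : ℕ} (s : Equiv.Perm (Fin n)) (ℓ : Fin n) {K : Finset (Fin (n - ℓ))}
    (hK : K ≠ Finset.univ) : K.image (s ∘ tail ℓ) ⊂ (cutSet s ℓ)ᶜ := by
  have h : ∀ j, s (tail ℓ j) ∈ (cutSet s ℓ)ᶜ := by
    intro j
    simpa [cutSet] using le_of_not_gt (not_tail_lt ℓ j)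
  rw [Finset.ssubset_iff_of_subset]
  · obtain ⟨j, hj⟩ := not_forall.mp (mt Finset.eq_univ_iff_forall.mpr hK)
    refine ⟨s (tail ℓ j), h j, ?_⟩
    simp only [Finset.mem_image, not_exists, not_and, Function.comp]
    intro k hk h
    exact hj (tail_injective ℓ (s.injective h) ▸ hk)
  · intro i hi
    obtain ⟨k, -, rfl⟩ := Finset.mem_image.mp hi
    exact h k

theorem sum_image_comp {A : Type*} [AddCommMonoid A] {n k : ℕ} (s : Equiv.Perm (Fin n))
    {e : Fin k → Fin n} (he : Function.Injective e) (K : Finset (Fin k)) (a : Fin n → A) :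
    ∑ i ∈ K.image (s ∘ e), a i = ∑ j ∈ K, a (s (e j)) :=
  Finset.sum_image fun _ _ _ _ h => he (s.injective h)

/-! ### Simple walls -/

/-- The parameters lie on the wall of `I` and its complement, and on no other wall. -/
structure SimpleWall {n : ℕ} (I : Finset (Fin n)) (c : Fin n → ℝ) : Prop where
  sum_univ : ∑ i, c i = 0
  sum_eq : ∑ i ∈ I, c i = 0
  eq_or_eq : ∀ J : Finset (Fin n), J.Nonempty → J ≠ Finset.univ → ∑ i ∈ J, c i = 0 →
    J = I ∨ J = Iᶜ
  nonempty : I.Nonempty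
  ne_univ : I ≠ Finset.univ

/-- The parameters are generic, and adjacent to the point `c` of a wall. -/
structure Adjacent {n : ℕ} (c c' : Fin n → ℝ) : Prop where
  sum_univ : ∑ i, c' i = 0
  pos : ∀ J : Finset (Fin n), 0 < ∑ i ∈ J, c i → 0 < ∑ i ∈ J, c' i

theorem Adjacent.neg {n : ℕ} {c c' : Fin n → ℝ} (h : Adjacent c c') (hc : ∑ i, c i = 0)
    {J : Finset (Fin n)} (hJ : ∑ i ∈ J, c i < 0) : ∑ i ∈ J, c' i < 0 := by
  have := h.pos Jᶜ
  rw [sum_compl_eq_neg hc, sum_compl_eq_neg h.sum_univ] at this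
  linarith [this (by linarith)]

/-- Adjacent parameters on the same side of a simple wall are in the same chamber. -/
theorem SimpleWall.sameChamber {n : ℕ} {I : Finset (Fin n)} {c c' c'' : Fin n → ℝ}
    (h : SimpleWall I c) (h' : Adjacent c c') (h'' : Adjacent c c'')
    (hI : 0 < (∑ i ∈ I, c' i) * ∑ i ∈ I, c'' i) : SameChamber c' c'' := by
  intro J
  rcases lt_trichotomy (∑ i ∈ J, c i) 0 with h1 | h1 | h1
  · exact iff_of_false (h'.neg h.sum_univ h1).not_gt (h''.neg h.sum_univ h1).not_gt
  · have hI' : 0 < ∑ i ∈ I, c' i ↔ 0 < ∑ i ∈ I, c'' i :=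
      ⟨fun h1 => pos_of_mul_pos_right hI h1.le, fun h1 => pos_of_mul_pos_left hI h1.le⟩
    by_cases hJ : J.Nonempty
    · by_cases hJ' : J = Finset.univ
      · rw [hJ', h'.sum_univ, h''.sum_univ]
      · rcases h.eq_or_eq J hJ hJ' h1 with rfl | rfl
        · exact hI'
        · rw [sum_compl_eq_neg h'.sum_univ, sum_compl_eq_neg h''.sum_univ]
          have hne : ∑ i ∈ I, c' i ≠ 0 := fun h0 => by simp [h0] at hI
          have hne' : ∑ i ∈ I, c'' i ≠ 0 := fun h0 => by simp [h0] at hI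
          constructor
          · intro h2
            by_contra h3
            have : 0 < ∑ i ∈ I, c'' i := lt_of_le_of_ne (by linarith) hne'.symm
            linarith [hI'.mpr this]
          · intro h2
            by_contra h3
            have : 0 < ∑ i ∈ I, c' i := lt_of_le_of_ne (by linarith) hne.symm
            linarith [hI'.mp this]
    · rw [Finset.not_nonempty_iff_eq_empty.mp hJ]
      simp
  · exact iff_of_true (h'.pos J h1) (h''.pos J h1)

theorem SimpleWall.genericStab {n : ℕ} {I : Finset (Fin n)} {c c' : Fin n → ℝ}
    (h : SimpleWall I c) (h' : Adjacent c c') (hI : ∑ i ∈ I, c' i ≠ 0) : GenericStab c' := by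
  intro J hJ hJ'
  rcases lt_trichotomy (∑ i ∈ J, c i) 0 with h1 | h1 | h1
  · exact (h'.neg h.sum_univ h1).ne
  · rcases h.eq_or_eq J hJ hJ' h1 with rfl | rfl
    · exact hI
    · rw [sum_compl_eq_neg h'.sum_univ]
      exact neg_ne_zero.mpr hI
  · exact (h'.pos J h1).ne'

/-- The part of the parameters on one side of a simple wall is generic. -/
theorem SimpleWall.restrict {n k : ℕ} {I : Finset (Fin n)} {c : Fin n → ℝ}
    (h : SimpleWall I c) {e : Fin k → Fin n} (he : Function.Injective e)
    (hr : Finset.univ.image e = I ∨ Finset.univ.image e = Iᶜ) :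
    ∑ j, (c ∘ e) j = 0 ∧ GenericStab (c ∘ e) := by
  have hs : ∀ K : Finset (Fin k), ∑ j ∈ K, (c ∘ e) j = ∑ i ∈ K.image e, c i := fun K =>
    (Finset.sum_image fun _ _ _ _ h => he h).symm
  refine ⟨?_, fun K hK hK' h0 => ?_⟩
  · rw [hs]
    rcases hr with hr | hr
    · rw [hr, h.sum_eq]
    · rw [hr, sum_compl_eq_neg h.sum_univ, h.sum_eq, neg_zero]
  · rw [hs] at h0
    have hlt : K.image e ⊂ Finset.univ.image e :=
      Finset.image_ssubset_image he |>.mpr (Finset.ssubset_univ_iff.mpr hK')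
    have hnu : K.image e ≠ Finset.univ := by
      rintro h1
      rw [h1] at hlt
      exact hlt.2 (Finset.subset_univ _)
    rcases h.eq_or_eq _ (hK.image e) hnu h0 with h1 | h1 <;> rcases hr with hr | hr <;>
      rw [h1, hr] at hlt
    · exact hlt.ne rfl
    · obtain ⟨i, hi⟩ := hK.image e
      rw [h1] at hi
      exact absurd (hlt.1 hi) (by simpa using hi)
    · obtain ⟨i, hi⟩ := hK.image e
      rw [h1] at hi
      exact absurd (hlt.1 hi) (by simpa using hi)
    · exact hlt.ne rfl

theorem image_head {n : ℕ} (s : Equiv.Perm (Fin n)) (ℓ : Fin n) :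
    Finset.univ.image (s ∘ head ℓ) = cutSet s ℓ := by
  ext i
  simp only [cutSet, Finset.mem_image, Finset.mem_univ, true_and, Function.comp, Finset.mem_map,
    Finset.mem_filter, Equiv.coe_toEmbedding]
  constructor
  · rintro ⟨j, rfl⟩
    exact ⟨_, head_lt ℓ j, rfl⟩
  · rintro ⟨j, hj, rfl⟩
    obtain ⟨k, rfl⟩ := exists_head ℓ hj
    exact ⟨k, rfl⟩

theorem image_tail {n : ℕ} (s : Equiv.Perm (Fin n)) (ℓ : Fin n) :
    Finset.univ.image (s ∘ tail ℓ) = (cutSet s ℓ)ᶜ := by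
  ext i
  simp only [cutSet, Finset.mem_image, Finset.mem_univ, true_and, Function.comp, Finset.mem_map,
    Finset.mem_filter, Equiv.coe_toEmbedding, Finset.mem_compl, not_exists, not_and]
  constructor
  · rintro ⟨j, rfl⟩ k hk h
    rw [s.injective h] at hk
    exact not_tail_lt ℓ j hk
  · intro h
    obtain ⟨k, hk⟩ := exists_tail ℓ (fun h' => h (s.symm i) h' (s.apply_symm_apply i))
    exact ⟨k, by rw [hk, s.apply_symm_apply]⟩


/-! ### The discontinuity at a simple wall -/

/-- Provides parameters arbitrarily close to a point of the wall, on the side given by the sign of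
`ε`, inside a prescribed open dense set: near `c` that side contains an open set. -/
theorem exists_adjacent {n : ℕ} {I : Finset (Fin n)} {c : Fin n → ℝ} (h : SimpleWall I c)
    {Q : zeroSum n → Prop} (hQ : OpenDense {d | Q d}) {N : Set (zeroSum n)}
    (hN : N ∈ nhds (⟨c, h.sum_univ⟩ : zeroSum n)) {ε : ℝ} (hε : ε ≠ 0) :
    ∃ d ∈ N, Q d ∧ Adjacent c (d : Fin n → ℝ) ∧ 0 < ε * ∑ i ∈ I, (d : Fin n → ℝ) i := by
  set x : zeroSum n := ⟨c, h.sum_univ⟩ with hx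
  have hcont : ∀ J : Finset (Fin n), Continuous fun d : zeroSum n => ∑ i ∈ J, (d : Fin n → ℝ) i :=
    fun J => by fun_prop
  have hadj : ∀ᶠ d : zeroSum n in nhds x, Adjacent c (d : Fin n → ℝ) := by
    have h1 : ∀ᶠ d : zeroSum n in nhds x, ∀ J : Finset (Fin n), 0 < ∑ i ∈ J, c i →
        0 < ∑ i ∈ J, (d : Fin n → ℝ) i := by
      rw [eventually_all]
      intro J
      by_cases hJ : 0 < ∑ i ∈ J, c i
      · filter_upwards [(hcont J).continuousAt.eventually (lt_mem_nhds (show 0 < ∑ i ∈ J,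
          (x : Fin n → ℝ) i from hJ))] with d hd _ using hd
      · exact Eventually.of_forall fun d hd => absurd hd hJ
    filter_upwards [h1] with d hd using ⟨d.2, hd⟩
  obtain ⟨V, hV, hVo, hxV⟩ := mem_nhds_iff.mp (inter_mem hN hadj)
  set S : Set (zeroSum n) := {d | 0 < ε * ∑ i ∈ I, (d : Fin n → ℝ) i} with hS
  have hSo : IsOpen S := isOpen_lt continuous_const (continuous_const.mul (hcont I))
  obtain ⟨i, hi⟩ := h.nonempty
  obtain ⟨j, hj⟩ := not_forall.mp (mt Finset.eq_univ_iff_forall.mpr h.ne_univ)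
  -- Moving along `v` changes the sum over `I` at the rate `ε`.
  let v : zeroSum n := ε • ⟨_, single_sub_single_mem i j⟩
  have hv : ∀ t : ℝ, ∑ k ∈ I, ((x + t • v : zeroSum n) : Fin n → ℝ) k = t * ε := by
    intro t
    have h1 := sum_single_sub_single i j I
    rw [if_pos hi, if_neg hj, sub_zero] at h1
    simp only [Submodule.coe_add, Submodule.coe_smul, Pi.add_apply, Pi.smul_apply, smul_eq_mul,
      Finset.sum_add_distrib, ← Finset.mul_sum, v]
    rw [h1, show ∑ k ∈ I, (x : Fin n → ℝ) k = 0 from h.sum_eq]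
    ring
  have hne : (V ∩ S).Nonempty := by
    have h1 : Tendsto (fun t : ℝ => x + t • v) (nhdsWithin 0 (Set.Ioi 0)) (nhds x) := by
      have : Continuous fun t : ℝ => x + t • v := by fun_prop
      have h2 := this.tendsto 0
      rw [zero_smul, add_zero] at h2
      exact h2.mono_left nhdsWithin_le_nhds
    obtain ⟨t, ht, ht0⟩ := ((h1.eventually (hVo.mem_nhds hxV)).and self_mem_nhdsWithin).exists
    refine ⟨_, ht, ?_⟩
    rw [hS, Set.mem_ofPred_eq, hv, mul_left_comm]
    exact mul_pos ht0 (mul_self_pos.mpr hε)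
  obtain ⟨d, hd, hdVS⟩ := hQ.2.exists_mem_open (hVo.inter hSo) hne
  exact ⟨d, (hV hdVS.1).1, hd, (hV hdVS.1).2, hdVS.2⟩

/-- `betaX` as a linear map. -/
noncomputable def Geometry.betaXL (G : Geometry b) {n : ℕ} (p : Fin n → Fin b → ℤ) :
    Coord n b →ₗ[ℝ] Fin n → ℝ :=
  LinearMap.pi fun i => ∑ j, G.bilL p (vVec p j i)

theorem Geometry.betaXL_apply (G : Geometry b) {n : ℕ} (p : Fin n → Fin b → ℤ) (x : Coord n b) :
    G.betaXL p x = G.betaX p x := by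
  funext i
  simp [Geometry.betaXL, Geometry.betaX, LinearMap.sum_apply, G.bilL_apply]

/-- The coordinates at which the parameters at a split of `c` are generic. -/
def Geometry.SplitGeneric (G : Geometry b) {n : ℕ} (p : Fin n → Fin b → ℤ) (I : Finset (Fin n))
    (c : Fin n → ℝ) (x : Coord n b) : Prop :=
  ∀ L J : Finset (Fin n), L.Nonempty → L ≠ Finset.univ → L ≠ I → L ≠ Iᶜ → J.Nonempty →
    J ⊂ L ∨ J ⊂ Lᶜ →
    (∑ i ∈ J, c i) * (∑ i ∈ L, G.betaX p x i) - (∑ i ∈ L, c i) * ∑ i ∈ J, G.betaX p x i ≠ 0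

/-- Each condition is linear in `betaX p x`. If `beta` equals `e_i - e_j`, with `i` in `J` and `j`
outside `J` on the same side of `L`, then the sum over `L` vanishes and the value is `-∑_L c`. This
is nonzero because `c` is on no wall other than that of `I`. -/
theorem Geometry.openDense_splitGeneric (G : Geometry b) {n : ℕ} (hn : 1 ≤ n)
    {p : Fin n → Fin b → ℤ} (hp : ∀ i, p i ∈ G.D4) {I : Finset (Fin n)} {c : Fin n → ℝ}
    (h : SimpleWall I c) : OpenDense {x | G.SplitGeneric p I c x} := by
  refine OpenDense.setOf_forall fun L => OpenDense.setOf_forall fun J =>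
    OpenDense.setOf_imp fun hL => OpenDense.setOf_imp fun hLu => OpenDense.setOf_imp fun hLI =>
    OpenDense.setOf_imp fun hLI' => OpenDense.setOf_imp fun hJ => OpenDense.setOf_imp fun hJL => ?_
  have key := openDense_ne_zero (((∑ i ∈ J, c i) • subsetSum L - (∑ i ∈ L, c i) • subsetSum J).comp
    (G.betaXL p)) ?_
  · simpa only [LinearMap.comp_apply, LinearMap.sub_apply, LinearMap.smul_apply, subsetSum_apply,
      smul_eq_mul, G.betaXL_apply] using key
  · obtain ⟨i, hi⟩ := hJ
    have hcL : ∑ i ∈ L, c i ≠ 0 := fun h0 => by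
      rcases h.eq_or_eq L hL hLu h0 with h1 | h1
      · exact hLI h1
      · exact hLI' h1
    obtain ⟨j, hjJ, hjL⟩ : ∃ j, j ∉ J ∧ (i ∈ L ↔ j ∈ L) := by
      rcases hJL with hJL | hJL
      · obtain ⟨j, hj, hj'⟩ := Finset.exists_of_ssubset hJL
        exact ⟨j, hj', iff_of_true (hJL.1 hi) hj⟩
      · obtain ⟨j, hj, hj'⟩ := Finset.exists_of_ssubset hJL
        exact ⟨j, hj', iff_of_false (Finset.mem_compl.mp (hJL.1 hi)) (Finset.mem_compl.mp hj)⟩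
    obtain ⟨x, hx⟩ := G.exists_betaX_eq hn hp (single_sub_single_mem i j)
    refine ⟨x, ?_⟩
    simp only [LinearMap.comp_apply, LinearMap.sub_apply, LinearMap.smul_apply, subsetSum_apply,
      smul_eq_mul, G.betaXL_apply, hx, sum_single_sub_single, if_pos hi, if_neg hjJ]
    by_cases hiL : i ∈ L
    · rw [if_pos hiL, if_pos (hjL.mp hiL)]
      simpa using hcL
    · rw [if_neg hiL, if_neg (mt hjL.mpr hiL)]
      simpa using hcL

theorem Geometry.bil_vCut (G : Geometry b) {n : ℕ} {γ : Fin n → Charge b}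
    (hγ : ∀ i, (γ i).1 ∈ G.D4) (B : Fin b → ℝ) (τ : ℝ) (s : Equiv.Perm (Fin n)) (ℓ : Fin n) :
    G.bil (fun i => (γ i).1) (vCut (fun i => (γ i).1) s ℓ) (G.point γ B τ)
      = Real.sqrt (2 * τ) * dszLR ℓ (γ ∘ s) := by
  rw [vCut, G.bil_sum_left]
  simp only [G.bil_sum_left, G.bil_vVec_point hγ, dszLR, dsz_sum_left, dsz_sum_right,
    Finset.mul_sum, Function.comp]
  rw [Finset.sum_comm]

/-- The quadratic refinement absorbs the sign of `κ(γ_LR)` into the signs of the two clusters. Since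
`n - 1 = 1 + (ℓ - 1) + (n - ℓ - 1)`, one power of `√(2τ₂)` is left to turn `γ_LR` into `v_ℓ · x`. -/
theorem Geometry.IsQuadraticRefinement.kerFactor_split {G : Geometry b} {σ : Charge b → ℝ}
    (h : G.IsQuadraticRefinement σ) {n : ℕ} {γ : Fin n → Charge b}
    (hγ : ∀ i, γ i ∈ G.chargeSet) {τ : ℝ} (s : Equiv.Perm (Fin n)) {ℓ : Fin n}
    (hℓ : 0 < (ℓ : ℕ)) :
    kerFactor σ γ τ * kap (dszLR ℓ (γ ∘ s)) = Real.sqrt (2 * τ) * dszLR ℓ (γ ∘ s) *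
      (kerFactor σ (γ ∘ s ∘ head ℓ) τ * kerFactor σ (γ ∘ s ∘ tail ℓ) τ) := by
  have hL : ∑ j, (γ ∘ s) (head ℓ j) ∈ G.chargeSet :=
    G.sum_mem_chargeSet (fun j => hγ _) ⟨⟨0, hℓ⟩, Finset.mem_univ _⟩
  have hR : ∑ j, (γ ∘ s) (tail ℓ j) ∈ G.chargeSet :=
    G.sum_mem_chargeSet (fun j => hγ _) ⟨⟨0, by omega⟩, Finset.mem_univ _⟩
  obtain ⟨k, hk⟩ := G.exists_int_dsz hL hR
  have hk' : dszLR ℓ (γ ∘ s) = k := hk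
  have h1 := h.2 _ hL _ hR
  rw [hk] at h1
  have hsum : ∑ j, (γ ∘ s) (head ℓ j) + ∑ j, (γ ∘ s) (tail ℓ j) = ∑ i, γ i := by
    rw [sum_head_add_sum_tail]
    exact Equiv.sum_comp s γ
  rw [hsum] at h1
  have hprod : (∏ j, σ ((γ ∘ s) (head ℓ j))) * ∏ j, σ ((γ ∘ s) (tail ℓ j)) = ∏ i, σ (γ i) := by
    rw [prod_head_mul_prod_tail ℓ fun i => σ ((γ ∘ s) i)]
    exact Equiv.prod_comp s fun i => σ (γ i)
  have hpow : Real.sqrt (2 * τ) ^ (n - 1)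
      = Real.sqrt (2 * τ) * (Real.sqrt (2 * τ) ^ ((ℓ : ℕ) - 1) *
        Real.sqrt (2 * τ) ^ (n - ℓ - 1)) := by
    rw [← pow_add, ← pow_succ']
    congr 1
    omega
  have hσ : σ (∑ i, γ i) * negOnePow k
      = σ (∑ j, (γ ∘ s) (head ℓ j)) * σ (∑ j, (γ ∘ s) (tail ℓ j)) := by
    rw [h1, mul_comm]
  simp only [kerFactor, hk', kap, hpow, ← hprod, Function.comp] at hσ ⊢
  rw [div_mul_div_comm, div_mul_eq_mul_div, mul_div_assoc']
  congr 1
  linear_combination (Real.sqrt (2 * τ) * (Real.sqrt (2 * τ) ^ ((ℓ : ℕ) - 1) *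
        Real.sqrt (2 * τ) ^ (n - ℓ - 1)) * (k : ℝ)) * hσ

namespace KernelSystem

variable {G : Geometry b} {g0 : ∀ n, (Fin n → Charge b) → (Fin n → ℝ) → ℝ}
  {E R : ∀ n, (Fin n → Charge b) → ℝ → ℝ} {σ : Charge b → ℝ}
  {Φ0 : ∀ n, (Fin n → Fin b → ℤ) → Coord n b → (Fin n → ℝ) → ℝ}
  {ΦE : ∀ n, (Fin n → Fin b → ℤ) → Coord n b → ℝ}

/-- Follows from the same property of the kernel, on division by the nonvanishing standard factor.
-/
theorem ghat_eq_of_sameChamber (K : KernelSystem G g0 E R σ Φ0 ΦE) {n : ℕ} (hn : 1 ≤ n)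
    {γ : Fin n → Charge b} (hγ : ∀ i, γ i ∈ G.chargeSet) {τ : ℝ} (hτ : 0 < τ) {c c' : Fin n → ℝ}
    (hc : ∑ i, c i = 0) (hc' : ∑ i, c' i = 0) (hg : GenericStab c) (hcc : SameChamber c c') :
    ghat g0 E n γ c τ = ghat g0 E n γ c' τ := by
  have h1 := K.ghatKernel_point hn hγ 0 hτ hc hg
  have h2 := K.ghatKernel_point hn hγ 0 hτ hc' (hcc.genericStab hc hc' hg)
  rw [K.ghatKernel_eq_of_sameChamber hn (fun i => (hγ i).1) hc hc' hg hcc, h2] at h1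
  exact (mul_left_cancel₀ (K.refinement.kerFactor_ne_zero hn hγ hτ) h1).symm

theorem coefficientRecursion (K : KernelSystem G g0 E R σ Φ0 ΦE) {n : ℕ} (hn : 1 ≤ n)
    {γ : Fin n → Charge b} (hγ : ∀ i, γ i ∈ G.chargeSet) {τ : ℝ} (hτ : 0 < τ) {c : Fin n → ℝ}
    (hc : ∑ i, c i = 0) (h : ∀ (m : Fin (n + 1)) (f : Fin n → Fin m), Function.Surjective f →
      GenericConf m (merge f γ) (merge f c)) : CoefficientRecursion (ghat g0 E) R n γ c τ := by
  refine coefficientRecursion_of_seedRecursion G K.symm K.one (K.recursion τ hτ) hn hγ c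
    fun m f hf => ?_
  have hm : m ≤ n := by simpa using Fintype.card_le_of_surjective f hf
  refine K.seed m ?_ _ (fun k => G.merge_mem_chargeSet hγ hf k) _ (by rw [sum_univ_merge, hc])
    (h ⟨m, by omega⟩ f hf)
  exact Nat.pos_of_ne_zero fun h0 => by
    subst h0
    exact (f ⟨0, hn⟩).elim0

end KernelSystem

theorem SimpleWall.sign_sub_eq_zero {n : ℕ} {I : Finset (Fin n)} {c c₁ c₂ : Fin n → ℝ}
    (h : SimpleWall I c) (h₁ : Adjacent c c₁) (h₂ : Adjacent c c₂) {L : Finset (Fin n)}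
    (hL : L.Nonempty) (hL' : L ≠ Finset.univ) (hLI : ¬ (L = I ∨ L = Iᶜ)) :
    Real.sign (∑ i ∈ L, c₁ i) - Real.sign (∑ i ∈ L, c₂ i) = 0 := by
  rcases lt_trichotomy (∑ i ∈ L, c i) 0 with h1 | h1 | h1
  · rw [Real.sign_of_neg (h₁.neg h.sum_univ h1), Real.sign_of_neg (h₂.neg h.sum_univ h1), sub_self]
  · exact absurd (h.eq_or_eq L hL hL' h1) hLI
  · rw [Real.sign_of_pos (h₁.pos L h1), Real.sign_of_pos (h₂.pos L h1), sub_self]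

theorem SimpleWall.sum_cutSet_eq_zero {n : ℕ} {I : Finset (Fin n)} {c : Fin n → ℝ}
    (h : SimpleWall I c) {L : Finset (Fin n)} (hLI : L = I ∨ L = Iᶜ) : ∑ i ∈ L, c i = 0 := by
  rcases hLI with rfl | rfl
  · exact h.sum_eq
  · rw [sum_compl_eq_neg h.sum_univ, h.sum_eq, neg_zero]

/-- The parameters at any split of a point on a simple wall are generic. -/
theorem Geometry.SplitGeneric.flow {G : Geometry b} {n : ℕ} {γ : Fin n → Charge b}
    (hγ : ∀ i, (γ i).1 ∈ G.D4) {τ : ℝ} (hτ : 0 < τ) (hgood : GoodConf γ) {I : Finset (Fin n)}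
    {c : Fin n → ℝ} (h : SimpleWall I c)
    (hsg : G.SplitGeneric (fun i => (γ i).1) I c (G.point γ 0 τ)) (s : Equiv.Perm (Fin n))
    {ℓ : Fin n} (hℓ : 0 < (ℓ : ℕ)) :
    GenericStab (D4D2.flow ℓ (γ ∘ s) (c ∘ s) ∘ head ℓ) ∧
      GenericStab (D4D2.flow ℓ (γ ∘ s) (c ∘ s) ∘ tail ℓ) := by
  by_cases hw : cutSet s ℓ = I ∨ cutSet s ℓ = Iᶜ
  · have hp0 : partialSum ℓ (c ∘ s) = 0 := by
      rw [partialSum_comp_perm]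
      exact h.sum_cutSet_eq_zero hw
    rw [flow_of_partialSum_eq_zero _ _ hp0]
    refine ⟨(h.restrict (e := s ∘ head ℓ) (s.injective.comp (head_injective ℓ)) ?_).2,
      (h.restrict (e := s ∘ tail ℓ) (s.injective.comp (tail_injective ℓ)) ?_).2⟩
    · rwa [image_head]
    · rw [image_tail]
      rcases hw with hw | hw
      · exact Or.inr (by rw [hw])
      · exact Or.inl (by rw [hw, compl_compl])
  · have hL := cutSet_nonempty s hℓ
    have hL' := cutSet_ne_univ s ℓ
    have hr : 0 < Real.sqrt (2 * τ) := Real.sqrt_pos.mpr (by positivity)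
    have key : ∀ J : Finset (Fin n), J.Nonempty → J ⊂ cutSet s ℓ ∨ J ⊂ (cutSet s ℓ)ᶜ →
        ∑ i ∈ J, flowSub γ c (cutSet s ℓ) i ≠ 0 := by
      intro J hJ hJL h0
      have h1 := hsg (cutSet s ℓ) J hL hL' (fun h => hw (Or.inl h)) (fun h => hw (Or.inr h)) hJ hJL
      apply h1
      have hβ := hgood.sum_beta_ne_zero hL hL'
      simp only [G.betaX_point hγ, Pi.smul_apply, smul_eq_mul, ← Finset.mul_sum]
      simp only [flowSub, Finset.sum_sub_distrib, ← Finset.sum_mul, ← Finset.sum_div] at h0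
      field_simp at h0
      -- Up to the factor `√(2τ₂)`, the condition of `SplitGeneric` is a subset sum of the
      -- parameters at the wall with the denominator cleared.
      linear_combination Real.sqrt (2 * τ) * h0
    rw [flow_comp_perm]
    constructor
    · intro K hK hK'
      have := key _ (hK.image (s ∘ head ℓ)) (Or.inl (map_head_ssubset s ℓ hK'))
      rwa [sum_image_comp s (head_injective ℓ)] at this
    · intro K hK hK'
      have := key _ (hK.image (s ∘ tail ℓ)) (Or.inr (map_tail_ssubset s ℓ hK'))
      rwa [sum_image_comp s (tail_injective ℓ)] at this

theorem continuous_flow {n k : ℕ} (ℓ : Fin n) (γ : Fin n → Charge b) (s : Equiv.Perm (Fin n))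
    (e : Fin k → Fin n) : Continuous fun d : zeroSum n => flow ℓ γ ((d : Fin n → ℝ) ∘ s) ∘ e := by
  refine continuous_pi fun j => ?_
  have h : ∀ i : Fin n, Continuous fun d : zeroSum n => (d : Fin n → ℝ) i := fun i =>
    (continuous_apply i).comp continuous_subtype_val
  exact (h _).sub (continuous_const.mul (continuous_finsetSum _ fun i _ => h _))

theorem eventually_sameChamber {X : Type*} [TopologicalSpace X] {k : ℕ} {f : X → Fin k → ℝ}
    (hf : Continuous f) (hf0 : ∀ x, ∑ i, f x i = 0) {x : X} (hg : GenericStab (f x)) :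
    ∀ᶠ y in nhds x, SameChamber (f x) (f y) :=
  (isOpen_sameChamber (hf0 x) hg hf hf0).mem_nhds (SameChamber.refl _)

/-! ### Jumps of `ghat` and of its kernel across a simple wall. -/

namespace KernelSystem

variable {G : Geometry b} {g0 : ∀ n, (Fin n → Charge b) → (Fin n → ℝ) → ℝ}
  {E R : ∀ n, (Fin n → Charge b) → ℝ → ℝ} {σ : Charge b → ℝ}
  {Φ0 : ∀ n, (Fin n → Fin b → ℤ) → Coord n b → (Fin n → ℝ) → ℝ}
  {ΦE : ∀ n, (Fin n → Fin b → ℤ) → Coord n b → ℝ}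

/-- Subtract the coefficient recursions at parameters on the two sides. `W` and the signs of `γ_LR`
are the same on both sides, and close to the wall the constituents stay in the same chambers, so
only the signs of the partial sums can differ. -/
theorem ghat_jump (K : KernelSystem G g0 E R σ Φ0 ΦE) {n : ℕ} (hn : 1 ≤ n)
    {γ : Fin n → Charge b} (hγ : ∀ i, γ i ∈ G.chargeSet) {τ : ℝ} (hτ : 0 < τ)
    (hgood : GoodConf γ) {I : Finset (Fin n)} {c : Fin n → ℝ} (h : SimpleWall I c)
    (hsg : G.SplitGeneric (fun i => (γ i).1) I c (G.point γ 0 τ)) {c₁ c₂ : Fin n → ℝ}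
    (h₁ : Adjacent c c₁) (h₂ : Adjacent c c₂) (hI₁ : 0 < ∑ i ∈ I, c₁ i)
    (hI₂ : ∑ i ∈ I, c₂ i < 0) :
    ghat g0 E n γ c₁ τ - ghat g0 E n γ c₂ τ = -(1 / 2 : ℝ) * symmetrize fun s =>
      ∑ ℓ ∈ cuts n, (1 / 2 : ℝ) *
        (Real.sign (partialSum ℓ (c₁ ∘ s)) - Real.sign (partialSum ℓ (c₂ ∘ s))) *
        (kap (dszLR ℓ (γ ∘ s)) * ghat g0 E ℓ (γ ∘ s ∘ head ℓ) (c ∘ s ∘ head ℓ) τ *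
          ghat g0 E (n - ℓ) (γ ∘ s ∘ tail ℓ) (c ∘ s ∘ tail ℓ) τ) := by
  have hγ' : ∀ i, (γ i).1 ∈ G.D4 := fun i => (hγ i).1
  have hbig : ∀ (s : Equiv.Perm (Fin n)) (ℓ : Fin n), 0 < (ℓ : ℕ) → bigGamma ℓ (γ ∘ s) ≠ 0 :=
    fun s ℓ hℓ => (hgood.comp s s.injective).bigGamma_ne_zero hℓ
  have hsum : ∀ (s : Equiv.Perm (Fin n)) (d : zeroSum n), ∑ i, ((d : Fin n → ℝ) ∘ s) i = 0 := by
    intro s d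
    exact (Equiv.sum_comp s (d : Fin n → ℝ)).trans d.2
  set x : zeroSum n := ⟨c, h.sum_univ⟩ with hx
  -- parameters close to the wall
  have hnear : ∀ᶠ d : zeroSum n in nhds x, ∀ (s : Equiv.Perm (Fin n)) (ℓ : Fin n), 0 < (ℓ : ℕ) →
      SameChamber (flow ℓ (γ ∘ s) (c ∘ s) ∘ head ℓ)
        (flow ℓ (γ ∘ s) ((d : Fin n → ℝ) ∘ s) ∘ head ℓ) ∧
      SameChamber (flow ℓ (γ ∘ s) (c ∘ s) ∘ tail ℓ)
        (flow ℓ (γ ∘ s) ((d : Fin n → ℝ) ∘ s) ∘ tail ℓ) := by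
    rw [eventually_all]
    intro s
    rw [eventually_all]
    intro ℓ
    by_cases hℓ : 0 < (ℓ : ℕ)
    · have hg := hsg.flow hγ' hτ hgood h s hℓ
      have e1 := eventually_sameChamber (x := x) (continuous_flow ℓ (γ ∘ s) s (head ℓ))
        (fun d => sum_flow_head _ _ ℓ (hbig s ℓ hℓ)) hg.1
      have e2 := eventually_sameChamber (x := x) (continuous_flow ℓ (γ ∘ s) s (tail ℓ))
        (fun d => sum_flow_tail _ (hsum s d) ℓ (hbig s ℓ hℓ)) hg.2
      filter_upwards [e1, e2] with d h1 h2 _ using ⟨h1, h2⟩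
    · exact Eventually.of_forall fun d hd => absurd hd hℓ
  -- The coefficient recursion uses the seed recursion at all mergings, so all of them have to be
  -- generic. The parameters `c₁`, `c₂` need not be; they are replaced by generic `d₁`, `d₂` of the
  -- same chambers.
  have hgen : OpenDense {d : zeroSum n | ∀ (m : Fin (n + 1)) (f : Fin n → Fin m),
      Function.Surjective f → GenericConf m (merge f γ) (merge f (d : Fin n → ℝ))} :=
    OpenDense.setOf_forall fun m => OpenDense.setOf_forall fun f => OpenDense.setOf_imp fun hf =>
      openDense_merge hf (openDense_genericConf (hgood.merge hf))
  obtain ⟨d₁, hd₁, hgen₁, hadj₁, hside₁⟩ := exists_adjacent h hgen hnear (ε := 1) one_ne_zero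
  obtain ⟨d₂, hd₂, hgen₂, hadj₂, hside₂⟩ := exists_adjacent h hgen hnear (ε := -1) (by norm_num)
  have hch₁ : SameChamber c₁ d₁ := h.sameChamber h₁ hadj₁ (mul_pos hI₁ (by linarith))
  have hch₂ : SameChamber c₂ d₂ :=
    h.sameChamber h₂ hadj₂ (mul_pos_of_neg_of_neg hI₂ (by linarith))
  have hrec₁ := K.coefficientRecursion hn hγ hτ d₁.2 hgen₁
  have hrec₂ := K.coefficientRecursion hn hγ hτ d₂.2 hgen₂
  rw [K.ghat_eq_of_sameChamber hn hγ hτ h₁.sum_univ d₁.2 (h.genericStab h₁ hI₁.ne') hch₁,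
    K.ghat_eq_of_sameChamber hn hγ hτ h₂.sum_univ d₂.2 (h.genericStab h₂ hI₂.ne) hch₂, hrec₁, hrec₂,
    add_sub_add_right_eq_sub, ← mul_sub, ← symmetrize_sub]
  congr 2
  funext s
  rw [← Finset.sum_sub_distrib]
  refine Finset.sum_congr rfl fun ℓ hℓ => ?_
  have hℓ' : 0 < (ℓ : ℕ) := by simpa [cuts] using hℓ
  have hg := hsg.flow hγ' hτ hgood h s hℓ'
  have hflow : ∀ d : zeroSum n, (∀ (s : Equiv.Perm (Fin n)) (ℓ : Fin n), 0 < (ℓ : ℕ) →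
      SameChamber (flow ℓ (γ ∘ s) (c ∘ s) ∘ head ℓ)
        (flow ℓ (γ ∘ s) ((d : Fin n → ℝ) ∘ s) ∘ head ℓ) ∧
      SameChamber (flow ℓ (γ ∘ s) (c ∘ s) ∘ tail ℓ)
        (flow ℓ (γ ∘ s) ((d : Fin n → ℝ) ∘ s) ∘ tail ℓ)) →
      ghat g0 E ℓ (γ ∘ s ∘ head ℓ) (flow ℓ (γ ∘ s) ((d : Fin n → ℝ) ∘ s) ∘ head ℓ) τ
        = ghat g0 E ℓ (γ ∘ s ∘ head ℓ) (flow ℓ (γ ∘ s) (c ∘ s) ∘ head ℓ) τ ∧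
      ghat g0 E (n - ℓ) (γ ∘ s ∘ tail ℓ) (flow ℓ (γ ∘ s) ((d : Fin n → ℝ) ∘ s) ∘ tail ℓ) τ
        = ghat g0 E (n - ℓ) (γ ∘ s ∘ tail ℓ) (flow ℓ (γ ∘ s) (c ∘ s) ∘ tail ℓ) τ := by
    intro d hd
    exact ⟨(K.ghat_eq_of_sameChamber hℓ' (fun _ => hγ _) hτ (sum_flow_head _ _ ℓ (hbig s ℓ hℓ'))
        (sum_flow_head _ _ ℓ (hbig s ℓ hℓ')) hg.1 (hd s ℓ hℓ').1).symm,
      (K.ghat_eq_of_sameChamber (by omega) (fun _ => hγ _) hτ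
        (sum_flow_tail _ (hsum s x) ℓ (hbig s ℓ hℓ'))
        (sum_flow_tail _ (hsum s d) ℓ (hbig s ℓ hℓ')) hg.2 (hd s ℓ hℓ').2).symm⟩
  rw [(hflow d₁ hd₁).1, (hflow d₁ hd₁).2, (hflow d₂ hd₂).1, (hflow d₂ hd₂).2]
  have hsg₁ : Real.sign (partialSum ℓ ((d₁ : Fin n → ℝ) ∘ s)) = Real.sign (partialSum ℓ (c₁ ∘ s)) := by
    rw [partialSum_comp_perm, partialSum_comp_perm]
    exact (hch₁.sign_eq h₁.sum_univ d₁.2 _).symm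
  have hsg₂ : Real.sign (partialSum ℓ ((d₂ : Fin n → ℝ) ∘ s)) = Real.sign (partialSum ℓ (c₂ ∘ s)) := by
    rw [partialSum_comp_perm, partialSum_comp_perm]
    exact (hch₂.sign_eq h₂.sum_univ d₂.2 _).symm
  rw [DeltaLR, DeltaLR, hsg₁, hsg₂]
  -- For a splitting along the wall the partial sum of `c` vanishes and the flow leaves `c`
  -- unchanged; for any other splitting the two signs agree and both sides vanish.
  by_cases hw : cutSet s ℓ = I ∨ cutSet s ℓ = Iᶜ
  · have hp0 : partialSum ℓ (c ∘ s) = 0 := by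
      rw [partialSum_comp_perm]
      exact h.sum_cutSet_eq_zero hw
    rw [flow_of_partialSum_eq_zero _ _ hp0]
    simp only [Function.comp_assoc]
    ring
  · have h0 := h.sign_sub_eq_zero h₁ h₂ (cutSet_nonempty s hℓ') (cutSet_ne_univ s ℓ) hw
    rw [← partialSum_comp_perm, ← partialSum_comp_perm] at h0
    rw [h0, sub_eq_zero.mp h0]
    ring

/-- The discontinuity of the kernel at a simple wall. -/
theorem ghatKernel_jump (K : KernelSystem G g0 E R σ Φ0 ΦE) {n : ℕ} (hn : 1 ≤ n)
    {p : Fin n → Fin b → ℤ} (hp : ∀ i, p i ∈ G.D4) {I : Finset (Fin n)} {c : Fin n → ℝ}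
    (h : SimpleWall I c) {c₁ c₂ : Fin n → ℝ}
    (h₁ : Adjacent c c₁) (h₂ : Adjacent c c₂) (hI₁ : 0 < ∑ i ∈ I, c₁ i)
    (hI₂ : ∑ i ∈ I, c₂ i < 0) (x : Coord n b) :
    G.ghatKernel Φ0 ΦE n p x c₁ - G.ghatKernel Φ0 ΦE n p x c₂ = -(1 / 2 : ℝ) * symmetrize fun s =>
      ∑ ℓ ∈ cuts n, (1 / 2 : ℝ) *
        (Real.sign (partialSum ℓ (c₁ ∘ s)) - Real.sign (partialSum ℓ (c₂ ∘ s))) *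
        (G.bil p (vCut p s ℓ) x *
          G.ghatKernel Φ0 ΦE ℓ (p ∘ s ∘ head ℓ) (x ∘ s ∘ head ℓ) (c ∘ s ∘ head ℓ) *
          G.ghatKernel Φ0 ΦE (n - ℓ) (p ∘ s ∘ tail ℓ) (x ∘ s ∘ tail ℓ) (c ∘ s ∘ tail ℓ)) := by
  have hg₁ := h.genericStab h₁ hI₁.ne'
  have hg₂ := h.genericStab h₂ hI₂.ne
  have hzero : ∀ (s : Equiv.Perm (Fin n)) (ℓ : Fin n), 0 < (ℓ : ℕ) →
      ¬ (cutSet s ℓ = I ∨ cutSet s ℓ = Iᶜ) →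
      Real.sign (partialSum ℓ (c₁ ∘ s)) - Real.sign (partialSum ℓ (c₂ ∘ s)) = 0 := by
    intro s ℓ hℓ hw
    rw [partialSum_comp_perm, partialSum_comp_perm]
    exact h.sign_sub_eq_zero h₁ h₂ (cutSet_nonempty s hℓ) (cutSet_ne_univ s ℓ) hw
  have hwall : ∀ (s : Equiv.Perm (Fin n)) (ℓ : Fin n), (cutSet s ℓ = I ∨ cutSet s ℓ = Iᶜ) →
      (∑ j, (c ∘ s ∘ head ℓ) j = 0 ∧ GenericStab (c ∘ s ∘ head ℓ)) ∧
      (∑ j, (c ∘ s ∘ tail ℓ) j = 0 ∧ GenericStab (c ∘ s ∘ tail ℓ)) := by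
    intro s ℓ hw
    refine ⟨h.restrict (s.injective.comp (head_injective ℓ)) ?_,
      h.restrict (s.injective.comp (tail_injective ℓ)) ?_⟩
    · rwa [image_head]
    · rw [image_tail]
      rcases hw with hw | hw
      · exact Or.inr (by rw [hw])
      · exact Or.inl (by rw [hw, compl_compl])
  have hdense := G.exists_mem_openDense hp ((G.openDense_good hp).inter
    (G.openDense_splitGeneric hn hp h))
  suffices heq : (fun x => G.ghatKernel Φ0 ΦE n p x c₁ - G.ghatKernel Φ0 ΦE n p x c₂) = fun x =>
      -(1 / 2 : ℝ) * symmetrize fun s => ∑ ℓ ∈ cuts n, (1 / 2 : ℝ) *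
        (Real.sign (partialSum ℓ (c₁ ∘ s)) - Real.sign (partialSum ℓ (c₂ ∘ s))) *
        (G.bil p (vCut p s ℓ) x *
          G.ghatKernel Φ0 ΦE ℓ (p ∘ s ∘ head ℓ) (x ∘ s ∘ head ℓ) (c ∘ s ∘ head ℓ) *
          G.ghatKernel Φ0 ΦE (n - ℓ) (p ∘ s ∘ tail ℓ) (x ∘ s ∘ tail ℓ) (c ∘ s ∘ tail ℓ)) from
    congrFun heq x
  -- Both sides are continuous in `x`, so charges in general position suffice, where `ghat_jump`
  -- applies.
  refine Continuous.ext_on hdense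
    ((K.contDiff_ghatKernel hn hp h₁.sum_univ hg₁).continuous.sub
      (K.contDiff_ghatKernel hn hp h₂.sum_univ hg₂).continuous) ?_ ?_
  · refine continuous_const.mul (continuous_const.mul (continuous_finsetSum _ fun s _ =>
      continuous_finsetSum _ fun ℓ hℓ => ?_))
    have hℓ' : 0 < (ℓ : ℕ) := by simpa [cuts] using hℓ
    by_cases hw : cutSet s ℓ = I ∨ cutSet s ℓ = Iᶜ
    · obtain ⟨⟨a1, a2⟩, a3, a4⟩ := hwall s ℓ hw
      refine continuous_const.mul (((G.continuous_bil p _).mul ?_).mul ?_)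
      · exact (K.contDiff_ghatKernel hℓ' (fun j => hp _) a1 a2).continuous.comp
          (reindexL (s ∘ head ℓ)).continuous
      · exact (K.contDiff_ghatKernel (by omega) (fun j => hp _) a3 a4).continuous.comp
          (reindexL (s ∘ tail ℓ)).continuous
    -- Off the wall the parameters of a cluster do not sum to zero, so nothing is known about
    -- continuity of the kernels, but their coefficient vanishes.
    · simp only [hzero s ℓ hℓ' hw, mul_zero, zero_mul]
      exact continuous_const
  · rintro _ ⟨⟨hgood, hsg⟩, γ, hγ, rfl, τ, hτ, rfl⟩
    have hgood' : GoodConf γ := G.goodConf_of_point (fun i => (hγ i).1) 0 τ hgood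
    have key := K.ghat_jump hn hγ hτ hgood' h hsg h₁ h₂ hI₁ hI₂
    simp only []
    rw [K.ghatKernel_point hn hγ 0 hτ h₁.sum_univ hg₁, K.ghatKernel_point hn hγ 0 hτ h₂.sum_univ hg₂,
      ← mul_sub, key, mul_left_comm, ← symmetrize_mul]
    congr 2
    funext s
    rw [Finset.mul_sum]
    refine Finset.sum_congr rfl fun ℓ hℓ => ?_
    have hℓ' : 0 < (ℓ : ℕ) := by simpa [cuts] using hℓ
    by_cases hw : cutSet s ℓ = I ∨ cutSet s ℓ = Iᶜ
    · obtain ⟨⟨a1, a2⟩, a3, a4⟩ := hwall s ℓ hw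
      have e1 := K.ghatKernel_point hℓ' (γ := γ ∘ s ∘ head ℓ) (fun j => hγ _) 0 hτ a1 a2
      have e2 := K.ghatKernel_point (by omega) (γ := γ ∘ s ∘ tail ℓ) (fun j => hγ _) 0 hτ a3 a4
      have e3 := K.refinement.kerFactor_split hγ (τ := τ) s hℓ'
      rw [G.bil_vCut fun i => (hγ i).1]
      change _ = _ * (_ * G.ghatKernel Φ0 ΦE ℓ (fun i => ((γ ∘ s ∘ head ℓ) i).1)
        (G.point (γ ∘ s ∘ head ℓ) 0 τ) (c ∘ s ∘ head ℓ) * G.ghatKernel Φ0 ΦE (n - ℓ)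
        (fun i => ((γ ∘ s ∘ tail ℓ) i).1) (G.point (γ ∘ s ∘ tail ℓ) 0 τ) (c ∘ s ∘ tail ℓ))
      rw [e1, e2]
      linear_combination (1 / 2 * (Real.sign (partialSum ℓ (c₁ ∘ s))
        - Real.sign (partialSum ℓ (c₂ ∘ s))) * ghat g0 E ℓ (γ ∘ s ∘ head ℓ) (c ∘ s ∘ head ℓ) τ *
          ghat g0 E (n - ℓ) (γ ∘ s ∘ tail ℓ) (c ∘ s ∘ tail ℓ) τ) * e3
    · simp only [hzero s ℓ hℓ' hw, mul_zero, zero_mul]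

end KernelSystem
end D4D2

namespace D4D2

/-! ### The measure on a hyperplane -/

section Wall

variable {E : Type*} [NormedAddCommGroup E] [NormedSpace ℝ E]

/-- The points of a compact set, moved along `d` by at most one unit. -/
theorem isCompact_sweep {K : Set E} (hK : IsCompact K) (d : E) :
    IsCompact ((fun z : E × ℝ => z.1 - z.2 • d) '' K ×ˢ Set.Icc (-1) 1) :=
  (hK.prod isCompact_Icc).image (by fun_prop)

variable [MeasurableSpace E] [BorelSpace E]

/-- The measure `δ(ℓ(x)) dx` on the kernel of `ℓ`, where `ℓ(d) = 1`: the measure of a slab, projected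
along `d`. -/
noncomputable def wallMeasure (μ : Measure E) (ℓ : E →L[ℝ] ℝ) (d : E) : Measure E :=
  (μ.restrict {x | 0 ≤ ℓ x ∧ ℓ x ≤ 1}).map fun x => x - ℓ x • d

theorem measurableSet_slab (ℓ : E →L[ℝ] ℝ) : MeasurableSet {x | 0 ≤ ℓ x ∧ ℓ x ≤ 1} :=
  ((isClosed_le continuous_const ℓ.continuous).inter
    (isClosed_le ℓ.continuous continuous_const)).measurableSet

theorem measurable_projection (ℓ : E →L[ℝ] ℝ) (d : E) : Measurable fun x => x - ℓ x • d :=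
  (continuous_id.sub (ℓ.continuous.smul continuous_const)).measurable

theorem ae_wallMeasure_eq_zero (μ : Measure E) {ℓ : E →L[ℝ] ℝ} {d : E} (hd : ℓ d = 1) :
    ∀ᵐ y ∂(wallMeasure μ ℓ d), ℓ y = 0 := by
  rw [wallMeasure, ae_map_iff (measurable_projection ℓ d).aemeasurable
    (measurableSet_eq_fun ℓ.continuous.measurable measurable_const)]
  refine Eventually.of_forall fun x => ?_
  simp [hd]

variable [FiniteDimensional ℝ E] (μ : Measure E) [μ.IsAddHaarMeasure]

instance (ℓ : E →L[ℝ] ℝ) (d : E) : SFinite (wallMeasure μ ℓ d) := by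
  unfold wallMeasure
  infer_instance

/-- Fubini and translation invariance: integration over the line through each point of the slab
counts every `x` with the length of the set of `s` for which `x - s • d` is in the slab. As `ℓ d =
1`, this length is one. -/
theorem lintegral_wallMeasure {ℓ : E →L[ℝ] ℝ} {d : E} (hd : ℓ d = 1) {F : E → ENNReal}
    (hF : Measurable F) :
    ∫⁻ y, (∫⁻ s : ℝ, F (y + s • d)) ∂(wallMeasure μ ℓ d) = ∫⁻ x, F x ∂μ := by
  have hadd : Measurable fun z : E × ℝ => z.1 + z.2 • d := by fun_prop
  have hm : Measurable fun y => ∫⁻ s : ℝ, F (y + s • d) :=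
    (hF.comp hadd).lintegral_prod_right'
  set D : Set E := {x | 0 ≤ ℓ x ∧ ℓ x ≤ 1} with hD
  have hDm : MeasurableSet D := measurableSet_slab ℓ
  rw [wallMeasure, lintegral_map hm (measurable_projection ℓ d), ← hD]
  have h1 : ∀ x, ∫⁻ s : ℝ, F (x - ℓ x • d + s • d) = ∫⁻ s : ℝ, F (x + s • d) := by
    intro x
    rw [← lintegral_sub_right_eq_self (fun s : ℝ => F (x + s • d)) (ℓ x)]
    congr 1
    funext s
    congr 1
    rw [sub_smul]
    abel
  simp_rw [h1]
  rw [← lintegral_indicator hDm]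
  have h2 : ∀ x, D.indicator (fun x => ∫⁻ s : ℝ, F (x + s • d)) x
      = ∫⁻ s : ℝ, D.indicator 1 x * F (x + s • d) := by
    intro x
    by_cases hx : x ∈ D
    · simp [Set.indicator_of_mem hx]
    · simp [Set.indicator_of_notMem hx]
  have hind : Measurable (D.indicator (1 : E → ENNReal)) := measurable_one.indicator hDm
  simp_rw [h2]
  rw [lintegral_lintegral_swap]
  swap
  · exact ((hind.comp measurable_fst).mul (hF.comp hadd)).aemeasurable
  have h3 : ∀ s : ℝ, ∫⁻ x, D.indicator 1 x * F (x + s • d) ∂μ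
      = ∫⁻ x, D.indicator 1 (x - s • d) * F x ∂μ := by
    intro s
    rw [← lintegral_add_right_eq_self (fun x => D.indicator 1 (x - s • d) * F x) (s • d)]
    simp only [add_sub_cancel_right]
  simp_rw [h3]
  rw [lintegral_lintegral_swap]
  swap
  · have hsub : Measurable fun z : ℝ × E => z.2 - z.1 • d := by fun_prop
    exact ((hind.comp hsub).mul (hF.comp measurable_snd)).aemeasurable
  refine lintegral_congr fun x => ?_
  have h4 : ∀ s : ℝ, D.indicator (1 : E → ENNReal) (x - s • d)
      = (Set.Icc (ℓ x - 1) (ℓ x)).indicator 1 s := by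
    intro s
    have : x - s • d ∈ D ↔ s ∈ Set.Icc (ℓ x - 1) (ℓ x) := by
      simp only [hD, Set.mem_ofPred_eq, map_sub, map_smul, hd, smul_eq_mul, mul_one, Set.mem_Icc]
      constructor <;> rintro ⟨h, h'⟩ <;> constructor <;> linarith
    by_cases hs : s ∈ Set.Icc (ℓ x - 1) (ℓ x)
    · rw [Set.indicator_of_mem hs, Set.indicator_of_mem (this.mpr hs)]
      rfl
    · rw [Set.indicator_of_notMem hs, Set.indicator_of_notMem (mt this.mp hs)]
  simp_rw [h4]
  rw [lintegral_mul_const _ (measurable_one.indicator measurableSet_Icc),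
    lintegral_indicator_one measurableSet_Icc, Real.volume_Icc]
  simp

/-- Every integral is an integral over the hyperplane and the transversal coordinate. -/
theorem map_prod_wallMeasure {ℓ : E →L[ℝ] ℝ} {d : E} (hd : ℓ d = 1) :
    ((wallMeasure μ ℓ d).prod volume).map (fun z : E × ℝ => z.1 + z.2 • d) = μ := by
  have hadd : Measurable fun z : E × ℝ => z.1 + z.2 • d := by fun_prop
  refine Measure.ext_of_lintegral _ fun F hF => ?_
  rw [lintegral_map hF hadd, lintegral_prod (fun z : E × ℝ => F (z.1 + z.2 • d)) (hF.comp hadd).aemeasurable]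
  exact lintegral_wallMeasure μ hd hF

theorem ae_ne_zero {ℓ : E →L[ℝ] ℝ} (h : ℓ ≠ 0) : ∀ᵐ x ∂μ, ℓ x ≠ 0 := by
  have h1 : (ℓ : E →ₗ[ℝ] ℝ).ker ≠ ⊤ := fun h' => h <| by
    ext x
    have : x ∈ (ℓ : E →ₗ[ℝ] ℝ).ker := by
      rw [h']
      trivial
    simpa using this
  have h2 := Measure.addHaar_submodule μ _ h1
  rw [ae_iff]
  convert h2 using 2
  ext x
  simp

/-- Pulled back to the slab, `ℓ'` becomes `ℓ' - ℓ' d • ℓ`. This form is nonzero at `x₀`, hence its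
kernel is a null set. -/
theorem ae_wallMeasure_ne_zero {ℓ ℓ' : E →L[ℝ] ℝ} {d x₀ : E} (hx₀ : ℓ x₀ = 0) (hx₀' : ℓ' x₀ ≠ 0) :
    ∀ᵐ y ∂(wallMeasure μ ℓ d), ℓ' y ≠ 0 := by
  rw [wallMeasure, ae_map_iff (p := fun y => ℓ' y ≠ 0) (measurable_projection ℓ d).aemeasurable
    (measurableSet_eq_fun ℓ'.continuous.measurable measurable_const).compl]
  refine ae_restrict_of_ae ?_
  have h : ℓ' - ℓ' d • ℓ ≠ 0 := fun h0 => by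
    have := congrArg (fun L : E →L[ℝ] ℝ => L x₀) h0
    simp [hx₀] at this
    exact hx₀' this
  filter_upwards [ae_ne_zero μ h] with x hx h0
  apply hx
  have h1 : ℓ' (x - ℓ x • d) = 0 := h0
  simp only [map_sub, map_smul, smul_eq_mul] at h1
  simp only [_root_.sub_apply, _root_.smul_apply, smul_eq_mul]
  linarith

instance (ℓ : E →L[ℝ] ℝ) (d : E) : IsFiniteMeasureOnCompacts (wallMeasure μ ℓ d) := by
  refine ⟨fun K hK => ?_⟩
  rw [wallMeasure, Measure.map_apply (measurable_projection ℓ d) hK.measurableSet]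
  refine lt_of_le_of_lt ?_ ((isCompact_sweep hK d).measure_lt_top (μ := μ))
  rw [Measure.restrict_apply ((measurable_projection ℓ d) hK.measurableSet)]
  refine measure_mono ?_
  rintro x ⟨hx, hx0, hx1⟩
  exact ⟨(x - ℓ x • d, -ℓ x), ⟨hx, by linarith, by linarith⟩, by simp⟩

/-! ### Smooth steps -/

/-- The derivative of the smooth step. -/
noncomputable def stepDeriv : ℝ → ℝ := deriv Real.smoothTransition

theorem hasDerivAt_step (r : ℝ) : HasDerivAt Real.smoothTransition (stepDeriv r) r :=
  ((Real.smoothTransition.contDiff (n := 1)).differentiable (by simp) r).hasDerivAt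

theorem continuous_stepDeriv : Continuous stepDeriv :=
  (Real.smoothTransition.contDiff (n := 1)).continuous_deriv (by simp)

theorem stepDeriv_eq_zero {r : ℝ} (hr : r ∉ Set.Icc (0 : ℝ) 1) : stepDeriv r = 0 := by
  have h : r < 0 ∨ 1 < r := by
    by_contra! h
    exact hr ⟨h.1, h.2⟩
  rcases h with h | h
  · have : Real.smoothTransition =ᶠ[nhds r] fun _ => 0 := by
      filter_upwards [gt_mem_nhds h] with x hx using Real.smoothTransition.zero_of_nonpos hx.le
    rw [stepDeriv, this.deriv_eq, deriv_const]
  · have : Real.smoothTransition =ᶠ[nhds r] fun _ => 1 := by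
      filter_upwards [lt_mem_nhds h] with x hx using Real.smoothTransition.one_of_one_le hx.le
    rw [stepDeriv, this.deriv_eq, deriv_const]

theorem integrable_stepDeriv : Integrable stepDeriv :=
  continuous_stepDeriv.integrable_of_hasCompactSupport
    (HasCompactSupport.intro isCompact_Icc fun _ => stepDeriv_eq_zero)

theorem integral_stepDeriv : ∫ r, stepDeriv r = 1 := by
  rw [integral_of_hasDerivAt_of_tendsto hasDerivAt_step integrable_stepDeriv (m := 0) (n := 1),
    sub_zero]
  · refine tendsto_const_nhds.congr' ?_
    filter_upwards [eventually_le_atBot 0] with r hr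
    exact (Real.smoothTransition.zero_of_nonpos hr).symm
  · refine tendsto_const_nhds.congr' ?_
    filter_upwards [eventually_ge_atTop 1] with r hr
    exact (Real.smoothTransition.one_of_one_le hr).symm

/-- Smooth steps across a hyperplane converge to the step function. -/
theorem tendsto_integral_step {X : Type*} [MeasurableSpace X] {ν : Measure X} {u : X → ℝ}
    (hu : Measurable u) {H : X → ℝ} (hH : Integrable H ν) :
    Tendsto (fun k : ℕ => ∫ x, Real.smoothTransition (((k : ℝ) + 1) * u x) * H x ∂ν) atTop
      (nhds (∫ x, if 0 < u x then H x else 0 ∂ν)) := by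
  refine tendsto_integral_of_dominated_convergence (fun x => ‖H x‖) (fun k => ?_) hH.norm
    (fun k => Eventually.of_forall fun x => ?_) (Eventually.of_forall fun x => ?_)
  · exact ((Real.smoothTransition.continuous.measurable.comp
      (hu.const_mul _)).aestronglyMeasurable).mul hH.aestronglyMeasurable
  · rw [norm_mul]
    refine mul_le_of_le_one_left (norm_nonneg _) ?_
    rw [Real.norm_of_nonneg (Real.smoothTransition.nonneg _)]
    exact Real.smoothTransition.le_one _
  · by_cases hx : 0 < u x
    · rw [if_pos hx]
      refine tendsto_const_nhds.congr' ?_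
      obtain ⟨N, hN⟩ := exists_nat_ge (u x)⁻¹
      filter_upwards [eventually_ge_atTop N] with k hk
      rw [Real.smoothTransition.one_of_one_le, one_mul]
      have h1 : (u x)⁻¹ ≤ (k : ℝ) + 1 := by
        have : (N : ℝ) ≤ k := by exact_mod_cast hk
        linarith
      calc (1 : ℝ) = (u x)⁻¹ * u x := (inv_mul_cancel₀ hx.ne').symm
        _ ≤ _ := mul_le_mul_of_nonneg_right h1 hx.le
    · rw [if_neg hx]
      refine tendsto_const_nhds.congr fun k => ?_
      rw [Real.smoothTransition.zero_of_nonpos, zero_mul]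
      exact mul_nonpos_of_nonneg_of_nonpos (by positivity) (not_lt.mp hx)

/-- The derivatives of smooth steps across a hyperplane converge to the measure on it. -/
theorem tendsto_integral_stepDeriv {ℓ : E →L[ℝ] ℝ} {d : E} (hd : ℓ d = 1) {G : E → ℝ}
    (hG : Measurable G) {M : ℝ} (hM : ∀ x, ‖G x‖ ≤ M) {K : Set E} (hK : IsCompact K)
    (hGK : ∀ x, x ∉ K → G x = 0) (hcont : ∀ᵐ y ∂(wallMeasure μ ℓ d), ContinuousAt G y) :
    Tendsto (fun k : ℕ => ∫ x, G x * (((k : ℝ) + 1) * stepDeriv (((k : ℝ) + 1) * ℓ x)) ∂μ) atTop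
      (nhds (∫ y, G y ∂(wallMeasure μ ℓ d))) := by
  set σ := wallMeasure μ ℓ d with hσ
  have hM0 : 0 ≤ M := (norm_nonneg _).trans (hM 0)
  have hadd : Measurable fun z : E × ℝ => z.1 + z.2 • d := by fun_prop
  have hst := continuous_stepDeriv.measurable
  have hint : ∀ a : ℝ, Integrable (fun x => G x * (a * stepDeriv (a * ℓ x))) μ := by
    intro a
    have hc : Continuous fun x => a * stepDeriv (a * ℓ x) :=
      continuous_const.mul (continuous_stepDeriv.comp (continuous_const.mul ℓ.continuous))
    obtain ⟨C, hC⟩ := hK.exists_bound_of_continuousOn hc.continuousOn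
    refine Integrable.mono' (g := K.indicator fun _ => M * C)
      ((integrable_indicator_iff hK.measurableSet).mpr
        (integrableOn_const hK.measure_lt_top.ne)) (hG.mul hc.measurable).aestronglyMeasurable
      (Eventually.of_forall fun x => ?_)
    by_cases hx : x ∈ K
    · rw [Set.indicator_of_mem hx, norm_mul]
      exact mul_le_mul (hM x) (hC x hx) (norm_nonneg _) hM0
    · rw [Set.indicator_of_notMem hx, hGK x hx, zero_mul, norm_zero]
  -- Write `x = y + s • d` with `y` on the wall and substitute `r = (k + 1) s`. The factor `k + 1`
  -- is absorbed, and `stepDeriv`, which has total mass one, acts as an approximate identity across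
  -- the wall.
  have key : ∀ k : ℕ, ∫ x, G x * (((k : ℝ) + 1) * stepDeriv (((k : ℝ) + 1) * ℓ x)) ∂μ
      = ∫ y, (∫ r : ℝ, G (y + (r / ((k : ℝ) + 1)) • d) *
          stepDeriv (((k : ℝ) + 1) * ℓ y + r)) ∂σ := by
    intro k
    set a : ℝ := (k : ℝ) + 1 with ha
    have ha0 : 0 < a := by positivity
    have hmp : MeasurePreserving (fun z : E × ℝ => z.1 + z.2 • d) (σ.prod volume) μ :=
      ⟨hadd, map_prod_wallMeasure μ hd⟩
    have hint' := (hmp.integrable_comp (hint a).aestronglyMeasurable).mpr (hint a)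
    conv_lhs => rw [← map_prod_wallMeasure μ hd]
    rw [integral_map hadd.aemeasurable (by
      rw [map_prod_wallMeasure μ hd]; exact (hint a).aestronglyMeasurable)]
    refine (integral_prod (fun z : E × ℝ => G (z.1 + z.2 • d) *
      (a * stepDeriv (a * ℓ (z.1 + z.2 • d)))) hint').trans ?_
    refine integral_congr_ae (Eventually.of_forall fun y => ?_)
    have h1 : ∀ s : ℝ, G (y + s • d) * (a * stepDeriv (a * ℓ (y + s • d)))
        = (fun r : ℝ => a * (G (y + (r / a) • d) * stepDeriv (a * ℓ y + r))) (a * s) := by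
      intro s
      simp only [map_add, map_smul, hd, smul_eq_mul, mul_one, mul_div_cancel_left₀ _ ha0.ne',
        mul_add]
      ring
    refine ((integral_congr_ae (Eventually.of_forall h1)).trans
      (Measure.integral_comp_mul_left (fun r : ℝ => a * (G (y + (r / a) • d) *
        stepDeriv (a * ℓ y + r))) a)).trans ?_
    rw [integral_const_mul, abs_of_pos (inv_pos.mpr ha0),
      smul_eq_mul, inv_mul_cancel_left₀ ha0.ne']
  simp_rw [key]
  -- `stepDeriv r` vanishes unless `0 ≤ r ≤ 1`, so `G` is evaluated at points shifted from `y` by at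
  -- most one unit of `d`, and only `y` in this compact set matter.
  set K' := (fun z : E × ℝ => z.1 - z.2 • d) '' K ×ˢ Set.Icc (-1) 1 with hK'
  have hK'c : IsCompact K' := isCompact_sweep hK d
  have hbd : ∀ (k : ℕ) (y : E) (r : ℝ), ‖G (y + (r / ((k : ℝ) + 1)) • d) * stepDeriv r‖
      ≤ K'.indicator (fun _ => M) y * ‖stepDeriv r‖ := by
    intro k y r
    rw [norm_mul]
    by_cases hr : r ∈ Set.Icc (0 : ℝ) 1
    · refine mul_le_mul_of_nonneg_right ?_ (norm_nonneg _)
      by_cases hy : y ∈ K'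
      · rw [Set.indicator_of_mem hy]
        exact hM _
      · rw [Set.indicator_of_notMem hy, hGK, norm_zero]
        intro h
        refine hy ⟨(_, r / ((k : ℝ) + 1)), ⟨h, ?_, ?_⟩, by simp⟩
        · have : 0 ≤ r / ((k : ℝ) + 1) := div_nonneg hr.1 (by positivity)
          linarith
        · rw [div_le_one (by positivity)]
          have : (0 : ℝ) ≤ k := Nat.cast_nonneg k
          linarith [hr.2]
    · rw [stepDeriv_eq_zero hr]
      simp
  refine tendsto_integral_of_dominated_convergence
    (fun y => K'.indicator (fun _ => M) y * ∫ r, ‖stepDeriv r‖) (fun k => ?_) ?_ (fun k => ?_) ?_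
  · have h1 : Measurable fun z : E × ℝ => G (z.1 + (z.2 / ((k : ℝ) + 1)) • d) *
        stepDeriv (((k : ℝ) + 1) * ℓ z.1 + z.2) := by
      have h2 : Measurable fun z : E × ℝ => z.1 + (z.2 / ((k : ℝ) + 1)) • d := by fun_prop
      have h3 : Measurable fun z : E × ℝ => ((k : ℝ) + 1) * ℓ z.1 + z.2 :=
        ((ℓ.continuous.measurable.comp measurable_fst).const_mul _).add measurable_snd
      exact (hG.comp h2).mul (hst.comp h3)
    exact (h1.stronglyMeasurable.integral_prod_right).aestronglyMeasurable
  · exact ((integrable_indicator_iff hK'c.measurableSet).mpr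
      (integrableOn_const hK'c.measure_lt_top.ne)).mul_const _
  · filter_upwards [ae_wallMeasure_eq_zero μ hd] with y hy
    rw [← integral_const_mul]
    refine norm_integral_le_of_norm_le (integrable_stepDeriv.norm.const_mul _)
      (Eventually.of_forall fun r => ?_)
    rw [hy, mul_zero, zero_add]
    exact hbd k y r
  · filter_upwards [ae_wallMeasure_eq_zero μ hd, hcont] with y hy hcy
    have h1 : G y = ∫ r, G y * stepDeriv r := by rw [integral_const_mul, integral_stepDeriv, mul_one]
    rw [h1]
    simp only [hy, mul_zero, zero_add]
    refine tendsto_integral_of_dominated_convergence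
      (fun r => K'.indicator (fun _ => M) y * ‖stepDeriv r‖) (fun k => ?_)
      (integrable_stepDeriv.norm.const_mul _) (fun k => Eventually.of_forall fun r => hbd k y r)
      (Eventually.of_forall fun r => ?_)
    · have h2 : Measurable fun r : ℝ => y + (r / ((k : ℝ) + 1)) • d := by fun_prop
      exact ((hG.comp h2).mul hst).aestronglyMeasurable
    · refine Tendsto.mul_const _ ?_
      have h2 : Tendsto (fun k : ℕ => y + (r / ((k : ℝ) + 1)) • d) atTop (nhds y) := by
        have h3 : Tendsto (fun k : ℕ => r / ((k : ℝ) + 1)) atTop (nhds 0) :=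
          tendsto_const_nhds.div_atTop (tendsto_natCast_atTop_atTop.atTop_add tendsto_const_nhds)
        have h4 := (h3.smul_const d).const_add y
        simpa using h4
      exact hcy.tendsto.comp h2

end Wall
end D4D2

namespace D4D2

/-! ### Functions which are smooth in the chambers of a hyperplane arrangement -/

section Arrangement

variable {E : Type*} [NormedAddCommGroup E] [NormedSpace ℝ E] {ι : Type*}

/-- The chamber of `x`. -/
noncomputable def pattern (L : ι → E →L[ℝ] ℝ) (x : E) : ι → Bool := fun i => decide (0 < L i x)

theorem pattern_eventually_eq (L : ι → E →L[ℝ] ℝ) {i : ι} {y : E} (h : L i y ≠ 0) :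
    ∀ᶠ x in nhds y, pattern L x i = pattern L y i := by
  rcases lt_or_gt_of_ne h with h | h
  · filter_upwards [(L i).continuous.continuousAt.eventually (gt_mem_nhds h)] with x hx
    simp only [pattern, not_lt.mpr (le_of_lt h), not_lt.mpr (le_of_lt hx)]
  · filter_upwards [(L i).continuous.continuousAt.eventually (lt_mem_nhds h)] with x hx
    simp [pattern, h, hx]

variable [Fintype ι] [DecidableEq ι]

/-- A finite sum of continuous functions cut off to chambers: measurability and integrability of
piecewise functions reduce to those of the pieces. -/
theorem apply_pattern_eq_sum (L : ι → E →L[ℝ] ℝ) (A : (ι → Bool) → E → ℝ) (x : E) :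
    A (pattern L x) x = ∑ S, {x | pattern L x = S}.indicator (A S) x := by
  rw [Finset.sum_eq_single (pattern L x)]
  · rw [Set.indicator_of_mem]
    rfl
  · intro S _ hS
    rw [Set.indicator_of_notMem]
    exact fun h => hS (Eq.symm h)
  · simp

variable [MeasurableSpace E] [BorelSpace E]

omit [DecidableEq ι] in
theorem measurableSet_pattern (L : ι → E →L[ℝ] ℝ) (S : ι → Bool) :
    MeasurableSet {x | pattern L x = S} := by
  have : {x | pattern L x = S} = ⋂ i, {x | decide (0 < L i x) = S i} := by
    ext x
    simp [pattern, funext_iff]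
  rw [this]
  refine MeasurableSet.iInter fun i => ?_
  have h : MeasurableSet {x | 0 < L i x} :=
    measurableSet_lt measurable_const (L i).continuous.measurable
  cases hS : S i
  · convert h.compl using 1
    ext x
    simp
  · convert h using 1
    ext x
    simp

theorem measurable_apply_pattern (L : ι → E →L[ℝ] ℝ) {A : (ι → Bool) → E → ℝ}
    (hA : ∀ S, Continuous (A S)) : Measurable fun x => A (pattern L x) x := by
  simp_rw [apply_pattern_eq_sum L A]
  exact Finset.measurable_fun_sum _ fun S _ =>
    (hA S).measurable.indicator (measurableSet_pattern L S)

theorem integrable_apply_pattern_mul (L : ι → E →L[ℝ] ℝ) {A : (ι → Bool) → E → ℝ}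
    (hA : ∀ S, Continuous (A S)) {ψ : E → ℝ} (hψ : Continuous ψ) (hψc : HasCompactSupport ψ)
    (ν : Measure E) [IsFiniteMeasureOnCompacts ν] :
    Integrable (fun x => A (pattern L x) x * ψ x) ν := by
  have : (fun x => A (pattern L x) x * ψ x)
      = fun x => ∑ S, {x | pattern L x = S}.indicator (fun x => A S x * ψ x) x :=
    funext (apply_pattern_eq_sum L fun S x => A S x * ψ x)
  rw [this]
  exact integrable_finsetSum _ fun S _ =>
    (((hA S).mul hψ).integrable_of_hasCompactSupport hψc.mul_left).indicator
      (measurableSet_pattern L S)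

omit [MeasurableSpace E] [BorelSpace E] in
theorem exists_bound_apply_pattern_mul (L : ι → E →L[ℝ] ℝ) {A : (ι → Bool) → E → ℝ}
    (hA : ∀ S, Continuous (A S)) {ψ : E → ℝ} (hψ : Continuous ψ) (hψc : HasCompactSupport ψ) :
    ∃ M, ∀ x, ‖A (pattern L x) x * ψ x‖ ≤ M := by
  have h : ∀ S, ∃ C, ∀ x, ‖A S x * ψ x‖ ≤ C := fun S =>
    (hψc.mul_left (f := A S)).exists_bound_of_continuous ((hA S).mul hψ)
  choose C hC using h
  refine ⟨∑ S, C S, fun x => (hC _ x).trans ?_⟩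
  exact Finset.single_le_sum (f := C) (fun S _ => (norm_nonneg _).trans (hC S x))
    (Finset.mem_univ (pattern L x))

variable [FiniteDimensional ℝ E]

theorem locallyIntegrable_apply_pattern (L : ι → E →L[ℝ] ℝ) {A : (ι → Bool) → E → ℝ}
    (hA : ∀ S, Continuous (A S)) (ν : Measure E) [IsFiniteMeasureOnCompacts ν] :
    LocallyIntegrable (fun x => A (pattern L x) x) ν := by
  have : (fun x => A (pattern L x) x)
      = fun x => ∑ S, {x | pattern L x = S}.indicator (A S) x :=
    funext (apply_pattern_eq_sum L A)
  rw [this]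
  have hp : ProperSpace E := FiniteDimensional.proper ℝ E
  refine (locallyIntegrable_iff (μ := ν)).mpr fun K hK => ?_
  exact integrable_finsetSum _ fun S _ =>
    ((hA S).continuousOn.integrableOn_compact hK).indicator (measurableSet_pattern L S)

variable (μ : Measure E) [μ.IsAddHaarMeasure]

/-- Integration by parts, for a function which is smooth in the chambers of a hyperplane
arrangement. -/
theorem integral_apply_pattern_mul_fderiv {L : ι → E →L[ℝ] ℝ} {d : ι → E} (hd : ∀ i, L i (d i) = 1)
    (hL : ∀ i j, i ≠ j → ∀ᵐ y ∂(wallMeasure μ (L i) (d i)), L j y ≠ 0) (w : E)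
    (J : Finset ι) : ∀ F : (ι → Bool) → E → ℝ, (∀ S, ContDiff ℝ ∞ (F S)) →
    (∀ S S' : ι → Bool, (∀ i ∈ J, S i = S' i) → F S = F S') →
    ∀ ψ : E → ℝ, ContDiff ℝ ∞ ψ → HasCompactSupport ψ →
    ∫ x, F (pattern L x) x * fderiv ℝ ψ x w ∂μ
      = -(∫ x, fderiv ℝ (F (pattern L x)) x w * ψ x ∂μ)
        - ∑ j ∈ J, L j w * ∫ y, (F (Function.update (pattern L y) j true) y
            - F (Function.update (pattern L y) j false) y) * ψ y ∂(wallMeasure μ (L j) (d j)) := by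
  -- Induction on the set of walls across which `F` may jump; without such walls this is ordinary
  -- integration by parts.
  induction J using Finset.induction_on with
  | empty =>
    intro F hF hJ ψ hψ hψc
    have h : ∀ S, F S = F fun _ => false := fun S => hJ _ _ (by simp)
    simp only [h, Finset.sum_empty, sub_zero]
    set f := F fun _ => false with hf
    have hfs : ContDiff ℝ ∞ f := hF _
    refine integral_mul_fderiv_eq_neg_fderiv_mul_of_integrable ?_ ?_ ?_
      (fun x _ => hfs.differentiable (by simp) x) (fun x _ => hψ.differentiable (by simp) x)
    · exact (((hfs.continuous_fderiv (by simp)).clm_apply continuous_const).mul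
        hψ.continuous).integrable_of_hasCompactSupport hψc.mul_left
    · exact (hfs.continuous.mul ((hψ.continuous_fderiv (by simp)).clm_apply
        continuous_const)).integrable_of_hasCompactSupport (hψc.fderiv_apply ℝ w).mul_left
    · exact (hfs.continuous.mul hψ.continuous).integrable_of_hasCompactSupport hψc.mul_left
  | insert i J hi ih =>
    intro F hF hJ ψ hψ hψc
    -- With respect to the wall `i`, `F` is `F0` plus `D` on the positive side, and neither `F0` nor
    -- `D` jumps across that wall.
    set F0 : (ι → Bool) → E → ℝ := fun S => F (Function.update S i false) with hF0
    set D : (ι → Bool) → E → ℝ := fun S x =>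
      F (Function.update S i true) x - F (Function.update S i false) x with hD
    have hF0s : ∀ S, ContDiff ℝ ∞ (F0 S) := fun S => hF _
    have hDs : ∀ S, ContDiff ℝ ∞ (D S) := fun S => (hF _).sub (hF _)
    have hup : ∀ (c : Bool) (S S' : ι → Bool), (∀ j ∈ J, S j = S' j) →
        F (Function.update S i c) = F (Function.update S' i c) := by
      intro c S S' h
      refine hJ _ _ fun j hj => ?_
      by_cases hji : j = i
      · rw [hji, Function.update_self, Function.update_self]
      · rw [Function.update_of_ne hji, Function.update_of_ne hji]
        exact h j (Finset.mem_of_mem_insert_of_ne hj hji)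
    have hF0J : ∀ S S' : ι → Bool, (∀ j ∈ J, S j = S' j) → F0 S = F0 S' := hup false
    have hDJ : ∀ S S' : ι → Bool, (∀ j ∈ J, S j = S' j) → D S = D S' := fun S S' h => by
      simp only [hD, hup _ S S' h]
    have hsplit : ∀ S x, F S x = F0 S x + if S i then D S x else 0 := by
      intro S x
      cases hS : S i
      · have : Function.update S i false = S := by rw [← hS, Function.update_eq_self]
        simp [hF0, this]
      · have : Function.update S i true = S := by rw [← hS, Function.update_eq_self]
        simp [hF0, hD, this]
    have hpat : ∀ x, (pattern L x i = true) ↔ 0 < L i x := fun x => by simp [pattern]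
    have hψ' : Continuous fun x => fderiv ℝ ψ x w :=
      (hψ.continuous_fderiv (by simp)).clm_apply continuous_const
    have hψ'c : HasCompactSupport fun x => fderiv ℝ ψ x w := hψc.fderiv_apply ℝ w
    have hdc : ∀ S, Continuous fun x => fderiv ℝ (D S) x w := fun S =>
      ((hDs S).continuous_fderiv (by simp)).clm_apply continuous_const
    -- the contribution of the difference, with smooth cutoffs
    set θ : ℕ → E → ℝ := fun k x => Real.smoothTransition (((k : ℝ) + 1) * L i x) with hθ
    have hθs : ∀ k, ContDiff ℝ ∞ (θ k) := fun k =>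
      Real.smoothTransition.contDiff.comp (contDiff_const.mul (L i).contDiff)
    have hθd : ∀ k x, fderiv ℝ (θ k) x w
        = ((k : ℝ) + 1) * stepDeriv (((k : ℝ) + 1) * L i x) * L i w := by
      intro k x
      have h1 : HasFDerivAt (θ k)
          (stepDeriv (((k : ℝ) + 1) * L i x) • (((k : ℝ) + 1) • L i)) x :=
        (hasDerivAt_step _).comp_hasFDerivAt x ((L i).hasFDerivAt.const_mul _)
      rw [h1.fderiv]
      simp only [_root_.smul_apply, smul_eq_mul]
      ring
    -- The induction hypothesis for `D` with test function `θ k * ψ`. The derivative of the cutoff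
    -- yields the second term on the left, which tends to the integral over the wall `i`.
    have hk : ∀ k : ℕ, (∫ x, θ k x * (D (pattern L x) x * fderiv ℝ ψ x w) ∂μ)
        + L i w * ∫ x, D (pattern L x) x * ψ x *
          (((k : ℝ) + 1) * stepDeriv (((k : ℝ) + 1) * L i x)) ∂μ
        = -(∫ x, θ k x * (fderiv ℝ (D (pattern L x)) x w * ψ x) ∂μ)
          - ∑ j ∈ J, L j w * ∫ y, θ k y * ((D (Function.update (pattern L y) j true) y
            - D (Function.update (pattern L y) j false) y) * ψ y) ∂(wallMeasure μ (L j) (d j)) := by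
      intro k
      have h := ih D hDs hDJ (fun x => θ k x * ψ x) ((hθs k).mul hψ) hψc.mul_left
      have h1 : ∀ x, fderiv ℝ (fun x => θ k x * ψ x) x w
          = θ k x * fderiv ℝ ψ x w
            + L i w * (ψ x * (((k : ℝ) + 1) * stepDeriv (((k : ℝ) + 1) * L i x))) := by
        intro x
        rw [fderiv_fun_mul ((hθs k).differentiable (by simp) x) (hψ.differentiable (by simp) x)]
        simp only [_root_.add_apply, _root_.smul_apply, smul_eq_mul, hθd]
        ring
      have hstc : Continuous fun x => ((k : ℝ) + 1) * stepDeriv (((k : ℝ) + 1) * L i x) :=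
        continuous_const.mul (continuous_stepDeriv.comp
          (continuous_const.mul (L i).continuous))
      have e1 : ∫ x, D (pattern L x) x * fderiv ℝ (fun x => θ k x * ψ x) x w ∂μ
          = (∫ x, θ k x * (D (pattern L x) x * fderiv ℝ ψ x w) ∂μ)
            + L i w * ∫ x, D (pattern L x) x * ψ x *
              (((k : ℝ) + 1) * stepDeriv (((k : ℝ) + 1) * L i x)) ∂μ := by
        rw [← integral_const_mul, ← integral_add]
        · refine integral_congr_ae (Eventually.of_forall fun x => ?_)
          simp only [h1]
          ring
        · refine (integrable_apply_pattern_mul L (fun S => (hDs S).continuous)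
            ((hθs k).continuous.mul hψ') hψ'c.mul_left μ).congr (Eventually.of_forall fun x => ?_)
          simp only [Pi.mul_apply]
          ring
        · refine (integrable_apply_pattern_mul L (fun S => (hDs S).continuous)
            ((continuous_const (y := L i w)).mul (hψ.continuous.mul hstc))
            hψc.mul_right.mul_left μ).congr (Eventually.of_forall fun x => ?_)
          simp only [Pi.mul_apply]
          ring
      rw [← e1, h]
      congr 2
      · refine integral_congr_ae (Eventually.of_forall fun x => ?_)
        ring
      · funext j
        congr 2
        funext y
        ring
    have hlim1 := tendsto_integral_step (L i).continuous.measurable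
      (integrable_apply_pattern_mul L (fun S => (hDs S).continuous) hψ' hψ'c μ)
    obtain ⟨M, hM⟩ := exists_bound_apply_pattern_mul L (fun S => (hDs S).continuous)
      hψ.continuous hψc
    -- Almost every point of the wall `i` avoids the other walls, and `D` does not see the sign at
    -- `i`; near such a point the integrand is one fixed smooth function.
    have hcont : ∀ᵐ y ∂(wallMeasure μ (L i) (d i)),
        ContinuousAt (fun x => D (pattern L x) x * ψ x) y := by
      have : ∀ᵐ y ∂(wallMeasure μ (L i) (d i)), ∀ j ∈ J, L j y ≠ 0 := by
        refine (ae_ball_iff J.countable_toSet).mpr ?_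
        exact fun j hj => hL i j fun h => hi (h ▸ hj)
      filter_upwards [this] with y hy
      have hev : ∀ᶠ x in nhds y, D (pattern L y) x * ψ x = D (pattern L x) x * ψ x := by
        have : ∀ᶠ x in nhds y, ∀ j ∈ J, pattern L x j = pattern L y j :=
          (Finset.eventually_all J).mpr fun j hj => pattern_eventually_eq L (hy j hj)
        filter_upwards [this] with x hx
        rw [hDJ _ _ hx]
      exact ((hDs _).continuous.mul hψ.continuous).continuousAt.congr hev
    have hlim2 := tendsto_integral_stepDeriv μ (hd i)
      ((measurable_apply_pattern L (fun S => (hDs S).continuous)).mul hψ.continuous.measurable)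
      hM hψc.isCompact
      (fun x hx => by rw [Pi.mul_apply, image_eq_zero_of_notMem_tsupport hx, mul_zero]) hcont
    have hlim3 := tendsto_integral_step (L i).continuous.measurable
      (integrable_apply_pattern_mul L hdc hψ.continuous hψc μ)
    have hlim4 : ∀ j ∈ J, _ := fun j (_ : j ∈ J) =>
      (tendsto_integral_step (L i).continuous.measurable
        (integrable_apply_pattern_mul L
          (A := fun S x => D (Function.update S j true) x - D (Function.update S j false) x)
          (fun S => ((hDs _).sub (hDs _)).continuous) hψ.continuous hψc
          (wallMeasure μ (L j) (d j)))).const_mul (L j w)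
    -- The identities for smooth cutoffs pass to the limit as the cutoffs become the indicator of
    -- the positive side.
    have hlim := tendsto_nhds_unique
      ((hlim1.add (hlim2.const_mul (L i w))).congr hk)
      (hlim3.neg.sub (tendsto_finsetSum J hlim4))
    have h0 := ih F0 hF0s hF0J ψ hψ hψc
    have hA : ∫ x, F (pattern L x) x * fderiv ℝ ψ x w ∂μ
        = (∫ x, F0 (pattern L x) x * fderiv ℝ ψ x w ∂μ)
          + ∫ x, (if 0 < L i x then D (pattern L x) x * fderiv ℝ ψ x w else 0) ∂μ := by
      rw [← integral_add]
      · refine integral_congr_ae (Eventually.of_forall fun x => ?_)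
        simp only [hsplit (pattern L x) x, hpat]
        split_ifs <;> ring
      · exact integrable_apply_pattern_mul L (fun S => (hF0s S).continuous) hψ' hψ'c μ
      · refine ((integrable_apply_pattern_mul L (fun S => (hDs S).continuous) hψ' hψ'c
          μ).indicator (s := {x | 0 < L i x})
            (measurableSet_lt measurable_const (L i).continuous.measurable)).congr
          (Eventually.of_forall fun x => ?_)
        simp [Set.indicator_apply]
    have hfd : ∀ S x, fderiv ℝ (F S) x w
        = fderiv ℝ (F0 S) x w + if S i then fderiv ℝ (D S) x w else 0 := by
      intro S x
      have : F S = fun x => F0 S x + if S i then D S x else 0 := funext (hsplit S)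
      rw [this]
      split_ifs
      · rw [fderiv_fun_add ((hF0s S).differentiable (by simp) x)
          ((hDs S).differentiable (by simp) x)]
        rfl
      · simp
    have hB : ∫ x, fderiv ℝ (F (pattern L x)) x w * ψ x ∂μ
        = (∫ x, fderiv ℝ (F0 (pattern L x)) x w * ψ x ∂μ)
          + ∫ x, (if 0 < L i x then fderiv ℝ (D (pattern L x)) x w * ψ x else 0) ∂μ := by
      rw [← integral_add]
      · refine integral_congr_ae (Eventually.of_forall fun x => ?_)
        simp only [hfd (pattern L x) x, hpat]
        split_ifs <;> ring
      · exact integrable_apply_pattern_mul L (A := fun S x => fderiv ℝ (F0 S) x w)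
          (fun S => ((hF0s S).continuous_fderiv (by simp)).clm_apply continuous_const)
          hψ.continuous hψc μ
      · refine ((integrable_apply_pattern_mul L hdc hψ.continuous hψc
          μ).indicator (s := {x | 0 < L i x})
            (measurableSet_lt measurable_const (L i).continuous.measurable)).congr
          (Eventually.of_forall fun x => ?_)
        simp [Set.indicator_apply]
    have hC : ∀ j ∈ J, L j w * ∫ y, (F (Function.update (pattern L y) j true) y
            - F (Function.update (pattern L y) j false) y) * ψ y ∂(wallMeasure μ (L j) (d j))
        = L j w * (∫ y, (F0 (Function.update (pattern L y) j true) y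
            - F0 (Function.update (pattern L y) j false) y) * ψ y ∂(wallMeasure μ (L j) (d j)))
          + L j w * ∫ y, (if 0 < L i y then (D (Function.update (pattern L y) j true) y
            - D (Function.update (pattern L y) j false) y) * ψ y else 0)
              ∂(wallMeasure μ (L j) (d j)) := by
      intro j hj
      have hij : i ≠ j := fun h => hi (h ▸ hj)
      rw [← mul_add, ← integral_add]
      · congr 2
        funext y
        rw [hsplit (Function.update (pattern L y) j true), 
          hsplit (Function.update (pattern L y) j false), Function.update_of_ne hij,
          Function.update_of_ne hij]
        simp only [hpat]
        split_ifs <;> ring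
      · exact integrable_apply_pattern_mul L
          (A := fun S x => F0 (Function.update S j true) x - F0 (Function.update S j false) x)
          (fun S => ((hF0s _).sub (hF0s _)).continuous) hψ.continuous hψc _
      · refine ((integrable_apply_pattern_mul L
          (A := fun S x => D (Function.update S j true) x - D (Function.update S j false) x)
          (fun S => ((hDs _).sub (hDs _)).continuous) hψ.continuous hψc
          (wallMeasure μ (L j) (d j))).indicator (s := {x | 0 < L i x})
            (measurableSet_lt measurable_const (L i).continuous.measurable)).congr
          (Eventually.of_forall fun x => ?_)
        simp [Set.indicator_apply]
    rw [hA, hB, Finset.sum_insert hi, Finset.sum_congr rfl hC, Finset.sum_add_distrib, h0]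
    have hDi : ∫ y, (F (Function.update (pattern L y) i true) y
            - F (Function.update (pattern L y) i false) y) * ψ y ∂(wallMeasure μ (L i) (d i))
        = ∫ y, D (pattern L y) y * ψ y ∂(wallMeasure μ (L i) (d i)) := rfl
    rw [hDi]
    simp only [Pi.mul_apply] at hlim
    linarith

end Arrangement

/-! ### Vignéras' operator on functions with jumps -/

instance isAddHaarMeasure_volume (n : ℕ) : (volume : Measure (Coord n b)).IsAddHaarMeasure :=
  Measure.instIsAddHaarMeasureForallVolumeOfMeasurableAddOfSigmaFinite

/-- The functional `u · x`. -/
noncomputable def Geometry.wallForm (G : Geometry b) {n : ℕ} (p : Fin n → Fin b → ℤ) (u : Coord n b) :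
    Coord n b →L[ℝ] ℝ := (G.bilL p u).toContinuousLinearMap

theorem Geometry.wallForm_apply (G : Geometry b) {n : ℕ} (p : Fin n → Fin b → ℤ) (u x : Coord n b) :
    G.wallForm p u x = G.bil p u x := rfl

/-- The vector `u / u²`. -/
noncomputable def Geometry.wallNormal (G : Geometry b) {n : ℕ} (p : Fin n → Fin b → ℤ)
    (u : Coord n b) : Coord n b := (G.bil p u u)⁻¹ • u

theorem Geometry.wallForm_wallNormal (G : Geometry b) {n : ℕ} (p : Fin n → Fin b → ℤ) {u : Coord n b}
    (hu : G.bil p u u ≠ 0) : G.wallForm p u (G.wallNormal p u) = 1 := by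
  rw [Geometry.wallNormal, map_smul, G.wallForm_apply, smul_eq_mul, inv_mul_cancel₀ hu]

theorem Geometry.deltaMeasure_eq (G : Geometry b) {n : ℕ} (p : Fin n → Fin b → ℤ) (u : Coord n b) :
    G.deltaMeasure p u = wallMeasure volume (G.wallForm p u) (G.wallNormal p u) := by
  rw [Geometry.deltaMeasure, wallMeasure]
  congr 1
  funext x
  rw [Geometry.wallNormal, smul_smul, G.wallForm_apply, div_eq_mul_inv]

/-- The inverse forms raise the index of the covector `u ·` and give back `u`. Thus `∂²` turns the
conormal of a wall into the derivative along `u`. -/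
theorem Geometry.sum_inv_kmat_mul (G : Geometry b) {n : ℕ} {p : Fin n → Fin b → ℤ}
    (hp : ∀ i, p i ∈ G.D4) (T : Coord n b →ₗ[ℝ] ℝ) (u : Coord n b) :
    ∑ i, ∑ a, ∑ a', (kmat G.κ (p i))⁻¹ a a' * (G.bil p u (coordDir i a') * T (coordDir i a))
      = T u := by
  have h1 : ∀ i a', G.bil p u (coordDir i a') = (kmat G.κ (p i) *ᵥ u i) a' := by
    intro i a'
    rw [G.bil_comm, coordDir, G.bil_single, G.cub_toR, single_one_dotProduct]
  have h2 : ∀ i a, ∑ a', (kmat G.κ (p i))⁻¹ a a' * (G.bil p u (coordDir i a') * T (coordDir i a))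
      = u i a * T (coordDir i a) := by
    intro i a
    simp_rw [h1, ← mul_assoc]
    rw [← Finset.sum_mul]
    congr 1
    have h3 : (kmat G.κ (p i))⁻¹ *ᵥ (kmat G.κ (p i) *ᵥ u i) = u i := by
      rw [Matrix.mulVec_mulVec, Matrix.nonsing_inv_mul _ (G.isUnit_det (hp i)), Matrix.one_mulVec]
    exact congrFun h3 a
  simp_rw [h2]
  conv_rhs => rw [← sum_coordDir u]
  simp [map_sum]

theorem Geometry.sum_inv_kmat_mul' (G : Geometry b) {n : ℕ} {p : Fin n → Fin b → ℤ}
    (hp : ∀ i, p i ∈ G.D4) (T : Coord n b →ₗ[ℝ] ℝ) (u : Coord n b) :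
    ∑ i, ∑ a, ∑ a', (kmat G.κ (p i))⁻¹ a a' * (G.bil p u (coordDir i a) * T (coordDir i a'))
      = T u := by
  rw [← G.sum_inv_kmat_mul hp T u]
  refine Finset.sum_congr rfl fun i _ => ?_
  rw [Finset.sum_comm]
  refine Finset.sum_congr rfl fun a _ => Finset.sum_congr rfl fun a' _ => ?_
  rw [G.inv_kmat_symm]

theorem integral_apply_pattern_mul_pd {n : ℕ} {ι : Type*} [Fintype ι] [DecidableEq ι]
    {L : ι → Coord n b →L[ℝ] ℝ} {d : ι → Coord n b} (hd : ∀ i, L i (d i) = 1)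
    (hL : ∀ i j, i ≠ j → ∀ᵐ y ∂(wallMeasure volume (L i) (d i)), L j y ≠ 0)
    {F : (ι → Bool) → Coord n b → ℝ} (hF : ∀ S, ContDiff ℝ ∞ (F S)) {ψ : Coord n b → ℝ}
    (hψ : ContDiff ℝ ∞ ψ) (hψc : HasCompactSupport ψ) (i : Fin n) (a : Fin b) :
    ∫ x, F (pattern L x) x * pd i a ψ x
      = -(∫ x, pd i a (F (pattern L x)) x * ψ x)
        - ∑ j, L j (coordDir i a) * ∫ y, (F (Function.update (pattern L y) j true) y
            - F (Function.update (pattern L y) j false) y) * ψ y ∂(wallMeasure volume (L j) (d j)) :=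
  integral_apply_pattern_mul_fderiv volume hd hL (coordDir i a) Finset.univ F hF
    (fun S S' h => by rw [funext fun i => h i (Finset.mem_univ i)]) ψ hψ hψc

theorem integral_apply_pattern_mul_pd_pd {n : ℕ} {ι : Type*} [Fintype ι] [DecidableEq ι]
    {L : ι → Coord n b →L[ℝ] ℝ} {d : ι → Coord n b} (hd : ∀ i, L i (d i) = 1)
    (hL : ∀ i j, i ≠ j → ∀ᵐ y ∂(wallMeasure volume (L i) (d i)), L j y ≠ 0)
    {F : (ι → Bool) → Coord n b → ℝ} (hF : ∀ S, ContDiff ℝ ∞ (F S)) {ψ : Coord n b → ℝ}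
    (hψ : ContDiff ℝ ∞ ψ) (hψc : HasCompactSupport ψ) (i : Fin n) (a a' : Fin b) :
    ∫ x, F (pattern L x) x * pd i a (pd i a' ψ) x
      = (∫ x, pd i a (pd i a' (F (pattern L x))) x * ψ x)
        + ∑ j, (L j (coordDir i a') * (∫ y, (fderiv ℝ (F (Function.update (pattern L y) j true)) y
              (coordDir i a) - fderiv ℝ (F (Function.update (pattern L y) j false)) y
              (coordDir i a)) * ψ y ∂(wallMeasure volume (L j) (d j)))
          - L j (coordDir i a) * ∫ y, (F (Function.update (pattern L y) j true) y
            - F (Function.update (pattern L y) j false) y) * fderiv ℝ ψ y (coordDir i a')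
              ∂(wallMeasure volume (L j) (d j))) := by
  rw [integral_apply_pattern_mul_pd hd hL hF (contDiff_pd hψ i a') (hasCompactSupport_pd hψc i a'),
    integral_apply_pattern_mul_pd hd hL (F := fun S => pd i a (F S)) (fun S => contDiff_pd (hF S) i a)
      hψ hψc i a', Finset.sum_sub_distrib]
  simp_rw [pd_comm (hF _) i i a' a]
  simp only [pd_apply]
  ring

theorem integral_sum_sum_sum {X : Type*} [MeasurableSpace X] {ν : Measure X} {n : ℕ}
    {f : Fin n → Fin b → Fin b → X → ℝ} (hf : ∀ i a a', Integrable (f i a a') ν)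
    (r : Fin n → Fin b → Fin b → ℝ) :
    ∫ x, ∑ i, ∑ a, ∑ a', r i a a' * f i a a' x ∂ν
      = ∑ i, ∑ a, ∑ a', r i a a' * ∫ x, f i a a' x ∂ν := by
  rw [integral_finsetSum _ fun i _ => integrable_finsetSum _ fun a _ =>
    integrable_finsetSum _ fun a' _ => (hf i a a').const_mul _]
  refine Finset.sum_congr rfl fun i _ => ?_
  rw [integral_finsetSum _ fun a _ => integrable_finsetSum _ fun a' _ => (hf i a a').const_mul _]
  refine Finset.sum_congr rfl fun a _ => ?_
  rw [integral_finsetSum _ fun a' _ => (hf i a a').const_mul _]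
  exact Finset.sum_congr rfl fun a' _ => integral_const_mul _ _

theorem integral_add_mul_add_mul {X : Type*} [MeasurableSpace X] {ν : Measure X} {f g h : X → ℝ}
    (hf : Integrable f ν) (hg : Integrable g ν) (hh : Integrable h ν) (r s : ℝ) :
    ∫ x, (f x + r * g x + s * h x) ∂ν = ∫ x, f x ∂ν + r * ∫ x, g x ∂ν + s * ∫ x, h x ∂ν := by
  rw [← integral_const_mul, ← integral_const_mul]
  refine (integral_add (hf.add (hg.const_mul r)) (hh.const_mul s)).trans ?_
  congr 1
  exact integral_add hf (hg.const_mul r)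

theorem integral_sum_sum {X : Type*} [MeasurableSpace X] {ν : Measure X} {n : ℕ}
    {f : Fin n → Fin b → X → ℝ} (hf : ∀ i a, Integrable (f i a) ν) :
    ∫ x, ∑ i, ∑ a, f i a x ∂ν = ∑ i, ∑ a, ∫ x, f i a x ∂ν := by
  rw [integral_finsetSum _ fun i _ => integrable_finsetSum _ fun a _ => hf i a]
  exact Finset.sum_congr rfl fun i _ => integral_finsetSum _ fun a _ => hf i a

variable (G : Geometry b) {n : ℕ} {p : Fin n → Fin b → ℤ} {ι : Type*} [Fintype ι] [DecidableEq ι]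

/-- The distribution `V_λ f`, for a function `f` which solves Vignéras' equation off a hyperplane
arrangement. -/
theorem Geometry.integral_apply_pattern_mul_vignerasAdj (hp : ∀ i, p i ∈ G.D4)
    {u : ι → Coord n b} (hu : ∀ i, G.bil p (u i) (u i) ≠ 0)
    (hL : ∀ i j, i ≠ j → ∀ᵐ y ∂(G.deltaMeasure p (u i)), G.bil p (u j) y ≠ 0)
    {F : (ι → Bool) → Coord n b → ℝ} (hF : ∀ S, ContDiff ℝ ∞ (F S)) (lam : ℝ)
    (hV : ∀ S x, G.vigneras p lam (F S) x = 0) {ψ : Coord n b → ℝ}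
    (hψ : ContDiff ℝ ∞ ψ) (hψc : HasCompactSupport ψ) :
    ∫ x, F (pattern (fun i => G.wallForm p (u i)) x) x * G.vignerasAdj p lam ψ x
      = ∑ j, ((∫ y, (fderiv ℝ (F (Function.update (pattern (fun i => G.wallForm p (u i)) y) j true)) y
              (u j) - fderiv ℝ (F (Function.update (pattern (fun i => G.wallForm p (u i)) y) j false)) y
              (u j)) * ψ y ∂(G.deltaMeasure p (u j)))
          - ∫ y, (F (Function.update (pattern (fun i => G.wallForm p (u i)) y) j true) y
            - F (Function.update (pattern (fun i => G.wallForm p (u i)) y) j false) y) *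
              fderiv ℝ ψ y (u j) ∂(G.deltaMeasure p (u j))) := by
  set L : ι → Coord n b →L[ℝ] ℝ := fun i => G.wallForm p (u i) with hLdef
  set d : ι → Coord n b := fun i => G.wallNormal p (u i) with hddef
  have hd : ∀ i, L i (d i) = 1 := fun i => G.wallForm_wallNormal p (hu i)
  have hσ : ∀ j, G.deltaMeasure p (u j) = wallMeasure volume (L j) (d j) := fun j =>
    G.deltaMeasure_eq p (u j)
  have hL' : ∀ i j, i ≠ j → ∀ᵐ y ∂(wallMeasure volume (L i) (d i)), L j y ≠ 0 := fun i j hij => by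
    rw [← hσ]
    exact hL i j hij
  simp_rw [hσ]
  have hFc : ∀ S, Continuous (F S) := fun S => (hF S).continuous
  have hfc : ∀ S (w : Coord n b), Continuous fun x => fderiv ℝ (F S) x w := fun S w =>
    ((hF S).continuous_fderiv (by simp)).clm_apply continuous_const
  -- the boundary terms, as linear functionals of a direction
  have hI1 : ∀ j w, Integrable (fun y => (fderiv ℝ (F (Function.update (pattern L y) j true)) y w
      - fderiv ℝ (F (Function.update (pattern L y) j false)) y w) * ψ y)
      (wallMeasure volume (L j) (d j)) := fun j w =>
    integrable_apply_pattern_mul L (A := fun S y => fderiv ℝ (F (Function.update S j true)) y w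
      - fderiv ℝ (F (Function.update S j false)) y w) (fun S => (hfc _ w).sub (hfc _ w))
      hψ.continuous hψc _
  have hI2 : ∀ j w, Integrable (fun y => (F (Function.update (pattern L y) j true) y
      - F (Function.update (pattern L y) j false) y) * fderiv ℝ ψ y w)
      (wallMeasure volume (L j) (d j)) := fun j w =>
    integrable_apply_pattern_mul L (A := fun S y => F (Function.update S j true) y
      - F (Function.update S j false) y) (fun S => (hFc _).sub (hFc _))
      ((hψ.continuous_fderiv (by simp)).clm_apply continuous_const) (hψc.fderiv_apply ℝ w) _
  set T1 : ι → Coord n b →ₗ[ℝ] ℝ := fun j =>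
    { toFun := fun w => ∫ y, (fderiv ℝ (F (Function.update (pattern L y) j true)) y w
        - fderiv ℝ (F (Function.update (pattern L y) j false)) y w) * ψ y
          ∂(wallMeasure volume (L j) (d j))
      map_add' := fun w w' => by
        rw [← integral_add (hI1 j w) (hI1 j w')]
        refine integral_congr_ae (Eventually.of_forall fun y => ?_)
        simp only [map_add]
        ring
      map_smul' := fun r w => by
        rw [smul_eq_mul, ← integral_const_mul]
        refine integral_congr_ae (Eventually.of_forall fun y => ?_)
        simp only [map_smul, smul_eq_mul, RingHom.id_apply]
        ring } with hT1
  set T2 : ι → Coord n b →ₗ[ℝ] ℝ := fun j =>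
    { toFun := fun w => ∫ y, (F (Function.update (pattern L y) j true) y
        - F (Function.update (pattern L y) j false) y) * fderiv ℝ ψ y w
          ∂(wallMeasure volume (L j) (d j))
      map_add' := fun w w' => by
        rw [← integral_add (hI2 j w) (hI2 j w')]
        refine integral_congr_ae (Eventually.of_forall fun y => ?_)
        simp only [map_add]
        ring
      map_smul' := fun r w => by
        rw [smul_eq_mul, ← integral_const_mul]
        refine integral_congr_ae (Eventually.of_forall fun y => ?_)
        simp only [map_smul, smul_eq_mul, RingHom.id_apply]
        ring } with hT2
  have hy : ∀ i a, ContDiff ℝ ∞ fun y : Coord n b => y i a := fun i a => by fun_prop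
  have hyψ : ∀ i a, ContDiff ℝ ∞ fun y : Coord n b => y i a * ψ y := fun i a => (hy i a).mul hψ
  have hyψc : ∀ i a, HasCompactSupport fun y : Coord n b => y i a * ψ y := fun i a => hψc.mul_left
  -- the second order part
  have hbox : ∫ x, F (pattern L x) x * G.box p ψ x
      = (∫ x, G.box p (F (pattern L x)) x * ψ x) + ∑ j, (T1 j (u j) - T2 j (u j)) := by
    have hA : ∀ i a a', Integrable fun x => F (pattern L x) x * pd i a (pd i a' ψ) x :=
      fun i a a' => integrable_apply_pattern_mul L hFc
        (contDiff_pd (contDiff_pd hψ i a') i a).continuous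
        (hasCompactSupport_pd (hasCompactSupport_pd hψc i a') i a) volume
    have hB : ∀ i a a', Integrable fun x => pd i a (pd i a' (F (pattern L x))) x * ψ x :=
      fun i a a' => integrable_apply_pattern_mul L (A := fun S => pd i a (pd i a' (F S)))
        (fun S => (contDiff_pd (contDiff_pd (hF S) i a') i a).continuous) hψ.continuous hψc volume
    have e1 : ∫ x, F (pattern L x) x * G.box p ψ x
        = ∑ i, ∑ a, ∑ a', (kmat G.κ (p i))⁻¹ a a' *
          ∫ x, F (pattern L x) x * pd i a (pd i a' ψ) x := by
      rw [← integral_sum_sum_sum hA fun i a a' => (kmat G.κ (p i))⁻¹ a a']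
      refine integral_congr_ae (Eventually.of_forall fun x => ?_)
      simp only [Geometry.box, Finset.mul_sum]
      refine Finset.sum_congr rfl fun i _ => Finset.sum_congr rfl fun a _ =>
        Finset.sum_congr rfl fun a' _ => ?_
      ring
    have e2 : ∫ x, G.box p (F (pattern L x)) x * ψ x
        = ∑ i, ∑ a, ∑ a', (kmat G.κ (p i))⁻¹ a a' *
          ∫ x, pd i a (pd i a' (F (pattern L x))) x * ψ x := by
      rw [← integral_sum_sum_sum hB fun i a a' => (kmat G.κ (p i))⁻¹ a a']
      refine integral_congr_ae (Eventually.of_forall fun x => ?_)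
      simp only [Geometry.box, Finset.sum_mul]
      refine Finset.sum_congr rfl fun i _ => Finset.sum_congr rfl fun a _ =>
        Finset.sum_congr rfl fun a' _ => ?_
      ring
    rw [e1, e2]
    simp_rw [integral_apply_pattern_mul_pd_pd hd hL' hF hψ hψc, mul_add, Finset.sum_add_distrib]
    congr 1
    -- Contracted with the inverse forms, the conormal `u_j ·` of the wall becomes the direction
    -- `u_j` in both boundary terms.
    have e3 : ∀ j, T1 j (u j) - T2 j (u j) = ∑ i, ∑ a, ∑ a', (kmat G.κ (p i))⁻¹ a a' *
        (L j (coordDir i a') * T1 j (coordDir i a) - L j (coordDir i a) * T2 j (coordDir i a')) := by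
      intro j
      conv_lhs => rw [← G.sum_inv_kmat_mul hp (T1 j) (u j), ← G.sum_inv_kmat_mul' hp (T2 j) (u j)]
      simp only [← Finset.sum_sub_distrib, ← mul_sub]
      rfl
    simp_rw [e3, Finset.mul_sum]
    symm
    rw [Finset.sum_comm]
    refine Finset.sum_congr rfl fun i _ => ?_
    rw [Finset.sum_comm]
    refine Finset.sum_congr rfl fun a _ => ?_
    rw [Finset.sum_comm]
    rfl
  -- the first order part
  have heuler : ∫ x, F (pattern L x) x * ∑ i, ∑ a, pd i a (fun y => y i a * ψ y) x
      = -∫ x, (∑ i, ∑ a, x i a * pd i a (F (pattern L x)) x) * ψ x := by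
    have hA : ∀ i a, Integrable fun x => F (pattern L x) x * pd i a (fun y => y i a * ψ y) x :=
      fun i a => integrable_apply_pattern_mul L hFc (contDiff_pd (hyψ i a) i a).continuous
        (hasCompactSupport_pd (hyψc i a) i a) volume
    have hB : ∀ i a, Integrable fun x => pd i a (F (pattern L x)) x * (x i a * ψ x) :=
      fun i a => integrable_apply_pattern_mul L (A := fun S => pd i a (F S))
        (fun S => (contDiff_pd (hF S) i a).continuous) (hyψ i a).continuous (hyψc i a) volume
    have e1 : ∫ x, F (pattern L x) x * ∑ i, ∑ a, pd i a (fun y => y i a * ψ y) x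
        = ∑ i, ∑ a, ∫ x, F (pattern L x) x * pd i a (fun y => y i a * ψ y) x := by
      rw [← integral_sum_sum hA]
      simp only [Finset.mul_sum]
    have e2 : ∫ x, (∑ i, ∑ a, x i a * pd i a (F (pattern L x)) x) * ψ x
        = ∑ i, ∑ a, ∫ x, pd i a (F (pattern L x)) x * (x i a * ψ x) := by
      rw [← integral_sum_sum hB]
      refine integral_congr_ae (Eventually.of_forall fun x => ?_)
      simp only [Finset.sum_mul]
      refine Finset.sum_congr rfl fun i _ => Finset.sum_congr rfl fun a _ => ?_
      ring
    have hC : ∀ j i a, Integrable (fun y => (F (Function.update (pattern L y) j true) y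
        - F (Function.update (pattern L y) j false) y) * (L j (coordDir i a) * (y i a * ψ y)))
        (wallMeasure volume (L j) (d j)) := fun j i a =>
      integrable_apply_pattern_mul L (A := fun S y => F (Function.update S j true) y
        - F (Function.update S j false) y) (fun S => (hFc _).sub (hFc _))
        (contDiff_const.mul (hyψ i a)).continuous (hyψc i a).mul_left _
    -- The boundary terms of Euler's operator combine to the factor `u_j · y`, which vanishes on the
    -- wall. Only the second order part of the operator contributes there.
    have e3 : ∀ j, ∑ i, ∑ a, L j (coordDir i a) *
        ∫ y, (F (Function.update (pattern L y) j true) y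
          - F (Function.update (pattern L y) j false) y) * (y i a * ψ y)
            ∂(wallMeasure volume (L j) (d j)) = 0 := by
      intro j
      have h1 : ∀ i a, L j (coordDir i a) *
          ∫ y, (F (Function.update (pattern L y) j true) y
            - F (Function.update (pattern L y) j false) y) * (y i a * ψ y)
              ∂(wallMeasure volume (L j) (d j))
          = ∫ y, (F (Function.update (pattern L y) j true) y
            - F (Function.update (pattern L y) j false) y) * (L j (coordDir i a) * (y i a * ψ y))
              ∂(wallMeasure volume (L j) (d j)) := by
        intro i a
        rw [← integral_const_mul]
        refine integral_congr_ae (Eventually.of_forall fun y => ?_)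
        ring
      simp_rw [h1]
      rw [← integral_sum_sum (hC j)]
      refine (integral_congr_ae ?_).trans (integral_zero _ _)
      filter_upwards [ae_wallMeasure_eq_zero volume (hd j)] with y hy
      have h2 : ∑ i, ∑ a, L j (coordDir i a) * y i a = 0 := by
        rw [← hy]
        conv_rhs => rw [← sum_coordDir y]
        simp only [map_sum, map_smul, smul_eq_mul]
        exact Finset.sum_congr rfl fun i _ => Finset.sum_congr rfl fun a _ => mul_comm _ _
      calc _ = (∑ i, ∑ a, L j (coordDir i a) * y i a) *
            ((F (Function.update (pattern L y) j true) y
              - F (Function.update (pattern L y) j false) y) * ψ y) := by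
            simp only [Finset.sum_mul]
            refine Finset.sum_congr rfl fun i _ => Finset.sum_congr rfl fun a _ => ?_
            ring
        _ = 0 := by rw [h2, zero_mul]
    rw [e1, e2]
    simp_rw [fun i a => integral_apply_pattern_mul_pd hd hL' hF (hyψ i a) (hyψc i a) i a,
      Finset.sum_sub_distrib, Finset.sum_neg_distrib]
    have e4 : ∑ i, ∑ a, ∑ j, L j (coordDir i a) *
        ∫ y, (F (Function.update (pattern L y) j true) y
          - F (Function.update (pattern L y) j false) y) * (y i a * ψ y)
            ∂(wallMeasure volume (L j) (d j)) = 0 := by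
      simp_rw [fun i => Finset.sum_comm (s := (Finset.univ : Finset (Fin b)))
        (t := (Finset.univ : Finset ι)) (f := fun a j => L j (coordDir i a) *
        ∫ y, (F (Function.update (pattern L y) j true) y
          - F (Function.update (pattern L y) j false) y) * (y i a * ψ y)
            ∂(wallMeasure volume (L j) (d j)))]
      rw [Finset.sum_comm]
      exact Finset.sum_eq_zero fun j _ => e3 j
    rw [e4, sub_zero]
  have hcb : HasCompactSupport (G.box p ψ) := hasCompactSupport_box G p hψc
  have hbI := integrable_apply_pattern_mul L hFc (contDiff_box G p hψ).continuous hcb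
    (volume : Measure (Coord n b))
  have heI := integrable_apply_pattern_mul L hFc
    (ψ := fun x => ∑ i, ∑ a, pd i a (fun y => y i a * ψ y) x)
    (continuous_finsetSum _ fun i _ => continuous_finsetSum _ fun a _ =>
      (contDiff_pd (hyψ i a) i a).continuous)
    (HasCompactSupport.intro hψc.isCompact fun x hx => Finset.sum_eq_zero fun i _ =>
      Finset.sum_eq_zero fun a _ => by
        have h0 : x ∉ tsupport fun y : Coord n b => y i a * ψ y :=
          fun h => hx (tsupport_mul_subset_right h)
        rw [pd_apply, fderiv_of_notMem_tsupport (𝕜 := ℝ) h0]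
        rfl)
    (volume : Measure (Coord n b))
  have hψI := integrable_apply_pattern_mul L hFc hψ.continuous hψc (volume : Measure (Coord n b))
  have e0 : ∫ x, F (pattern L x) x * G.vignerasAdj p lam ψ x
      = (∫ x, F (pattern L x) x * G.box p ψ x)
        + -(2 * Real.pi) * (∫ x, F (pattern L x) x * ∑ i, ∑ a, pd i a (fun y => y i a * ψ y) x)
        + -(2 * Real.pi * lam) * ∫ x, F (pattern L x) x * ψ x := by
    rw [← integral_add_mul_add_mul hbI heI hψI]
    refine integral_congr_ae (Eventually.of_forall fun x => ?_)
    simp only [Geometry.vignerasAdj]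
    ring
  have hbI' := integrable_apply_pattern_mul L (A := fun S => G.box p (F S))
    (fun S => (contDiff_box G p (hF S)).continuous) hψ.continuous hψc
    (volume : Measure (Coord n b))
  have heI' := integrable_apply_pattern_mul L
    (A := fun S x => ∑ i, ∑ a, x i a * pd i a (F S) x)
    (fun S => continuous_finsetSum _ fun i _ => continuous_finsetSum _ fun a _ =>
      (hy i a).continuous.mul (contDiff_pd (hF S) i a).continuous) hψ.continuous hψc
    (volume : Measure (Coord n b))
  -- The bulk terms form Vignéras' operator applied to `F` inside the chambers, which is zero.
  have e5 : (∫ x, G.box p (F (pattern L x)) x * ψ x)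
      + 2 * Real.pi * (∫ x, (∑ i, ∑ a, x i a * pd i a (F (pattern L x)) x) * ψ x)
      + -(2 * Real.pi * lam) * (∫ x, F (pattern L x) x * ψ x) = 0 := by
    rw [← integral_add_mul_add_mul hbI' heI' hψI]
    refine (integral_congr_ae (Eventually.of_forall fun x => ?_)).trans (integral_zero _ _)
    have h := hV (pattern L x) x
    simp only [Geometry.vigneras] at h
    calc _ = (G.box p (F (pattern L x)) x + 2 * Real.pi *
        ((∑ i, ∑ a, x i a * pd i a (F (pattern L x)) x) - lam * F (pattern L x) x)) * ψ x := by
          ring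
      _ = 0 := by rw [h, zero_mul]
  rw [e0, hbox, heuler]
  have e6 : ∀ j, T1 j (u j) - T2 j (u j) = (∫ y, (fderiv ℝ (F (Function.update (pattern L y) j true)) y
              (u j) - fderiv ℝ (F (Function.update (pattern L y) j false)) y
              (u j)) * ψ y ∂(wallMeasure volume (L j) (d j)))
          - ∫ y, (F (Function.update (pattern L y) j true) y
            - F (Function.update (pattern L y) j false) y) *
              fderiv ℝ ψ y (u j) ∂(wallMeasure volume (L j) (d j)) := fun j => rfl
  rw [← Finset.sum_congr rfl fun j _ => e6 j]
  linarith


/-! ### The walls of marginal stability -/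

/-- Reversing both `ℓ` and `d` replaces the slab `0 ≤ ℓ ≤ 1` by its translate along `-d`, with the
same projection. -/
theorem wallMeasure_neg {V : Type*} [NormedAddCommGroup V] [NormedSpace ℝ V] [MeasurableSpace V]
    [BorelSpace V] [FiniteDimensional ℝ V] (μ : Measure V) [μ.IsAddHaarMeasure] {ℓ : V →L[ℝ] ℝ}
    {d : V} (hd : ℓ d = 1) : wallMeasure μ (-ℓ) (-d) = wallMeasure μ ℓ d := by
  have h1 : (fun x => x - (-ℓ) x • (-d)) = fun x => x - ℓ x • d := by
    funext x
    simp
  ext A hA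
  rw [wallMeasure, wallMeasure, h1, Measure.map_apply (measurable_projection ℓ d) hA,
    Measure.map_apply (measurable_projection ℓ d) hA,
    Measure.restrict_apply (measurable_projection ℓ d hA),
    Measure.restrict_apply (measurable_projection ℓ d hA),
    ← measure_preimage_add_right μ d ((fun x => x - ℓ x • d) ⁻¹' A ∩ {x | 0 ≤ ℓ x ∧ ℓ x ≤ 1})]
  congr 1
  ext x
  have h2 : x + d - ℓ (x + d) • d = x - ℓ x • d := by
    rw [map_add, hd, add_smul, one_smul]
    abel
  rw [map_add, hd] at h2
  simp only [Set.mem_inter_iff, Set.mem_preimage, Set.mem_ofPred_eq, map_add, hd, h2,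
    _root_.neg_apply]
  constructor <;> rintro ⟨h, h', h''⟩ <;> exact ⟨h, by linarith, by linarith⟩

theorem Geometry.bil_neg_neg (G : Geometry b) {n : ℕ} (p : Fin n → Fin b → ℤ) (u : Coord n b) :
    G.bil p (-u) (-u) = G.bil p u u := by
  rw [G.bil_neg_left, G.bil_comm, G.bil_neg_left, neg_neg]

theorem Geometry.deltaMeasure_neg (G : Geometry b) {n : ℕ} (p : Fin n → Fin b → ℤ) {u : Coord n b}
    (hu : G.bil p u u ≠ 0) : G.deltaMeasure p (-u) = G.deltaMeasure p u := by
  rw [G.deltaMeasure_eq, G.deltaMeasure_eq, ← wallMeasure_neg volume (G.wallForm_wallNormal p hu)]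
  congr 1
  · ext x
    exact G.bil_neg_left p u x
  · rw [Geometry.wallNormal, Geometry.wallNormal, G.bil_neg_neg, smul_neg]

variable (G : Geometry b) {n : ℕ}

/-- `u_I`, the sum of the `u_{ij}` with `i` in `I` and `j` not in `I`. -/
noncomputable def Geometry.uSub (p : Fin n → Fin b → ℤ) (I : Finset (Fin n)) : Coord n b :=
  ∑ i ∈ I, ∑ j ∈ Iᶜ, G.uVec p i j

theorem Geometry.uCut_eq (p : Fin n → Fin b → ℤ) (s : Equiv.Perm (Fin n)) (ℓ : Fin n) :
    G.uCut p s ℓ = G.uSub p (cutSet s ℓ) := by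
  rw [Geometry.uCut, Geometry.uSub, ← image_head, sum_image_comp s (head_injective ℓ)]
  refine Finset.sum_congr rfl fun i _ => ?_
  rw [image_head, ← image_tail, sum_image_comp s (tail_injective ℓ)]

theorem Geometry.uSub_apply (p : Fin n → Fin b → ℤ) (I : Finset (Fin n)) (k : Fin n) :
    G.uSub p I k = (if k ∈ I then ∑ j ∈ Iᶜ, G.mass p j else -∑ i ∈ I, G.mass p i) • G.t := by
  have h1 : G.uSub p I k = (∑ i ∈ I, if k = i then (∑ j ∈ Iᶜ, G.mass p j) • G.t else 0)
      - ∑ j ∈ Iᶜ, if k = j then (∑ i ∈ I, G.mass p i) • G.t else 0 := by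
    have h2 : ∀ i j, G.uVec p i j k = (if k = i then G.mass p j • G.t else 0)
        - if k = j then G.mass p i • G.t else 0 := by
      intro i j
      rw [G.uVec_eq, Pi.sub_apply, Pi.single_apply, Pi.single_apply]
    simp only [Geometry.uSub, Finset.sum_apply, h2, Finset.sum_sub_distrib]
    congr 1
    · refine Finset.sum_congr rfl fun i _ => ?_
      split_ifs
      · rw [Finset.sum_smul]
      · simp
    · rw [Finset.sum_comm]
      refine Finset.sum_congr rfl fun i _ => ?_
      split_ifs
      · rw [Finset.sum_smul]
      · simp
  rw [h1, Finset.sum_ite_eq, Finset.sum_ite_eq]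
  by_cases hk : k ∈ I
  · simp [hk]
  · simp [hk]

theorem Geometry.uSub_compl (p : Fin n → Fin b → ℤ) (I : Finset (Fin n)) :
    G.uSub p Iᶜ = -G.uSub p I := by
  funext k
  rw [Pi.neg_apply, G.uSub_apply, G.uSub_apply, compl_compl, ← neg_smul]
  by_cases hk : k ∈ I <;> simp [hk]

theorem Geometry.bil_uSub_eq (p : Fin n → Fin b → ℤ) (I : Finset (Fin n)) (x : Coord n b) :
    G.bil p (G.uSub p I) x = (∑ j ∈ Iᶜ, G.mass p j) * (∑ i ∈ I, G.height p x i)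
      - (∑ i ∈ I, G.mass p i) * ∑ j ∈ Iᶜ, G.height p x j := by
  rw [Geometry.uSub, G.bil_sum_left]
  simp_rw [G.bil_sum_left, G.bil_uVec, Finset.sum_sub_distrib, ← Finset.sum_mul, ← Finset.mul_sum]
  rw [← Finset.sum_mul]

theorem Geometry.bil_uSub (p : Fin n → Fin b → ℤ) (I : Finset (Fin n)) (x : Coord n b) :
    G.bil p (G.uSub p I) x = -2 * ∑ i ∈ I, G.stabX p x i := by
  simp only [G.stabX_eq, ← Finset.mul_sum, Finset.sum_sub_distrib, ← Finset.sum_mul, G.bil_uSub_eq]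
  rw [← Finset.sum_add_sum_compl I (G.mass p), ← Finset.sum_add_sum_compl I (G.height p x)]
  ring

theorem Geometry.height_uSub (p : Fin n → Fin b → ℤ) (I : Finset (Fin n)) (k : Fin n) :
    G.height p (G.uSub p I) k
      = (if k ∈ I then ∑ j ∈ Iᶜ, G.mass p j else -∑ i ∈ I, G.mass p i) * G.mass p k := by
  rw [Geometry.height, G.uSub_apply, G.cub_smul_right]
  rfl

theorem Geometry.sum_mass_pos {p : Fin n → Fin b → ℤ} (hp : ∀ i, p i ∈ G.D4)
    {I : Finset (Fin n)} (hI : I.Nonempty) : 0 < ∑ i ∈ I, G.mass p i :=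
  Finset.sum_pos (fun i _ => G.mass_pos hp i) hI

/-- With `m` and `m'` the total masses of `I` and of its complement, the square is `m m' (m + m')`.
-/
theorem Geometry.bil_uSub_self_pos {p : Fin n → Fin b → ℤ} (hp : ∀ i, p i ∈ G.D4)
    {I : Finset (Fin n)} (hI : I.Nonempty) (hI' : I ≠ Finset.univ) :
    0 < G.bil p (G.uSub p I) (G.uSub p I) := by
  have h1 := G.sum_mass_pos hp hI
  have h2 := G.sum_mass_pos hp (I := Iᶜ) (Finset.nonempty_iff_ne_empty.mpr (by simpa using hI'))
  have e1 : ∑ i ∈ I, G.height p (G.uSub p I) i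
      = (∑ j ∈ Iᶜ, G.mass p j) * ∑ i ∈ I, G.mass p i := by
    rw [Finset.mul_sum]
    exact Finset.sum_congr rfl fun i hi => by rw [G.height_uSub, if_pos hi]
  have e2 : ∑ i ∈ Iᶜ, G.height p (G.uSub p I) i
      = -(∑ j ∈ I, G.mass p j) * ∑ i ∈ Iᶜ, G.mass p i := by
    rw [Finset.mul_sum]
    exact Finset.sum_congr rfl fun i hi => by rw [G.height_uSub, if_neg (Finset.mem_compl.mp hi)]
  rw [G.bil_uSub_eq, e1, e2]
  nlinarith [mul_pos (mul_pos h2 h1) h2, mul_pos (mul_pos h1 h1) h2]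

theorem Geometry.height_add_smul (p : Fin n → Fin b → ℤ) (x u : Coord n b) (r : ℝ) (i : Fin n) :
    G.height p (x + r • u) i = G.height p x i + r * G.height p u i := by
  rw [Geometry.height, Pi.add_apply, Pi.smul_apply, G.cub_add_right, G.cub_smul_right]
  rfl

/-- Motion transversal to a wall does not affect the stability parameters of the two clusters. -/
theorem Geometry.stabX_add_smul_uSub (p : Fin n → Fin b → ℤ) (I : Finset (Fin n)) {k : ℕ}
    {e : Fin k → Fin n} (he : Finset.univ.image e = I ∨ Finset.univ.image e = Iᶜ)
    (x : Coord n b) (r : ℝ) :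
    G.stabX (p ∘ e) ((x + r • G.uSub p I) ∘ e) = G.stabX (p ∘ e) (x ∘ e) := by
  -- On either cluster `u_I` shifts the heights `(p_i t x_i)` by a multiple of the masses. The
  -- stability parameters of the cluster are insensitive to such a shift.
  obtain ⟨m, hm⟩ : ∃ m : ℝ, ∀ j, G.height p (G.uSub p I) (e j) = m * G.mass p (e j) := by
    have hmem : ∀ j, e j ∈ Finset.univ.image e := fun j =>
      Finset.mem_image_of_mem _ (Finset.mem_univ j)
    rcases he with he | he
    · exact ⟨∑ j ∈ Iᶜ, G.mass p j, fun j => by rw [G.height_uSub, if_pos (he ▸ hmem j)]⟩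
    · exact ⟨-∑ i ∈ I, G.mass p i, fun j => by
        rw [G.height_uSub, if_neg (Finset.mem_compl.mp (he ▸ hmem j))]⟩
  have h1 : ∀ j, G.height (p ∘ e) ((x + r • G.uSub p I) ∘ e) j
      = G.height (p ∘ e) (x ∘ e) j + r * m * G.mass (p ∘ e) j := by
    intro j
    have h2 := G.height_add_smul p x (G.uSub p I) r (e j)
    rw [hm, ← mul_assoc] at h2
    exact h2
  funext j
  rw [G.stabX_eq, G.stabX_eq]
  simp only [h1, Finset.sum_add_distrib, ← Finset.mul_sum]
  ring

theorem Geometry.exists_stabX_eq (hn : 1 ≤ n) {p : Fin n → Fin b → ℤ} (hp : ∀ i, p i ∈ G.D4)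
    {c : Fin n → ℝ} (hc : ∑ i, c i = 0) : ∃ x, G.stabX p x = c := by
  have hM : 0 < ∑ i, G.mass p i := G.sum_mass_pos hp ⟨⟨0, hn⟩, Finset.mem_univ _⟩
  refine ⟨fun i => (-2 * c i / (∑ j, G.mass p j) / G.mass p i) • G.t, ?_⟩
  have h1 : ∀ i, G.height p (fun i => (-2 * c i / (∑ j, G.mass p j) / G.mass p i) • G.t) i
      = -2 * c i / ∑ j, G.mass p j := by
    intro i
    rw [Geometry.height, G.cub_smul_right]
    exact div_mul_cancel₀ _ (G.mass_pos hp i).ne'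
  funext i
  rw [G.stabX_eq]
  simp only [h1]
  rw [← Finset.sum_div, ← Finset.mul_sum, hc]
  field_simp
  ring

/-- On a wall, the stability parameters of a cluster are proportional to those of the
whole. -/
theorem Geometry.sameChamber_stabX_comp {p : Fin n → Fin b → ℤ} (hp : ∀ i, p i ∈ G.D4)
    {I : Finset (Fin n)} {x : Coord n b} (hI : ∑ i ∈ I, G.stabX p x i = 0) {k : ℕ} (hk : 1 ≤ k)
    {e : Fin k → Fin n} (hinj : Function.Injective e)
    (he : Finset.univ.image e = I ∨ Finset.univ.image e = Iᶜ) :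
    SameChamber (G.stabX p x ∘ e) (G.stabX (p ∘ e) (x ∘ e)) := by
  have hu := G.bil_uSub p I x
  rw [hI, mul_zero, G.bil_uSub_eq] at hu
  have hsum : ∀ f : Fin n → ℝ, ∑ j, f (e j) = ∑ i ∈ Finset.univ.image e, f i := fun f =>
    (Finset.sum_image fun _ _ _ _ h => hinj h).symm
  have hMe : 0 < ∑ j, G.mass (p ∘ e) j :=
    G.sum_mass_pos (p := p ∘ e) (fun i => hp _) ⟨⟨0, hk⟩, Finset.mem_univ _⟩
  have hM : 0 < ∑ i, G.mass p i := G.sum_mass_pos hp ⟨e ⟨0, hk⟩, Finset.mem_univ _⟩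
  have hMe' : ∑ j, G.mass (p ∘ e) j = ∑ i ∈ Finset.univ.image e, G.mass p i := hsum (G.mass p)
  have hHe' : ∑ j, G.height (p ∘ e) (x ∘ e) j = ∑ i ∈ Finset.univ.image e, G.height p x i :=
    hsum (G.height p x)
  -- On the wall the ratio of height to mass is the same for both clusters, hence for each cluster
  -- and the whole.
  have key : (∑ j, G.mass (p ∘ e) j) * ∑ i, G.height p x i
      = (∑ i, G.mass p i) * ∑ j, G.height (p ∘ e) (x ∘ e) j := by
    rw [hMe', hHe', ← Finset.sum_add_sum_compl I (G.mass p),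
      ← Finset.sum_add_sum_compl I (G.height p x)]
    rcases he with he | he <;> rw [he] <;> linarith
  have h1 : G.stabX p x ∘ e = ((∑ i, G.mass p i) / ∑ j, G.mass (p ∘ e) j) •
      G.stabX (p ∘ e) (x ∘ e) := by
    funext j
    rw [Pi.smul_apply, smul_eq_mul, div_mul_eq_mul_div, eq_div_iff hMe.ne', Function.comp_apply,
      G.stabX_eq, G.stabX_eq]
    have e1 : G.height (p ∘ e) (x ∘ e) j = G.height p x (e j) := rfl
    have e2 : G.mass (p ∘ e) j = G.mass p (e j) := rfl
    rw [e1, e2]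
    linear_combination (1 / 2 : ℝ) * G.mass p (e j) * key
  rw [h1]
  exact sameChamber_smul _ (div_pos hM hMe)

/-- The walls, labelled by the subsets which contain the first index. -/
abbrev Wall (n : ℕ) : Type := {I : Finset (Fin n) // I ≠ Finset.univ ∧ ∃ i ∈ I, (i : ℕ) = 0}

theorem Wall.nonempty (I : Wall n) : I.1.Nonempty := I.2.2.imp fun _ h => h.1

theorem Wall.exists_eq {L : Finset (Fin n)} (hL : L.Nonempty) (hL' : L ≠ Finset.univ) :
    ∃ I : Wall n, L = I.1 ∨ L = I.1ᶜ := by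
  have ⟨k, _⟩ := hL
  by_cases h : (⟨0, k.pos⟩ : Fin n) ∈ L
  · exact ⟨⟨L, hL', _, h, rfl⟩, Or.inl rfl⟩
  · refine ⟨⟨Lᶜ, fun h' => ?_, ⟨0, k.pos⟩, Finset.mem_compl.mpr h, rfl⟩, Or.inr (compl_compl L).symm⟩
    obtain ⟨j, hj⟩ := hL
    exact absurd hj (Finset.mem_compl.mp (h' ▸ Finset.mem_univ j))

theorem Wall.ne_compl (I J : Wall n) : I.1 ≠ J.1ᶜ := by
  intro h
  obtain ⟨i, hi, hi0⟩ := I.2.2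
  obtain ⟨j, hj, hj0⟩ := J.2.2
  have : i = j := Fin.ext (hi0.trans hj0.symm)
  rw [h, Finset.mem_compl, this] at hi
  exact hi hj

/-- Distinct walls are transversal. -/
theorem Wall.exists_sum {I J : Wall n} (h : I ≠ J) :
    ∃ c : Fin n → ℝ, ∑ i, c i = 0 ∧ ∑ i ∈ I.1, c i = 0 ∧ ∑ i ∈ J.1, c i ≠ 0 := by
  have hs : ∀ (A : Finset (Fin n)) (i j : Fin n), ∑ k ∈ A, (Pi.single i 1 - Pi.single j 1 :
      Fin n → ℝ) k = (if i ∈ A then 1 else 0) - if j ∈ A then 1 else 0 := by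
    intro A i j
    simp only [Pi.sub_apply, Finset.sum_sub_distrib, Pi.single_apply]
    simp
  have hne : I.1 ≠ J.1 := fun h' => h (Subtype.ext h')
  obtain ⟨i, hi, hi0⟩ := I.2.2
  obtain ⟨j, hj, hj0⟩ := J.2.2
  obtain rfl : i = j := Fin.ext (hi0.trans hj0.symm)
  by_cases hIJ : I.1 ⊆ J.1
  · obtain ⟨k, hk, hk'⟩ := Finset.exists_of_ssubset (hIJ.ssubset_of_ne hne)
    obtain ⟨l, hl⟩ := not_forall.mp (mt Finset.eq_univ_iff_forall.mpr J.2.1)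
    refine ⟨Pi.single k 1 - Pi.single l 1, ?_, ?_, ?_⟩
    · rw [hs]
      simp
    · rw [hs, if_neg hk', if_neg fun h => hl (hIJ h), sub_zero]
    · rw [hs, if_pos hk, if_neg hl]
      norm_num
  · obtain ⟨k, hk, hk'⟩ := Finset.not_subset.mp hIJ
    refine ⟨Pi.single i 1 - Pi.single k 1, ?_, ?_, ?_⟩
    · rw [hs]
      simp
    · rw [hs, if_pos hi, if_pos hk, sub_self]
    · rw [hs, if_pos hj, if_neg hk']
      norm_num

theorem Geometry.ae_bil_uSub_eq_zero {p : Fin n → Fin b → ℤ} {u : Coord n b}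
    (hu : G.bil p u u ≠ 0) : ∀ᵐ y ∂(G.deltaMeasure p u), G.bil p u y = 0 := by
  rw [G.deltaMeasure_eq]
  exact ae_wallMeasure_eq_zero volume (G.wallForm_wallNormal p hu)

theorem Geometry.ae_bil_uSub_ne_zero (hn : 1 ≤ n) {p : Fin n → Fin b → ℤ} (hp : ∀ i, p i ∈ G.D4)
    {I J : Wall n} (h : I ≠ J) :
    ∀ᵐ y ∂(G.deltaMeasure p (G.uSub p I.1)), G.bil p (G.uSub p J.1) y ≠ 0 := by
  rw [G.deltaMeasure_eq]
  obtain ⟨c, hc, hI, hJ⟩ := Wall.exists_sum h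
  obtain ⟨x, hx⟩ := G.exists_stabX_eq hn hp hc
  refine ae_wallMeasure_ne_zero volume (ℓ' := G.wallForm p (G.uSub p J.1)) (x₀ := x) ?_ ?_
  · rw [G.wallForm_apply, G.bil_uSub, hx, hI, mul_zero]
  · rw [G.wallForm_apply, G.bil_uSub, hx]
    exact mul_ne_zero (by norm_num) hJ

/-- Almost every point of a wall lies on no other wall. -/
theorem Geometry.ae_simpleWall (hn : 1 ≤ n) {p : Fin n → Fin b → ℤ} (hp : ∀ i, p i ∈ G.D4)
    (I : Wall n) :
    ∀ᵐ y ∂(G.deltaMeasure p (G.uSub p I.1)), SimpleWall I.1 (G.stabX p y) := by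
  have h1 : ∀ᵐ y ∂(G.deltaMeasure p (G.uSub p I.1)), ∀ J : Wall n, I ≠ J →
      G.bil p (G.uSub p J.1) y ≠ 0 :=
    ae_all_iff.mpr fun J => by
      by_cases h : I = J
      · exact Eventually.of_forall fun y h' => absurd h h'
      · filter_upwards [G.ae_bil_uSub_ne_zero hn hp h] with y hy _ using hy
  filter_upwards [h1, G.ae_bil_uSub_eq_zero (G.bil_uSub_self_pos hp I.nonempty I.2.1).ne']
    with y hy hy0
  have hsum : ∀ J : Finset (Fin n), G.bil p (G.uSub p J) y = 0 ↔ ∑ i ∈ J, G.stabX p y i = 0 := by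
    intro J
    rw [G.bil_uSub]
    simp
  refine ⟨G.sum_stabX p y, (hsum _).mp hy0, fun L hL hL' h0 => ?_, I.nonempty, I.2.1⟩
  obtain ⟨J, hJ⟩ := Wall.exists_eq hL hL'
  have hJI : I = J := by
    by_contra hne
    refine hy J hne ((hsum _).mpr ?_)
    rcases hJ with rfl | rfl
    · exact h0
    · rwa [sum_compl_eq_neg (G.sum_stabX p y), neg_eq_zero] at h0
  rw [hJI]
  exact hJ


/-! ### Kernels of `ĝ_n` -/

namespace KernelSystem

variable {G : Geometry b} {g0 : ∀ n, (Fin n → Charge b) → (Fin n → ℝ) → ℝ}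
  {E R : ∀ n, (Fin n → Charge b) → ℝ → ℝ} {σ : Charge b → ℝ}
  {Φ0 : ∀ n, (Fin n → Fin b → ℤ) → Coord n b → (Fin n → ℝ) → ℝ}
  {ΦE : ∀ n, (Fin n → Fin b → ℤ) → Coord n b → ℝ}

theorem ghatKernel_stabX_point (K : KernelSystem G g0 E R σ Φ0 ΦE) {n : ℕ} (hn : 1 ≤ n)
    {γ : Fin n → Charge b} (hγ : ∀ i, γ i ∈ G.chargeSet) (B : Fin b → ℝ) {τ : ℝ} (hτ : 0 < τ)
    (hg : GenericStab (G.stab B γ)) :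
    G.ghatKernel Φ0 ΦE n (fun i => (γ i).1) (G.point γ B τ)
      (G.stabX (fun i => (γ i).1) (G.point γ B τ))
      = kerFactor σ γ τ * ghat g0 E n γ (G.stab B γ) τ := by
  have hr : 0 < Real.sqrt (2 * τ) := Real.sqrt_pos.mpr (by positivity)
  have hs := G.stabX_point (fun i => (hγ i).1) B τ
  have h0 : ∑ i, G.stab B γ i = 0 := by
    have h := G.sum_stabX (fun i => (γ i).1) (G.point γ B τ)
    rw [hs] at h
    simp only [Pi.smul_apply, smul_eq_mul, ← Finset.mul_sum] at h
    exact (mul_eq_zero.mp h).resolve_left hr.ne'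
  rw [← K.ghatKernel_point hn hγ B hτ h0 hg, hs]
  refine (K.ghatKernel_eq_of_sameChamber hn (fun i => (hγ i).1) h0 ?_ hg
    (sameChamber_smul _ hr).symm _).symm
  rw [← hs]
  exact G.sum_stabX _ _

theorem eventually_ghatKernel_stabX (K : KernelSystem G g0 E R σ Φ0 ΦE) {n : ℕ} (hn : 1 ≤ n)
    {p : Fin n → Fin b → ℤ} (hp : ∀ i, p i ∈ G.D4) {x : Coord n b}
    (hx : GenericStab (G.stabX p x)) :
    ∀ᶠ y in nhds x, G.ghatKernel Φ0 ΦE n p y (G.stabX p x)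
      = G.ghatKernel Φ0 ΦE n p y (G.stabX p y) := by
  filter_upwards [eventually_sameChamber (G.continuous_stabX p) (G.sum_stabX p) hx] with y hy
  exact K.ghatKernel_eq_of_sameChamber hn hp (G.sum_stabX p x) (G.sum_stabX p y) hx hy y

theorem isKernel_ghatKernel (K : KernelSystem G g0 E R σ Φ0 ΦE) :
    G.IsKernel σ (ghat g0 E) fun n p x => G.ghatKernel Φ0 ΦE n p x (G.stabX p x) := by
  refine ⟨fun n hn γ hγ B τ hτ hg => K.ghatKernel_stabX_point hn hγ B hτ hg,
    fun n hn p hp x hx => ContinuousAt.continuousWithinAt ?_⟩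
  exact ((K.contDiff_ghatKernel hn hp (G.sum_stabX p x) hx).continuous.continuousAt).congr
    (K.eventually_ghatKernel_stabX hn hp hx)

/-- In a chamber both functions are continuous and agree at the dense set of points coming from
charges, so a kernel is unique off the walls. -/
theorem kernel_eq (K : KernelSystem G g0 E R σ Φ0 ΦE)
    {Φ : ∀ n, (Fin n → Fin b → ℤ) → Coord n b → ℝ} (hΦ : G.IsKernel σ (ghat g0 E) Φ) {n : ℕ}
    (hn : 1 ≤ n) {p : Fin n → Fin b → ℤ} (hp : ∀ i, p i ∈ G.D4) {x : Coord n b}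
    (hx : GenericStab (G.stabX p x)) :
    Φ n p x = G.ghatKernel Φ0 ΦE n p x (G.stabX p x) := by
  set U := {y | SameChamber (G.stabX p x) (G.stabX p y)} with hUdef
  have hU : IsOpen U :=
    isOpen_sameChamber (G.sum_stabX p x) hx (G.continuous_stabX p) (G.sum_stabX p)
  have hgU : ∀ y ∈ U, GenericStab (G.stabX p y) := fun y hy =>
    SameChamber.genericStab hy (G.sum_stabX p x) (G.sum_stabX p y) hx
  have h := Set.EqOn.of_subset_closure (f := Φ n p)
    (g := fun y => G.ghatKernel Φ0 ΦE n p y (G.stabX p x)) (t := U) ?_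
    ((hΦ.2 n hn p hp).mono hgU)
    (K.contDiff_ghatKernel hn hp (G.sum_stabX p x) hx).continuous.continuousOn
    Set.inter_subset_left ((G.dense_points hp).open_subset_closure_inter hU)
  · exact h (SameChamber.refl _)
  · rintro y ⟨hy, γ, hγ, rfl, τ, hτ, rfl⟩
    have hr : 0 < Real.sqrt (2 * τ) := Real.sqrt_pos.mpr (by positivity)
    have hg : GenericStab (G.stab 0 γ) := by
      intro I hI hI' h0
      refine hgU _ hy I hI hI' ?_
      rw [G.stabX_point (fun i => (hγ i).1)]
      simp only [Pi.smul_apply, smul_eq_mul, ← Finset.mul_sum, h0, mul_zero]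
    rw [hΦ.1 n hn γ hγ 0 τ hτ hg, ← K.ghatKernel_stabX_point hn hγ 0 hτ hg]
    exact (K.ghatKernel_eq_of_sameChamber hn hp (G.sum_stabX _ x) (G.sum_stabX _ _) hx hy _).symm

end KernelSystem

/-! ### Sign patterns -/

/-- On which side of the walls the parameters lie. -/
noncomputable def stabPattern {n : ℕ} (c : Fin n → ℝ) : Wall n → Bool :=
  fun I => decide (∑ i ∈ I.1, c i < 0)

theorem Geometry.pattern_eq (G : Geometry b) {n : ℕ} (p : Fin n → Fin b → ℤ) (x : Coord n b) :
    pattern (fun I : Wall n => G.wallForm p (G.uSub p I.1)) x = stabPattern (G.stabX p x) := by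
  funext I
  simp only [pattern, stabPattern, G.wallForm_apply, G.bil_uSub, decide_eq_decide]
  constructor <;> intro h <;> linarith

theorem stabPattern_eq_iff {n : ℕ} {c c' : Fin n → ℝ} {I : Wall n} :
    stabPattern c I = stabPattern c' I ↔ (∑ i ∈ I.1, c i < 0 ↔ ∑ i ∈ I.1, c' i < 0) := by
  simp only [stabPattern, decide_eq_decide]

theorem pos_iff_of_stabPattern_eq {n : ℕ} {c c' : Fin n → ℝ} (hc : ∑ i, c i = 0)
    (hc' : ∑ i, c' i = 0) {L : Finset (Fin n)} {I : Wall n} (hL : L = I.1 ∨ L = I.1ᶜ)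
    (h0 : ∑ i ∈ L, c i ≠ 0) (h0' : ∑ i ∈ L, c' i ≠ 0) (h : stabPattern c I = stabPattern c' I) :
    0 < ∑ i ∈ L, c i ↔ 0 < ∑ i ∈ L, c' i := by
  rw [stabPattern_eq_iff] at h
  rcases hL with rfl | rfl
  · rw [← not_iff_not, not_lt, not_lt, h0.le_iff_lt, h0'.le_iff_lt, h]
  · rw [sum_compl_eq_neg hc, sum_compl_eq_neg hc', neg_pos, neg_pos, h]

theorem sameChamber_of_stabPattern_eq {n : ℕ} {c c' : Fin n → ℝ} (hc : ∑ i, c i = 0)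
    (hc' : ∑ i, c' i = 0) (hg : GenericStab c) (hg' : GenericStab c')
    (h : stabPattern c = stabPattern c') : SameChamber c c' := by
  intro L
  rcases L.eq_empty_or_nonempty with rfl | hL
  · simp
  by_cases hL' : L = Finset.univ
  · rw [hL', hc, hc']
  obtain ⟨I, hI⟩ := Wall.exists_eq hL hL'
  exact pos_iff_of_stabPattern_eq hc hc' hI (hg L hL hL') (hg' L hL hL') (congrFun h I)

/-- The sums deciding the chamber of a cluster run over proper parts of it. They are the sums of
other walls, whose signs agree. -/
theorem SimpleWall.sameChamber_comp {n k : ℕ} {I : Finset (Fin n)} {c c' : Fin n → ℝ}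
    (h : SimpleWall I c) (h' : SimpleWall I c')
    (hpat : ∀ J : Wall n, J.1 ≠ I → J.1 ≠ Iᶜ → stabPattern c J = stabPattern c' J)
    {e : Fin k → Fin n} (he : Function.Injective e)
    (hr : Finset.univ.image e = I ∨ Finset.univ.image e = Iᶜ) :
    SameChamber (c ∘ e) (c' ∘ e) := by
  intro M
  rcases M.eq_empty_or_nonempty with rfl | hM
  · simp
  by_cases hM' : M = Finset.univ
  · rw [hM', (h.restrict he hr).1, (h'.restrict he hr).1]
  have h0 := (h.restrict he hr).2 M hM hM'
  have h0' := (h'.restrict he hr).2 M hM hM'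
  have hs : ∀ d : Fin n → ℝ, ∑ j ∈ M, (d ∘ e) j = ∑ i ∈ M.image e, d i := fun d =>
    (Finset.sum_image fun _ _ _ _ h => he h).symm
  rw [hs] at h0 h0'
  rw [hs, hs]
  have hne : ¬ (M.image e = I ∨ M.image e = Iᶜ) := fun hw => h0 (h.sum_cutSet_eq_zero hw)
  obtain ⟨J, hJ⟩ := Wall.exists_eq (hM.image e) fun hu => h0 (by rw [hu, h.sum_univ])
  refine pos_iff_of_stabPattern_eq h.sum_univ h'.sum_univ hJ h0 h0' (hpat J ?_ ?_)
  · rintro hJI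
    rw [hJI] at hJ
    exact hne hJ
  · rintro hJI
    rw [hJI, compl_compl] at hJ
    exact hne hJ.symm

theorem Adjacent.stabPattern_eq {n : ℕ} {I : Wall n} {c c' : Fin n → ℝ} (h : SimpleWall I.1 c)
    (h' : Adjacent c c') :
    stabPattern c' = Function.update (stabPattern c) I (decide (∑ i ∈ I.1, c' i < 0)) := by
  funext J
  by_cases hJ : J = I
  · rw [hJ, Function.update_self]
    rfl
  · rw [Function.update_of_ne hJ, stabPattern_eq_iff]
    rcases lt_trichotomy (∑ i ∈ J.1, c i) 0 with h1 | h1 | h1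
    · exact iff_of_true (h'.neg h.sum_univ h1) h1
    · rcases h.eq_or_eq J.1 J.nonempty J.2.1 h1 with h2 | h2
      · exact absurd (Subtype.ext h2) hJ
      · exact absurd h2 (Wall.ne_compl J I)
    · exact iff_of_false (h'.pos _ h1).not_gt h1.not_gt

/-! ### The kernel in a chamber, and its jump at a wall -/

section

variable (G : Geometry b) (Φ0 : ∀ n, (Fin n → Fin b → ℤ) → Coord n b → (Fin n → ℝ) → ℝ)
  (ΦE : ∀ n, (Fin n → Fin b → ℤ) → Coord n b → ℝ) {n : ℕ} (p : Fin n → Fin b → ℤ)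

open Classical in
/-- The kernel of `ĝ_n` in the chamber of a sign pattern, extended to all `x`. -/
noncomputable def Geometry.chamberKernel (S : Wall n → Bool) : Coord n b → ℝ := fun x =>
  if h : ∃ c : Fin n → ℝ, ∑ i, c i = 0 ∧ GenericStab c ∧ stabPattern c = S then
    G.ghatKernel Φ0 ΦE n p x h.choose else 0

/-- The function `Δ_{n,ℓ}`, with the kernels at fixed parameters `c`. -/
noncomputable def Geometry.splitKernel (s : Equiv.Perm (Fin n)) (ℓ : Fin n) (c : Fin n → ℝ) :
    Coord n b → ℝ := fun x =>
  (1 / 2 : ℝ) * G.bil p (vCut p s ℓ) x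
    * G.ghatKernel Φ0 ΦE ℓ (p ∘ s ∘ head ℓ) (x ∘ s ∘ head ℓ) (c ∘ s ∘ head ℓ)
    * G.ghatKernel Φ0 ΦE (n - ℓ) (p ∘ s ∘ tail ℓ) (x ∘ s ∘ tail ℓ) (c ∘ s ∘ tail ℓ)

/-- The parameters lie on the wall of a splitting, and have a given sign pattern off this wall. -/
def SplitPattern (s : Equiv.Perm (Fin n)) (ℓ : Fin n) (S : Wall n → Bool) (c : Fin n → ℝ) : Prop :=
  SimpleWall (cutSet s ℓ) c ∧
    ∀ J : Wall n, J.1 ≠ cutSet s ℓ → J.1 ≠ (cutSet s ℓ)ᶜ → stabPattern c J = S J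

open Classical in
/-- The function `Δ_{n,ℓ}` on the part of the wall with a given sign pattern, extended to
all `x`. -/
noncomputable def Geometry.wallKernel (s : Equiv.Perm (Fin n)) (ℓ : Fin n) (S : Wall n → Bool) :
    Coord n b → ℝ := fun x =>
  if h : ∃ c, SplitPattern s ℓ S c then G.splitKernel Φ0 ΦE p s ℓ h.choose x else 0

end

namespace KernelSystem

variable {G : Geometry b} {g0 : ∀ n, (Fin n → Charge b) → (Fin n → ℝ) → ℝ}
  {E R : ∀ n, (Fin n → Charge b) → ℝ → ℝ} {σ : Charge b → ℝ}
  {Φ0 : ∀ n, (Fin n → Fin b → ℤ) → Coord n b → (Fin n → ℝ) → ℝ}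
  {ΦE : ∀ n, (Fin n → Fin b → ℤ) → Coord n b → ℝ}
  (K : KernelSystem G g0 E R σ Φ0 ΦE) {n : ℕ} (hn : 1 ≤ n)
  {p : Fin n → Fin b → ℤ} (hp : ∀ i, p i ∈ G.D4)

include K hn hp

theorem chamberKernel_eq {c : Fin n → ℝ} (hc : ∑ i, c i = 0) (hg : GenericStab c) :
    G.chamberKernel Φ0 ΦE p (stabPattern c) = fun x => G.ghatKernel Φ0 ΦE n p x c := by
  funext x
  have h : ∃ c' : Fin n → ℝ, ∑ i, c' i = 0 ∧ GenericStab c' ∧ stabPattern c' = stabPattern c :=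
    ⟨c, hc, hg, rfl⟩
  rw [Geometry.chamberKernel, dif_pos h]
  obtain ⟨h1, h2, h3⟩ := h.choose_spec
  exact K.ghatKernel_eq_of_sameChamber hn hp h1 hc h2
    (sameChamber_of_stabPattern_eq h1 hc h2 hg h3) x

/-- Sign patterns not realised by generic parameters have kernel zero, so smoothness, and likewise
Vignéras' equation, hold for every Boolean pattern, as the integration by parts requires. -/
theorem contDiff_chamberKernel (S : Wall n → Bool) : ContDiff ℝ ∞ (G.chamberKernel Φ0 ΦE p S) := by
  by_cases h : ∃ c : Fin n → ℝ, ∑ i, c i = 0 ∧ GenericStab c ∧ stabPattern c = S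
  · obtain ⟨c, hc, hg, rfl⟩ := h
    rw [K.chamberKernel_eq hn hp hc hg]
    exact K.contDiff_ghatKernel hn hp hc hg
  · have : G.chamberKernel Φ0 ΦE p S = fun _ => 0 := funext fun x => dif_neg h
    rw [this]
    exact contDiff_const

theorem vigneras_chamberKernel (S : Wall n → Bool) (x : Coord n b) :
    G.vigneras p ((n : ℝ) - 1) (G.chamberKernel Φ0 ΦE p S) x = 0 := by
  by_cases h : ∃ c : Fin n → ℝ, ∑ i, c i = 0 ∧ GenericStab c ∧ stabPattern c = S
  · obtain ⟨c, hc, hg, rfl⟩ := h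
    rw [K.chamberKernel_eq hn hp hc hg]
    exact K.vigneras_ghatKernel hn hp hc hg x
  · have : G.chamberKernel Φ0 ΦE p S = fun _ => 0 := funext fun x => dif_neg h
    have h0 : ∀ (i : Fin n) (a : Fin b), pd i a (fun _ : Coord n b => (0 : ℝ)) = fun _ => 0 :=
      fun i a => funext fun y => by simp [pd]
    rw [this]
    simp [Geometry.vigneras, Geometry.box, h0]

/-- Every kernel agrees with the kernel in the chamber of `x`. -/
theorem kernel_eq_chamberKernel {Φ : ∀ n, (Fin n → Fin b → ℤ) → Coord n b → ℝ}
    (hΦ : G.IsKernel σ (ghat g0 E) Φ) {x : Coord n b} (hx : GenericStab (G.stabX p x)) :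
    Φ n p x = G.chamberKernel Φ0 ΦE p
      (pattern (fun I : Wall n => G.wallForm p (G.uSub p I.1)) x) x := by
  rw [G.pattern_eq, K.chamberKernel_eq hn hp (G.sum_stabX p x) hx, K.kernel_eq hΦ hn hp hx]

omit hn

theorem splitKernel_congr {s : Equiv.Perm (Fin n)} {ℓ : Fin n} (hℓ : 0 < (ℓ : ℕ))
    {S : Wall n → Bool} {c c' : Fin n → ℝ} (h : SplitPattern s ℓ S c) (h' : SplitPattern s ℓ S c') :
    G.splitKernel Φ0 ΦE p s ℓ c = G.splitKernel Φ0 ΦE p s ℓ c' := by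
  have hpat : ∀ J : Wall n, J.1 ≠ cutSet s ℓ → J.1 ≠ (cutSet s ℓ)ᶜ →
      stabPattern c J = stabPattern c' J := fun J h1 h2 => (h.2 J h1 h2).trans (h'.2 J h1 h2).symm
  have hH := s.injective.comp (head_injective ℓ)
  have hT := s.injective.comp (tail_injective ℓ)
  have rH : Finset.univ.image (s ∘ head ℓ) = cutSet s ℓ ∨
    Finset.univ.image (s ∘ head ℓ) = (cutSet s ℓ)ᶜ := Or.inl (image_head s ℓ)
  have rT : Finset.univ.image (s ∘ tail ℓ) = cutSet s ℓ ∨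
    Finset.univ.image (s ∘ tail ℓ) = (cutSet s ℓ)ᶜ := Or.inr (image_tail s ℓ)
  funext x
  have e1 : G.ghatKernel Φ0 ΦE ℓ (p ∘ s ∘ head ℓ) (x ∘ s ∘ head ℓ) (c ∘ s ∘ head ℓ)
      = G.ghatKernel Φ0 ΦE ℓ (p ∘ s ∘ head ℓ) (x ∘ s ∘ head ℓ) (c' ∘ s ∘ head ℓ) :=
    K.ghatKernel_eq_of_sameChamber hℓ (fun i => hp _) (h.1.restrict hH rH).1
      (h'.1.restrict hH rH).1 (h.1.restrict hH rH).2 (h.1.sameChamber_comp h'.1 hpat hH rH) _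
  have e2 : G.ghatKernel Φ0 ΦE (n - ℓ) (p ∘ s ∘ tail ℓ) (x ∘ s ∘ tail ℓ) (c ∘ s ∘ tail ℓ)
      = G.ghatKernel Φ0 ΦE (n - ℓ) (p ∘ s ∘ tail ℓ) (x ∘ s ∘ tail ℓ) (c' ∘ s ∘ tail ℓ) :=
    K.ghatKernel_eq_of_sameChamber (by omega) (fun i => hp _) (h.1.restrict hT rT).1
      (h'.1.restrict hT rT).1 (h.1.restrict hT rT).2 (h.1.sameChamber_comp h'.1 hpat hT rT) _
  rw [Geometry.splitKernel, Geometry.splitKernel, e1, e2]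

theorem wallKernel_eq {s : Equiv.Perm (Fin n)} {ℓ : Fin n} (hℓ : 0 < (ℓ : ℕ))
    {S : Wall n → Bool} {c : Fin n → ℝ} (h : SplitPattern s ℓ S c) :
    G.wallKernel Φ0 ΦE p s ℓ S = G.splitKernel Φ0 ΦE p s ℓ c := by
  have h' : ∃ c, SplitPattern s ℓ S c := ⟨c, h⟩
  rw [← K.splitKernel_congr hp hℓ h'.choose_spec h]
  exact funext fun x => dif_pos h'

theorem contDiff_splitKernel {s : Equiv.Perm (Fin n)} {ℓ : Fin n} (hℓ : 0 < (ℓ : ℕ))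
    {c : Fin n → ℝ} (h : SimpleWall (cutSet s ℓ) c) :
    ContDiff ℝ ∞ (G.splitKernel Φ0 ΦE p s ℓ c) := by
  have hH := h.restrict (s.injective.comp (head_injective ℓ)) (Or.inl (image_head s ℓ))
  have hT := h.restrict (s.injective.comp (tail_injective ℓ)) (Or.inr (image_tail s ℓ))
  have h1 : ContDiff ℝ ∞ fun x => G.bil p (vCut p s ℓ) x :=
    (G.wallForm p (vCut p s ℓ)).contDiff
  exact ((contDiff_const.mul h1).mul
    ((K.contDiff_ghatKernel hℓ (p := p ∘ s ∘ head ℓ) (fun i => hp _) hH.1 hH.2).comp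
      (reindexL (s ∘ head ℓ)).contDiff)).mul
    ((K.contDiff_ghatKernel (n := n - ℓ) (by omega) (p := p ∘ s ∘ tail ℓ) (fun i => hp _) hT.1
      hT.2).comp (reindexL (s ∘ tail ℓ)).contDiff)

theorem contDiff_wallKernel (s : Equiv.Perm (Fin n)) {ℓ : Fin n} (hℓ : 0 < (ℓ : ℕ))
    (S : Wall n → Bool) : ContDiff ℝ ∞ (G.wallKernel Φ0 ΦE p s ℓ S) := by
  by_cases h : ∃ c, SplitPattern s ℓ S c
  · obtain ⟨c, hc⟩ := h
    rw [K.wallKernel_eq hp hℓ hc]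
    exact K.contDiff_splitKernel hp hℓ hc.1
  · have : G.wallKernel Φ0 ΦE p s ℓ S = fun _ => 0 := funext fun x => dif_neg h
    rw [this]
    exact contDiff_const

/-- Near a wall, `Δ_{n,ℓ}` agrees with a smooth function on each line transversal to the wall. -/
theorem jump_eq_wallKernel {Φ : ∀ n, (Fin n → Fin b → ℤ) → Coord n b → ℝ}
    (hΦ : G.IsKernel σ (ghat g0 E) Φ) {s : Equiv.Perm (Fin n)} {ℓ : Fin n} (hℓ : 0 < (ℓ : ℕ))
    {y : Coord n b} (hy : SimpleWall (cutSet s ℓ) (G.stabX p y)) (r : ℝ) :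
    G.jump Φ p s ℓ (y + r • G.uCut p s ℓ)
      = G.wallKernel Φ0 ΦE p s ℓ (pattern (fun I : Wall n => G.wallForm p (G.uSub p I.1)) y)
        (y + r • G.uCut p s ℓ) := by
  rw [K.wallKernel_eq hp hℓ (c := G.stabX p y) ⟨hy, fun J _ _ => by rw [G.pattern_eq]⟩]
  -- Along the transversal line the parameters of a cluster are constant, and on the wall they are
  -- in the same chamber as the restriction of those of the whole. The kernel of the cluster thus
  -- stays in one chamber along the whole line.
  have hstep : ∀ {k : ℕ} (hk : 1 ≤ k) (e : Fin k → Fin n), Function.Injective (s ∘ e) →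
      (Finset.univ.image (s ∘ e) = cutSet s ℓ ∨ Finset.univ.image (s ∘ e) = (cutSet s ℓ)ᶜ) →
      Φ k (p ∘ s ∘ e) ((y + r • G.uCut p s ℓ) ∘ s ∘ e)
        = G.ghatKernel Φ0 ΦE k (p ∘ s ∘ e) ((y + r • G.uCut p s ℓ) ∘ s ∘ e)
          (G.stabX p y ∘ s ∘ e) := by
    intro k hk e hinj he
    have h1 := hy.restrict hinj he
    have h2 := G.sameChamber_stabX_comp hp hy.sum_eq hk hinj he
    have h3 := G.stabX_add_smul_uSub p (cutSet s ℓ) he y r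
    rw [← G.uCut_eq] at h3
    have h4 := h2.genericStab h1.1 (G.sum_stabX _ _) h1.2
    rw [K.kernel_eq hΦ hk (p := p ∘ s ∘ e) (fun i => hp _) (by rw [h3]; exact h4), h3]
    exact (K.ghatKernel_eq_of_sameChamber hk (p := p ∘ s ∘ e) (fun i => hp _) h1.1
      (G.sum_stabX _ _) h1.2 h2 _).symm
  rw [Geometry.jump, Geometry.splitKernel,
    hstep hℓ (head ℓ) (s.injective.comp (head_injective ℓ)) (Or.inl (image_head s ℓ)),
    hstep (k := n - ℓ) (by omega) (tail ℓ) (s.injective.comp (tail_injective ℓ))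
      (Or.inr (image_tail s ℓ))]

omit K hp

/-- The orientation of a splitting with respect to a wall. -/
def _root_.D4D2.orientation (I : Wall n) (s : Equiv.Perm (Fin n)) (ℓ : Fin n) : ℝ :=
  if cutSet s ℓ = I.1 then 1 else if cutSet s ℓ = I.1ᶜ then -1 else 0

include K hn hp

/-- Since `u_I · x` is `-2` times the sum of the parameters over `I`, the value `true` labels the
side where that sum is negative, which reverses the sign of the jump. The signs of the partial sums
differ by two, leaving the factor `½` of `Δ_{n,ℓ}` and an orientation. -/
theorem chamberKernel_jump {I : Wall n} {c : Fin n → ℝ} (h : SimpleWall I.1 c) (x : Coord n b) :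
    G.chamberKernel Φ0 ΦE p (Function.update (stabPattern c) I true) x
        - G.chamberKernel Φ0 ΦE p (Function.update (stabPattern c) I false) x
      = symmetrize fun s => ∑ ℓ ∈ cuts n,
          orientation I s ℓ * G.wallKernel Φ0 ΦE p s ℓ (stabPattern c) x := by
  obtain ⟨⟨c₁, hc₁⟩, -, -, h₁, hI₁⟩ := exists_adjacent h (Q := fun _ => True)
    (by simpa using openDense_univ) Filter.univ_mem (ε := 1) one_ne_zero
  obtain ⟨⟨c₂, hc₂⟩, -, -, h₂, hI₂⟩ := exists_adjacent h (Q := fun _ => True)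
    (by simpa using openDense_univ) Filter.univ_mem (ε := -1) (by norm_num)
  replace hI₁ : 0 < ∑ i ∈ I.1, c₁ i := by simpa using hI₁
  replace hI₂ : ∑ i ∈ I.1, c₂ i < 0 := by simpa using hI₂
  have e1 := h₁.stabPattern_eq h
  have e2 := h₂.stabPattern_eq h
  rw [decide_eq_false hI₁.not_gt] at e1
  rw [decide_eq_true hI₂] at e2
  rw [← e1, ← e2, K.chamberKernel_eq hn hp h₁.sum_univ (h.genericStab h₁ hI₁.ne'),
    K.chamberKernel_eq hn hp h₂.sum_univ (h.genericStab h₂ hI₂.ne)]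
  have hj := K.ghatKernel_jump hn hp h h₁ h₂ hI₁ hI₂ x
  have hj' : G.ghatKernel Φ0 ΦE n p x c₂ - G.ghatKernel Φ0 ΦE n p x c₁
      = -(G.ghatKernel Φ0 ΦE n p x c₁ - G.ghatKernel Φ0 ΦE n p x c₂) := by ring
  rw [hj', hj, ← neg_mul, neg_neg, ← symmetrize_mul]
  congr 1
  funext s
  rw [Finset.mul_sum]
  refine Finset.sum_congr rfl fun ℓ hℓ => ?_
  have hℓ' : 0 < (ℓ : ℕ) := (Finset.mem_filter.mp hℓ).2
  rw [partialSum_comp_perm, partialSum_comp_perm]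
  by_cases hw : cutSet s ℓ = I.1 ∨ cutSet s ℓ = I.1ᶜ
  · have hsw : SimpleWall (cutSet s ℓ) c := by
      refine ⟨h.sum_univ, h.sum_cutSet_eq_zero hw, fun J hJ hJ' hJ0 => ?_, cutSet_nonempty s hℓ',
        cutSet_ne_univ s ℓ⟩
      rcases hw with hw | hw <;> rw [hw]
      · exact h.eq_or_eq J hJ hJ' hJ0
      · rw [compl_compl]
        exact (h.eq_or_eq J hJ hJ' hJ0).symm
    rw [K.wallKernel_eq hp hℓ' (c := c) ⟨hsw, fun _ _ _ => rfl⟩, Geometry.splitKernel]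
    rcases hw with hw | hw
    · rw [orientation, if_pos hw, hw, Real.sign_of_pos hI₁, Real.sign_of_neg hI₂]
      ring
    · have hne : I.1ᶜ ≠ I.1 := fun h => Wall.ne_compl I I h.symm
      rw [orientation, hw, if_neg hne, if_pos rfl, sum_compl_eq_neg h₁.sum_univ,
        sum_compl_eq_neg h₂.sum_univ, Real.sign_of_neg (neg_lt_zero.mpr hI₁),
        Real.sign_of_pos (neg_pos.mpr hI₂)]
      ring
  · rw [h.sign_sub_eq_zero h₁ h₂ (cutSet_nonempty s hℓ') (cutSet_ne_univ s ℓ) hw, orientation,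
      if_neg fun h => hw (Or.inl h), if_neg fun h => hw (Or.inr h)]
    ring

end KernelSystem

/-! ### The modularity constraint -/

instance (G : Geometry b) {n : ℕ} (p : Fin n → Fin b → ℤ) (u : Coord n b) :
    IsFiniteMeasureOnCompacts (G.deltaMeasure p u) := by
  rw [G.deltaMeasure_eq]
  infer_instance

theorem SimpleWall.compl {n : ℕ} {I : Finset (Fin n)} {c : Fin n → ℝ} (h : SimpleWall I c) :
    SimpleWall Iᶜ c where
  sum_univ := h.sum_univ
  sum_eq := by rw [sum_compl_eq_neg h.sum_univ, h.sum_eq, neg_zero]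
  eq_or_eq J hJ hJ' h0 := by
    rw [compl_compl]
    exact (h.eq_or_eq J hJ hJ' h0).symm
  nonempty := Finset.nonempty_iff_ne_empty.mpr (by simpa using h.ne_univ)
  ne_univ h' := h.nonempty.ne_empty (by simpa using h')

theorem orientation_eq_zero {n : ℕ} {I J : Wall n} {s : Equiv.Perm (Fin n)} {ℓ : Fin n}
    (hI : cutSet s ℓ = I.1 ∨ cutSet s ℓ = I.1ᶜ) (hJ : J ≠ I) : orientation J s ℓ = 0 := by
  have hne : J.1 ≠ I.1 := fun h => hJ (Subtype.ext h)
  rcases hI with hI | hI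
  · rw [orientation, hI, if_neg hne.symm, if_neg (Wall.ne_compl I J)]
  · rw [orientation, hI, if_neg (Wall.ne_compl J I).symm, if_neg fun h => hne (compl_injective h).symm]

theorem Geometry.ae_simpleWall_cut (G : Geometry b) {n : ℕ} (hn : 1 ≤ n) {p : Fin n → Fin b → ℤ}
    (hp : ∀ i, p i ∈ G.D4) (s : Equiv.Perm (Fin n)) {ℓ : Fin n} (hℓ : 0 < (ℓ : ℕ)) :
    ∀ᵐ y ∂(G.deltaMeasure p (G.uCut p s ℓ)), SimpleWall (cutSet s ℓ) (G.stabX p y) := by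
  obtain ⟨I, hI⟩ := Wall.exists_eq (cutSet_nonempty s hℓ) (cutSet_ne_univ s ℓ)
  rw [G.uCut_eq]
  rcases hI with hI | hI
  · rw [hI]
    exact G.ae_simpleWall hn hp I
  · rw [hI, G.uSub_compl, G.deltaMeasure_neg p (G.bil_uSub_self_pos hp I.nonempty I.2.1).ne']
    filter_upwards [G.ae_simpleWall hn hp I] with y hy using hy.compl

theorem Geometry.ae_genericStab (G : Geometry b) {n : ℕ} {p : Fin n → Fin b → ℤ}
    (hp : ∀ i, p i ∈ G.D4) : ∀ᵐ x : Coord n b, GenericStab (G.stabX p x) := by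
  have h1 : ∀ᵐ x : Coord n b, ∀ I : Wall n, G.wallForm p (G.uSub p I.1) x ≠ 0 :=
    ae_all_iff.mpr fun I => ae_ne_zero volume fun h => by
      have h2 := G.bil_uSub_self_pos hp I.nonempty I.2.1
      rw [← G.wallForm_apply, h] at h2
      exact lt_irrefl _ h2
  filter_upwards [h1] with x hx L hL hL' h0
  obtain ⟨I, hI⟩ := Wall.exists_eq hL hL'
  refine hx I ?_
  rw [G.wallForm_apply, G.bil_uSub]
  rcases hI with rfl | rfl
  · rw [h0, mul_zero]
  · rw [sum_compl_eq_neg (G.sum_stabX p x), neg_eq_zero] at h0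
    rw [h0, mul_zero]

theorem hasLineDerivAt_of_line_eq {V : Type*} [NormedAddCommGroup V] [NormedSpace ℝ V] {f g : V → ℝ}
    {y u : V} (h : ∀ r : ℝ, f (y + r • u) = g (y + r • u)) (hg : ContDiff ℝ ∞ g) :
    HasLineDerivAt ℝ f (fderiv ℝ g y u) y u := by
  have h1 := (hg.differentiable (by simp) y).hasFDerivAt.hasLineDerivAt u
  unfold HasLineDerivAt at h1 ⊢
  rw [show (fun t : ℝ => f (y + t • u)) = fun t : ℝ => g (y + t • u) from funext h]
  exact h1

namespace KernelSystem

variable {G : Geometry b} {g0 : ∀ n, (Fin n → Charge b) → (Fin n → ℝ) → ℝ}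
  {E R : ∀ n, (Fin n → Charge b) → ℝ → ℝ} {σ : Charge b → ℝ}
  {Φ0 : ∀ n, (Fin n → Fin b → ℤ) → Coord n b → (Fin n → ℝ) → ℝ}
  {ΦE : ∀ n, (Fin n → Fin b → ℤ) → Coord n b → ℝ}
  (K : KernelSystem G g0 E R σ Φ0 ΦE) {n : ℕ} (hn : 1 ≤ n)
  {p : Fin n → Fin b → ℤ} (hp : ∀ i, p i ∈ G.D4)
  {Φ : ∀ n, (Fin n → Fin b → ℤ) → Coord n b → ℝ} (hΦ : G.IsKernel σ (ghat g0 E) Φ)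

include K hn hp

/-- The formula for the jump is an identity for all `x` at fixed `c`, and not only for `x` on the
wall, so it can be differentiated in every direction. -/
theorem fderiv_chamberKernel_jump {I : Wall n} {c : Fin n → ℝ} (h : SimpleWall I.1 c)
    (x w : Coord n b) :
    fderiv ℝ (G.chamberKernel Φ0 ΦE p (Function.update (stabPattern c) I true)) x w
        - fderiv ℝ (G.chamberKernel Φ0 ΦE p (Function.update (stabPattern c) I false)) x w
      = symmetrize fun s => ∑ ℓ ∈ cuts n,
          orientation I s ℓ * fderiv ℝ (G.wallKernel Φ0 ΦE p s ℓ (stabPattern c)) x w := by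
  have hd : ∀ S, DifferentiableAt ℝ (G.chamberKernel Φ0 ΦE p S) x := fun S =>
    (K.contDiff_chamberKernel hn hp S).differentiable (by simp) x
  have h1 : HasFDerivAt (fun x => (n.factorial : ℝ)⁻¹ * ∑ s, ∑ ℓ ∈ cuts n,
      orientation I s ℓ * G.wallKernel Φ0 ΦE p s ℓ (stabPattern c) x)
      ((n.factorial : ℝ)⁻¹ • ∑ s, ∑ ℓ ∈ cuts n,
        orientation I s ℓ • fderiv ℝ (G.wallKernel Φ0 ΦE p s ℓ (stabPattern c)) x) x :=
    (HasFDerivAt.fun_sum fun s _ => HasFDerivAt.fun_sum fun ℓ hℓ =>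
      (((K.contDiff_wallKernel hp s (Finset.mem_filter.mp hℓ).2 _).differentiable
        (by simp) x).hasFDerivAt.const_mul _)).const_mul _
  have h2 := (hd (Function.update (stabPattern c) I true)).hasFDerivAt.sub
    (hd (Function.update (stabPattern c) I false)).hasFDerivAt
  have h3 : (G.chamberKernel Φ0 ΦE p (Function.update (stabPattern c) I true)
      - G.chamberKernel Φ0 ΦE p (Function.update (stabPattern c) I false))
      = fun x => (n.factorial : ℝ)⁻¹ * ∑ s, ∑ ℓ ∈ cuts n,
        orientation I s ℓ * G.wallKernel Φ0 ΦE p s ℓ (stabPattern c) x :=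
    funext fun x => K.chamberKernel_jump hn hp h x
  rw [h3] at h2
  have h4 := congrArg (fun T : Coord n b →L[ℝ] ℝ => T w) (h2.unique h1)
  simpa [symmetrize, _root_.sum_apply] using h4

include hΦ

theorem hasLineDerivAt_jump (s : Equiv.Perm (Fin n)) {ℓ : Fin n} (hℓ : 0 < (ℓ : ℕ)) :
    ∀ᵐ y ∂(G.deltaMeasure p (G.uCut p s ℓ)),
      HasLineDerivAt ℝ (G.jump Φ p s ℓ) (fderiv ℝ (G.wallKernel Φ0 ΦE p s ℓ
        (pattern (fun I : Wall n => G.wallForm p (G.uSub p I.1)) y)) y (G.uCut p s ℓ)) y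
        (G.uCut p s ℓ) ∧
      G.jump Φ p s ℓ y = G.wallKernel Φ0 ΦE p s ℓ
        (pattern (fun I : Wall n => G.wallForm p (G.uSub p I.1)) y) y := by
  filter_upwards [G.ae_simpleWall_cut hn hp s hℓ] with y hy
  refine ⟨hasLineDerivAt_of_line_eq (fun r => K.jump_eq_wallKernel hp hΦ hℓ hy r)
    (K.contDiff_wallKernel hp s hℓ _), ?_⟩
  simpa using K.jump_eq_wallKernel hp hΦ hℓ hy 0

omit hΦ

omit hn in
theorem integrable_fderiv_wallKernel_mul (s : Equiv.Perm (Fin n)) {ℓ : Fin n} (hℓ : 0 < (ℓ : ℕ))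
    {φ : Coord n b → ℝ} (hφ : ContDiff ℝ ∞ φ) (hc : HasCompactSupport φ) (w : Coord n b)
    (ν : Measure (Coord n b)) [IsFiniteMeasureOnCompacts ν] :
    Integrable (fun y => fderiv ℝ (G.wallKernel Φ0 ΦE p s ℓ
      (pattern (fun I : Wall n => G.wallForm p (G.uSub p I.1)) y)) y w * φ y) ν :=
  integrable_apply_pattern_mul _ (A := fun S y => fderiv ℝ (G.wallKernel Φ0 ΦE p s ℓ S) y w)
    (fun S => ((K.contDiff_wallKernel hp s hℓ S).continuous_fderiv (by simp)).clm_apply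
      continuous_const) hφ.continuous hc ν

omit hn in
theorem integrable_wallKernel_mul_fderiv (s : Equiv.Perm (Fin n)) {ℓ : Fin n} (hℓ : 0 < (ℓ : ℕ))
    {φ : Coord n b → ℝ} (hφ : ContDiff ℝ ∞ φ) (hc : HasCompactSupport φ) (w : Coord n b)
    (ν : Measure (Coord n b)) [IsFiniteMeasureOnCompacts ν] :
    Integrable (fun y => G.wallKernel Φ0 ΦE p s ℓ
      (pattern (fun I : Wall n => G.wallForm p (G.uSub p I.1)) y) y * fderiv ℝ φ y w) ν :=
  integrable_apply_pattern_mul _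
    (fun S => (K.contDiff_wallKernel hp s hℓ S).continuous)
    ((hφ.continuous_fderiv (by simp)).clm_apply continuous_const) (hc.fderiv_apply ℝ w) ν

include hΦ

/-- The factor `u²` cancels against the direction `u / u²`. Then `δ'` contributes `-∫ u · ∂(Δ φ)`,
and adding `2 ∫ (u · ∂Δ) φ` leaves the combination found by integration by parts. -/
theorem deltaPrimePair_add_deltaPair (s : Equiv.Perm (Fin n)) {ℓ : Fin n} (hℓ : 0 < (ℓ : ℕ))
    {φ : Coord n b → ℝ} (hφ : ContDiff ℝ ∞ φ) (hc : HasCompactSupport φ) :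
    G.bil p (G.uCut p s ℓ) (G.uCut p s ℓ) *
        G.deltaPrimePair p (G.uCut p s ℓ) (fun x => G.jump Φ p s ℓ x * φ x)
      + 2 * G.deltaPair p (G.uCut p s ℓ)
        (fun x => lineDeriv ℝ (G.jump Φ p s ℓ) x (G.uCut p s ℓ) * φ x)
      = (∫ y, fderiv ℝ (G.wallKernel Φ0 ΦE p s ℓ
          (pattern (fun I : Wall n => G.wallForm p (G.uSub p I.1)) y)) y (G.uCut p s ℓ) * φ y
          ∂(G.deltaMeasure p (G.uCut p s ℓ)))
        - ∫ y, G.wallKernel Φ0 ΦE p s ℓ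
          (pattern (fun I : Wall n => G.wallForm p (G.uSub p I.1)) y) y *
            fderiv ℝ φ y (G.uCut p s ℓ) ∂(G.deltaMeasure p (G.uCut p s ℓ)) := by
  set u := G.uCut p s ℓ with hu
  have hu0 : G.bil p u u ≠ 0 := by
    rw [hu, G.uCut_eq]
    exact (G.bil_uSub_self_pos hp (cutSet_nonempty s hℓ) (cutSet_ne_univ s ℓ)).ne'
  have hJ := K.hasLineDerivAt_jump hn hp hΦ s hℓ
  rw [← hu] at hJ
  have hI1 := K.integrable_fderiv_wallKernel_mul hp s hℓ hφ hc u (G.deltaMeasure p u)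
  have hI2 := K.integrable_wallKernel_mul_fderiv hp s hℓ hφ hc u (G.deltaMeasure p u)
  have e1 : G.bil p u u * G.deltaPrimePair p u (fun x => G.jump Φ p s ℓ x * φ x)
      = -((∫ y, fderiv ℝ (G.wallKernel Φ0 ΦE p s ℓ
          (pattern (fun I : Wall n => G.wallForm p (G.uSub p I.1)) y)) y u * φ y
          ∂(G.deltaMeasure p u))
        + ∫ y, G.wallKernel Φ0 ΦE p s ℓ
          (pattern (fun I : Wall n => G.wallForm p (G.uSub p I.1)) y) y *
            fderiv ℝ φ y u ∂(G.deltaMeasure p u)) := by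
    rw [Geometry.deltaPrimePair, ← integral_add hI1 hI2, mul_neg, ← integral_const_mul]
    congr 1
    refine integral_congr_ae ?_
    filter_upwards [hJ] with y hy
    have h1 : HasLineDerivAt ℝ φ (fderiv ℝ φ y u) y u :=
      (hφ.differentiable (by simp) y).hasFDerivAt.hasLineDerivAt u
    have h2 : HasLineDerivAt ℝ (fun x => G.jump Φ p s ℓ x * φ x) _ y u := HasDerivAt.mul hy.1 h1
    rw [(h2.smul (G.bil p u u)⁻¹).lineDeriv, smul_eq_mul, mul_inv_cancel_left₀ hu0]
    simp only [zero_smul, add_zero, hy.2]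
  have e2 : G.deltaPair p u (fun x => lineDeriv ℝ (G.jump Φ p s ℓ) x u * φ x)
      = ∫ y, fderiv ℝ (G.wallKernel Φ0 ΦE p s ℓ
          (pattern (fun I : Wall n => G.wallForm p (G.uSub p I.1)) y)) y u * φ y
          ∂(G.deltaMeasure p u) := by
    refine integral_congr_ae ?_
    filter_upwards [hJ] with y hy
    rw [hy.1.lineDeriv]
  rw [e1, e2]
  ring

omit hΦ

omit K hn in
/-- The term of a splitting in the modularity constraint, as a term of its wall. -/
theorem sum_orientation_mul (s : Equiv.Perm (Fin n)) {ℓ : Fin n} (hℓ : 0 < (ℓ : ℕ))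
    {φ : Coord n b → ℝ} :
    (∫ y, fderiv ℝ (G.wallKernel Φ0 ΦE p s ℓ
          (pattern (fun I : Wall n => G.wallForm p (G.uSub p I.1)) y)) y (G.uCut p s ℓ) * φ y
          ∂(G.deltaMeasure p (G.uCut p s ℓ)))
        - ∫ y, G.wallKernel Φ0 ΦE p s ℓ
          (pattern (fun I : Wall n => G.wallForm p (G.uSub p I.1)) y) y *
            fderiv ℝ φ y (G.uCut p s ℓ) ∂(G.deltaMeasure p (G.uCut p s ℓ))
      = ∑ J : Wall n, orientation J s ℓ * ((∫ y, fderiv ℝ (G.wallKernel Φ0 ΦE p s ℓ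
          (pattern (fun I : Wall n => G.wallForm p (G.uSub p I.1)) y)) y (G.uSub p J.1) * φ y
          ∂(G.deltaMeasure p (G.uSub p J.1)))
        - ∫ y, G.wallKernel Φ0 ΦE p s ℓ
          (pattern (fun I : Wall n => G.wallForm p (G.uSub p I.1)) y) y *
            fderiv ℝ φ y (G.uSub p J.1) ∂(G.deltaMeasure p (G.uSub p J.1))) := by
  obtain ⟨I, hI⟩ := Wall.exists_eq (cutSet_nonempty s hℓ) (cutSet_ne_univ s ℓ)
  rw [Finset.sum_eq_single I]
  · rw [G.uCut_eq]
    rcases hI with hI | hI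
    · rw [orientation, if_pos hI, hI, one_mul]
    · have hne : I.1ᶜ ≠ I.1 := fun h => Wall.ne_compl I I h.symm
      rw [orientation, hI, if_neg hne, if_pos rfl, G.uSub_compl,
        G.deltaMeasure_neg p (G.bil_uSub_self_pos hp I.nonempty I.2.1).ne']
      simp only [map_neg, neg_mul, mul_neg, integral_neg]
      ring
  · intro J _ hJ
    rw [orientation_eq_zero hI hJ, zero_mul]
  · simp

omit K hn hp in
theorem integral_symmetrize_mul {ν : Measure (Coord n b)}
    {f : Equiv.Perm (Fin n) → Fin n → Coord n b → ℝ} {r : Equiv.Perm (Fin n) → Fin n → ℝ}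
    (hf : ∀ (s : Equiv.Perm (Fin n)), ∀ ℓ ∈ cuts n, Integrable (f s ℓ) ν) :
    ∫ y, (symmetrize fun s => ∑ ℓ ∈ cuts n, r s ℓ * f s ℓ y) ∂ν
      = symmetrize fun s => ∑ ℓ ∈ cuts n, r s ℓ * ∫ y, f s ℓ y ∂ν := by
  simp only [symmetrize]
  rw [integral_const_mul, integral_finsetSum _ fun s _ => integrable_finsetSum _ fun ℓ hℓ =>
    (hf s ℓ hℓ).const_mul _]
  congr 1
  refine Finset.sum_congr rfl fun s _ => ?_
  rw [integral_finsetSum _ fun ℓ hℓ => (hf s ℓ hℓ).const_mul _]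
  exact Finset.sum_congr rfl fun ℓ _ => integral_const_mul _ _

include hΦ

/-- Every kernel of `ĝ_n` satisfies the modularity constraint. -/
theorem modularityConstraint : G.ModularityConstraint Φ n p := by
  set L : Wall n → Coord n b →L[ℝ] ℝ := fun I => G.wallForm p (G.uSub p I.1) with hL
  have hF := K.contDiff_chamberKernel hn hp
  -- The walls form a null set, so the values of a kernel on them are irrelevant for the
  -- distribution.
  have hae : Φ n p =ᵐ[volume] fun x => G.chamberKernel Φ0 ΦE p (pattern L x) x := by
    filter_upwards [G.ae_genericStab hp] with x hx using K.kernel_eq_chamberKernel hn hp hΦ hx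
  refine ⟨?_, fun s ℓ hℓ => ?_, fun φ hφ hc s ℓ hℓ => ⟨?_, ?_⟩, fun φ hφ hc => ?_⟩
  · intro x
    obtain ⟨A, hA, h⟩ := locallyIntegrable_apply_pattern L (fun S => (hF S).continuous) volume x
    exact ⟨A, hA, h.congr (ae_restrict_of_ae hae.symm)⟩
  · filter_upwards [K.hasLineDerivAt_jump hn hp hΦ s hℓ] with y hy
      using hy.1.lineDifferentiableAt
  · refine (K.integrable_fderiv_wallKernel_mul hp s hℓ hφ hc (G.uCut p s ℓ) _).congr ?_
    filter_upwards [K.hasLineDerivAt_jump hn hp hΦ s hℓ] with y hy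
    rw [hy.1.lineDeriv]
  · refine (K.integrable_wallKernel_mul_fderiv hp s hℓ hφ hc (G.uCut p s ℓ) _).congr ?_
    filter_upwards [K.hasLineDerivAt_jump hn hp hΦ s hℓ] with y hy
    rw [hy.2, (hφ.differentiable (by simp) y).lineDeriv_eq_fderiv]
  · have e1 : ∫ x, Φ n p x * G.vignerasAdj p ((n : ℝ) - 1) φ x
        = ∫ x, G.chamberKernel Φ0 ΦE p (pattern L x) x * G.vignerasAdj p ((n : ℝ) - 1) φ x := by
      refine integral_congr_ae ?_
      filter_upwards [hae] with x hx
      rw [hx]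
    rw [e1, G.integral_apply_pattern_mul_vignerasAdj hp
      (fun I : Wall n => (G.bil_uSub_self_pos hp I.nonempty I.2.1).ne')
      (fun I J h => G.ae_bil_uSub_ne_zero hn hp h) hF _ (K.vigneras_chamberKernel hn hp) hφ hc]
    have e2 : ∀ J : Wall n,
        (∫ y, (fderiv ℝ (G.chamberKernel Φ0 ΦE p (Function.update (pattern L y) J true)) y
            (G.uSub p J.1) - fderiv ℝ (G.chamberKernel Φ0 ΦE p
              (Function.update (pattern L y) J false)) y (G.uSub p J.1)) * φ y
            ∂(G.deltaMeasure p (G.uSub p J.1)))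
        = symmetrize fun s => ∑ ℓ ∈ cuts n, orientation J s ℓ *
          ∫ y, fderiv ℝ (G.wallKernel Φ0 ΦE p s ℓ (pattern L y)) y (G.uSub p J.1) * φ y
            ∂(G.deltaMeasure p (G.uSub p J.1)) := by
      intro J
      rw [← integral_symmetrize_mul fun s ℓ hℓ =>
        K.integrable_fderiv_wallKernel_mul hp s (Finset.mem_filter.mp hℓ).2 hφ hc _ _]
      refine integral_congr_ae ?_
      filter_upwards [G.ae_simpleWall hn hp J] with y hy
      rw [hL, G.pattern_eq, K.fderiv_chamberKernel_jump hn hp hy, mul_comm, ← symmetrize_mul]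
      congr 1
      funext s
      rw [Finset.mul_sum]
      exact Finset.sum_congr rfl fun ℓ _ => by ring
    have e3 : ∀ J : Wall n,
        (∫ y, (G.chamberKernel Φ0 ΦE p (Function.update (pattern L y) J true) y
            - G.chamberKernel Φ0 ΦE p (Function.update (pattern L y) J false) y) *
              fderiv ℝ φ y (G.uSub p J.1) ∂(G.deltaMeasure p (G.uSub p J.1)))
        = symmetrize fun s => ∑ ℓ ∈ cuts n, orientation J s ℓ *
          ∫ y, G.wallKernel Φ0 ΦE p s ℓ (pattern L y) y * fderiv ℝ φ y (G.uSub p J.1)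
            ∂(G.deltaMeasure p (G.uSub p J.1)) := by
      intro J
      rw [← integral_symmetrize_mul fun s ℓ hℓ =>
        K.integrable_wallKernel_mul_fderiv hp s (Finset.mem_filter.mp hℓ).2 hφ hc _ _]
      refine integral_congr_ae ?_
      filter_upwards [G.ae_simpleWall hn hp J] with y hy
      rw [hL, G.pattern_eq, K.chamberKernel_jump hn hp hy, mul_comm, ← symmetrize_mul]
      congr 1
      funext s
      rw [Finset.mul_sum]
      exact Finset.sum_congr rfl fun ℓ _ => by ring
    -- A splitting belongs to one wall, possibly with reversed orientation; its term is written as a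
    -- sum over all walls with all but one coefficient zero.
    have e4 : ∀ (s : Equiv.Perm (Fin n)), ∀ ℓ ∈ cuts n, _ := fun s ℓ hℓ =>
      (K.deltaPrimePair_add_deltaPair hn hp hΦ s (Finset.mem_filter.mp hℓ).2 hφ hc).trans
        (sum_orientation_mul hp s (Finset.mem_filter.mp hℓ).2)
    simp only [symmetrize]
    rw [Finset.sum_congr rfl fun s _ => Finset.sum_congr rfl (e4 s)]
    have e5 : ∀ J : Wall n, _ := fun J => congrArg₂ (fun a b : ℝ => a - b) (e2 J) (e3 J)
    refine (Finset.sum_congr rfl fun J _ => e5 J).trans ?_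
    simp only [symmetrize, ← mul_sub, ← Finset.sum_sub_distrib, ← Finset.mul_sum]
    congr 1
    -- The sum over walls of the integration by parts is exchanged with the sum over splittings of
    -- the constraint.
    rw [Finset.sum_comm]
    refine Finset.sum_congr rfl fun s _ => ?_
    rw [Finset.sum_comm]

end KernelSystem
end D4D2

/-! ### The coefficient recursion and the modularity constraint. -/

theorem proposition2 {b : ℕ} (G : Geometry b)
    (g0 : ∀ n, (Fin n → Charge b) → (Fin n → ℝ) → ℝ)
    (E0 : ∀ n, (Fin n → Charge b) → ℝ)
    (Eplus E R : ∀ n, (Fin n → Charge b) → ℝ → ℝ)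
    -- `g^{(0)}_1 = 1`, and `g^{(0)}_n` is symmetric in the pairs `(γ_i, c_i)`
    (hone : ∀ γ ∈ G.chargeSet, ∀ c, g0 1 (fun _ => γ) c = 1)
    (hsymm : ∀ n (γ : Fin n → Charge b), (∀ i, γ i ∈ G.chargeSet) →
      ∀ (c : Fin n → ℝ) (s : Equiv.Perm (Fin n)), g0 n (γ ∘ s) (c ∘ s) = g0 n γ c)
    -- `E_n = E^{(0)}_n + E^{(+)}_n`
    (hsplit : ∀ n, 1 ≤ n → ∀ γ : Fin n → Charge b, (∀ i, γ i ∈ G.chargeSet) → ∀ τ : ℝ, 0 < τ →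
      E n γ τ = E0 n γ + Eplus n γ τ)
    -- the non-decreasing part is `g^{(0)}_n` at `c_i = β_{ni}`
    (hE0 : ∀ n, 1 ≤ n → ∀ γ : Fin n → Charge b, (∀ i, γ i ∈ G.chargeSet) →
      E0 n γ = g0 n γ (beta γ))
    -- the recursion for the decreasing part
    (hEplus : ∀ n, 1 ≤ n → ∀ γ : Fin n → Charge b, (∀ i, γ i ∈ G.chargeSet) → ∀ τ : ℝ, 0 < τ →
      Eplus n γ τ = -symmetrize fun s => ∑ bl : Composition n with 1 < bl.length,
        W R bl.length (merge bl.index (γ ∘ s)) τ *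
          ∏ k, E (bl.blocksFun k) (γ ∘ s ∘ bl.embedding k) τ) :
    -- the recursion holds wherever `g^{(0)}` obeys its own at the configuration and its mergings
    (∀ n, 1 ≤ n → ∀ γ : Fin n → Charge b, (∀ i, γ i ∈ G.chargeSet) →
      ∀ c : Fin n → ℝ, ∑ i, c i = 0 →
      (∀ m (f : Fin n → Fin m), Function.Surjective f →
        SeedRecursion g0 m (merge f γ) (merge f c)) →
      ∀ τ : ℝ, 0 < τ → CoefficientRecursion (ghat g0 E) R n γ c τ) ∧
    -- the modularity constraint
    ((∀ n, 1 ≤ n → ∀ γ : Fin n → Charge b, (∀ i, γ i ∈ G.chargeSet) →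
        ∀ c : Fin n → ℝ, ∑ i, c i = 0 → GenericConf n γ c → SeedRecursion g0 n γ c) →
      ∀ (σ : Charge b → ℝ) (Φ0 : ∀ n, (Fin n → Fin b → ℤ) → Coord n b → (Fin n → ℝ) → ℝ)
        (ΦE : ∀ n, (Fin n → Fin b → ℤ) → Coord n b → ℝ),
      G.IsQuadraticRefinement σ → G.IsSeedKernel σ g0 Φ0 → G.IsKernelIndep σ E ΦE →
      -- the kernels of `E_n` are smooth solutions of Vignéras' equation ...
      (∀ n, 1 ≤ n → ∀ p : Fin n → Fin b → ℤ, (∀ i, p i ∈ G.D4) →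
        ContDiff ℝ ∞ (ΦE n p) ∧ ∀ x, G.vigneras p ((n : ℝ) - 1) (ΦE n p) x = 0) →
      -- ... which depend on `x` only through the DSZ products ...
      (∀ n, 1 ≤ n → ∀ p : Fin n → Fin b → ℤ, (∀ i, p i ∈ G.D4) → ∀ x x' : Coord n b,
        (∀ i j, G.bil p (vVec p i j) x = G.bil p (vVec p i j) x') → ΦE n p x = ΦE n p x') →
      -- ... and the part `E^{(+)}_n` decreases exponentially for large `τ₂`
      (∀ n, 1 ≤ n → ∀ p : Fin n → Fin b → ℤ, (∀ i, p i ∈ G.D4) → ∀ y : Coord n b,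
        GenericStab (G.betaX p y) → ∃ ε : ℝ, 0 < ε ∧
          (fun τ : ℝ => ΦE n p (Real.sqrt (2 * τ) • y)
              - Φ0 n p (Real.sqrt (2 * τ) • y) (G.betaX p (Real.sqrt (2 * τ) • y)))
            =O[Filter.atTop] fun τ : ℝ => Real.exp (-ε * τ)) →
      (∃ Φ, G.IsKernel σ (ghat g0 E) Φ) ∧
      ∀ Φ, G.IsKernel σ (ghat g0 E) Φ → ∀ n, 1 ≤ n → ∀ p : Fin n → Fin b → ℤ,
        (∀ i, p i ∈ G.D4) → G.ModularityConstraint Φ n p) := by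
  have hg : SymmPairOn G.chargeSet g0 := hsymm
  -- The assumptions on the constant and the decreasing part of `E` enter only in this combined
  -- form.
  have hE : ∀ τ : ℝ, 0 < τ → ∀ n, 1 ≤ n → ∀ γ : Fin n → Charge b, (∀ i, γ i ∈ G.chargeSet) →
      E n γ τ = g0 n γ (beta γ) - symmetrize fun s =>
        ∑ bl : Composition n with 1 < bl.length, W R bl.length (merge bl.index (γ ∘ s)) τ *
          ∏ k, E (bl.blocksFun k) (γ ∘ s ∘ bl.embedding k) τ := by
    intro τ hτ n hn γ hγ
    rw [hsplit n hn γ hγ τ hτ, hE0 n hn γ hγ, hEplus n hn γ hγ τ hτ, sub_eq_add_neg]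
  refine ⟨fun n hn γ hγ c _ hseed τ hτ =>
    coefficientRecursion_of_seedRecursion G hg hone (hE τ hτ) hn hγ c hseed, ?_⟩
  intro hseed σ Φ0 ΦE hσ hΦ0 hΦE hvig hinv hdecay
  have K : KernelSystem G g0 E R σ Φ0 ΦE :=
    ⟨hone, hg, hE, hseed, hσ, hΦ0, hΦE, hvig, hinv, hdecay⟩
  exact ⟨⟨_, K.isKernel_ghatKernel⟩, fun Φ hΦ n hn p hp => K.modularityConstraint hn hp hΦ⟩
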